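/- Let $d\ge 1$ and $\lambda>0$. Write $\mathbf M=[0,1]^{\mathbb N\times\mathbb N}$, let $\mathbb Q$ be the product of uniform distributions on $\mathbf M$, and let $\hat\eta$ be a Poisson point process on $\mathbb S=\mathbb R^d\times[0,1]\times\mathbf M$ with intensity measure $\lambda\,\ell_d\otimes\ell\otimes\mathbb Q$ ($\ell_d$, $\ell$ Lebesgue measures), defined on a probability space $(\Omega,\mathcal F,\mathbb P)$. In a point $(x,t,M)\in\mathbb S$, $x$ is the location, $t$ the birth time and $M$ a double sequence of marks. *Edge marking.* Let $\{B_n\}_{n\in\mathbb N}$ be an enumeration of the lattice unit cubes $\prod_{i=1}^d[n_i,n_i+1)$, $n_i\in\mathbb Z$. For $\eta\subset\mathbb S$, $T(\eta)$ is the set of marked edges $(\{x,y\},v_{m,n})$ obtained from all $s_1=(x,t,(u_{i,j}))$, $s_2=(y,s,(v_{i,j}))$ in $\eta$ with $x\ne y$ and $t<s$, where $s_1$ is the $m$-th oldest point (in order of birth times) of $\eta$ in the cube $B_n$ containing $x$. For $W\subset\mathbb R^d$, $\hat\eta|_W$ is the restriction of $\hat\eta$ to points with location in $W$. *Functional.*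 Let $f$ be a measurable real functional on finite subsets of $(\mathbb R^d)^{[2]}\times[0,1]$, where $(\mathbb R^d)^{[2]}$ is the set of two-element subsets of $\mathbb R^d$ (measurability is with respect to the $\sigma$-field generated by the counting maps). The add-one cost is $$D_{(x,t,M)}(\eta)=f\big(T(\eta\cup\{(x,t,M)\})\big)-f\big(T(\eta\cup\{(x,t,M)\})\setminus\{x\}\big),$$ where $\setminus\{x\}$ means removing the vertex $x$ and all marked edges at $x$. Let $\hat\Omega=\Omega\times\mathbf M$, $\hat{\mathbb P}=\mathbb P\otimes\mathbb Q$, with expectation $\hat{\mathbb E}$, and write $\mathbf 0$ for the origin of $\mathbb R^d$. A cube is a set $W=\prod_{i=1}^d[x_i,x_i+l)$ with $x_i\in\mathbb R$, $l>0$; its volume is $|W|$. Cubes $W_n$ tend to $\mathbb R^d$ if every ball is contained in $W_n$ for all large $n$. *Assumptions.* 1. $f$ is weakly stabilizing: $f$ is invariant under translations of $\mathbb R^d$ (marks kept), and there is a random variable $\Delta_1$ on $\hat\Omega$ such that $D_{(\mathbf 0,1,M)}(\hat\eta|_{W_n})\to\Delta_1$ in $\hat{\mathbb P}$-probability for every sequence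 of cubes $W_n$ tending to $\mathbb R^d$. 2. For some $p>2$, $\displaystyle\sup_{W\text{ cube},\,\mathbf 0\in W}\hat{\mathbb E}\big[|D_{(\mathbf 0,1,M)}(\hat\eta|_W)|^p\big]<\infty$. *Conclusion.* For every cube $W$, $f(T(\hat\eta|_W))\in L^2(\mathbb P)$. For every $t\in[0,1]$ there is a random variable $\Delta_t$ on $\hat\Omega$ such that $D_{(\mathbf 0,t,M)}(\hat\eta|_{W_n})\to\Delta_t$ in $\hat{\mathbb P}$-probability for every sequence of cubes $W_n$ tending to $\mathbb R^d$. For any choice of these limits, let $\hat\eta_t$ be the restriction of $\hat\eta$ to points with birth time in $[0,t)$, and $$\sigma^2=\lambda\int_0^1\hat{\mathbb E}\Big[\mathbb E[\Delta_t\mid\hat\eta_t]^2\Big]\,dt ,$$ the inner conditional expectation being taken with respect to $\mathbb P$ with $M$ held fixed. Then $\sigma^2$ does not depend on the choice, $0\le\sigma^2<\infty$, and for every sequence of cubes $W$ tending to $\mathbb R^d$, $$\frac{f(T(\hat\eta|_W))-\mathbb E[f(T(\hat\eta|_W))]}{\sqrt{|W|}}\xrightarrow{d}\mathcal N(0,\sigma^2),\qquad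 \frac{\operatorname{Var}[f(T(\hat\eta|_W))]}{|W|}\to\sigma^2 .$$ Moreover, $\sigma^2>0$ if $\hat{\mathbb P}(\Delta_1\neq0)>0$. -/

import Mathlib

open MeasureTheory ProbabilityTheory Filter Topology
open scoped ENNReal NNReal

noncomputable section

namespace MarkedPoisson

/-! ## Spaces -/

/-- The space `ℝ^d`. -/
abbrev Loc (d : ℕ) : Type := EuclideanSpace ℝ (Fin d)

/-- The space `[0,1]^{ℕ × ℕ}` of double sequences of marks. -/
abbrev Marks : Type := ℕ × ℕ → unitInterval

/-- The space `ℝ^d × [0,1] × [0,1]^{ℕ × ℕ}` of marked points `(x, t, M)`: a location, a birth time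
and a double sequence of marks. -/
abbrev Pt (d : ℕ) : Type := Loc d × unitInterval × Marks

/-- The law of a double sequence of independent uniform marks. -/
def markLaw : Measure Marks :=
  Measure.infinitePi fun _ : ℕ × ℕ => (volume : Measure unitInterval)

/-- The intensity measure `lam · (Lebesgue ⊗ uniform ⊗ markLaw)`. -/
def intensity (d : ℕ) (lam : ℝ≥0) : Measure (Pt d) :=
  lam • (volume : Measure (Loc d)).prod ((volume : Measure unitInterval).prod markLaw)

/-! ## Poisson processes -/

/-- `η` is a Poisson point process with intensity measure `μ`, realised as a random locally finite
set of points on the probability space `(Ω, P)`. -/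
structure IsPoissonProcess {Ω S : Type*} [MeasurableSpace Ω] [TopologicalSpace S]
    [MeasurableSpace S] (μ : Measure S) (P : Measure Ω) (η : Ω → Set S) : Prop where
  locallyFinite : ∀ (ω : Ω) (K : Set S), IsCompact K → (η ω ∩ K).Finite
  measurable_count : ∀ B : Set S, MeasurableSet B → Measurable fun ω => (η ω ∩ B).encard
  law_count : ∀ B : Set S, MeasurableSet B → μ B ≠ ∞ →
    P.map (fun ω => (η ω ∩ B).encard)
      = (poissonMeasure (μ B).toNNReal).map (fun k : ℕ => (k : ℕ∞))
  indep_count : ∀ (n : ℕ) (B : Fin n → Set S), (∀ i, MeasurableSet (B i)) →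
    (∀ i j, i ≠ j → Disjoint (B i) (B j)) → iIndepFun (fun i ω => (η ω ∩ B i).encard) P

/-! ## Graphs with marks on the edges -/

/-- Undirected edges: the two-element subsets of `ℝ^d`. -/
abbrev Edge (d : ℕ) : Type := {e : Sym2 (Loc d) // ¬ e.IsDiag}

/-- The Borel structure of unordered pairs: the quotient of that of ordered pairs. -/
@[reducible] def sym2Sigma (d : ℕ) : MeasurableSpace (Sym2 (Loc d)) :=
  MeasurableSpace.map (fun p : Loc d × Loc d => s(p.1, p.2)) inferInstance

/-- Undirected edges with a mark in `[0,1]`. -/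
abbrev MarkedEdge (d : ℕ) : Type := Edge d × unitInterval

/-- The Borel structure of the space of marked edges. -/
@[reducible] def markedEdgeSigma (d : ℕ) : MeasurableSpace (MarkedEdge d) :=
  MeasurableSpace.prod (MeasurableSpace.comap Subtype.val (sym2Sigma d)) inferInstance

/-- The sigma-field on the finite sets of marked edges that is generated by the counting maps
`A ↦ #(A ∩ B)`, `B` Borel. -/
@[reducible] def finiteConfigSigma (d : ℕ) : MeasurableSpace (Finset (MarkedEdge d)) :=
  ⨆ (B : Set (MarkedEdge d)) (_ : MeasurableSet[markedEdgeSigma d] B),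
    MeasurableSpace.comap (fun A : Finset (MarkedEdge d) => ((A : Set (MarkedEdge d)) ∩ B).encard)
      inferInstance

/-- The translation of an edge by `z`. -/
def translateEdge {d : ℕ} (z : Loc d) (e : Edge d) : Edge d :=
  ⟨e.1.map fun x => z + x, fun h => e.2 ((Sym2.isDiag_map (add_right_injective z)).1 h)⟩

open Classical in
/-- The translation by `z` of a finite set of marked edges; the marks are kept. -/
def translate {d : ℕ} (z : Loc d) (A : Finset (MarkedEdge d)) : Finset (MarkedEdge d) :=
  A.image fun a => (translateEdge z a.1, a.2)

def TranslationInvariant {d : ℕ} (f : Finset (MarkedEdge d) → ℝ) : Prop :=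
  ∀ (z : Loc d) (A : Finset (MarkedEdge d)), f (translate z A) = f A

open Classical in
/-- The value of `f` at a set `A` of marked edges. The functional `f` lives on finite sets only;
below it is evaluated only at finite sets (see `edgeMarking_finite`), so that the
default value `0` plays no role. -/
def evalOn {d : ℕ} (f : Finset (MarkedEdge d) → ℝ) (A : Set (MarkedEdge d)) : ℝ :=
  if h : A.Finite then f h.toFinset else 0

/-! ## The edge marking map -/

/-- The unit cube `∏ [n_i, n_i + 1)`. -/
def unitCube {d : ℕ} (n : Fin d → ℤ) : Set (Loc d) :=
  {x | ∀ i, (n i : ℝ) ≤ x i ∧ x i < n i + 1}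

/-- The number of points of `η` in `B` that are strictly older than `t`. A point of `η` in `B` with
birth time `t` is therefore the `m`th oldest point in `B`, where `m = 0` is the very oldest. -/
def ageRank {d : ℕ} (η : Set (Pt d)) (B : Set (Loc d)) (t : unitInterval) : ℕ :=
  {s | s ∈ η ∧ s.1 ∈ B ∧ s.2.1 < t}.ncard

/-- The edge marking map `T` associated with the enumeration `n ↦ unitCube (e n)` of the lattice
unit cubes: if `s₁` is older than `s₂` and is the `m`th oldest point in the `n`th cube, then the
edge between their locations carries the `(m, n)`th mark of the younger point `s₂`. -/
def edgeMarking {d : ℕ} (e : ℕ ≃ (Fin d → ℤ)) (η : Set (Pt d)) : Set (MarkedEdge d) :=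
  {a | ∃ s₁ ∈ η, ∃ s₂ ∈ η, ∃ n : ℕ, s₁.2.1 < s₂.2.1 ∧ s₁.1 ∈ unitCube (e n) ∧
    (a.1 : Sym2 (Loc d)) = s(s₁.1, s₂.1) ∧
    a.2 = s₂.2.2 (ageRank η (unitCube (e n)) s₁.2.1, n)}

lemma unitCube_unique {d : ℕ} {x : Loc d} {m n : Fin d → ℤ} (hm : x ∈ unitCube m)
    (hn : x ∈ unitCube n) : m = n := by
  funext i
  have h1 := hm i
  have h2 := hn i
  have h3 : (m i : ℝ) < n i + 1 := by linarith
  have h4 : (n i : ℝ) < m i + 1 := by linarith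
  have h5 : m i < n i + 1 := by exact_mod_cast h3
  have h6 : n i < m i + 1 := by exact_mod_cast h4
  omega

lemma edgeMarking_finite {d : ℕ} (e : ℕ ≃ (Fin d → ℤ)) {η : Set (Pt d)} (hη : η.Finite) :
    (edgeMarking e η).Finite := by
  have hcov : edgeMarking e η ⊆ ⋃ s₁ ∈ η, ⋃ s₂ ∈ η,
      {a | a ∈ edgeMarking e η ∧ ∃ n : ℕ, s₁.1 ∈ unitCube (e n) ∧
        (a.1 : Sym2 (Loc d)) = s(s₁.1, s₂.1) ∧
        a.2 = s₂.2.2 (ageRank η (unitCube (e n)) s₁.2.1, n)} := by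
    intro a ha
    obtain ⟨s₁, h₁, s₂, h₂, n, -, hc, hs, hu⟩ := id ha
    simp only [Set.mem_iUnion]
    exact ⟨s₁, h₁, s₂, h₂, ha, n, hc, hs, hu⟩
  refine Set.Finite.subset (hη.biUnion fun s₁ _ => hη.biUnion fun s₂ _ => ?_) hcov
  refine Set.Subsingleton.finite ?_
  rintro a ⟨-, n, hn, has, hau⟩ b ⟨-, m, hm, hbs, hbu⟩
  have hmn : n = m := e.injective (unitCube_unique hn hm)
  subst hmn
  exact Prod.ext (Subtype.ext (has.trans hbs.symm)) (hau.trans hbu.symm)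

/-- Removing the vertex `x` and all edges at `x`. -/
def removeVertex {d : ℕ} (x : Loc d) (A : Set (MarkedEdge d)) : Set (MarkedEdge d) :=
  {a | a ∈ A ∧ x ∉ (a.1 : Sym2 (Loc d))}

/-- The restriction of `η` to the marked points with location in `W`. -/
def restrict {d : ℕ} (η : Set (Pt d)) (W : Set (Loc d)) : Set (Pt d) :=
  {s | s ∈ η ∧ s.1 ∈ W}

/-- The add-one cost `D_s(η) = f(T(η ∪ {s})) - f(T(η ∪ {s}) \ {x})` of `s = (x, t, M)`. -/
def addOneCost {d : ℕ} (e : ℕ ≃ (Fin d → ℤ)) (f : Finset (MarkedEdge d) → ℝ) (s : Pt d)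
    (η : Set (Pt d)) : ℝ :=
  evalOn f (edgeMarking e (insert s η)) -
    evalOn f (removeVertex s.1 (edgeMarking e (insert s η)))

/-! ## Cubes -/

/-- A cube `∏ [x_i, x_i + l)` with `l > 0`. -/
structure Cube (d : ℕ) where
  corner : Loc d
  side : ℝ
  side_pos : 0 < side

def Cube.toSet {d : ℕ} (W : Cube d) : Set (Loc d) :=
  {y | ∀ i, W.corner i ≤ y i ∧ y i < W.corner i + W.side}

/-- The sequence of cubes tends to `ℝ^d`: it eventually contains any given ball. -/
def TendsToSpace {d : ℕ} (W : ℕ → Cube d) : Prop :=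
  ∀ r : ℝ, ∀ᶠ n in atTop, Metric.closedBall (0 : Loc d) r ⊆ (W n).toSet

/-! ## Stabilization and moments

The extra double sequence `M` of marks of the added point is independent of the process: the
underlying space is `Ω × Marks` with the measure `P.prod markLaw`. -/

section

variable {d : ℕ} {Ω : Type*} [MeasurableSpace Ω]

/-- The random variable `f(T(η|_W))`. -/
def value (e : ℕ ≃ (Fin d → ℤ)) (η : Ω → Set (Pt d)) (f : Finset (MarkedEdge d) → ℝ)
    (W : Cube d) (ω : Ω) : ℝ :=
  evalOn f (edgeMarking e (restrict (η ω) W.toSet))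

/-- The random variable `D_{(0,t,M)}(η|_W)` on `Ω × Marks`. -/
def originCost (e : ℕ ≃ (Fin d → ℤ)) (η : Ω → Set (Pt d)) (f : Finset (MarkedEdge d) → ℝ)
    (t : unitInterval) (W : Cube d) (z : Ω × Marks) : ℝ :=
  addOneCost e f (0, t, z.2) (restrict (η z.1) W.toSet)

/-- `Δ` is the limit add-one cost at birth time `t`: along every sequence of cubes tending to the
whole space, `D_{(0,t,M)}(η|_W)` converges to `Δ` in probability. -/
def IsLimitCost (P : Measure Ω) (e : ℕ ≃ (Fin d → ℤ)) (η : Ω → Set (Pt d))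
    (f : Finset (MarkedEdge d) → ℝ) (t : unitInterval) (Δ : Ω × Marks → ℝ) : Prop :=
  Measurable Δ ∧ ∀ W : ℕ → Cube d, TendsToSpace W →
    TendstoInMeasure (P.prod markLaw) (fun n => originCost e η f t (W n)) atTop Δ

def WeaklyStabilizing (P : Measure Ω) (e : ℕ ≃ (Fin d → ℤ)) (η : Ω → Set (Pt d))
    (f : Finset (MarkedEdge d) → ℝ) : Prop :=
  TranslationInvariant f ∧ ∃ Δ₁ : Ω × Marks → ℝ, IsLimitCost P e η f 1 Δ₁

/-- The `p`th absolute moments of the add-one costs `D_{(0,1,M)}(η|_W)` are bounded uniformly over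
the cubes `W` that contain the origin. -/
def MomentCondition (P : Measure Ω) (e : ℕ ≃ (Fin d → ℤ)) (η : Ω → Set (Pt d))
    (f : Finset (MarkedEdge d) → ℝ) (p : ℝ) : Prop :=
  (⨆ (W : Cube d) (_ : (0 : Loc d) ∈ W.toSet),
    ∫⁻ z, ‖originCost e η f 1 W z‖ₑ ^ p ∂(P.prod markLaw)) < ∞

/-- The sigma-field on `Ω` generated by the restriction `η_t` of the process to the points with
birth time in `[0, t)`. -/
@[reducible] def historySigma (η : Ω → Set (Pt d)) (t : unitInterval) : MeasurableSpace Ω :=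
  ⨆ (B : Set (Pt d)) (_ : MeasurableSet B),
    MeasurableSpace.comap (fun ω => ({s | s ∈ η ω ∧ s.2.1 < t} ∩ B).encard) inferInstance

/-- The conditional expectation `E[X | η_t]` with respect to `P`, the mark sequence `M` (which is
independent of the process) being held fixed. As a random variable on `Ω × Marks` this is the
conditional expectation of `X` given `η_t` and `M`. -/
def condHistory (P : Measure Ω) (η : Ω → Set (Pt d)) (t : unitInterval) (X : Ω × Marks → ℝ) :
    Ω × Marks → ℝ :=
  (P.prod markLaw)[X | MeasurableSpace.prod (historySigma η t) inferInstance]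

/-- The quantity `lam ∫₀¹ Ê[E[Δ_t | η_t]²] dt`. -/
def varianceFormula (P : Measure Ω) (lam : ℝ≥0) (η : Ω → Set (Pt d))
    (Δ : unitInterval → Ω × Marks → ℝ) : ℝ≥0∞ :=
  lam * ∫⁻ t : unitInterval, ∫⁻ z,
    ENNReal.ofReal (condHistory P η t (Δ t) z ^ 2) ∂(P.prod markLaw)

end

end MarkedPoisson

end

/-! The edge marks are built from birth times, ranks in lattice cubes and mark sequences, but their
law is simple. Given the locations and birth times, distinct pairs of points read distinct
coordinates of the mark sequences: the younger point owns the sequence, and the cube and the age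
rank of the older point select the coordinate. Hence `T(η|_W)` has the law of the complete graph on
a Poisson number of independent uniform points of `W` with independent uniform marks on all pairs
(`IsPoissonProcess.map_valueGraph`). Birth times and the lattice leave the law altogether. The same
holds jointly for two configurations whose common points are older than all the others
(`Nested.map_markedGraph`).

Variance. Let `A` be a Poisson set of mean `m t` and `B`, `B'` independent Poisson sets of mean `m
(1 - t)`, and consider `E[g(A ∪ B) g(A ∪ B')]` for the random complete graphs. Moving `t` from `0`
to `1` turns the squared mean into the second moment. The derivative in `t` is `m` times the
correlation of the costs of an additional vertex in `A ∪ B` and in `A ∪ B'`. So the variance is `m ∫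
resampled dt` (`FullyExchangeable.variance_eq`), and bounding the correlation by the second moment
of the cost gives a Poincaré inequality (`FullyExchangeable.variance_le`). Given the history `η_t`,
the future of the Poisson process is independent of it. The square of a conditional expectation is a
correlation of two copies with resampled future, and the common past is older, so the correlation at
`t` equals `Ê[E[D_t | η_t]²]` (`IsPoissonProcess.integral_condHistory_sq`).

Stabilization. Weak stabilization together with moments of an order `p > 2` gives convergence of the
add-one cost at birth time `1` in mean square, uniformly over large cubes. For a cube `V` made of
lattice unit cubes, the cost in `V` is the cost of the subgraph induced by `V`. The distance between
the costs in `V` and in `W` is therefore the cost norm of a functional of the complete graph, which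
does not depend on the birth time. So the estimate at time `1` holds at all times, and all limits
`Δ_t` exist (`IsPoissonProcess.exists_limitCost`). Averaging the variance identity over the location
of the additional vertex, which is mostly far from the boundary of `W`, gives the limit of the
variance (`IsPoissonProcess.tendsto_variance`).

Normal limit. Large disjoint boxes with integer corners are packed into `W`. The values in the boxes
are independent and identically distributed, so for a fixed box size their normalized sum obeys the
classical central limit theorem. The remainder has a small cost unless the additional vertex is near
the boundary of a box or outside all boxes, so its variance is small relative to `|W|` by the
Poincaré inequality (`IsPoissonProcess.variance_remainder_le`). Characteristic functions combine the
two.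

Positivity. The resampled correlation is continuous in `t`, and at `t = 1` it is the second moment
of the cost. If `σ² = 0`, the correlation in a large box is small for almost every `t`, hence also
at `t = 1`, which forces `Δ₁ = 0` almost surely. -/

noncomputable section

set_option linter.unusedSectionVars false

namespace MarkedPoisson

/-! ## Finite configurations -/

/-- The finite subsets of `S`. -/
structure Conf (S : Type*) where
  carrier : Set S
  finite : carrier.Finite

namespace Conf

variable {S : Type*}

lemma ext_carrier {A B : Conf S} (h : A.carrier = B.carrier) : A = B := by
  cases A; cases B; congr

/-- The configurations without points in `B`. -/
def void (B : Set S) : Set (Conf S) := {A | A.carrier ∩ B = ∅}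

/-- Configurations are sets, without multiplicities, so void events are rich enough to generate.
They form a pi-system: equality of laws, independence and measurability all reduce to void events.
-/
instance [MeasurableSpace S] : MeasurableSpace (Conf S) :=
  MeasurableSpace.generateFrom {V | ∃ B, MeasurableSet B ∧ V = void B}

lemma measurableSet_void [MeasurableSpace S] {B : Set S} (hB : MeasurableSet B) :
    MeasurableSet (void B) :=
  MeasurableSpace.measurableSet_generateFrom ⟨B, hB, rfl⟩

lemma measurable_of_void {Ω : Type*} [MeasurableSpace Ω] [MeasurableSpace S] {g : Ω → Conf S}
    (h : ∀ B, MeasurableSet B → MeasurableSet {ω | (g ω).carrier ∩ B = ∅}) : Measurable g :=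
  measurable_generateFrom (by rintro _ ⟨B, hB, rfl⟩; exact h B hB)

lemma void_inter_void (B C : Set S) : void B ∩ void C = void (B ∪ C) := by
  ext A
  simp [void, Set.inter_union_distrib_left, Set.union_empty_iff]

lemma isPiSystem_void [MeasurableSpace S] :
    IsPiSystem {V : Set (Conf S) | ∃ B, MeasurableSet B ∧ V = void B} := by
  rintro _ ⟨B, hB, rfl⟩ _ ⟨C, hC, rfl⟩ -
  exact ⟨B ∪ C, hB.union hC, void_inter_void B C⟩

/-- A simple point process is determined by its void probabilities. -/
lemma measure_ext [MeasurableSpace S] {μ ν : Measure (Conf S)} [IsProbabilityMeasure μ]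
    [IsProbabilityMeasure ν] (h : ∀ B, MeasurableSet B → μ (void B) = ν (void B)) : μ = ν :=
  ext_of_generate_finite _ rfl isPiSystem_void
    (by rintro _ ⟨B, hB, rfl⟩; exact h B hB) (by simp)

/-- Two different finite sets are told apart by a basic open set that contains a point of one and
misses the other, which is closed. The Lusin–Souslin theorem in `measurableSet_generic_inter`
requires this of its target. -/
instance [TopologicalSpace S] [SecondCountableTopology S] [T1Space S] [MeasurableSpace S]
    [OpensMeasurableSpace S] : MeasurableSpace.CountablySeparated (Conf S) := by
  refine ⟨⟨void '' TopologicalSpace.countableBasis S,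
    (TopologicalSpace.countable_countableBasis S).image _, ?_, ?_⟩⟩
  · rintro _ ⟨U, hU, rfl⟩
    exact measurableSet_void (TopologicalSpace.isOpen_of_mem_countableBasis hU).measurableSet
  · have key : ∀ A A' : Conf S, (∀ s ∈ void '' TopologicalSpace.countableBasis S,
        A ∈ s ↔ A' ∈ s) → A.carrier ⊆ A'.carrier := by
      intro A A' h a ha
      by_contra hna
      obtain ⟨U, hU, haU, hUA⟩ := (TopologicalSpace.isBasis_countableBasis S).exists_subset_of_mem_open
        (show a ∈ A'.carrierᶜ from hna) A'.finite.isClosed.isOpen_compl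
      have h1 : A' ∈ void U := by
        ext x
        simp only [Set.mem_inter_iff, Set.mem_empty_iff_false, iff_false, not_and]
        exact fun hx hxU => hUA hxU hx
      have h2 : A ∈ void U := (h _ ⟨U, hU, rfl⟩).2 h1
      exact (Set.eq_empty_iff_forall_notMem.1 h2 a) ⟨ha, haU⟩
    intro A _ A' _ h
    exact ext_carrier (Set.Subset.antisymm (key A A' h) (key A' A fun s hs => (h s hs).symm))

instance : Union (Conf S) := ⟨fun A B => ⟨A.carrier ∪ B.carrier, A.finite.union B.finite⟩⟩

lemma carrier_union (A B : Conf S) : (A ∪ B).carrier = A.carrier ∪ B.carrier := rfl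

/-- Adding a point to a configuration. -/
def add (s : S) (A : Conf S) : Conf S := ⟨insert s A.carrier, A.finite.insert s⟩

lemma measurable_union [MeasurableSpace S] :
    Measurable fun p : Conf S × Conf S => p.1 ∪ p.2 := by
  refine measurable_of_void fun B hB => ?_
  have : {p : Conf S × Conf S | (p.1 ∪ p.2).carrier ∩ B = ∅} = void B ×ˢ void B := by
    ext p
    simp [void, carrier_union, Set.union_inter_distrib_right, Set.union_empty_iff]
  rw [this]
  exact (measurableSet_void hB).prod (measurableSet_void hB)

lemma measurable_add [MeasurableSpace S] :
    Measurable fun p : S × Conf S => add p.1 p.2 := by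
  refine measurable_of_void fun B hB => ?_
  have : {p : S × Conf S | (add p.1 p.2).carrier ∩ B = ∅} = Bᶜ ×ˢ void B := by
    ext p
    simp only [add, void, Set.mem_ofPred_eq, Set.mem_prod, Set.mem_compl_iff]
    rw [Set.insert_eq, Set.union_inter_distrib_right, Set.union_empty_iff]
    simp
  rw [this]
  exact hB.compl.prod (measurableSet_void hB)

/-- The finite set `A` as a configuration (empty if `A` is infinite). -/
def ofSet (A : Set S) : Conf S :=
  open Classical in if h : A.Finite then ⟨A, h⟩ else ⟨∅, Set.finite_empty⟩

lemma carrier_ofSet {A : Set S} (h : A.Finite) : (ofSet A).carrier = A := by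
  simp [ofSet, h]

/-- The configuration of the points `x i`, `i ∈ I`. -/
def points {κ : Type*} (x : κ → S) (I : Finset κ) : Conf S := ⟨x '' I, I.finite_toSet.image x⟩

lemma points_mem_void {κ : Type*} {x : κ → S} {I : Finset κ} {B : Set S} :
    points x I ∈ void B ↔ ∀ i ∈ I, x i ∉ B := by
  simp only [points, void, Set.mem_ofPred_eq, Set.eq_empty_iff_forall_notMem]
  constructor
  · exact fun h i hi hB => h (x i) ⟨⟨i, hi, rfl⟩, hB⟩
  · rintro h _ ⟨⟨i, hi, rfl⟩, hB⟩
    exact h i hi hB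

lemma measurable_points [MeasurableSpace S] {κ Ω : Type*} [MeasurableSpace Ω] [Countable κ]
    {x : Ω → κ → S} {I : Ω → Finset κ} (hx : Measurable x)
    (hI : ∀ i, MeasurableSet {ω | i ∈ I ω}) :
    Measurable fun ω => points (x ω) (I ω) := by
  refine measurable_of_void fun B hB => ?_
  have : {ω | (points (x ω) (I ω)).carrier ∩ B = ∅} = ⋂ i, ({ω | i ∈ I ω}ᶜ ∪ {ω | x ω i ∈ Bᶜ}) := by
    ext ω
    have := points_mem_void (x := x ω) (I := I ω) (B := B)
    rw [void, Set.mem_ofPred_eq] at this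
    simp only [Set.mem_ofPred_eq, this, Set.mem_iInter, Set.mem_union, Set.mem_compl_iff]
    exact forall_congr' fun i => imp_iff_not_or
  rw [this]
  exact .iInter fun i => (hI i).compl.union (((measurable_pi_apply i).comp hx) hB.compl)

end Conf

/-! ## Void probabilities of Poisson processes -/

/-- The generating function of the Poisson law, from the exponential series. With `q` the
probability that one point misses a set, it becomes a void probability. -/
lemma lintegral_pow_poisson (r : ℝ≥0) {q : ℝ≥0∞} (hq : q ≤ 1) :
    ∫⁻ n, q ^ n ∂(poissonMeasure r) = ENNReal.ofReal (Real.exp (-(r * (1 - q.toReal)))) := by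
  have hqt : q ≠ ∞ := ne_top_of_le_ne_top ENNReal.one_ne_top hq
  lift q to ℝ≥0 using hqt
  have h1 : ∀ n : ℕ, ((q : ℝ≥0∞) ^ n) = ENNReal.ofReal ((q : ℝ) ^ n) := fun n => by
    rw [ENNReal.ofReal_pow (NNReal.coe_nonneg q), ENNReal.ofReal_coe_nnreal]
  have hq1 : (q : ℝ) ≤ 1 := by exact_mod_cast hq
  simp_rw [h1]
  rw [← ofReal_integral_eq_lintegral_ofReal]
  · rw [integral_poissonMeasure]
    congr 1
    have h2 := (NormedSpace.expSeries_div_hasSum_exp (𝔸 := ℝ) ((r : ℝ) * q)).mul_left (Real.exp (-r))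
    rw [← Real.exp_eq_exp_ℝ, ← Real.exp_add] at h2
    have h3 : (-(r : ℝ) + r * q) = -(r * (1 - ((q : ℝ≥0∞)).toReal)) := by simp; ring
    rw [h3] at h2
    rw [← h2.tsum_eq]
    refine tsum_congr fun n => ?_
    simp [mul_pow]
    ring
  · refine (integrable_const (1 : ℝ)).mono' (by fun_prop) (ae_of_all _ fun n => ?_)
    simp only [Real.norm_eq_abs, abs_pow, NNReal.abs_eq]
    exact pow_le_one₀ q.2 hq1
  · exact ae_of_all _ fun n => by positivity

lemma infinitePi_forall_notMem {S κ : Type*} [MeasurableSpace S] {ρ : κ → Measure S}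
    [∀ i, IsProbabilityMeasure (ρ i)] {J : Finset κ} {B : Set S} (hB : MeasurableSet B)
    {q : ℝ≥0∞} (hJ : ∀ i ∈ J, ρ i Bᶜ = q) :
    Measure.infinitePi ρ {x | ∀ i ∈ J, x i ∉ B} = q ^ J.card := by
  have : {x : κ → S | ∀ i ∈ J, x i ∉ B} = Set.pi (J : Set κ) fun _ => Bᶜ := by
    ext; simp
  rw [this, Measure.infinitePi_pi _ (fun _ _ => hB.compl), Finset.prod_congr rfl hJ]
  simp

/-- A Poisson number of independent points with law `ρ` has the void probabilities of a Poisson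
process. -/
lemma mixed_void {S κ : Type*} [MeasurableSpace S] [Countable κ] {ρ : κ → Measure S}
    [∀ i, IsProbabilityMeasure (ρ i)] (r : ℝ≥0) {J : ℕ → Finset κ} (hJ : ∀ n, (J n).card = n)
    {ρ₀ : Measure S} [IsProbabilityMeasure ρ₀]
    (hρ : ∀ n, ∀ i ∈ J n, ρ i = ρ₀) {B : Set S} (hB : MeasurableSet B) :
    ((poissonMeasure r).prod (Measure.infinitePi ρ)).map (fun p => Conf.points p.2 (J p.1))
      (Conf.void B) = ENNReal.ofReal (Real.exp (-(r * (ρ₀ B).toReal))) := by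
  have hm : Measurable fun p : ℕ × (κ → S) => Conf.points p.2 (J p.1) :=
    Conf.measurable_points measurable_snd fun i =>
      (measurable_fst (MeasurableSet.of_discrete (s := {n | i ∈ J n})))
  rw [Measure.map_apply hm (Conf.measurableSet_void hB),
    Measure.prod_apply (hm (Conf.measurableSet_void hB))]
  have h1 : ∀ n : ℕ, Measure.infinitePi ρ (Prod.mk n ⁻¹'
      ((fun p : ℕ × (κ → S) => Conf.points p.2 (J p.1)) ⁻¹' Conf.void B)) = (ρ₀ Bᶜ) ^ n := by
    intro n
    have : (Prod.mk n ⁻¹' ((fun p : ℕ × (κ → S) => Conf.points p.2 (J p.1)) ⁻¹' Conf.void B))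
        = {x | ∀ i ∈ J n, x i ∉ B} := by
      ext x
      exact Conf.points_mem_void
    rw [this, infinitePi_forall_notMem hB (q := ρ₀ Bᶜ) (fun i hi => by rw [hρ n i hi]), hJ]
  simp_rw [h1]
  rw [lintegral_pow_poisson r prob_le_one, prob_compl_eq_one_sub hB,
    ENNReal.toReal_sub_of_le prob_le_one ENNReal.one_ne_top]
  simp

section Points

variable {Ω S : Type*} [MeasurableSpace Ω] [TopologicalSpace S] [MeasurableSpace S]
  {μ : Measure S} {P : Measure Ω} {η : Ω → Set S}

lemma IsPoissonProcess.finite_inter (hη : IsPoissonProcess μ P η) {R K : Set S} (hK : IsCompact K)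
    (hR : R ⊆ K) (ω : Ω) : (η ω ∩ R).Finite :=
  (hη.locallyFinite ω K hK).subset (Set.inter_subset_inter_right _ hR)

lemma IsPoissonProcess.measurableSet_void (hη : IsPoissonProcess μ P η) {B : Set S}
    (hB : MeasurableSet B) : MeasurableSet {ω | η ω ∩ B = ∅} := by
  have := hη.measurable_count B hB (measurableSet_singleton 0)
  convert this using 1
  ext ω
  simp

lemma IsPoissonProcess.void_prob (hη : IsPoissonProcess μ P η) {B : Set S}
    (hB : MeasurableSet B) (hμ : μ B ≠ ∞) :
    P {ω | η ω ∩ B = ∅} = ENNReal.ofReal (Real.exp (-(μ B).toReal)) := by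
  have h := congrArg (fun ν => ν {(0 : ℕ∞)}) (hη.law_count B hB hμ)
  rw [Measure.map_apply (hη.measurable_count B hB) (measurableSet_singleton 0),
    Measure.map_apply (by fun_prop) (measurableSet_singleton 0)] at h
  have h1 : (fun ω => (η ω ∩ B).encard) ⁻¹' {0} = {ω | η ω ∩ B = ∅} := by ext ω; simp
  have h2 : (fun k : ℕ => (k : ℕ∞)) ⁻¹' {0} = {0} := by ext; simp
  rw [h1, h2, poissonMeasure_singleton] at h
  simpa [ENNReal.coe_toNNReal_eq_toReal] using h

lemma IsPoissonProcess.measurable_conf (hη : IsPoissonProcess μ P η) {R K : Set S}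
    (hK : IsCompact K) (hR : R ⊆ K) (hRm : MeasurableSet R) :
    Measurable fun ω => Conf.ofSet (η ω ∩ R) := by
  refine Conf.measurable_of_void fun B hB => ?_
  simp only [fun ω => Conf.carrier_ofSet (hη.finite_inter hK hR ω), Set.inter_assoc]
  exact hη.measurableSet_void (hRm.inter hB)

lemma IsPoissonProcess.conf_mem_void (hη : IsPoissonProcess μ P η) {R K : Set S}
    (hK : IsCompact K) (hR : R ⊆ K) (B : Set S) (ω : Ω) :
    Conf.ofSet (η ω ∩ R) ∈ Conf.void B ↔ η ω ∩ (R ∩ B) = ∅ := by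
  simp [Conf.void, Conf.carrier_ofSet (hη.finite_inter hK hR ω), Set.inter_assoc]

/-- In a region of finite intensity, a Poisson process is a Poisson number of independent points. -/
lemma IsPoissonProcess.map_conf [IsProbabilityMeasure P] (hη : IsPoissonProcess μ P η) {R K : Set S}
    (hK : IsCompact K) (hR : R ⊆ K) (hRm : MeasurableSet R)
    {κ : Type*} [Countable κ] {ρ : κ → Measure S} [∀ i, IsProbabilityMeasure (ρ i)]
    {r : ℝ≥0} {J : ℕ → Finset κ} (hJ : ∀ n, (J n).card = n)
    {ρ₀ : Measure S} [IsProbabilityMeasure ρ₀] (hρ : ∀ n, ∀ i ∈ J n, ρ i = ρ₀)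
    (hμ : μ.restrict R = r • ρ₀) :
    P.map (fun ω => Conf.ofSet (η ω ∩ R)) =
      ((poissonMeasure r).prod (Measure.infinitePi ρ)).map (fun p => Conf.points p.2 (J p.1)) := by
  have hm := hη.measurable_conf hK hR hRm
  have hm' : Measurable fun p : ℕ × (κ → S) => Conf.points p.2 (J p.1) :=
    Conf.measurable_points measurable_snd fun i =>
      (measurable_fst (MeasurableSet.of_discrete (s := {n | i ∈ J n})))
  have := Measure.isProbabilityMeasure_map (μ := P) hm.aemeasurable
  have := Measure.isProbabilityMeasure_map
    (μ := (poissonMeasure r).prod (Measure.infinitePi ρ)) hm'.aemeasurable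
  refine Conf.measure_ext fun B hB => ?_
  rw [mixed_void r hJ hρ hB, Measure.map_apply hm (Conf.measurableSet_void hB)]
  have h1 : (fun ω => Conf.ofSet (η ω ∩ R)) ⁻¹' Conf.void B = {ω | η ω ∩ (R ∩ B) = ∅} := by
    ext ω
    exact hη.conf_mem_void hK hR B ω
  have h2 : μ (R ∩ B) = r * ρ₀ B := by
    rw [Set.inter_comm, ← Measure.restrict_apply hB, hμ]
    rfl
  have h3 : μ (R ∩ B) ≠ ∞ := by
    rw [h2]
    exact ENNReal.mul_ne_top ENNReal.coe_ne_top (measure_ne_top _ _)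
  rw [h1, hη.void_prob (hRm.inter hB) h3, h2]
  simp

/-- Additivity of `μ` on disjoint sets turns the exponential of the total intensity into a product.
Since void events generate, this is all that the independence of the restrictions needs. -/
lemma IsPoissonProcess.void_prob_biUnion (hη : IsPoissonProcess μ P η) {ι : Type*}
    (s : Finset ι) {B : ι → Set S}
    (hB : ∀ i ∈ s, MeasurableSet (B i)) (hμ : ∀ i ∈ s, μ (B i) ≠ ∞)
    (hd : (s : Set ι).PairwiseDisjoint B) :
    P (⋂ i ∈ s, {ω | η ω ∩ B i = ∅}) = ∏ i ∈ s, P {ω | η ω ∩ B i = ∅} := by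
  have h1 : (⋂ i ∈ s, {ω | η ω ∩ B i = ∅}) = {ω | η ω ∩ (⋃ i ∈ s, B i) = ∅} := by
    ext ω
    simp [Set.inter_iUnion₂]
  have h2 : μ (⋃ i ∈ s, B i) = ∑ i ∈ s, μ (B i) := measure_biUnion_finset hd hB
  rw [h1, hη.void_prob (s.measurableSet_biUnion hB)
    (by rw [h2]; exact ENNReal.sum_ne_top.2 hμ),
    Finset.prod_congr rfl fun i hi => hη.void_prob (hB i hi) (hμ i hi), h2,
    ENNReal.toReal_sum hμ, ← Finset.sum_neg_distrib, Real.exp_sum,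
    ENNReal.ofReal_prod_of_nonneg fun i _ => (Real.exp_pos _).le]

/-- The restrictions of a Poisson process to disjoint regions are independent. -/
lemma IsPoissonProcess.iIndepFun_conf [IsProbabilityMeasure P] (hη : IsPoissonProcess μ P η)
    {ι : Type*} {R K : ι → Set S}
    (hK : ∀ i, IsCompact (K i)) (hR : ∀ i, R i ⊆ K i) (hRm : ∀ i, MeasurableSet (R i))
    (hμ : ∀ i, μ (R i) ≠ ∞) (hd : Pairwise (Function.onFun Disjoint R)) :
    iIndepFun (fun i ω => Conf.ofSet (η ω ∩ R i)) P := by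
  have hpre : ∀ i (B : Set S), (fun ω => Conf.ofSet (η ω ∩ R i)) ⁻¹' Conf.void B =
      {ω | η ω ∩ (R i ∩ B) = ∅} := fun i B => by
    ext ω
    exact hη.conf_mem_void (hK i) (hR i) B ω
  refine iIndepSets.iIndep (fun i => (hη.measurable_conf (hK i) (hR i) (hRm i)).comap_le)
    (fun i => (fun V => (fun ω => Conf.ofSet (η ω ∩ R i)) ⁻¹' V) ''
      {V | ∃ B, MeasurableSet B ∧ V = Conf.void B}) (fun i => ?_) (fun i => ?_) ?_
  · exact Conf.isPiSystem_void.comap _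
  · exact MeasurableSpace.comap_generateFrom
  · rw [iIndepSets_iff]
    intro s f hf
    -- For indices outside `s` the set plays no role; `∅` is a default that makes a single choice
    -- function possible.
    have hf' : ∀ i : ι, ∃ B, MeasurableSet B ∧ (i ∈ s → f i = {ω | η ω ∩ (R i ∩ B) = ∅}) := by
      intro i
      by_cases hi : i ∈ s
      · obtain ⟨_, ⟨B, hB, rfl⟩, hfB⟩ := hf i hi
        exact ⟨B, hB, fun _ => by rw [← hfB]; exact hpre i B⟩
      · exact ⟨∅, MeasurableSet.empty, fun h => absurd h hi⟩
    choose B hB hfB using hf'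
    rw [Finset.prod_congr rfl fun i hi => congrArg P (hfB i hi),
      Set.iInter₂_congr hfB]
    exact hη.void_prob_biUnion s (fun i _ => (hRm i).inter (hB i))
      (fun i _ => measure_ne_top_of_subset Set.inter_subset_left (hμ i))
      fun i _ j _ hij => (hd hij).mono Set.inter_subset_left Set.inter_subset_left

end Points

end MarkedPoisson

namespace MarkedPoisson

/-! ## Marked graphs -/

attribute [local instance] finiteConfigSigma

section Graph

variable {d : ℕ} {κ : Type*}

lemma measurable_of_count {Ω : Type*} [MeasurableSpace Ω] {g : Ω → Finset (MarkedEdge d)}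
    (h : ∀ B, MeasurableSet[markedEdgeSigma d] B →
      Measurable fun ω => ((g ω : Set (MarkedEdge d)) ∩ B).encard) : Measurable g := by
  refine Measurable.of_comap_le ?_
  rw [MeasurableSpace.comap_iSup]
  refine iSup_le fun B => ?_
  rw [MeasurableSpace.comap_iSup]
  refine iSup_le fun hB => ?_
  rw [MeasurableSpace.comap_comp]
  exact (h B hB).comap_le

lemma measurable_count {B : Set (MarkedEdge d)} (hB : MeasurableSet[markedEdgeSigma d] B) :
    Measurable fun A : Finset (MarkedEdge d) => ((A : Set (MarkedEdge d)) ∩ B).encard := by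
  refine Measurable.of_comap_le ?_
  exact le_iSup₂ (f := fun (B : Set (MarkedEdge d)) (_ : MeasurableSet[markedEdgeSigma d] B) =>
    MeasurableSpace.comap (fun A : Finset (MarkedEdge d) => ((A : Set (MarkedEdge d)) ∩ B).encard)
      inferInstance) B hB

lemma finite_graph (x : κ → Loc d) (u : Sym2 κ → unitInterval) (I : Finset κ) :
    {a : MarkedEdge d | ∃ i ∈ I, ∃ k ∈ I, i ≠ k ∧ (a.1 : Sym2 (Loc d)) = s(x i, x k) ∧
      a.2 = u s(i, k)}.Finite := by
  have : {a : MarkedEdge d | ∃ i ∈ I, ∃ k ∈ I, i ≠ k ∧ (a.1 : Sym2 (Loc d)) = s(x i, x k) ∧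
      a.2 = u s(i, k)} ⊆ (fun a : MarkedEdge d => ((a.1 : Sym2 (Loc d)), a.2)) ⁻¹'
        ((fun q : κ × κ => (s(x q.1, x q.2), u s(q.1, q.2))) '' ((I : Set κ) ×ˢ (I : Set κ))) := by
    rintro a ⟨i, hi, k, hk, -, h1, h2⟩
    exact ⟨(i, k), ⟨hi, hk⟩, Prod.ext h1.symm h2.symm⟩
  refine (Set.Finite.preimage ?_ ((I.finite_toSet.prod I.finite_toSet).image _)).subset this
  intro a _ b _ h
  exact Prod.ext (Subtype.ext (Prod.ext_iff.1 h).1) (Prod.ext_iff.1 h).2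

/-- The complete graph with vertices `x i`, `i ∈ I`, and edge marks `u`. -/
def graph (x : κ → Loc d) (u : Sym2 κ → unitInterval) (I : Finset κ) : Finset (MarkedEdge d) :=
  (finite_graph x u I).toFinset

lemma mem_graph {x : κ → Loc d} {u : Sym2 κ → unitInterval} {I : Finset κ} {a : MarkedEdge d} :
    a ∈ graph x u I ↔ ∃ i ∈ I, ∃ k ∈ I, i ≠ k ∧ (a.1 : Sym2 (Loc d)) = s(x i, x k) ∧
      a.2 = u s(i, k) := by
  simp [graph]

/-- The proper pairs of elements of `I`. -/
def properPairs (I : Finset κ) : Finset (Sym2 κ) :=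
  open Classical in I.sym2.filter fun p => ¬ p.IsDiag

lemma mk_mem_properPairs {I : Finset κ} {i k : κ} :
    s(i, k) ∈ properPairs I ↔ (i ∈ I ∧ k ∈ I) ∧ i ≠ k := by
  simp [properPairs, Finset.mem_sym2_iff]

lemma graph_congr {x : κ → Loc d} {u v : Sym2 κ → unitInterval} {I : Finset κ}
    (h : ∀ p ∈ properPairs I, u p = v p) : graph x u I = graph x v I := by
  ext a
  simp only [mem_graph]
  refine exists_congr fun i => and_congr_right fun hi => exists_congr fun k =>
    and_congr_right fun hk => and_congr_right fun hik => ?_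
  rw [h _ (mk_mem_properPairs.2 ⟨⟨hi, hk⟩, hik⟩)]

lemma not_isDiag_map {x : κ → Loc d} {I : Finset κ} (hx : Set.InjOn x I) {p : Sym2 κ}
    (hp : p ∈ properPairs I) : ¬ (p.map x).IsDiag := by
  induction p with
  | _ i k =>
    rw [mk_mem_properPairs] at hp
    simp only [Sym2.map_mk, Sym2.mk_isDiag_iff]
    exact fun h => hp.2 (hx hp.1.1 hp.1.2 h)

/-- The marked edge of the graph `graph x u I` that corresponds to the pair `p`. -/
def edgeOf {I : Finset κ} (x : κ → Loc d) (hx : Set.InjOn x I) (u : Sym2 κ → unitInterval)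
    (p : properPairs I) : MarkedEdge d :=
  (⟨p.1.map x, not_isDiag_map hx p.2⟩, u p.1)

lemma edgeOf_injective {I : Finset κ} {x : κ → Loc d} (hx : Set.InjOn x I)
    (u : Sym2 κ → unitInterval) : Function.Injective (edgeOf x hx u) := by
  rintro ⟨p, hp⟩ ⟨q, hq⟩ h
  have h1 : p.map x = q.map x := congrArg Subtype.val (Prod.ext_iff.1 h).1
  apply Subtype.ext
  induction p with
  | _ i k =>
    induction q with
    | _ i' k' =>
      rw [mk_mem_properPairs] at hp hq
      simp only [Sym2.map_mk, Sym2.eq_iff] at h1 ⊢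
      rcases h1 with ⟨h1, h2⟩ | ⟨h1, h2⟩
      · exact Or.inl ⟨hx hp.1.1 hq.1.1 h1, hx hp.1.2 hq.1.2 h2⟩
      · exact Or.inr ⟨hx hp.1.1 hq.1.2 h1, hx hp.1.2 hq.1.1 h2⟩

lemma graph_eq_range {I : Finset κ} {x : κ → Loc d} (hx : Set.InjOn x I)
    (u : Sym2 κ → unitInterval) :
    (graph x u I : Set (MarkedEdge d)) = Set.range (edgeOf x hx u) := by
  ext a
  simp only [Finset.mem_coe, mem_graph, Set.mem_range]
  constructor
  · rintro ⟨i, hi, k, hk, hik, h1, h2⟩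
    exact ⟨⟨s(i, k), mk_mem_properPairs.2 ⟨⟨hi, hk⟩, hik⟩⟩,
      Prod.ext (Subtype.ext (by simpa [edgeOf] using h1.symm)) h2.symm⟩
  · rintro ⟨⟨p, hp⟩, rfl⟩
    induction p with
    | _ i k =>
      have := mk_mem_properPairs.1 hp
      exact ⟨i, this.1.1, k, this.1.2, this.2, rfl, rfl⟩

/-- With distinct locations, edges correspond one to one to proper pairs of labels, so the count in
`B` is a finite sum of indicators. This is the form in which counts are seen to be measurable. -/
lemma encard_graph_inter {I : Finset κ} {x : κ → Loc d} (hx : Set.InjOn x I)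
    (u : Sym2 κ → unitInterval) (B : Set (MarkedEdge d)) :
    ((graph x u I : Set (MarkedEdge d)) ∩ B).encard =
      ((open Classical in (Finset.univ.filter fun p : properPairs I =>
        edgeOf x hx u p ∈ B).card : ℕ) : ℕ∞) := by
  classical
  rw [graph_eq_range hx, ← Set.image_preimage_eq_range_inter,
    (edgeOf_injective hx u).encard_image, ← Set.encard_coe_eq_coe_finsetCard]
  congr 1
  ext p
  simp

lemma measurableSet_injOn {Ω : Type*} [MeasurableSpace Ω] {x : Ω → κ → Loc d}
    (hx : ∀ i, Measurable fun ω => x ω i) (I : Finset κ) :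
    MeasurableSet {ω | Set.InjOn (x ω) I} := by
  have : {ω | Set.InjOn (x ω) I} = ⋂ i ∈ I, ⋂ k ∈ I, ⋂ (_ : i ≠ k), {ω | x ω i = x ω k}ᶜ := by
    ext ω
    simp only [Set.mem_iInter, Set.mem_compl_iff, Set.mem_ofPred_eq]
    exact ⟨fun h i hi k hk hik hx => hik (h hi hk hx), fun h i hi k hk hx => by
      by_contra hik
      exact h i hi k hk hik hx⟩
  rw [this]
  exact I.measurableSet_biInter fun i _ => I.measurableSet_biInter fun k _ =>
    .iInter fun _ => (measurableSet_eq_fun (hx i) (hx k)).compl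

-- The value `∅` is imposed where locations coincide, since there different pairs may give the same
-- edge and the count is no sum over pairs. For independent uniform points of a cube this event is
-- null.
open Classical in
lemma measurable_graph {Ω : Type*} [MeasurableSpace Ω] {x : Ω → κ → Loc d}
    {u : Ω → Sym2 κ → unitInterval} (hx : ∀ i, Measurable fun ω => x ω i)
    {I : Finset κ} (hu : ∀ p ∈ properPairs I, Measurable fun ω => u ω p) :
    Measurable fun ω => if Set.InjOn (x ω) I then graph (x ω) (u ω) I else ∅ := by
  refine measurable_of_restrict_of_restrict_compl (measurableSet_injOn hx I) ?_ ?_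
  · have h1 : ({ω | Set.InjOn (x ω) I}.domRestrict fun ω =>
        if Set.InjOn (x ω) I then graph (x ω) (u ω) I else ∅) =
        fun ω : {ω | Set.InjOn (x ω) I} => graph (x ω) (u ω) I := by
      ext1 ω
      exact if_pos ω.2
    rw [h1]
    refine measurable_of_count fun B hB => ?_
    have h2 : ∀ ω : {ω | Set.InjOn (x ω) I}, ((graph (x ω) (u ω) I : Set (MarkedEdge d)) ∩ B).encard
        = ((∑ p : properPairs I, if edgeOf (x ω) ω.2 (u ω) p ∈ B then 1 else 0 : ℕ) : ℕ∞) := by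
      intro ω
      rw [encard_graph_inter ω.2, Finset.card_filter]
    simp_rw [h2]
    refine (measurable_from_top (f := fun n : ℕ => (n : ℕ∞))).comp
      (Finset.measurable_sum _ fun p _ => ?_)
    refine Measurable.ite ?_ measurable_const measurable_const
    have h3 : @Measurable _ _ _ (markedEdgeSigma d)
        (fun ω : {ω | Set.InjOn (x ω) I} => edgeOf (x ω) ω.2 (u ω) p) := by
      let _ : MeasurableSpace (Edge d) := MeasurableSpace.comap Subtype.val (sym2Sigma d)
      refine Measurable.prodMk ?_ ?_
      · refine measurable_comap_iff.2 ?_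
        obtain ⟨p, hp⟩ := p
        induction p with
        | _ i k =>
          -- The sigma-field on unordered pairs is the image of that on ordered pairs, so this map
          -- is measurable by definition.
          have h4 : @Measurable _ _ _ (sym2Sigma d) (fun p : Loc d × Loc d => s(p.1, p.2)) :=
            fun s hs => hs
          exact h4.comp (((hx i).comp measurable_subtype_coe).prodMk
            ((hx k).comp measurable_subtype_coe))
      · exact (hu p p.2).comp measurable_subtype_coe
    exact h3 hB
  · have h1 : ({ω | Set.InjOn (x ω) I}ᶜ.domRestrict fun ω =>
        if Set.InjOn (x ω) I then graph (x ω) (u ω) I else ∅) = fun _ => ∅ := by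
      ext1 ω
      exact if_neg ω.2
    rw [h1]
    exact measurable_const

end Graph

/-! ## Edge marking of finite configurations -/

section Marking

variable {d : ℕ} {κ : Type*} (e : ℕ ≃ (Fin d → ℤ))

/-- The edge marking of a finite configuration. -/
def markedGraph (A : Conf (Pt d)) : Finset (MarkedEdge d) := (edgeMarking_finite e A.finite).toFinset

/-- The configurations with distinct locations and distinct birth times. -/
def Generic (A : Conf (Pt d)) : Prop :=
  Set.InjOn (fun s : Pt d => s.1) A.carrier ∧ Set.InjOn (fun s : Pt d => s.2.1) A.carrier

/-- The index of the unit cube that contains `x`. -/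
def cubeIndex (x : Loc d) : ℕ := e.symm fun i => ⌊x i⌋

lemma mem_unitCube_iff {x : Loc d} {n : ℕ} : x ∈ unitCube (e n) ↔ cubeIndex e x = n := by
  rw [cubeIndex, Equiv.symm_apply_eq, funext_iff]
  exact forall_congr' fun i => (Int.floor_eq_iff).symm

lemma measurable_cubeIndex : Measurable (cubeIndex e) := by
  refine (measurable_of_countable e.symm).comp (measurable_pi_lambda _ fun i => ?_)
  exact Int.measurable_floor.comp (by fun_prop)

/-- The age rank of the point `i` within its cube. -/
def ageIndex (x : κ → Loc d) (t : κ → unitInterval) (I : Finset κ) (i : κ) : ℕ :=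
  open Classical in ∑ k ∈ I, if cubeIndex e (x k) = cubeIndex e (x i) ∧ t k < t i then 1 else 0

/-- The younger element of a pair. -/
def younger (t : κ → unitInterval) (p : Sym2 κ) : κ :=
  if t (Quot.out p).1 < t (Quot.out p).2 then (Quot.out p).2 else (Quot.out p).1

/-- The older element of a pair. -/
def older (t : κ → unitInterval) (p : Sym2 κ) : κ :=
  if t (Quot.out p).1 < t (Quot.out p).2 then (Quot.out p).1 else (Quot.out p).2

/-- The representative chosen by `Quot.out` may list the pair in either order; a strict inequality
of birth times makes the outcome independent of it. -/
lemma younger_older_mk {t : κ → unitInterval} {i k : κ} (h : t i < t k) :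
    younger t s(i, k) = k ∧ older t s(i, k) = i := by
  have h1 : s((Quot.out s(i, k)).1, (Quot.out s(i, k)).2) = s(i, k) := Quot.out_eq s(i, k)
  rw [Sym2.eq_iff] at h1
  rcases h1 with ⟨h1, h2⟩ | ⟨h1, h2⟩
  · simp [younger, older, h1, h2, h]
  · simp [younger, older, h1, h2, h.not_gt]

/-- The double sequence index of the mark that is used for a pair of points. -/
def markIndex (x : κ → Loc d) (t : κ → unitInterval) (I : Finset κ) (p : Sym2 κ) : ℕ × ℕ :=
  (ageIndex e x t I (older t p), cubeIndex e (x (older t p)))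

/-- The edge mark of a pair of points. -/
def pairMark (x : κ → Loc d) (t : κ → unitInterval) (M : κ → Marks) (I : Finset κ)
    (p : Sym2 κ) : unitInterval :=
  M (younger t p) (markIndex e x t I p)

lemma ageRank_points {x : κ → Loc d} {t : κ → unitInterval} {M : κ → Marks} {I : Finset κ}
    (hx : Set.InjOn x I) (i : κ) :
    ageRank (Conf.points (fun i => (x i, t i, M i)) I).carrier (unitCube (e (cubeIndex e (x i))))
      (t i) = ageIndex e x t I i := by
  classical
  rw [ageRank, ageIndex, ← Finset.card_filter]
  have : {s | s ∈ (Conf.points (fun i => (x i, t i, M i)) I).carrier ∧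
      s.1 ∈ unitCube (e (cubeIndex e (x i))) ∧ s.2.1 < t i} = (fun i => (x i, t i, M i)) ''
      (I.filter fun k => cubeIndex e (x k) = cubeIndex e (x i) ∧ t k < t i : Finset κ) := by
    ext s
    constructor
    · rintro ⟨⟨k, hk, rfl⟩, h1, h2⟩
      exact ⟨k, by simpa using ⟨hk, (mem_unitCube_iff e).1 h1, h2⟩, rfl⟩
    · rintro ⟨k, hk, rfl⟩
      simp only [Finset.coe_filter, Set.mem_ofPred_eq] at hk
      exact ⟨⟨k, hk.1, rfl⟩, (mem_unitCube_iff e).2 hk.2.1, hk.2.2⟩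
  rw [this, Set.InjOn.ncard_image, Set.ncard_coe_finset]
  intro k hk l hl h
  simp only [Finset.coe_filter, Set.mem_ofPred_eq] at hk hl
  exact hx hk.1 hl.1 (Prod.ext_iff.1 h).1

/-- The edge marking of finitely many points is the complete graph with marks read off from the
marks of the younger points. -/
lemma markedGraph_points {x : κ → Loc d} {t : κ → unitInterval} {M : κ → Marks} {I : Finset κ}
    (hx : Set.InjOn x I) (ht : Set.InjOn t I) :
    markedGraph e (Conf.points (fun i => (x i, t i, M i)) I) =
      graph x (pairMark e x t M I) I := by
  ext a
  simp only [markedGraph, Set.Finite.mem_toFinset, mem_graph]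
  constructor
  · rintro ⟨_, ⟨i, hi, rfl⟩, _, ⟨k, hk, rfl⟩, n, hik, hn, h1, h2⟩
    rw [mem_unitCube_iff] at hn
    subst hn
    have hne : i ≠ k := fun h => by subst h; exact lt_irrefl _ hik
    refine ⟨i, hi, k, hk, hne, h1, ?_⟩
    have hyo := younger_older_mk (t := t) hik
    rw [h2, ageRank_points e hx, pairMark, markIndex, hyo.1, hyo.2]
  · have key : ∀ i ∈ I, ∀ k ∈ I, t i < t k → (a.1 : Sym2 (Loc d)) = s(x i, x k) →
        a.2 = pairMark e x t M I s(i, k) →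
        a ∈ edgeMarking e (Conf.points (fun i => (x i, t i, M i)) I).carrier := by
      intro i hi k hk hik h1 h2
      refine ⟨_, ⟨i, hi, rfl⟩, _, ⟨k, hk, rfl⟩, cubeIndex e (x i), hik, (mem_unitCube_iff e).2 rfl,
        h1, ?_⟩
      rw [ageRank_points e hx, h2, pairMark, markIndex, (younger_older_mk hik).1,
        (younger_older_mk hik).2]
    rintro ⟨i, hi, k, hk, hne, h1, h2⟩
    rcases lt_trichotomy (t i) (t k) with h | h | h
    · exact key i hi k hk h h1 h2
    · exact absurd (ht hi hk h) hne
    · exact key k hk i hi h (by rw [h1, Sym2.eq_swap]) (by rw [h2, Sym2.eq_swap])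

section Measurability

variable {Ω : Type*} [MeasurableSpace Ω] {x : Ω → κ → Loc d} {t : Ω → κ → unitInterval}

lemma measurable_ageIndex (hx : ∀ i, Measurable fun ω => x ω i)
    (ht : ∀ i, Measurable fun ω => t ω i) (I : Finset κ) (i : κ) :
    Measurable fun ω => ageIndex e (x ω) (t ω) I i := by
  refine Finset.measurable_sum _ fun k _ => Measurable.ite ?_ measurable_const measurable_const
  exact (measurableSet_eq_fun ((measurable_cubeIndex e).comp (hx k))
    ((measurable_cubeIndex e).comp (hx i))).inter (measurableSet_lt (f := fun ω => t ω k) (g := fun ω => t ω i) (ht k) (ht i))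

lemma measurable_pairMark {M : Ω → κ → Marks} (hx : ∀ i, Measurable fun ω => x ω i)
    (ht : ∀ i, Measurable fun ω => t ω i) (hM : ∀ i, Measurable fun ω => M ω i)
    (I : Finset κ) (p : Sym2 κ) : Measurable fun ω => pairMark e (x ω) (t ω) (M ω) I p := by
  have key : ∀ i k, Measurable fun ω => M ω k (ageIndex e (x ω) (t ω) I i, cubeIndex e (x ω i)) := by
    intro i k
    have h1 : Measurable fun q : Marks × (ℕ × ℕ) => q.1 q.2 :=
      measurable_from_prod_countable_left fun n => measurable_pi_apply n
    exact h1.comp ((hM k).prodMk ((measurable_ageIndex e hx ht I i).prodMk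
      ((measurable_cubeIndex e).comp (hx i))))
  have : (fun ω => pairMark e (x ω) (t ω) (M ω) I p) = fun ω =>
      if t ω (Quot.out p).1 < t ω (Quot.out p).2 then
        M ω (Quot.out p).2 (ageIndex e (x ω) (t ω) I (Quot.out p).1,
          cubeIndex e (x ω (Quot.out p).1))
      else M ω (Quot.out p).1 (ageIndex e (x ω) (t ω) I (Quot.out p).2,
          cubeIndex e (x ω (Quot.out p).2)) := by
    ext1 ω
    simp only [pairMark, markIndex, younger, older]
    split_ifs <;> rfl
  rw [this]
  exact Measurable.ite (measurableSet_lt (ht _) (ht _)) (key _ _) (key _ _)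

end Measurability

/-- The sequences of points with increasing birth times and distinct locations. -/
def orderedSeq (d n : ℕ) : Set (Fin n → Pt d) :=
  {s | StrictMono (fun i => (s i).2.1) ∧ Set.InjOn (fun i => (s i).1) (Finset.univ : Finset (Fin n))}

lemma measurableSet_orderedSeq (n : ℕ) : MeasurableSet (orderedSeq d n) := by
  refine MeasurableSet.inter (s₁ := {s : Fin n → Pt d | StrictMono (fun i => (s i).2.1)}) ?_
    (measurableSet_injOn (fun i => by fun_prop) _)
  have : {s : Fin n → Pt d | StrictMono (fun i => (s i).2.1)} =
      ⋂ (i) (k) (_ : i < k), {s | (s i).2.1 < (s k).2.1} := by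
    ext s
    simp [StrictMono]
  rw [this]
  exact .iInter fun i => .iInter fun k => .iInter fun _ =>
    measurableSet_lt (by fun_prop) (by fun_prop)

/-- A strictly increasing sequence of birth times is determined by its range, and the birth time
then identifies the point. -/
lemma injOn_points_orderedSeq (n : ℕ) :
    Set.InjOn (fun s : Fin n → Pt d => Conf.points s Finset.univ) (orderedSeq d n) := by
  intro s hs s' hs' h
  have hr : Set.range s = Set.range s' := by
    have := congrArg Conf.carrier h
    simpa [Conf.points] using this
  have ht : (fun i => (s i).2.1) = fun i => (s' i).2.1 := by
    refine (hs.1.range_inj hs'.1).1 ?_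
    rw [show (fun i => (s i).2.1) = (fun q : Pt d => q.2.1) ∘ s from rfl,
      show (fun i => (s' i).2.1) = (fun q : Pt d => q.2.1) ∘ s' from rfl,
      Set.range_comp, Set.range_comp, hr]
  funext i
  obtain ⟨k, hk⟩ : s i ∈ Set.range s' := hr ▸ Set.mem_range_self i
  have h1 : (s' k).2.1 = (s' i).2.1 := by rw [hk]; exact congrFun ht i
  rw [← hk, hs'.1.injective h1]

/-- Sorting by birth time enumerates a generic configuration. Together with
`injOn_points_orderedSeq` this parametrizes generic configurations injectively by sequences. -/
lemma generic_iff {A : Conf (Pt d)} :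
    Generic A ↔ ∃ n, ∃ s ∈ orderedSeq d n, Conf.points s Finset.univ = A := by
  constructor
  · intro hA
    let F := A.finite.toFinset
    let s₀ : Fin F.card → Pt d := fun i => (F.equivFin.symm i : Pt d)
    have hs₀ : Set.range s₀ = A.carrier := by
      have : s₀ = Subtype.val ∘ F.equivFin.symm := rfl
      rw [this, F.equivFin.symm.surjective.range_comp]
      simp [F]
    have hinj : Function.Injective s₀ :=
      Subtype.val_injective.comp F.equivFin.symm.injective
    let σ := Tuple.sort fun i => (s₀ i).2.1
    have hr : Set.range (s₀ ∘ σ) = A.carrier := by rw [σ.surjective.range_comp, hs₀]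
    have hmem : ∀ i, (s₀ ∘ σ) i ∈ A.carrier := fun i => hr ▸ Set.mem_range_self i
    have hinj' : Function.Injective (s₀ ∘ σ) := hinj.comp σ.injective
    refine ⟨F.card, s₀ ∘ σ, ⟨?_, ?_⟩, ?_⟩
    · refine (Tuple.monotone_sort fun i => (s₀ i).2.1).strictMono_of_injective ?_
      exact fun i k h => hinj' (hA.2 (hmem i) (hmem k) h)
    · exact fun i _ k _ h => hinj' (hA.1 (hmem i) (hmem k) h)
    · refine Conf.ext_carrier ?_
      simp only [Conf.points, Finset.coe_univ, Set.image_univ]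
      exact hr
  · rintro ⟨n, s, hs, rfl⟩
    constructor
    · rintro _ ⟨i, -, rfl⟩ _ ⟨k, -, rfl⟩ h
      rw [hs.2 (by simp) (by simp) h]
    · rintro _ ⟨i, -, rfl⟩ _ ⟨k, -, rfl⟩ h
      rw [hs.1.injective h]

instance : StandardBorelSpace (Pt d) := inferInstance

instance (n : ℕ) : StandardBorelSpace (Fin n → Pt d) :=
  @StandardBorelSpace.pi_countable _ _ _ _ fun _ => inferInstanceAs (StandardBorelSpace (Pt d))

/-- Ranks and edges are Borel functions of a sequence of points, whereas the sigma-field on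
configurations only knows void events. Generic configurations are injective Borel images of sorted
sequences, and by the Lusin–Souslin theorem such images of Borel sets are measurable. -/
lemma measurableSet_generic_inter {U : Set (Finset (MarkedEdge d))} (hU : MeasurableSet U) :
    MeasurableSet {A : Conf (Pt d) | Generic A ∧ markedGraph e A ∈ U} := by
  classical
  have h1 : {A : Conf (Pt d) | Generic A ∧ markedGraph e A ∈ U} = ⋃ n,
      (fun s : Fin n → Pt d => Conf.points s Finset.univ) '' (orderedSeq d n ∩
        {s | (if Set.InjOn (fun i => (s i).1) (Finset.univ : Finset (Fin n)) then
          graph (fun i => (s i).1) (pairMark e (fun i => (s i).1) (fun i => (s i).2.1)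
            (fun i => (s i).2.2) Finset.univ) Finset.univ else ∅) ∈ U}) := by
    have h2 : ∀ n, ∀ s ∈ orderedSeq d n, markedGraph e (Conf.points s Finset.univ) =
        if Set.InjOn (fun i => (s i).1) (Finset.univ : Finset (Fin n)) then
          graph (fun i => (s i).1) (pairMark e (fun i => (s i).1) (fun i => (s i).2.1)
            (fun i => (s i).2.2) Finset.univ) Finset.univ else ∅ := by
      intro n s hs
      rw [if_pos hs.2, ← markedGraph_points e hs.2 hs.1.injective.injOn]
    ext A
    simp only [Set.mem_ofPred_eq, generic_iff, Set.mem_iUnion, Set.mem_image, Set.mem_inter_iff]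
    constructor
    · rintro ⟨⟨n, s, hs, rfl⟩, hA⟩
      exact ⟨n, s, ⟨hs, by rwa [← h2 n s hs]⟩, rfl⟩
    · rintro ⟨n, s, ⟨hs, hsU⟩, rfl⟩
      exact ⟨⟨n, s, hs, rfl⟩, by rwa [h2 n s hs]⟩
  rw [h1]
  refine .iUnion fun n => MeasurableSet.image_of_measurable_injOn
    ((measurableSet_orderedSeq n).inter ?_) ?_ ((injOn_points_orderedSeq n).mono Set.inter_subset_left)
  · exact measurable_graph (fun i => by fun_prop) (fun p _ => measurable_pairMark e
      (fun i => by fun_prop) (fun i => by fun_prop) (fun i => by fun_prop) _ p) hU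
  · exact Conf.measurable_points measurable_id fun i => by simp

lemma measurableSet_generic (e : ℕ ≃ (Fin d → ℤ)) : MeasurableSet {A : Conf (Pt d) | Generic A} := by
  simpa using measurableSet_generic_inter e MeasurableSet.univ

open Classical in
/-- The edge marking is a measurable function of generic configurations. -/
lemma measurable_markedGraph :
    Measurable fun A : Conf (Pt d) => if Generic A then markedGraph e A else ∅ := by
  intro U hU
  have h0 := measurableSet_generic e
  have : (fun A : Conf (Pt d) => if Generic A then markedGraph e A else ∅) ⁻¹' U =
      {A | Generic A ∧ markedGraph e A ∈ U} ∪
        ({A | Generic A}ᶜ ∩ {_A | (∅ : Finset (MarkedEdge d)) ∈ U}) := by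
    ext A
    by_cases hA : Generic A <;> simp [hA]
  rw [this]
  exact (measurableSet_generic_inter e hU).union (h0.compl.inter (.const _))

end Marking

end MarkedPoisson

namespace MarkedPoisson

attribute [local instance] finiteConfigSigma

/-! ## The law of the marked graph given the locations -/

instance : IsProbabilityMeasure markLaw := by unfold markLaw; infer_instance

/-- Independent marks of all points. -/
def marksLaw (κ : Type*) : Measure (κ → Marks) := Measure.infinitePi fun _ => markLaw

/-- Independent uniform marks of all pairs. -/
def fieldLaw (κ : Type*) : Measure (Sym2 κ → unitInterval) := Measure.infinitePi fun _ => volume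

instance (κ : Type*) : IsProbabilityMeasure (marksLaw κ) := by unfold marksLaw; infer_instance

instance (κ : Type*) : IsProbabilityMeasure (fieldLaw κ) := by unfold fieldLaw; infer_instance

section Reindex

variable {d : ℕ} {κ : Type*} (e : ℕ ≃ (Fin d → ℤ))

/-- After uncurrying, all mark sequences together are one independent uniform array; reading it at
distinct places gives independent uniform variables again. -/
lemma map_marksLaw_of_injective {K : Type*} {j : K → κ × (ℕ × ℕ)} (hj : Function.Injective j) :
    (marksLaw κ).map (fun M k => M (j k).1 (j k).2) =
      Measure.infinitePi fun _ : K => (volume : Measure unitInterval) := by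
  have h1 : (fun (M : κ → Marks) k => M (j k).1 (j k).2) =
      (fun (w : κ × (ℕ × ℕ) → unitInterval) k => w (j k)) ∘
        (MeasurableEquiv.curry κ (ℕ × ℕ) unitInterval).symm := rfl
  rw [h1, ← Measure.map_map (by fun_prop) (by fun_prop), marksLaw]
  unfold markLaw
  rw [Measure.infinitePi_map_curry_symm (fun (_ : κ) (_ : ℕ × ℕ) => (volume : Measure unitInterval)),
    Measure.map_infinitePi_infinitePi_of_inj hj]

lemma map_fieldLaw_of_injective {K : Type*} {j : K → Sym2 κ} (hj : Function.Injective j) :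
    (fieldLaw κ).map (fun u k => u (j k)) =
      Measure.infinitePi fun _ : K => (volume : Measure unitInterval) :=
  Measure.map_infinitePi_infinitePi_of_inj hj

variable {x : κ → Loc d} {t : κ → unitInterval} {I₁ I₂ : Finset κ}

/-- Everything counted for `i` is counted for `k`, and `i` itself is counted for `k` only. Hence two
older partners in the same cube select different marks of the younger point. -/
lemma ageIndex_lt {I : Finset κ} {i k : κ} (hi : i ∈ I)
    (hc : cubeIndex e (x i) = cubeIndex e (x k)) (h : t i < t k) :
    ageIndex e x t I i < ageIndex e x t I k := by
  classical
  unfold ageIndex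
  refine Finset.sum_lt_sum (fun l _ => ?_) ⟨i, hi, ?_⟩
  · by_cases h1 : cubeIndex e (x l) = cubeIndex e (x i) ∧ t l < t i
    · rw [if_pos h1, if_pos ⟨h1.1.trans hc, h1.2.trans h⟩]
    · rw [if_neg h1]
      exact Nat.zero_le _
  · simp [hc, h]

/-- The points of the configurations `I₁` and `I₂` have distinct locations and birth times, and
the common points are older than all other points. -/
structure Nested (x : κ → Loc d) (t : κ → unitInterval) (I₁ I₂ : Finset κ) : Prop where
  injOn_loc : Set.InjOn x {i | i ∈ I₁ ∨ i ∈ I₂}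
  injOn_time : Set.InjOn t {i | i ∈ I₁ ∨ i ∈ I₂}
  older : ∀ i, i ∈ I₁ → i ∈ I₂ → ∀ k, (k ∈ I₁ ∨ k ∈ I₂) → ¬ (k ∈ I₁ ∧ k ∈ I₂) → t i < t k

/-- The rank of a common point counts older points only, and any point of either configuration that
is older than a common point is itself common. -/
lemma Nested.ageIndex_eq (h : Nested x t I₁ I₂) {i : κ} (h1 : i ∈ I₁) (h2 : i ∈ I₂) :
    ageIndex e x t I₁ i = ageIndex e x t I₂ i := by
  classical
  unfold ageIndex
  rw [← Finset.card_filter, ← Finset.card_filter]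
  congr 1
  ext k
  simp only [Finset.mem_filter]
  have key : ∀ k, (k ∈ I₁ ∨ k ∈ I₂) → t k < t i → k ∈ I₁ ∧ k ∈ I₂ := fun k hk hki => by
    by_contra hn
    exact lt_asymm hki (h.older i h1 h2 k hk hn)
  exact ⟨fun hk => ⟨(key k (Or.inl hk.1) hk.2.2).2, hk.2⟩,
    fun hk => ⟨(key k (Or.inr hk.1) hk.2.2).1, hk.2⟩⟩

/-- The index of the mark that belongs to a pair of points. -/
def pairIndex (x : κ → Loc d) (t : κ → unitInterval) (I₁ I₂ : Finset κ) (p : Sym2 κ) :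
    κ × (ℕ × ℕ) :=
  (younger t p, markIndex e x t (open Classical in if p ∈ properPairs I₁ then I₁ else I₂) p)

lemma exists_older_younger {I : Finset κ} (ht : Set.InjOn t I) {p : Sym2 κ}
    (hp : p ∈ properPairs I) : ∃ i ∈ I, ∃ k ∈ I, p = s(i, k) ∧ t i < t k := by
  induction p with
  | _ i k =>
    obtain ⟨⟨hi, hk⟩, hne⟩ := mk_mem_properPairs.1 hp
    rcases lt_trichotomy (t i) (t k) with h | h | h
    · exact ⟨i, hi, k, hk, rfl, h⟩
    · exact absurd (ht hi hk h) hne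
    · exact ⟨k, hk, i, hi, Sym2.eq_swap, h⟩

lemma Nested.pairIndex_left (p : Sym2 κ) (hp : p ∈ properPairs I₁) :
    pairIndex e x t I₁ I₂ p = (younger t p, markIndex e x t I₁ p) := by
  simp [pairIndex, hp]

/-- A pair that lies in both configurations has a common older point, whose rank is the same in
both; the preference for `I₁` in `pairIndex` is therefore harmless. -/
lemma Nested.pairIndex_right (h : Nested x t I₁ I₂) (p : Sym2 κ) (hp : p ∈ properPairs I₂) :
    pairIndex e x t I₁ I₂ p = (younger t p, markIndex e x t I₂ p) := by
  by_cases hp1 : p ∈ properPairs I₁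
  · rw [Nested.pairIndex_left e p hp1]
    obtain ⟨i, hi, k, hk, rfl, hik⟩ := exists_older_younger
      (h.injOn_time.mono fun _ hi => Or.inr hi) hp
    simp only [markIndex, (younger_older_mk hik).2]
    rw [h.ageIndex_eq e (mk_mem_properPairs.1 hp1).1.1 hi]
  · simp [pairIndex, hp1]

/-- No mark is read twice, even across the two configurations. Within one configuration, pairs with
the same younger point differ in the cube or in the rank of the older point. Across configurations,
the age condition excludes a shared younger point unless the second pair also lies in `I₁`. -/
lemma Nested.pairIndex_injOn (h : Nested x t I₁ I₂) :
    Set.InjOn (pairIndex e x t I₁ I₂) {p | p ∈ properPairs I₁ ∨ p ∈ properPairs I₂} := by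
  have same : ∀ I : Finset κ, (∀ i ∈ I, i ∈ I₁ ∨ i ∈ I₂) → ∀ p ∈ properPairs I,
      ∀ q ∈ properPairs I, younger t p = younger t q →
      markIndex e x t I p = markIndex e x t I q → p = q := by
    intro I hI p hp q hq h1 h2
    have htI : Set.InjOn t I := h.injOn_time.mono hI
    obtain ⟨i, hi, k, hk, rfl, hik⟩ := exists_older_younger htI hp
    obtain ⟨i', hi', k', hk', rfl, hik'⟩ := exists_older_younger htI hq
    rw [(younger_older_mk hik).1, (younger_older_mk hik').1] at h1
    subst h1
    simp only [markIndex, (younger_older_mk hik).2, (younger_older_mk hik').2, Prod.mk.injEq] at h2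
    rcases lt_trichotomy (t i) (t i') with h3 | h3 | h3
    · exact absurd h2.1 (ageIndex_lt e hi h2.2 h3).ne
    · rw [htI hi hi' h3]
    · exact absurd h2.1.symm (ageIndex_lt e hi' h2.2.symm h3).ne
  -- A shared younger point `k` would be common to both configurations. The older partner `i'` would
  -- then be common too by the age condition, and the pair would lie in `I₁`.
  have diff : ∀ p ∈ properPairs I₁, ∀ q ∈ properPairs I₂, q ∉ properPairs I₁ →
      younger t p ≠ younger t q := by
    intro p hp q hq hq1 h1
    obtain ⟨i, hi, k, hk, rfl, hik⟩ := exists_older_younger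
      (h.injOn_time.mono fun _ hi => Or.inl hi) hp
    obtain ⟨i', hi', k', hk', rfl, hik'⟩ := exists_older_younger
      (h.injOn_time.mono fun _ hi => Or.inr hi) hq
    rw [(younger_older_mk hik).1, (younger_older_mk hik').1] at h1
    subst h1
    have hi1 : i' ∉ I₁ := fun hi1 => hq1 (mk_mem_properPairs.2
      ⟨⟨hi1, hk⟩, (mk_mem_properPairs.1 hq).2⟩)
    exact lt_asymm hik' (h.older k hk hk' i' (Or.inr hi') fun h3 => hi1 h3.1)
  intro p hp q hq hpq
  by_cases hp1 : p ∈ properPairs I₁ <;> by_cases hq1 : q ∈ properPairs I₁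
  · rw [Nested.pairIndex_left e p hp1, Nested.pairIndex_left e q hq1, Prod.mk.injEq] at hpq
    exact same I₁ (fun _ => Or.inl) p hp1 q hq1 hpq.1 hpq.2
  · exact absurd (Prod.ext_iff.1 hpq).1 (diff p hp1 q (hq.resolve_left hq1) hq1)
  · exact absurd (Prod.ext_iff.1 hpq).1.symm (diff q hq1 p (hp.resolve_left hp1) hp1)
  · have hp2 := hp.resolve_left hp1
    have hq2 := hq.resolve_left hq1
    rw [h.pairIndex_right e p hp2, h.pairIndex_right e q hq2, Prod.mk.injEq] at hpq
    exact same I₂ (fun _ => Or.inr) p hp2 q hq2 hpq.1 hpq.2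

lemma measurable_graph_field {I : Finset κ} (hx : Set.InjOn x I) {Ω : Type*} [MeasurableSpace Ω]
    {u : Ω → Sym2 κ → unitInterval} (hu : ∀ p ∈ properPairs I, Measurable fun ω => u ω p) :
    Measurable fun ω => graph x (u ω) I := by
  have := measurable_graph (x := fun _ : Ω => x) (u := u) (fun i => measurable_const) hu
  simpa [hx] using this

/-- Given the locations, the edge marks of two nested configurations are independent and
uniform. -/
lemma Nested.map_markedGraph (h : Nested x t I₁ I₂) :
    (marksLaw κ).map (fun M => (markedGraph e (Conf.points (fun i => (x i, t i, M i)) I₁),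
      markedGraph e (Conf.points (fun i => (x i, t i, M i)) I₂))) =
    (fieldLaw κ).map (fun u => (graph x u I₁, graph x u I₂)) := by
  classical
  have hx1 : Set.InjOn x I₁ := h.injOn_loc.mono fun _ => Or.inl
  have hx2 : Set.InjOn x I₂ := h.injOn_loc.mono fun _ => Or.inr
  let K := {p : Sym2 κ // p ∈ properPairs I₁ ∨ p ∈ properPairs I₂}
  -- Both graphs read the marks of pairs in `K` only, so the default value `0` elsewhere is never
  -- seen.
  let ext : (K → unitInterval) → Sym2 κ → unitInterval := fun w p =>
    if hp : p ∈ properPairs I₁ ∨ p ∈ properPairs I₂ then w ⟨p, hp⟩ else 0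
  have hext : ∀ p : Sym2 κ, Measurable fun w => ext w p := by
    intro p
    by_cases hp : p ∈ properPairs I₁ ∨ p ∈ properPairs I₂
    · simp only [ext, hp, dite_true]
      exact measurable_pi_apply _
    · simp only [ext, hp, dite_false]
      exact measurable_const
  have hΨ : Measurable fun w => (graph x (ext w) I₁, graph x (ext w) I₂) :=
    (measurable_graph_field hx1 fun p _ => hext p).prodMk
      (measurable_graph_field hx2 fun p _ => hext p)
  have h1 : (fun M : κ → Marks => (markedGraph e (Conf.points (fun i => (x i, t i, M i)) I₁),
      markedGraph e (Conf.points (fun i => (x i, t i, M i)) I₂))) =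
      (fun w => (graph x (ext w) I₁, graph x (ext w) I₂)) ∘ fun M (p : K) =>
        M (pairIndex e x t I₁ I₂ p.1).1 (pairIndex e x t I₁ I₂ p.1).2 := by
    funext M
    rw [markedGraph_points e hx1 (h.injOn_time.mono fun _ => Or.inl),
      markedGraph_points e hx2 (h.injOn_time.mono fun _ => Or.inr)]
    refine Prod.ext (graph_congr fun p hp => ?_) (graph_congr fun p hp => ?_)
    · simp only [pairMark, ext, hp, true_or, dite_true]
      rw [Nested.pairIndex_left e p hp]
    · simp only [pairMark, ext, hp, or_true, dite_true]
      rw [h.pairIndex_right e p hp]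
  have h2 : (fun u : Sym2 κ → unitInterval => (graph x u I₁, graph x u I₂)) =
      (fun w => (graph x (ext w) I₁, graph x (ext w) I₂)) ∘ fun u (p : K) => u p.1 := by
    funext u
    refine Prod.ext (graph_congr fun p hp => ?_) (graph_congr fun p hp => ?_) <;>
      simp [ext, hp]
  have hinj : Function.Injective fun p : K => pairIndex e x t I₁ I₂ p.1 := fun p q hpq =>
    Subtype.ext (h.pairIndex_injOn e p.2 q.2 hpq)
  -- Both sides are the same function of a family indexed by `K`; in either case the family is read
  -- injectively from independent uniform variables.
  rw [h1, h2, ← Measure.map_map hΨ (by fun_prop), ← Measure.map_map hΨ (by fun_prop),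
    map_marksLaw_of_injective hinj, map_fieldLaw_of_injective Subtype.val_injective]

/-- For equal configurations the age condition is empty, so a single configuration is covered by the
results on pairs without any restriction on the birth times beyond distinctness. -/
lemma Nested.refl {I : Finset κ} (hx : Set.InjOn x I) (ht : Set.InjOn t I) : Nested x t I I :=
  ⟨by simpa using hx, by simpa using ht, fun i hi _ k hk hk' => absurd hk (by simpa using hk')⟩

lemma generic_points {M : κ → Marks} {I : Finset κ} (hx : Set.InjOn x I) (ht : Set.InjOn t I) :
    Generic (Conf.points (fun i => (x i, t i, M i)) I) := by
  constructor
  · rintro _ ⟨i, hi, rfl⟩ _ ⟨k, hk, rfl⟩ h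
    rw [hx hi hk h]
  · rintro _ ⟨i, hi, rfl⟩ _ ⟨k, hk, rfl⟩ h
    rw [ht hi hk h]

end Reindex

section Random

variable {d : ℕ} {κ : Type*} [Countable κ] (e : ℕ ≃ (Fin d → ℤ)) {Ω : Type*} [MeasurableSpace Ω]

lemma measurableSet_finset_eq {I : Ω → Finset κ} (hI : ∀ i, MeasurableSet {ω | i ∈ I ω})
    (J : Finset κ) : MeasurableSet {ω | I ω = J} := by
  have : {ω | I ω = J} = ⋂ i, {ω | i ∈ I ω ↔ i ∈ J} := by
    ext ω
    simp [Finset.ext_iff]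
  rw [this]
  refine .iInter fun i => ?_
  by_cases hi : i ∈ J
  · simpa [hi] using hI i
  · have h : {ω | i ∈ I ω ↔ i ∈ J} = {ω | i ∈ I ω}ᶜ := by ext; simp [hi]
    rw [h]
    exact (hI i).compl

open Classical in
lemma measurable_graph_random {x : Ω → κ → Loc d} {u : Ω → Sym2 κ → unitInterval}
    {I : Ω → Finset κ} (hx : Measurable x) (hu : Measurable u)
    (hI : ∀ i, MeasurableSet {ω | i ∈ I ω}) :
    Measurable fun ω => if Set.InjOn (x ω) (I ω) then graph (x ω) (u ω) (I ω) else ∅ := by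
  intro U hU
  have : (fun ω => if Set.InjOn (x ω) (I ω) then graph (x ω) (u ω) (I ω) else ∅) ⁻¹' U =
      ⋃ J, {ω | I ω = J} ∩
        (fun ω => if Set.InjOn (x ω) J then graph (x ω) (u ω) J else ∅) ⁻¹' U := by
    ext ω
    simp only [Set.mem_preimage, Set.mem_iUnion, Set.mem_inter_iff, Set.mem_ofPred_eq]
    exact ⟨fun h => ⟨I ω, rfl, h⟩, fun ⟨J, hJ, h⟩ => by rw [hJ]; exact h⟩
  rw [this]
  exact .iUnion fun J => (measurableSet_finset_eq hI J).inter
    (measurable_graph (fun i => (measurable_pi_apply i).comp hx)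
      (fun p _ => (measurable_pi_apply p).comp hu) hU)

/-- Given the locations, the edge marks of two nested configurations are independent and
uniform: version with random locations and birth times. -/
lemma identDistrib_pair (Q : Measure Ω) [IsProbabilityMeasure Q] {x : Ω → κ → Loc d}
    {t : Ω → κ → unitInterval} {I₁ I₂ : Ω → Finset κ} (hx : Measurable x) (ht : Measurable t)
    (hI₁ : ∀ i, MeasurableSet {ω | i ∈ I₁ ω}) (hI₂ : ∀ i, MeasurableSet {ω | i ∈ I₂ ω})
    (h : ∀ᵐ ω ∂Q, Nested (x ω) (t ω) (I₁ ω) (I₂ ω)) :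
    IdentDistrib
      (fun p : Ω × (κ → Marks) =>
        (markedGraph e (Conf.points (fun i => (x p.1 i, t p.1 i, p.2 i)) (I₁ p.1)),
          markedGraph e (Conf.points (fun i => (x p.1 i, t p.1 i, p.2 i)) (I₂ p.1))))
      (fun p : Ω × (Sym2 κ → unitInterval) =>
        (graph (x p.1) p.2 (I₁ p.1), graph (x p.1) p.2 (I₂ p.1)))
      (Q.prod (marksLaw κ)) (Q.prod (fieldLaw κ)) := by
  classical
  -- `G` and `F` are globally measurable substitutes that agree with the edge marking and with the
  -- complete graph on the almost sure event of nestedness.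
  let G : Conf (Pt d) → Finset (MarkedEdge d) := fun A => if Generic A then markedGraph e A else ∅
  have hG : Measurable G := measurable_markedGraph e
  let F : (κ → Loc d) → (Sym2 κ → unitInterval) → Finset κ → Finset (MarkedEdge d) :=
    fun x u I => if Set.InjOn x I then graph x u I else ∅
  let L : Ω × (κ → Marks) → Finset (MarkedEdge d) × Finset (MarkedEdge d) := fun p =>
    (G (Conf.points (fun i => (x p.1 i, t p.1 i, p.2 i)) (I₁ p.1)),
      G (Conf.points (fun i => (x p.1 i, t p.1 i, p.2 i)) (I₂ p.1)))
  let R : Ω × (Sym2 κ → unitInterval) → Finset (MarkedEdge d) × Finset (MarkedEdge d) := fun p =>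
    (F (x p.1) p.2 (I₁ p.1), F (x p.1) p.2 (I₂ p.1))
  have hs : Measurable fun p : Ω × (κ → Marks) =>
      fun i => ((x p.1 i, t p.1 i, p.2 i) : Pt d) := by fun_prop
  have hL : Measurable L :=
    (hG.comp (Conf.measurable_points hs fun i => measurable_fst (hI₁ i))).prodMk
      (hG.comp (Conf.measurable_points hs fun i => measurable_fst (hI₂ i)))
  have hR : Measurable R :=
    (measurable_graph_random (hx.comp measurable_fst) measurable_snd
        fun i => measurable_fst (hI₁ i)).prodMk
      (measurable_graph_random (hx.comp measurable_fst) measurable_snd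
        fun i => measurable_fst (hI₂ i))
  have hLω : ∀ ω, Nested (x ω) (t ω) (I₁ ω) (I₂ ω) → ∀ M, L (ω, M) =
      (markedGraph e (Conf.points (fun i => (x ω i, t ω i, M i)) (I₁ ω)),
        markedGraph e (Conf.points (fun i => (x ω i, t ω i, M i)) (I₂ ω))) := by
    intro ω hω M
    simp only [L, G]
    rw [if_pos (generic_points (hω.injOn_loc.mono fun _ => Or.inl)
      (hω.injOn_time.mono fun _ => Or.inl)), if_pos (generic_points
      (hω.injOn_loc.mono fun _ => Or.inr) (hω.injOn_time.mono fun _ => Or.inr))]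
  have hRω : ∀ ω, Nested (x ω) (t ω) (I₁ ω) (I₂ ω) → ∀ u, R (ω, u) =
      (graph (x ω) u (I₁ ω), graph (x ω) u (I₂ ω)) := by
    intro ω hω u
    simp only [R, F]
    rw [if_pos (hω.injOn_loc.mono fun _ => Or.inl), if_pos (hω.injOn_loc.mono fun _ => Or.inr)]
  have h1 : L =ᵐ[Q.prod (marksLaw κ)] fun p : Ω × (κ → Marks) =>
      (markedGraph e (Conf.points (fun i => (x p.1 i, t p.1 i, p.2 i)) (I₁ p.1)),
        markedGraph e (Conf.points (fun i => (x p.1 i, t p.1 i, p.2 i)) (I₂ p.1))) := by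
    filter_upwards [Measure.quasiMeasurePreserving_fst.ae h] with p hp
    exact hLω p.1 hp p.2
  have h2 : R =ᵐ[Q.prod (fieldLaw κ)] fun p : Ω × (Sym2 κ → unitInterval) =>
        (graph (x p.1) p.2 (I₁ p.1), graph (x p.1) p.2 (I₂ p.1)) := by
    filter_upwards [Measure.quasiMeasurePreserving_fst.ae h] with p hp
    exact hRω p.1 hp p.2
  refine ⟨⟨L, hL, h1.symm⟩, ⟨R, hR, h2.symm⟩, ?_⟩
  rw [← Measure.map_congr h1, ← Measure.map_congr h2]
  refine Measure.ext fun U hU => ?_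
  rw [Measure.map_apply hL hU, Measure.map_apply hR hU, Measure.prod_apply (hL hU),
    Measure.prod_apply (hR hU)]
  -- By Fubini it suffices to compare the laws for fixed locations and birth times, where
  -- `Nested.map_markedGraph` applies.
  refine lintegral_congr_ae ?_
  filter_upwards [h] with ω hω
  have h3 : Measurable fun M => L (ω, M) := hL.comp (by fun_prop)
  have h4 : Measurable fun u => R (ω, u) := hR.comp (by fun_prop)
  have h5 := hω.map_markedGraph e
  rw [← funext (hLω ω hω), ← funext (hRω ω hω)] at h5
  have h6 := congrArg (fun ν => ν U) h5
  rwa [Measure.map_apply h3 hU, Measure.map_apply h4 hU] at h6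

end Random

end MarkedPoisson

namespace MarkedPoisson

/-! ## Poisson averages of bounded arrays -/

section Shift

open scoped BoundedContinuousFunction

/-- The Banach space of bounded continuous functions on `X`. -/
def BddFun (X : Type*) [TopologicalSpace X] : Type _ := X →ᵇ ℝ

section

variable {X : Type*} [TopologicalSpace X]

instance : NormedAddCommGroup (BddFun X) := inferInstanceAs (NormedAddCommGroup (X →ᵇ ℝ))
instance : NormedSpace ℝ (BddFun X) := inferInstanceAs (NormedSpace ℝ (X →ᵇ ℝ))
instance : CompleteSpace (BddFun X) := inferInstanceAs (CompleteSpace (X →ᵇ ℝ))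

/-- The underlying function. -/
def BddFun.toFun (c : BddFun X) : X → ℝ := DFunLike.coe (F := X →ᵇ ℝ) c

instance : CoeFun (BddFun X) fun _ => X → ℝ := ⟨BddFun.toFun⟩
instance : NormedAlgebra ℚ (BddFun X →L[ℝ] BddFun X) := NormedAlgebra.restrictScalars ℚ ℝ _

/-- Evaluation at a point. -/
def BddFun.eval (x : X) : BddFun X →L[ℝ] ℝ := BoundedContinuousFunction.evalCLM ℝ x

lemma BddFun.ext {b c : BddFun X} (h : ∀ x, b x = c x) : b = c :=
  BoundedContinuousFunction.ext h

lemma BddFun.abs_apply_le (c : BddFun X) (x : X) : |c x| ≤ ‖c‖ :=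
  BoundedContinuousFunction.norm_coe_le_norm (show X →ᵇ ℝ from c) x

lemma BddFun.integrable {Y : Type*} [MeasurableSpace Y] [Countable Y]
    [MeasurableSingletonClass Y] {μ : Measure Y} [IsFiniteMeasure μ] (c : BddFun X) (φ : Y → X) :
    Integrable (fun y => c (φ y)) μ :=
  (integrable_const ‖c‖).mono' (measurable_of_countable _).aestronglyMeasurable
    (ae_of_all _ fun _ => c.abs_apply_le _)

end

variable {X : Type*} [TopologicalSpace X] [DiscreteTopology X]

/-- A bounded function on a discrete space. -/
def BddFun.mk (c : X → ℝ) (C : ℝ) (hc : ∀ x, |c x| ≤ C) : BddFun X :=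
  BoundedContinuousFunction.ofNormedAddCommGroupDiscrete c C hc

lemma BddFun.mk_apply (c : X → ℝ) (C : ℝ) (hc : ∀ x, |c x| ≤ C) (x : X) :
    BddFun.mk c C hc x = c x := rfl

/-- The shift `c ↦ c ∘ φ` of bounded functions. -/
def shiftOp (φ : X → X) : BddFun X →L[ℝ] BddFun X :=
  LinearMap.mkContinuous
    { toFun := fun c => (show X →ᵇ ℝ from c).compContinuous ⟨φ, continuous_of_discreteTopology⟩
      map_add' := fun _ _ => rfl
      map_smul' := fun _ _ => rfl } 1 fun c => by
    rw [one_mul]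
    exact (BoundedContinuousFunction.norm_le (norm_nonneg _)).2 fun x => c.abs_apply_le _

lemma shiftOp_apply (φ : X → X) (c : BddFun X) (x : X) : shiftOp φ c x = c (φ x) := rfl

lemma shiftOp_pow_apply (φ : X → X) (n : ℕ) (c : BddFun X) (x : X) :
    (shiftOp φ ^ n) c x = c (φ^[n] x) := by
  induction n generalizing x with
  | zero => rfl
  | succ n ih =>
    rw [pow_succ', mul_apply_eq_comp, shiftOp_apply, ih, Function.iterate_succ_apply]

lemma commute_shiftOp {φ ψ : X → X} (h : ∀ x, φ (ψ x) = ψ (φ x)) :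
    Commute (shiftOp φ) (shiftOp ψ) := by
  refine ContinuousLinearMap.ext fun c => BddFun.ext fun x => ?_
  simp only [mul_apply_eq_comp, shiftOp_apply, h]

/-- Since `exp (r (S - 1)) = exp (-r) ∑ rⁿ Sⁿ / n!`, averaging over a Poisson number of shifts is an
operator exponential. Derivatives in the Poisson parameter become derivatives of exponentials of
bounded operators. -/
lemma exp_shiftOp_apply (φ : X → X) (r : ℝ≥0) (c : BddFun X) (x : X) :
    NormedSpace.exp ((r : ℝ) • (shiftOp φ - 1)) c x = ∫ n, c (φ^[n] x) ∂(poissonMeasure r) := by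
  have h1 : (r : ℝ) • (shiftOp φ - 1) = (r : ℝ) • shiftOp φ +
      algebraMap ℝ (BddFun X →L[ℝ] BddFun X) (-r) := by
    rw [Algebra.algebraMap_eq_smul_one, smul_sub, neg_smul, sub_eq_add_neg]
  rw [h1, NormedSpace.exp_add_of_commute (Algebra.commutes _ _).symm,
    ← NormedSpace.algebraMap_exp_comm, ← Real.exp_eq_exp_ℝ]
  have h2 := NormedSpace.exp_series_hasSum_exp' (𝕂 := ℝ) ((r : ℝ) • shiftOp φ)
  have h3 := (hasSum_integral_poissonMeasure (BddFun.integrable (μ := poissonMeasure r) c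
    fun n => φ^[n] x))
  let ev : (BddFun X →L[ℝ] BddFun X) →L[ℝ] ℝ :=
    (BddFun.eval x).comp (ContinuousLinearMap.apply ℝ (BddFun X) c)
  have h4 := (ev.hasSum h2).mul_left (Real.exp (-r))
  have h5 : (NormedSpace.exp ((r : ℝ) • shiftOp φ) *
      algebraMap ℝ (BddFun X →L[ℝ] BddFun X) (Real.exp (-r))) c x =
      Real.exp (-r) * ev (NormedSpace.exp ((r : ℝ) • shiftOp φ)) := by
    rw [Algebra.algebraMap_eq_smul_one, mul_smul_comm, mul_one]
    rfl
  rw [h5]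
  refine h4.unique ?_
  have h6 : (fun n : ℕ => Real.exp (-r) * ev ((n.factorial : ℝ)⁻¹ • ((r : ℝ) • shiftOp φ) ^ n)) =
      fun n : ℕ => (Real.exp (-r) * r ^ n / n.factorial) • c (φ^[n] x) := by
    funext n
    rw [map_smul, smul_pow, map_smul, ← shiftOp_pow_apply φ n c x]
    change Real.exp (-r) * (_ * (_ * (shiftOp φ ^ n) c x)) = _ * _
    ring
  rw [h6]
  exact h3

end Shift

section Mix

/-- The law of the numbers of common points and of points of each of the two configurations that
arise by resampling after time `t`. -/
def mixLaw (m : ℝ≥0) (t : unitInterval) : Measure (ℕ × ℕ × ℕ) :=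
  (poissonMeasure (m * unitInterval.toNNReal t)).prod
    ((poissonMeasure (m * unitInterval.toNNReal (unitInterval.symm t))).prod
      (poissonMeasure (m * unitInterval.toNNReal (unitInterval.symm t))))

instance (m : ℝ≥0) (t : unitInterval) : IsProbabilityMeasure (mixLaw m t) := by
  unfold mixLaw; infer_instance

/-- The shifts of the three coordinates. -/
def shiftA : BddFun (ℕ × ℕ × ℕ) →L[ℝ] BddFun (ℕ × ℕ × ℕ) :=
  shiftOp fun p => (p.1 + 1, p.2.1, p.2.2)
def shiftB : BddFun (ℕ × ℕ × ℕ) →L[ℝ] BddFun (ℕ × ℕ × ℕ) :=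
  shiftOp fun p => (p.1, p.2.1 + 1, p.2.2)
def shiftC : BddFun (ℕ × ℕ × ℕ) →L[ℝ] BddFun (ℕ × ℕ × ℕ) :=
  shiftOp fun p => (p.1, p.2.1, p.2.2 + 1)

/-- The generator of the flow `t ↦ mixLaw m t`. -/
def mixGen (m : ℝ≥0) : BddFun (ℕ × ℕ × ℕ) →L[ℝ] BddFun (ℕ × ℕ × ℕ) :=
  (m : ℝ) • ((shiftA - 1) - (shiftB - 1) - (shiftC - 1))

/-- The flow `t ↦ mixLaw m t` on bounded arrays. -/
def mixFlow (m : ℝ≥0) (t : ℝ) : BddFun (ℕ × ℕ × ℕ) →L[ℝ] BddFun (ℕ × ℕ × ℕ) :=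
  NormedSpace.exp (t • mixGen m) * NormedSpace.exp ((m : ℝ) • (shiftB - 1) + (m : ℝ) • (shiftC - 1))

lemma commute_AB : Commute shiftA shiftB := commute_shiftOp fun _ => rfl
lemma commute_AC : Commute shiftA shiftC := commute_shiftOp fun _ => rfl
lemma commute_BC : Commute shiftB shiftC := commute_shiftOp fun _ => rfl

/-- At `t = 0` all intensity is in the second and third coordinates; the generator moves it to the
first at the expense of both. The shifts commute, so the exponentials combine into three separate
Poisson averages. -/
lemma mixFlow_eq (m : ℝ≥0) (t : ℝ) : mixFlow m t =
    NormedSpace.exp ((m * t) • (shiftA - 1)) * (NormedSpace.exp ((m * (1 - t)) • (shiftB - 1)) *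
      NormedSpace.exp ((m * (1 - t)) • (shiftC - 1))) := by
  have c1 : ∀ {S T : BddFun (ℕ × ℕ × ℕ) →L[ℝ] BddFun (ℕ × ℕ × ℕ)}, Commute S T →
      ∀ a b : ℝ, Commute (a • (S - 1)) (b • (T - 1)) := fun h a b =>
    (((h.sub_right (Commute.one_right _)).sub_left
      (Commute.one_left _)).smul_left a).smul_right b
  have hs : ∀ S : BddFun (ℕ × ℕ × ℕ) →L[ℝ] BddFun (ℕ × ℕ × ℕ), ∀ a b : ℝ,
      Commute (a • (S - 1)) (b • (S - 1)) := fun S a b => c1 (Commute.refl S) a b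
  rw [mixFlow, ← NormedSpace.exp_add_of_commute (c1 commute_BC _ _),
    ← NormedSpace.exp_add_of_commute
      ((c1 commute_AB _ _).add_right (c1 commute_AC _ _)),
    ← NormedSpace.exp_add_of_commute]
  · congr 1
    rw [mixGen]
    module
  · have h1 : t • mixGen m = (t * m) • (shiftA - 1) + (-(t * m)) • (shiftB - 1) +
        (-(t * m)) • (shiftC - 1) := by
      rw [mixGen]
      module
    rw [h1]
    exact (((c1 commute_AB _ _).add_left (hs _ _ _)).add_left (c1 commute_BC.symm _ _)).add_right
      (((c1 commute_AC _ _).add_left (c1 commute_BC _ _)).add_left (hs _ _ _))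

/-- Starting from the origin, the numbers of shifts in the three directions are the three
independent Poisson counts of `mixLaw`. -/
lemma mixFlow_apply (m : ℝ≥0) (t : unitInterval) (c : BddFun (ℕ × ℕ × ℕ)) :
    mixFlow m t c (0, 0, 0) = ∫ p, c p ∂(mixLaw m t) := by
  have e1 : (m : ℝ) * t = ((m * unitInterval.toNNReal t : ℝ≥0) : ℝ) := by simp
  have e2 : (m : ℝ) * (1 - t) =
      ((m * unitInterval.toNNReal (unitInterval.symm t) : ℝ≥0) : ℝ) := by simp
  rw [mixFlow_eq, e1, e2, mul_apply_eq_comp, mul_apply_eq_comp, shiftA,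
    shiftB, shiftC, exp_shiftOp_apply, mixLaw,
    integral_prod (fun p => c p) (c.integrable fun p => p)]
  refine integral_congr_ae (ae_of_all _ fun a => ?_)
  simp only
  rw [exp_shiftOp_apply, integral_prod (fun q => c (a, q)) (c.integrable fun q => (a, q))]
  refine integral_congr_ae (ae_of_all _ fun b => ?_)
  simp only
  rw [exp_shiftOp_apply]
  refine integral_congr_ae (ae_of_all _ fun b' => ?_)
  simp only
  congr 1
  have i1 : ∀ n : ℕ, ∀ p : ℕ × ℕ × ℕ, (fun p : ℕ × ℕ × ℕ => (p.1 + 1, p.2.1, p.2.2))^[n] p =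
      (p.1 + n, p.2.1, p.2.2) := by
    intro n
    induction n with
    | zero => intro p; rfl
    | succ n ih => intro p; rw [Function.iterate_succ_apply, ih]; simp; ring
  have i2 : ∀ n : ℕ, ∀ p : ℕ × ℕ × ℕ, (fun p : ℕ × ℕ × ℕ => (p.1, p.2.1 + 1, p.2.2))^[n] p =
      (p.1, p.2.1 + n, p.2.2) := by
    intro n
    induction n with
    | zero => intro p; rfl
    | succ n ih => intro p; rw [Function.iterate_succ_apply, ih]; simp; ring
  have i3 : ∀ n : ℕ, ∀ p : ℕ × ℕ × ℕ, (fun p : ℕ × ℕ × ℕ => (p.1, p.2.1, p.2.2 + 1))^[n] p =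
      (p.1, p.2.1, p.2.2 + n) := by
    intro n
    induction n with
    | zero => intro p; rfl
    | succ n ih => intro p; rw [Function.iterate_succ_apply, ih]; simp; ring
  rw [i1, i2, i3]
  simp

/-- The generator commutes with the constant exponential factor, so it can be moved to act on the
array first; the derivative is again a value of the flow. -/
lemma hasDerivAt_mixFlow (m : ℝ≥0) (t : ℝ) (c : BddFun (ℕ × ℕ × ℕ)) (x : ℕ × ℕ × ℕ) :
    HasDerivAt (fun s => mixFlow m s c x) (mixFlow m t (mixGen m c) x) t := by
  let ev : (BddFun (ℕ × ℕ × ℕ) →L[ℝ] BddFun (ℕ × ℕ × ℕ)) →L[ℝ] ℝ :=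
    (BddFun.eval x).comp (ContinuousLinearMap.apply ℝ _ c)
  have h1 := hasDerivAt_exp_smul_const (𝕂 := ℝ) (mixGen m) t
  have h2 := (h1.mul_const (NormedSpace.exp ((m : ℝ) • (shiftB - 1) + (m : ℝ) • (shiftC - 1))))
  have h3 := ev.hasFDerivAt.comp_hasDerivAt t h2
  have hc : Commute (mixGen m) (NormedSpace.exp ((m : ℝ) • (shiftB - 1) + (m : ℝ) • (shiftC - 1))) := by
    refine Commute.exp_right ?_
    have c1 : ∀ {S T : BddFun (ℕ × ℕ × ℕ) →L[ℝ] BddFun (ℕ × ℕ × ℕ)}, Commute S T →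
      Commute (S - 1) (T - 1) := fun h =>
        ((h.sub_right (Commute.one_right _)).sub_left (Commute.one_left _))
    refine (Commute.smul_left ?_ _)
    refine Commute.add_right (Commute.smul_right ?_ _) (Commute.smul_right ?_ _)
    · exact ((c1 commute_AB).sub_left (Commute.refl _)).sub_left (c1 commute_BC.symm)
    · exact ((c1 commute_AC).sub_left (c1 commute_BC)).sub_left (Commute.refl _)
  rw [mul_assoc, hc.eq, ← mul_assoc] at h3
  exact h3

lemma continuous_mixFlow (m : ℝ≥0) (c : BddFun (ℕ × ℕ × ℕ)) (x : ℕ × ℕ × ℕ) :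
    Continuous fun t => mixFlow m t c x :=
  continuous_iff_continuousAt.2 fun t => (hasDerivAt_mixFlow m t c x).continuousAt

/-- The fundamental theorem of calculus along the flow. At `t = 1` there are only common points, at
`t = 0` only separate ones, so for an array of correlations the left-hand side is a variance. -/
lemma mixFlow_one_sub_zero (m : ℝ≥0) (c : BddFun (ℕ × ℕ × ℕ)) :
    ∫ p, c p ∂(mixLaw m 1) - ∫ p, c p ∂(mixLaw m 0) =
      ∫ t : unitInterval, ∫ p, mixGen m c p ∂(mixLaw m t) := by
  have h1 := intervalIntegral.integral_eq_sub_of_hasDerivAt (a := 0) (b := 1)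
    (fun t _ => hasDerivAt_mixFlow m t c (0, 0, 0))
    ((continuous_mixFlow m (mixGen m c) _).intervalIntegrable _ _)
  have e1 := mixFlow_apply m 1 c
  have e0 := mixFlow_apply m 0 c
  rw [Set.Icc.coe_one] at e1
  rw [Set.Icc.coe_zero] at e0
  rw [← e1, ← e0, ← h1, intervalIntegral.integral_of_le zero_le_one, ← integral_Icc_eq_integral_Ioc]
  simp_rw [← mixFlow_apply]
  exact (integral_subtype_comap measurableSet_Icc fun t : ℝ =>
    mixFlow m t (mixGen m c) (0, 0, 0)).symm

lemma continuous_integral_mixLaw (m : ℝ≥0) (c : BddFun (ℕ × ℕ × ℕ)) :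
    Continuous fun t : unitInterval => ∫ p, c p ∂(mixLaw m t) := by
  simp_rw [← mixFlow_apply]
  exact (continuous_mixFlow m c _).comp continuous_subtype_val

end Mix

end MarkedPoisson

namespace MarkedPoisson

/-! ## Exchangeable families and resampling -/

/-- Labels of vertices: three sequences of vertices and one additional vertex `none`. -/
abbrev Vertex : Type := Option (Fin 3 × ℕ)

/-- The first `n` vertices of the `j`th sequence. -/
def cls (j : Fin 3) (n : ℕ) : Finset Vertex :=
  (Finset.range n).image fun i => some (j, i)

/-- The first `a` vertices of the sequence `0` and the first `b` vertices of the sequence `j`. -/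
def comb (j : Fin 3) (a b : ℕ) : Finset Vertex := cls 0 a ∪ cls j b

lemma mem_cls {j k : Fin 3} {n i : ℕ} : some (k, i) ∈ cls j n ↔ k = j ∧ i < n := by
  simp only [cls, Finset.mem_image, Finset.mem_range, Option.some.injEq, Prod.mk.injEq]
  exact ⟨fun ⟨a, ha, h1, h2⟩ => ⟨h1.symm, h2 ▸ ha⟩, fun ⟨h1, h2⟩ => ⟨i, h2, h1.symm, rfl⟩⟩

lemma none_notMem_cls {j : Fin 3} {n : ℕ} : none ∉ cls j n := by simp [cls]

lemma none_notMem_comb {j : Fin 3} {a b : ℕ} : none ∉ comb j a b := by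
  simp [comb, none_notMem_cls]

lemma mem_comb {j k : Fin 3} {a b i : ℕ} :
    some (k, i) ∈ comb j a b ↔ (k = 0 ∧ i < a) ∨ (k = j ∧ i < b) := by
  simp [comb, mem_cls]

lemma card_cls (j : Fin 3) (n : ℕ) : (cls j n).card = n := by
  rw [cls, Finset.card_image_of_injective _ fun a b h => by simpa using h, Finset.card_range]

lemma cls_succ (j : Fin 3) (n : ℕ) : cls j (n + 1) = insert (some (j, n)) (cls j n) := by
  simp [cls, Finset.range_add_one]

lemma cls_zero (j : Fin 3) : cls j 0 = ∅ := rfl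

lemma comb_succ_left (j : Fin 3) (a b : ℕ) :
    comb j (a + 1) b = insert (some (0, a)) (comb j a b) := by
  rw [comb, cls_succ, Finset.insert_union, comb]

lemma comb_succ_right (j : Fin 3) (a b : ℕ) :
    comb j a (b + 1) = insert (some (j, b)) (comb j a b) := by
  rw [comb, cls_succ, Finset.union_insert, comb]

lemma comb_zero_right (j : Fin 3) (a : ℕ) : comb j a 0 = cls 0 a := by
  rw [comb, cls_zero, Finset.union_empty]

lemma comb_zero_left (j : Fin 3) (b : ℕ) : comb j 0 b = cls j b := by
  rw [comb, cls_zero, Finset.empty_union]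

lemma map_swap_insert {κ : Type*} [DecidableEq κ] {I : Finset κ} {x y : κ} (hx : x ∉ I)
    (hy : y ∉ I) : (insert x I).map (Equiv.swap x y).toEmbedding = insert y I := by
  ext z
  rw [Finset.mem_map_equiv, Equiv.symm_swap, Finset.mem_insert, Finset.mem_insert,
    Equiv.swap_apply_def]
  split_ifs with h1 h2
  · subst h1; simp only [hx, hy, or_false]; exact eq_comm
  · subst h2; simp
  · tauto

lemma map_swap_of_notMem {κ : Type*} [DecidableEq κ] {I : Finset κ} {x y : κ} (hx : x ∉ I)
    (hy : y ∉ I) : I.map (Equiv.swap x y).toEmbedding = I := by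
  ext z
  rw [Finset.mem_map_equiv, Equiv.symm_swap, Equiv.swap_apply_def]
  split_ifs with h1 h2
  · subst h1; simp [hx, hy]
  · subst h2; simp [hx, hy]
  · rfl

section Abstract

variable {Θ 𝒢 : Type*} [MeasurableSpace Θ] [MeasurableSpace 𝒢]

/-- A family of random objects indexed by finite sets of vertices whose law is invariant under the
permutations of the labels that fix the additional vertex. -/
structure ExchangeableAt (ν : Measure Θ) (G : Finset Vertex → Θ → 𝒢) : Prop where
  measurable : ∀ I, Measurable (G I)
  exch : ∀ σ : Equiv.Perm Vertex, σ none = none → ∀ I J,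
    ν.map (fun θ => (G I θ, G J θ)) =
      ν.map (fun θ => (G (I.map σ.toEmbedding) θ, G (J.map σ.toEmbedding) θ))

/-- A family of random objects indexed by finite sets of vertices whose law is invariant under all
permutations of the labels, with independence for disjoint sets. -/
structure FullyExchangeable (ν : Measure Θ) (G : Finset Vertex → Θ → 𝒢) : Prop where
  measurable : ∀ I, Measurable (G I)
  exch : ∀ σ : Equiv.Perm Vertex, ∀ I J,
    ν.map (fun θ => (G I θ, G J θ)) =
      ν.map (fun θ => (G (I.map σ.toEmbedding) θ, G (J.map σ.toEmbedding) θ))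
  indep : ∀ I J, Disjoint I J → IndepFun (G I) (G J) ν

lemma FullyExchangeable.exchangeableAt {ν : Measure Θ} {G : Finset Vertex → Θ → 𝒢}
    (h : FullyExchangeable ν G) : ExchangeableAt ν G := ⟨h.measurable, fun σ _ => h.exch σ⟩

/-- The cost of the additional vertex. -/
def starCost (G : Finset Vertex → Θ → 𝒢) (g : 𝒢 → ℝ) (I : Finset Vertex) (θ : Θ) : ℝ :=
  g (G (insert none I) θ) - g (G I θ)

/-- The resampled correlation of the cost of the additional vertex. -/
def resampled (m : ℝ≥0) (ν : Measure Θ) (G : Finset Vertex → Θ → 𝒢) (g : 𝒢 → ℝ)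
    (t : unitInterval) : ℝ :=
  ∫ q : (ℕ × ℕ × ℕ) × Θ, starCost G g (comb 1 q.1.1 q.1.2.1) q.2 *
    starCost G g (comb 2 q.1.1 q.1.2.2) q.2 ∂((mixLaw m t).prod ν)

/-- The second moment of the cost of the additional vertex. -/
def costMoment (m : ℝ≥0) (ν : Measure Θ) (G : Finset Vertex → Θ → 𝒢) (g : 𝒢 → ℝ) : ℝ :=
  ∫ q : ℕ × Θ, starCost G g (cls 0 q.1) q.2 ^ 2 ∂((poissonMeasure m).prod ν)

/-- The cost of the additional vertex is square integrable. -/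
def FiniteCost (m : ℝ≥0) (ν : Measure Θ) (G : Finset Vertex → Θ → 𝒢) (g : 𝒢 → ℝ) : Prop :=
  MemLp (fun q : ℕ × Θ => starCost G g (cls 0 q.1) q.2) 2 ((poissonMeasure m).prod ν)

variable {m : ℝ≥0} {ν : Measure Θ} [IsProbabilityMeasure ν] {G : Finset Vertex → Θ → 𝒢}
  {g g' : 𝒢 → ℝ}

lemma ExchangeableAt.measurable_pair (hG : ExchangeableAt ν G) {Y : Type*} [MeasurableSpace Y]
    [Countable Y] [MeasurableSingletonClass Y] (I J : Y → Finset Vertex) :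
    Measurable fun q : Y × Θ => (G (I q.1) q.2, G (J q.1) q.2) :=
  measurable_from_prod_countable_right fun y => (hG.measurable (I y)).prodMk (hG.measurable (J y))

lemma ExchangeableAt.measurable_starCost (hG : ExchangeableAt ν G) (hg : Measurable g)
    (I : Finset Vertex) : Measurable (starCost G g I) :=
  (hg.comp (hG.measurable _)).sub (hg.comp (hG.measurable _))

/-- Transpositions that fix the additional vertex trade the last vertex of sequence `j` for the next
one of sequence `0`, one at a time. Only the total number of vertices matters. -/
lemma ExchangeableAt.map_comb (hG : ExchangeableAt ν G) {j : Fin 3} (hj : j ≠ 0) (a b : ℕ) :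
    ν.map (fun θ => (G (insert none (comb j a b)) θ, G (comb j a b) θ)) =
      ν.map (fun θ => (G (insert none (cls 0 (a + b))) θ, G (cls 0 (a + b)) θ)) := by
  induction b generalizing a with
  | zero => rw [comb_zero_right, add_zero]
  | succ b ih =>
    have h1 : some (j, b) ∉ comb j a b := by simp [mem_comb, hj]
    have h2 : (some (0, a) : Vertex) ∉ comb j a b := by simp [mem_comb, hj.symm]
    have h3 : (comb j a (b + 1)).map (Equiv.swap (some (j, b)) (some (0, a))).toEmbedding =
        comb j (a + 1) b := by
      rw [comb_succ_right, map_swap_insert h1 h2, comb_succ_left]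
    have hσ : Equiv.swap (some (j, b) : Vertex) (some (0, a)) none = none :=
      Equiv.swap_apply_of_ne_of_ne (by simp) (by simp)
    rw [hG.exch (Equiv.swap (some (j, b)) (some (0, a))) hσ, Finset.map_insert, h3,
      Equiv.toEmbedding_apply, hσ, ih, show a + 1 + b = a + (b + 1) by ring]

lemma map_add_poisson (r s : ℝ≥0) :
    ((poissonMeasure r).prod (poissonMeasure s)).map (fun p => p.1 + p.2) =
      poissonMeasure (r + s) := poissonMeasure_conv_poissonMeasure r s

lemma toNNReal_add_symm (t : unitInterval) :
    m * unitInterval.toNNReal t + m * unitInterval.toNNReal (unitInterval.symm t) = m := by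
  rw [← mul_add]
  have : unitInterval.toNNReal t + unitInterval.toNNReal (unitInterval.symm t) = 1 := by
    ext; simp
  rw [this, mul_one]

lemma map_mixLaw_one (t : unitInterval) :
    (mixLaw m t).map (fun p => p.1 + p.2.1) = poissonMeasure m := by
  rw [← toNNReal_add_symm (m := m) t, ← map_add_poisson, toNNReal_add_symm (m := m) t]
  have : (fun p : ℕ × ℕ × ℕ => p.1 + p.2.1) = (fun p : ℕ × ℕ => p.1 + p.2) ∘
      Prod.map id Prod.fst := rfl
  rw [this, ← Measure.map_map (by fun_prop) (by fun_prop), mixLaw,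
    ← Measure.map_prod_map _ _ measurable_id measurable_fst]
  simp

lemma map_mixLaw_two (t : unitInterval) :
    (mixLaw m t).map (fun p => p.1 + p.2.2) = poissonMeasure m := by
  rw [← toNNReal_add_symm (m := m) t, ← map_add_poisson, toNNReal_add_symm (m := m) t]
  have : (fun p : ℕ × ℕ × ℕ => p.1 + p.2.2) = (fun p : ℕ × ℕ => p.1 + p.2) ∘
      Prod.map id Prod.snd := rfl
  rw [this, ← Measure.map_map (by fun_prop) (by fun_prop), mixLaw,
    ← Measure.map_prod_map _ _ measurable_id measurable_snd]
  simp

/-- Each of the two configurations of the resampling has the original law. -/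
lemma ExchangeableAt.map_mix (hG : ExchangeableAt ν G) {j : Fin 3} (hj : j ≠ 0)
    {t : unitInterval} {k : ℕ × ℕ × ℕ → ℕ}
    (hk : (mixLaw m t).map (fun p => p.1 + k p) = poissonMeasure m) :
    ((mixLaw m t).prod ν).map (fun q => (G (insert none (comb j q.1.1 (k q.1))) q.2,
      G (comb j q.1.1 (k q.1)) q.2)) =
    ((poissonMeasure m).prod ν).map (fun q => (G (insert none (cls 0 q.1)) q.2,
      G (cls 0 q.1) q.2)) := by
  have m1 := hG.measurable_pair (fun p : ℕ × ℕ × ℕ => insert none (comb j p.1 (k p)))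
    (fun p => comb j p.1 (k p))
  have m2 := hG.measurable_pair (fun n : ℕ => insert none (cls 0 n)) (fun n => cls 0 n)
  refine Measure.ext fun U hU => ?_
  rw [Measure.map_apply m1 hU, Measure.map_apply m2 hU, Measure.prod_apply (m1 hU),
    Measure.prod_apply (m2 hU), ← hk, lintegral_map (measurable_of_countable _)
      (measurable_of_countable _)]
  refine lintegral_congr fun p => ?_
  have h1 := congrArg (fun μ => μ U) (hG.map_comb hj p.1 (k p))
  rwa [Measure.map_apply ((hG.measurable _).prodMk (hG.measurable _)) hU,
    Measure.map_apply ((hG.measurable _).prodMk (hG.measurable _)) hU] at h1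

lemma ExchangeableAt.identDistrib_starCost (hG : ExchangeableAt ν G) (hg : Measurable g)
    {j : Fin 3} (hj : j ≠ 0) {t : unitInterval} {k : ℕ × ℕ × ℕ → ℕ}
    (hk : (mixLaw m t).map (fun p => p.1 + k p) = poissonMeasure m) :
    IdentDistrib (fun q : (ℕ × ℕ × ℕ) × Θ => starCost G g (comb j q.1.1 (k q.1)) q.2)
      (fun q : ℕ × Θ => starCost G g (cls 0 q.1) q.2) ((mixLaw m t).prod ν)
      ((poissonMeasure m).prod ν) := by
  have h : IdentDistrib (fun q : (ℕ × ℕ × ℕ) × Θ => (G (insert none (comb j q.1.1 (k q.1))) q.2,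
      G (comb j q.1.1 (k q.1)) q.2)) (fun q : ℕ × Θ => (G (insert none (cls 0 q.1)) q.2,
      G (cls 0 q.1) q.2)) ((mixLaw m t).prod ν) ((poissonMeasure m).prod ν) :=
    ⟨(hG.measurable_pair (fun p : ℕ × ℕ × ℕ => insert none (comb j p.1 (k p)))
      (fun p => comb j p.1 (k p))).aemeasurable,
     (hG.measurable_pair (fun n : ℕ => insert none (cls 0 n)) (fun n => cls 0 n)).aemeasurable,
     hG.map_mix hj hk⟩
  have hu : Measurable fun z : 𝒢 × 𝒢 => g z.1 - g z.2 :=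
    (hg.comp measurable_fst).sub (hg.comp measurable_snd)
  exact h.comp hu

lemma ExchangeableAt.identDistrib_one (hG : ExchangeableAt ν G) (hg : Measurable g)
    (t : unitInterval) :
    IdentDistrib (fun q : (ℕ × ℕ × ℕ) × Θ => starCost G g (comb 1 q.1.1 q.1.2.1) q.2)
      (fun q : ℕ × Θ => starCost G g (cls 0 q.1) q.2) ((mixLaw m t).prod ν)
      ((poissonMeasure m).prod ν) :=
  hG.identDistrib_starCost hg (by decide) (k := fun p => p.2.1) (map_mixLaw_one t)

lemma ExchangeableAt.identDistrib_two (hG : ExchangeableAt ν G) (hg : Measurable g)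
    (t : unitInterval) :
    IdentDistrib (fun q : (ℕ × ℕ × ℕ) × Θ => starCost G g (comb 2 q.1.1 q.1.2.2) q.2)
      (fun q : ℕ × Θ => starCost G g (cls 0 q.1) q.2) ((mixLaw m t).prod ν)
      ((poissonMeasure m).prod ν) :=
  hG.identDistrib_starCost hg (by decide) (k := fun p => p.2.2) (map_mixLaw_two t)

lemma ExchangeableAt.integrable_mul (hG : ExchangeableAt ν G) (hg : Measurable g)
    (hc : FiniteCost m ν G g) (t : unitInterval) :
    Integrable (fun q : (ℕ × ℕ × ℕ) × Θ => starCost G g (comb 1 q.1.1 q.1.2.1) q.2 *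
      starCost G g (comb 2 q.1.1 q.1.2.2) q.2) ((mixLaw m t).prod ν) :=
  ((hG.identDistrib_one hg t).memLp_iff.2 hc).integrable_mul
    ((hG.identDistrib_two hg t).memLp_iff.2 hc)

lemma starCost_sub (I : Finset Vertex) (θ : Θ) :
    starCost G (fun x => g x - g' x) I θ = starCost G g I θ - starCost G g' I θ := by
  simp only [starCost]; ring

/-- The resampled correlations depend continuously on the functional. -/
lemma ExchangeableAt.abs_resampled_sub_le (hG : ExchangeableAt ν G) (hg : Measurable g)
    (hg' : Measurable g') (hc : FiniteCost m ν G g) (hc' : FiniteCost m ν G g') {s : ℝ} (hs : 0 < s)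
    (t : unitInterval) :
    |resampled m ν G g t - resampled m ν G g' t| ≤
      costMoment m ν G (fun x => g x - g' x) / s +
        s * (costMoment m ν G g + costMoment m ν G g') / 2 := by
  have hcd : FiniteCost m ν G (fun x => g x - g' x) := by
    unfold FiniteCost
    simp_rw [starCost_sub]
    exact hc.sub hc'
  have i1 := hG.identDistrib_one (m := m) hg t
  have i2' := hG.identDistrib_two (m := m) hg' t
  have id1 := hG.identDistrib_one (m := m) (g := fun x => g x - g' x) (hg.sub hg') t
  have id2 := hG.identDistrib_two (m := m) (g := fun x => g x - g' x) (hg.sub hg') t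
  have i2 := hG.identDistrib_two (m := m) hg t
  have i1' := hG.identDistrib_one (m := m) hg' t
  have sq : ∀ {h : 𝒢 → ℝ} {j : (ℕ × ℕ × ℕ) × Θ → ℝ}, IdentDistrib j
      (fun q : ℕ × Θ => starCost G h (cls 0 q.1) q.2) ((mixLaw m t).prod ν)
      ((poissonMeasure m).prod ν) → FiniteCost m ν G h →
      Integrable (fun q => j q ^ 2) ((mixLaw m t).prod ν) ∧
        ∫ q, j q ^ 2 ∂((mixLaw m t).prod ν) = costMoment m ν G h := fun hj hh =>
    ⟨(hj.memLp_iff.2 hh).integrable_sq, (hj.comp (measurable_id.pow_const 2)).integral_eq⟩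
  rw [resampled, resampled, ← integral_sub (hG.integrable_mul hg hc t) (hG.integrable_mul hg' hc' t)]
  refine (abs_integral_le_integral_abs).trans ?_
  have hb : Integrable (fun q : (ℕ × ℕ × ℕ) × Θ =>
      starCost G (fun x => g x - g' x) (comb 1 q.1.1 q.1.2.1) q.2 ^ 2 / (2 * s) +
      starCost G (fun x => g x - g' x) (comb 2 q.1.1 q.1.2.2) q.2 ^ 2 / (2 * s) +
      (s / 2) * starCost G g (comb 2 q.1.1 q.1.2.2) q.2 ^ 2 +
      (s / 2) * starCost G g' (comb 1 q.1.1 q.1.2.1) q.2 ^ 2) ((mixLaw m t).prod ν) :=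
    ((((sq id1 hcd).1.div_const _).add ((sq id2 hcd).1.div_const _)).add
      ((sq i2 hc).1.const_mul _)).add ((sq i1' hc').1.const_mul _)
  refine (integral_mono_of_nonneg (ae_of_all _ fun q => abs_nonneg _) hb
    (ae_of_all _ fun q => ?_)).trans (le_of_eq ?_)
  · simp only
    rw [starCost_sub, starCost_sub]
    generalize starCost G g (comb 1 q.1.1 q.1.2.1) q.2 = a
    generalize starCost G g (comb 2 q.1.1 q.1.2.2) q.2 = b
    generalize starCost G g' (comb 1 q.1.1 q.1.2.1) q.2 = a'
    generalize starCost G g' (comb 2 q.1.1 q.1.2.2) q.2 = b'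
    -- Young's inequality with a weight `s`, which is left free and is tuned by
    -- `exists_pos_div_add_mul_lt`.
    have key : ∀ u v : ℝ, |u * v| ≤ u ^ 2 / (2 * s) + (s / 2) * v ^ 2 := by
      intro u v
      have : u ^ 2 / (2 * s) + (s / 2) * v ^ 2 - |u * v| = (|u| - s * |v|) ^ 2 / (2 * s) := by
        rw [abs_mul, ← sq_abs u, ← sq_abs v]
        field_simp
        ring
      have h2 : 0 ≤ (|u| - s * |v|) ^ 2 / (2 * s) := by positivity
      linarith
    -- The product difference is split so that each summand has one small factor and one factor with
    -- a bounded second moment.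
    have e1 : a * b - a' * b' = (a - a') * b + (b - b') * a' := by ring
    rw [e1]
    have := abs_add_le ((a - a') * b) ((b - b') * a')
    have := key (a - a') b
    have := key (b - b') a'
    linarith
  · rw [integral_add, integral_add, integral_add, integral_div, integral_div, integral_const_mul,
      integral_const_mul, (sq id1 hcd).2, (sq id2 hcd).2, (sq i2 hc).2, (sq i1' hc').2]
    · field_simp
      ring
    · exact (sq id1 hcd).1.div_const _
    · exact (sq id2 hcd).1.div_const _
    · exact ((sq id1 hcd).1.div_const _).add ((sq id2 hcd).1.div_const _)
    · exact (sq i2 hc).1.const_mul _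
    · exact (((sq id1 hcd).1.div_const _).add ((sq id2 hcd).1.div_const _)).add
        ((sq i2 hc).1.const_mul _)
    · exact (sq i1' hc').1.const_mul _

/-- Each of the two configurations alone has the original law, so `2|ab| ≤ a² + b²` gives a bound
that is uniform in `t`. -/
lemma ExchangeableAt.abs_resampled_le (hG : ExchangeableAt ν G) (hg : Measurable g)
    (hc : FiniteCost m ν G g) (t : unitInterval) :
    |resampled m ν G g t| ≤ costMoment m ν G g := by
  have i1 := hG.identDistrib_one (m := m) hg t
  have i2 := hG.identDistrib_two (m := m) hg t
  rw [resampled]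
  refine abs_integral_le_integral_abs.trans ?_
  have s1 := ((i1.memLp_iff.2 hc).integrable_sq.div_const 2).add
    ((i2.memLp_iff.2 hc).integrable_sq.div_const 2)
  refine (integral_mono_of_nonneg (ae_of_all _ fun q => abs_nonneg _) s1
    (ae_of_all _ fun q => ?_)).trans (le_of_eq ?_)
  · simp only [Pi.add_apply, abs_mul]
    rw [← sq_abs (starCost G g (comb 1 q.1.1 q.1.2.1) q.2),
      ← sq_abs (starCost G g (comb 2 q.1.1 q.1.2.2) q.2)]
    nlinarith [sq_nonneg (|starCost G g (comb 1 q.1.1 q.1.2.1) q.2| -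
      |starCost G g (comb 2 q.1.1 q.1.2.2) q.2|)]
  · have e1 := (i1.comp (u := fun x => x ^ 2) (measurable_id.pow_const 2)).integral_eq
    have e2 := (i2.comp (u := fun x => x ^ 2) (measurable_id.pow_const 2)).integral_eq
    simp only [Function.comp_def] at e1 e2
    rw [integral_add' ((i1.memLp_iff.2 hc).integrable_sq.div_const 2)
      ((i2.memLp_iff.2 hc).integrable_sq.div_const 2), integral_div, integral_div, e1, e2,
      costMoment]
    ring

end Abstract

end MarkedPoisson

namespace MarkedPoisson

/-! ## The variance identity -/

/-- Truncation of real numbers to `[-k, k]`. -/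
def clamp (k y : ℝ) : ℝ := max (-k) (min y k)

lemma measurable_clamp (k : ℝ) : Measurable (clamp k) := by unfold clamp; fun_prop

lemma abs_clamp_le {k : ℝ} (hk : 0 ≤ k) (y : ℝ) : |clamp k y| ≤ k := by
  rw [abs_le, clamp]
  exact ⟨le_max_left _ _, max_le (by linarith) (min_le_right _ _)⟩

lemma clamp_of_abs_le {k y : ℝ} (h : |y| ≤ k) : clamp k y = y := by
  rw [abs_le] at h
  rw [clamp, min_eq_left h.2, max_eq_right h.1]

lemma abs_clamp_sub_le (k x y : ℝ) : |clamp k x - clamp k y| ≤ |x - y| := by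
  unfold clamp
  refine (abs_max_sub_max_le_max _ _ _ _).trans ?_
  rw [sub_self, abs_zero, max_eq_right (abs_nonneg _)]
  refine (abs_min_sub_min_le_max _ _ _ _).trans ?_
  rw [sub_self, abs_zero, max_eq_left (abs_nonneg _)]

lemma abs_clamp_le_abs {k : ℝ} (hk : 0 ≤ k) (y : ℝ) : |clamp k y| ≤ |y| := by
  have := abs_clamp_sub_le k y 0
  rwa [clamp_of_abs_le (y := 0) (by simpa using hk), sub_zero, sub_zero] at this

lemma tendsto_clamp (y : ℝ) : Tendsto (fun k : ℕ => clamp k y) atTop (𝓝 y) := by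
  refine tendsto_const_nhds.congr' ?_
  filter_upwards [eventually_ge_atTop ⌈|y|⌉₊] with k hk
  exact (clamp_of_abs_le ((Nat.le_ceil _).trans (by exact_mod_cast hk))).symm

lemma poissonMeasure_zero_eq_dirac : poissonMeasure 0 = Measure.dirac 0 := by
  refine Measure.ext_of_singleton fun n => ?_
  rw [poissonMeasure_singleton]
  rcases Nat.eq_zero_or_pos n with rfl | hn
  · simp
  · simp [hn.ne']

section Abstract

variable {Θ 𝒢 : Type*} [MeasurableSpace Θ] [MeasurableSpace 𝒢]
  {m : ℝ≥0} {ν : Measure Θ} [IsProbabilityMeasure ν] {G : Finset Vertex → Θ → 𝒢}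
  {g g' : 𝒢 → ℝ}

lemma mixLaw_one : mixLaw m 1 =
    (poissonMeasure m).prod ((Measure.dirac 0).prod (Measure.dirac 0)) := by
  simp [mixLaw, poissonMeasure_zero_eq_dirac]

lemma mixLaw_zero : mixLaw m 0 =
    (Measure.dirac 0).prod ((poissonMeasure m).prod (poissonMeasure m)) := by
  simp [mixLaw, poissonMeasure_zero_eq_dirac]

lemma integrable_of_abs_le {Y : Type*} [MeasurableSpace Y] {μ : Measure Y} [IsFiniteMeasure μ]
    {F : Y → ℝ} (hF : Measurable F) {C : ℝ} (hC : ∀ y, |F y| ≤ C) : Integrable F μ :=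
  (integrable_const C).mono' hF.aestronglyMeasurable (ae_of_all _ hC)

/-- The correlations of the two configurations of the resampling. -/
def corr (ν : Measure Θ) (G : Finset Vertex → Θ → 𝒢) (g : 𝒢 → ℝ) (I J : Finset Vertex) : ℝ :=
  ∫ θ, g (G I θ) * g (G J θ) ∂ν

lemma abs_mul_le_sq {C x y : ℝ} (hx : |x| ≤ C) (hy : |y| ≤ C) : |x * y| ≤ C ^ 2 := by
  rw [abs_mul, sq]
  exact mul_le_mul hx hy (abs_nonneg _) ((abs_nonneg x).trans hx)

lemma abs_corr_le {C : ℝ} (hC : ∀ x, |g x| ≤ C) (I J : Finset Vertex) :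
    |corr ν G g I J| ≤ C ^ 2 := by
  have h := norm_integral_le_of_norm_le_const (μ := ν) (f := fun θ => g (G I θ) * g (G J θ))
    (C := C ^ 2) (ae_of_all _ fun θ => abs_mul_le_sq (hC _) (hC _))
  simpa [corr] using h

lemma FullyExchangeable.corr_map (hG : FullyExchangeable ν G) (hg : Measurable g)
    (σ : Equiv.Perm Vertex) (I J : Finset Vertex) :
    corr ν G g (I.map σ.toEmbedding) (J.map σ.toEmbedding) = corr ν G g I J := by
  have hp : ∀ I J, Measurable fun θ => (G I θ, G J θ) := fun I J =>
    (hG.measurable I).prodMk (hG.measurable J)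
  have hu : Measurable fun z : 𝒢 × 𝒢 => g z.1 * g z.2 :=
    (hg.comp measurable_fst).mul (hg.comp measurable_snd)
  have key : ∀ I J, corr ν G g I J = ∫ z, g z.1 * g z.2 ∂(ν.map fun θ => (G I θ, G J θ)) :=
    fun I J => (integral_map (hp I J).aemeasurable hu.aestronglyMeasurable).symm
  rw [key, key, hG.exch σ I J]

/-- The array of correlations. -/
def corrArray (ν : Measure Θ) (G : Finset Vertex → Θ → 𝒢) (g : 𝒢 → ℝ) [IsProbabilityMeasure ν]
    {C : ℝ} (hC : ∀ x, |g x| ≤ C) : BddFun (ℕ × ℕ × ℕ) :=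
  BddFun.mk (fun p => corr ν G g (comb 1 p.1 p.2.1) (comb 2 p.1 p.2.2)) (C ^ 2)
    fun _ => abs_corr_le hC _ _

/-- The array of correlations of the costs. -/
def costArray (ν : Measure Θ) (G : Finset Vertex → Θ → 𝒢) (g : 𝒢 → ℝ) [IsProbabilityMeasure ν]
    {C : ℝ} (hC : ∀ x, |g x| ≤ C) : BddFun (ℕ × ℕ × ℕ) :=
  BddFun.mk (fun p => ∫ θ, starCost G g (comb 1 p.1 p.2.1) θ *
    starCost G g (comb 2 p.1 p.2.2) θ ∂ν) ((2 * C) ^ 2) fun p => by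
      have hb : ∀ I θ, |starCost G g I θ| ≤ 2 * C := fun I θ =>
        (abs_sub _ _).trans (by linarith [hC (G (insert none I) θ), hC (G I θ)])
      have h := norm_integral_le_of_norm_le_const (μ := ν)
        (f := fun θ => starCost G g (comb 1 p.1 p.2.1) θ * starCost G g (comb 2 p.1 p.2.2) θ)
        (C := (2 * C) ^ 2) (ae_of_all _ fun θ => abs_mul_le_sq (hb _ _) (hb _ _))
      simpa using h

lemma abs_starCost_le {C : ℝ} (hC : ∀ x, |g x| ≤ C) (I : Finset Vertex) (θ : Θ) :
    |starCost G g I θ| ≤ 2 * C :=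
  (abs_sub _ _).trans (by linarith [hC (G (insert none I) θ), hC (G I θ)])

lemma ExchangeableAt.resampled_eq (hG : ExchangeableAt ν G) (hg : Measurable g)
    {C : ℝ} (hC : ∀ x, |g x| ≤ C) (t : unitInterval) :
    resampled m ν G g t = ∫ p, costArray ν G g hC p ∂(mixLaw m t) := by
  rw [resampled, integral_prod]
  · rfl
  · refine integrable_of_abs_le ?_ fun q => abs_mul_le_sq (abs_starCost_le hC _ _)
      (abs_starCost_le hC _ _)
    refine measurable_from_prod_countable_right fun p => ?_
    exact (hG.measurable_starCost hg (comb 1 p.1 p.2.1)).mul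
      (hG.measurable_starCost hg (comb 2 p.1 p.2.2))

/-- The product of two costs expands into four correlations. By full exchangeability the additional
vertex can be renamed: it is the next common vertex if it occurs in both configurations, and the
next vertex of sequence `1` or `2` if it occurs in one of them. The signs then match those of the
three shifts in the generator. -/
lemma FullyExchangeable.mixGen_corrArray (hG : FullyExchangeable ν G) (hg : Measurable g)
    {C : ℝ} (hC : ∀ x, |g x| ≤ C) (p : ℕ × ℕ × ℕ) :
    mixGen m (corrArray ν G g hC) p = m * costArray ν G g hC p := by
  obtain ⟨a, b, b'⟩ := p
  have hI : ∀ I J, Integrable (fun θ => g (G I θ) * g (G J θ)) ν := fun I J =>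
    integrable_of_abs_le ((hg.comp (hG.measurable I)).mul (hg.comp (hG.measurable J)))
      fun θ => abs_mul_le_sq (hC _) (hC _)
  have h0 : none ∉ comb 1 a b := none_notMem_comb
  have h0' : none ∉ comb 2 a b' := none_notMem_comb
  have e1 : corr ν G g (insert none (comb 1 a b)) (insert none (comb 2 a b')) =
      corr ν G g (comb 1 (a + 1) b) (comb 2 (a + 1) b') := by
    rw [comb_succ_left, comb_succ_left, ← hG.corr_map hg (Equiv.swap none (some (0, a))),
      map_swap_insert h0 (by simp [mem_comb]), map_swap_insert h0' (by simp [mem_comb])]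
  have e2 : corr ν G g (insert none (comb 1 a b)) (comb 2 a b') =
      corr ν G g (comb 1 a (b + 1)) (comb 2 a b') := by
    rw [comb_succ_right, ← hG.corr_map hg (Equiv.swap none (some (1, b))),
      map_swap_insert h0 (by simp [mem_comb]), map_swap_of_notMem h0' (by simp [mem_comb])]
  have e3 : corr ν G g (comb 1 a b) (insert none (comb 2 a b')) =
      corr ν G g (comb 1 a b) (comb 2 a (b' + 1)) := by
    rw [comb_succ_right, ← hG.corr_map hg (Equiv.swap none (some (2, b'))),
      map_swap_insert h0' (by simp [mem_comb]), map_swap_of_notMem h0 (by simp [mem_comb])]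
  have e4 : costArray ν G g hC (a, b, b') =
      corr ν G g (insert none (comb 1 a b)) (insert none (comb 2 a b')) -
      corr ν G g (insert none (comb 1 a b)) (comb 2 a b') -
      (corr ν G g (comb 1 a b) (insert none (comb 2 a b')) -
      corr ν G g (comb 1 a b) (comb 2 a b')) := by
    unfold corr
    rw [← integral_sub (hI _ _) (hI _ _), ← integral_sub (hI _ _) (hI _ _)]
    refine Eq.trans ?_ (integral_sub ((hI (insert none (comb 1 a b)) (insert none (comb 2 a b'))).sub
      (hI (insert none (comb 1 a b)) (comb 2 a b'))) ((hI (comb 1 a b) (insert none (comb 2 a b'))).sub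
      (hI (comb 1 a b) (comb 2 a b'))))
    refine integral_congr_ae (ae_of_all _ fun θ => ?_)
    simp only [starCost]
    ring
  have e5 : mixGen m (corrArray ν G g hC) (a, b, b') =
      m * ((corr ν G g (comb 1 (a + 1) b) (comb 2 (a + 1) b') -
        corr ν G g (comb 1 a b) (comb 2 a b')) -
        (corr ν G g (comb 1 a (b + 1)) (comb 2 a b') - corr ν G g (comb 1 a b) (comb 2 a b')) -
        (corr ν G g (comb 1 a b) (comb 2 a (b' + 1)) - corr ν G g (comb 1 a b) (comb 2 a b'))) :=
    rfl
  rw [e5, e4, e1, e2, e3]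
  ring

lemma FullyExchangeable.map_cls (hG : FullyExchangeable ν G) (j : Fin 3) (n : ℕ) :
    ν.map (G (cls j n)) = ν.map (G (cls 0 n)) := by
  by_cases hj : j = 0
  · rw [hj]
  · have h := hG.exchangeableAt.map_comb hj 0 n
    have h2 := congrArg (Measure.map Prod.snd) h
    rw [Measure.map_map measurable_snd ((hG.measurable _).prodMk (hG.measurable _)),
      Measure.map_map measurable_snd ((hG.measurable _).prodMk (hG.measurable _)), zero_add,
      comb_zero_left] at h2
    exact h2

lemma ExchangeableAt.measurable_value (hG : ExchangeableAt ν G) (hg : Measurable g) :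
    Measurable fun q : ℕ × Θ => g (G (cls 0 q.1) q.2) :=
  measurable_from_prod_countable_right fun n => hg.comp (hG.measurable (cls 0 n))

/-- The variance identity for bounded functionals. -/
lemma FullyExchangeable.variance_eq_of_bounded (hG : FullyExchangeable ν G) (hg : Measurable g)
    {C : ℝ} (hC : ∀ x, |g x| ≤ C) :
    variance (fun q : ℕ × Θ => g (G (cls 0 q.1) q.2)) ((poissonMeasure m).prod ν) =
      m * ∫ t, resampled m ν G g t := by
  have hm := ExchangeableAt.measurable_value hG.exchangeableAt hg
  have hL : MemLp (fun q : ℕ × Θ => g (G (cls 0 q.1) q.2)) 2 ((poissonMeasure m).prod ν) :=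
    MemLp.of_bound hm.aestronglyMeasurable C (ae_of_all _ fun q => hC _)
  have h := mixFlow_one_sub_zero m (corrArray ν G g hC)
  have hR : ∫ t : unitInterval, ∫ p, mixGen m (corrArray ν G g hC) p ∂(mixLaw m t) =
      m * ∫ t, resampled m ν G g t := by
    rw [← integral_const_mul]
    refine integral_congr_ae (ae_of_all _ fun t => ?_)
    simp only
    rw [hG.exchangeableAt.resampled_eq hg hC, ← integral_const_mul]
    exact integral_congr_ae (ae_of_all _ fun p => hG.mixGen_corrArray hg hC p)
  rw [← hR, ← h, variance_eq_sub hL]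
  congr 1
  -- At `t = 1` the two configurations coincide and the flow gives the second moment.
  · have hi : Integrable (fun q : ℕ × Θ => g (G (cls 0 q.1) q.2) ^ 2) ((poissonMeasure m).prod ν) :=
      hL.integrable_sq
    have e : ∫ q : ℕ × Θ, g (G (cls 0 q.1) q.2) ^ 2 ∂((poissonMeasure m).prod ν) =
        ∫ n, ∫ θ, g (G (cls 0 n) θ) ^ 2 ∂ν ∂(poissonMeasure m) := integral_prod _ hi
    simp only [Pi.pow_apply]
    rw [e, mixLaw_one, integral_prod _ ((corrArray ν G g hC).integrable fun p => p)]
    refine integral_congr_ae (ae_of_all _ fun n => ?_)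
    simp only
    rw [integral_prod (fun q => (corrArray ν G g hC) (n, q))
      ((corrArray ν G g hC).integrable fun p => (n, p)), integral_dirac, integral_dirac]
    simp only [corrArray, BddFun.mk_apply, comb_zero_right, corr, sq]
  -- At `t = 0` the two configurations are disjoint, and independence factorizes the correlation
  -- into the squared mean.
  · have hi : Integrable (fun q : ℕ × Θ => g (G (cls 0 q.1) q.2)) ((poissonMeasure m).prod ν) :=
      hL.integrable (by norm_num)
    have e : ∫ q : ℕ × Θ, g (G (cls 0 q.1) q.2) ∂((poissonMeasure m).prod ν) =
        ∫ n, ∫ θ, g (G (cls 0 n) θ) ∂ν ∂(poissonMeasure m) := integral_prod _ hi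
    rw [e, mixLaw_zero, integral_prod _ ((corrArray ν G g hC).integrable fun p => p),
      integral_dirac, integral_prod (fun q => (corrArray ν G g hC) (0, q))
      ((corrArray ν G g hC).integrable fun p => (0, p)), sq, ← integral_mul_const]
    refine integral_congr_ae (ae_of_all _ fun b => ?_)
    simp only
    rw [← integral_const_mul]
    refine integral_congr_ae (ae_of_all _ fun b' => ?_)
    simp only [corrArray, BddFun.mk_apply, comb_zero_left, corr]
    have hd : Disjoint (cls 1 b) (cls 2 b') := by
      rw [Finset.disjoint_left]
      rintro (_ | ⟨j, i⟩) h1 h2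
      · exact none_notMem_cls h1
      · rw [mem_cls] at h1 h2
        exact absurd (h1.1.symm.trans h2.1) (by decide)
    have hm : ∀ j n, ∫ θ, g (G (cls j n) θ) ∂ν = ∫ θ, g (G (cls 0 n) θ) ∂ν := fun j n => by
      rw [← integral_map (hG.measurable _).aemeasurable hg.aestronglyMeasurable, hG.map_cls,
        integral_map (hG.measurable _).aemeasurable hg.aestronglyMeasurable]
    rw [← hm 1 b, ← hm 2 b']
    exact (((hG.indep _ _ hd).comp hg hg).integral_mul_eq_mul_integral
      (hg.comp (hG.measurable _)).aestronglyMeasurable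
      (hg.comp (hG.measurable _)).aestronglyMeasurable).symm

end Abstract

end MarkedPoisson

/-! ### The variance identity for unbounded functionals, by truncation -/

namespace MarkedPoisson

section Abstract

variable {Θ 𝒢 : Type*} [MeasurableSpace Θ] [MeasurableSpace 𝒢]
  {m : ℝ≥0} {ν : Measure Θ} [IsProbabilityMeasure ν] {G : Finset Vertex → Θ → 𝒢}
  {g g' : 𝒢 → ℝ}

lemma costMoment_nonneg : 0 ≤ costMoment m ν G g := integral_nonneg fun _ => sq_nonneg _

lemma ExchangeableAt.measurable_cost (hG : ExchangeableAt ν G) (hg : Measurable g) :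
    Measurable fun q : ℕ × Θ => starCost G g (cls 0 q.1) q.2 :=
  measurable_from_prod_countable_right fun n => hG.measurable_starCost hg (cls 0 n)

/-- Truncation by `clamp` is a contraction, so it cannot increase a difference; cutting off with an
indicator would not have this property. -/
lemma abs_starCost_clamp_le (k : ℝ) (I : Finset Vertex) (θ : Θ) :
    |starCost G (fun x => clamp k (g x)) I θ| ≤ |starCost G g I θ| := abs_clamp_sub_le _ _ _

lemma ExchangeableAt.finiteCost_clamp (hG : ExchangeableAt ν G) (hg : Measurable g)
    (hc : FiniteCost m ν G g) (k : ℝ) : FiniteCost m ν G fun x => clamp k (g x) :=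
  MemLp.mono hc (hG.measurable_cost ((measurable_clamp k).comp hg)).aestronglyMeasurable
    (ae_of_all _ fun _ => abs_starCost_clamp_le k _ _)

lemma costMoment_clamp_le (hc : FiniteCost m ν G g) (k : ℝ) :
    costMoment m ν G (fun x => clamp k (g x)) ≤ costMoment m ν G g :=
  integral_mono_of_nonneg (ae_of_all _ fun _ => sq_nonneg _) hc.integrable_sq
    (ae_of_all _ fun _ => sq_le_sq.2 (abs_starCost_clamp_le k _ _))

lemma ExchangeableAt.tendsto_costMoment_sub_clamp (hG : ExchangeableAt ν G) (hg : Measurable g)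
    (hc : FiniteCost m ν G g) :
    Tendsto (fun k : ℕ => costMoment m ν G (fun x => g x - clamp k (g x))) atTop (𝓝 0) := by
  have h0 : (0 : ℝ) = ∫ q : ℕ × Θ, (0 : ℝ) ∂((poissonMeasure m).prod ν) := by simp
  rw [h0]
  refine tendsto_integral_of_dominated_convergence
    (fun q => 4 * starCost G g (cls 0 q.1) q.2 ^ 2) (fun k => ?_) (hc.integrable_sq.const_mul 4)
    (fun k => ae_of_all _ fun q => ?_) (ae_of_all _ fun q => ?_)
  · exact ((hG.measurable_cost (hg.sub ((measurable_clamp k).comp hg))).pow_const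
      2).aestronglyMeasurable
  · rw [Real.norm_eq_abs, abs_of_nonneg (sq_nonneg _), starCost_sub,
      show (4 : ℝ) * starCost G g (cls 0 q.1) q.2 ^ 2 = (2 * |starCost G g (cls 0 q.1) q.2|) ^ 2 by
        rw [mul_pow, sq_abs]; norm_num]
    refine sq_le_sq.2 ((abs_sub _ _).trans ?_)
    rw [abs_of_nonneg (a := 2 * |starCost G g (cls 0 q.1) q.2|) (by positivity)]
    linarith [abs_starCost_clamp_le (G := G) (g := g) k (cls 0 q.1) q.2]
  · have h : ∀ x : 𝒢, Tendsto (fun k : ℕ => g x - clamp k (g x)) atTop (𝓝 0) := fun x => by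
      simpa using (tendsto_const_nhds (x := g x)).sub (tendsto_clamp (g x))
    simpa [starCost] using ((h (G (insert none (cls 0 q.1)) q.2)).sub
      (h (G (cls 0 q.1) q.2))).pow 2

/-- The weight `s` is first made small against `M`, and then `δ` small against `s`. -/
lemma exists_pos_div_add_mul_lt {M ε : ℝ} (hM : 0 ≤ M) (hε : 0 < ε) :
    ∃ s > 0, ∃ δ > 0, ∀ x, x ≤ δ → x / s + s * M < ε := by
  refine ⟨ε / (2 * (M + 1)), by positivity, ε / (2 * (M + 1)) * (ε / 3), by positivity,
    fun x hx => ?_⟩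
  have hs : 0 < ε / (2 * (M + 1)) := by positivity
  have h1 : x / (ε / (2 * (M + 1))) ≤ ε / 3 := by
    rw [div_le_iff₀ hs]; linarith
  have h2 : ε / (2 * (M + 1)) * M ≤ ε / 2 := by
    rw [div_mul_eq_mul_div, div_le_div_iff₀ (by positivity) (by norm_num)]
    nlinarith
  linarith

/-- Convergence of the functionals in the cost norm entails uniform convergence of the resampled
correlations. -/
lemma ExchangeableAt.tendstoUniformly_resampled (hG : ExchangeableAt ν G) (hg : Measurable g)
    {gs : ℕ → 𝒢 → ℝ} (hgs : ∀ k, Measurable (gs k)) (hc : FiniteCost m ν G g)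
    (hcs : ∀ k, FiniteCost m ν G (gs k)) (hb : ∀ k, costMoment m ν G (gs k) ≤ costMoment m ν G g)
    (hlim : Tendsto (fun k => costMoment m ν G (fun x => g x - gs k x)) atTop (𝓝 0)) :
    TendstoUniformly (fun k t => resampled m ν G (gs k) t) (resampled m ν G g) atTop := by
  rw [Metric.tendstoUniformly_iff]
  intro ε hε
  obtain ⟨s, hs, δ, hδ, h⟩ := exists_pos_div_add_mul_lt
    (costMoment_nonneg (m := m) (ν := ν) (G := G) (g := g)) hε
  filter_upwards [hlim.eventually_le_const hδ] with k hk t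
  rw [Real.dist_eq]
  refine (hG.abs_resampled_sub_le hg (hgs k) hc (hcs k) hs t).trans_lt ((h _ hk).trans_le' ?_)
  have := mul_le_mul_of_nonneg_left (hb k) hs.le
  linarith

lemma ExchangeableAt.tendstoUniformly_resampled_clamp (hG : ExchangeableAt ν G)
    (hg : Measurable g) (hc : FiniteCost m ν G g) :
    TendstoUniformly (fun (k : ℕ) t => resampled m ν G (fun x => clamp k (g x)) t)
      (resampled m ν G g) atTop :=
  hG.tendstoUniformly_resampled hg (fun k => (measurable_clamp k).comp hg) hc
    (fun k => hG.finiteCost_clamp hg hc k) (fun k => costMoment_clamp_le hc k)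
    (hG.tendsto_costMoment_sub_clamp hg hc)

/-- For truncated functionals the correlation is a Poisson average of a bounded array, hence
continuous along the flow, and uniform limits stay continuous. Continuity up to `t = 1` is what the
positivity of the limit variance rests on. -/
lemma ExchangeableAt.continuous_resampled (hG : ExchangeableAt ν G) (hg : Measurable g)
    (hc : FiniteCost m ν G g) : Continuous (resampled m ν G g) := by
  refine (hG.tendstoUniformly_resampled_clamp hg hc).continuous
    (Frequently.of_forall fun k => ?_)
  have hk : ∀ x, |clamp k (g x)| ≤ (k : ℝ) := fun x => abs_clamp_le (Nat.cast_nonneg k) _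
  refine (continuous_integral_mixLaw m _).congr fun t =>
    (hG.resampled_eq ((measurable_clamp k).comp hg) hk t).symm

/-- At `t = 1` nothing is resampled: both factors are the same cost. -/
lemma ExchangeableAt.resampled_one (hG : ExchangeableAt ν G) (hg : Measurable g)
    (hc : FiniteCost m ν G g) : resampled m ν G g 1 = costMoment m ν G g := by
  rw [resampled, costMoment, integral_prod _ (hG.integrable_mul hg hc 1),
    integral_prod _ hc.integrable_sq]
  have hi := (hG.integrable_mul hg hc 1).integral_prod_left
  rw [mixLaw_one] at hi ⊢
  rw [integral_prod _ hi]
  refine integral_congr_ae (ae_of_all _ fun n => ?_)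
  simp only
  rw [Measure.dirac_prod_dirac, integral_dirac]
  simp only [comb_zero_right, sq]

/-- The Poincaré inequality for bounded functionals. It is needed before the general variance
identity, because it supplies the square integrability of an unbounded functional. -/
lemma FullyExchangeable.variance_le_of_bounded (hG : FullyExchangeable ν G) (hg : Measurable g)
    {C : ℝ} (hC : ∀ x, |g x| ≤ C) (hc : FiniteCost m ν G g) :
    variance (fun q : ℕ × Θ => g (G (cls 0 q.1) q.2)) ((poissonMeasure m).prod ν) ≤
      m * costMoment m ν G g := by
  rw [hG.variance_eq_of_bounded hg hC]
  refine mul_le_mul_of_nonneg_left ?_ m.2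
  refine (le_abs_self _).trans ?_
  have := norm_integral_le_of_norm_le_const (μ := (volume : Measure unitInterval))
    (f := fun t => resampled m ν G g t) (C := costMoment m ν G g)
    (ae_of_all _ fun t => hG.exchangeableAt.abs_resampled_le hg hc t)
  simpa using this

/-- The second moment of the difference of two independent copies. -/
lemma lintegral_sub_sq_eq {Y : Type*} [MeasurableSpace Y] {π : Measure Y} [IsProbabilityMeasure π]
    {X : Y → ℝ} (hX : MemLp X 2 π) :
    ∫⁻ z, ENNReal.ofReal ((X z.1 - X z.2) ^ 2) ∂(π.prod π) =
      ENNReal.ofReal (2 * variance X π) := by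
  have h1 : MemLp (fun z : Y × Y => X z.1) 2 (π.prod π) := hX.comp_fst π
  have h2 : MemLp (fun z : Y × Y => X z.2) 2 (π.prod π) := hX.comp_snd π
  have hind : IndepFun (fun z : Y × Y => X z.1) (fun z => X z.2) (π.prod π) :=
    indepFun_prod₀ hX.aemeasurable hX.aemeasurable
  have hv := variance_sub h1 h2
  rw [hind.covariance_eq_zero h1 h2, mul_zero, sub_zero] at hv
  have e1 : variance (fun z : Y × Y => X z.1) (π.prod π) = variance X π :=
    (measurePreserving_fst (μ := π) (ν := π)).variance_fun_comp hX.aemeasurable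
  have e2 : variance (fun z : Y × Y => X z.2) (π.prod π) = variance X π :=
    (measurePreserving_snd (μ := π) (ν := π)).variance_fun_comp hX.aemeasurable
  have i1 : Integrable (fun z : Y × Y => X z.1) (π.prod π) := h1.integrable (by norm_num)
  have i2 : Integrable (fun z : Y × Y => X z.2) (π.prod π) := h2.integrable (by norm_num)
  have h0 : ∫ z : Y × Y, ((fun z : Y × Y => X z.1) - fun z : Y × Y => X z.2) z ∂(π.prod π) = 0 := by
    rw [integral_sub' i1 i2, integral_fun_fst, integral_fun_snd, sub_self]
  rw [variance_of_integral_eq_zero (h1.sub h2).aemeasurable h0, e1, e2] at hv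
  rw [two_mul, ← hv]
  exact (ofReal_integral_eq_lintegral_ofReal (h1.sub h2).integrable_sq
    (ae_of_all _ fun _ => sq_nonneg _)).symm

/-- A functional with a square integrable cost is square integrable. -/
lemma FullyExchangeable.memLp (hG : FullyExchangeable ν G) (hg : Measurable g)
    (hc : FiniteCost m ν G g) :
    MemLp (fun q : ℕ × Θ => g (G (cls 0 q.1) q.2)) 2 ((poissonMeasure m).prod ν) := by
  set π := (poissonMeasure m).prod ν
  set F := fun q : ℕ × Θ => g (G (cls 0 q.1) q.2) with hF
  have hE := hG.exchangeableAt
  have hFm : Measurable F := hE.measurable_value hg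
  -- No moment of `F` is available yet. Differences of two independent copies avoid centering, and
  -- the Poincaré inequality bounds their truncated versions uniformly in `k`; Fatou's lemma then
  -- removes the truncation.
  have hk : ∀ k : ℕ, ∫⁻ z, ENNReal.ofReal ((clamp k (F z.1) - clamp k (F z.2)) ^ 2) ∂(π.prod π) ≤
      ENNReal.ofReal (2 * (m * costMoment m ν G g)) := fun k => by
    have hb : ∀ x, |clamp k (g x)| ≤ (k : ℝ) := fun x => abs_clamp_le (Nat.cast_nonneg k) _
    rw [lintegral_sub_sq_eq (X := fun q => clamp k (F q)) (MemLp.of_bound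
      ((measurable_clamp k).comp hFm).aestronglyMeasurable k (ae_of_all _ fun q => hb _))]
    refine ENNReal.ofReal_le_ofReal (mul_le_mul_of_nonneg_left ?_ two_pos.le)
    exact (hG.variance_le_of_bounded ((measurable_clamp k).comp hg) hb
      (hE.finiteCost_clamp hg hc k)).trans
      (mul_le_mul_of_nonneg_left (costMoment_clamp_le hc k) m.2)
  have hlim : ∫⁻ z, ENNReal.ofReal ((F z.1 - F z.2) ^ 2) ∂(π.prod π) ≤
      ENNReal.ofReal (2 * (m * costMoment m ν G g)) := by
    have e : ∀ z : (ℕ × Θ) × (ℕ × Θ), ENNReal.ofReal ((F z.1 - F z.2) ^ 2) =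
        liminf (fun k : ℕ => ENNReal.ofReal ((clamp k (F z.1) - clamp k (F z.2)) ^ 2)) atTop :=
      fun z => (ENNReal.tendsto_ofReal (((tendsto_clamp (F z.1)).sub
        (tendsto_clamp (F z.2))).pow 2)).liminf_eq.symm
    simp_rw [e]
    refine (lintegral_liminf_le fun k => ?_).trans ?_
    · exact ((((measurable_clamp k).comp (hFm.comp measurable_fst)).sub
        ((measurable_clamp k).comp (hFm.comp measurable_snd))).pow_const 2).ennreal_ofReal
    · exact liminf_le_of_frequently_le' (Frequently.of_forall hk)
  have hm2 : Measurable fun z : (ℕ × Θ) × (ℕ × Θ) => ENNReal.ofReal ((F z.1 - F z.2) ^ 2) :=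
    (((hFm.comp measurable_fst).sub (hFm.comp measurable_snd)).pow_const 2).ennreal_ofReal
  rw [lintegral_prod _ hm2.aemeasurable] at hlim
  -- By Fubini some constant `F z` differs from `F` by a square integrable function, so `F` itself
  -- is square integrable.
  obtain ⟨z, hz⟩ := (ae_lt_top hm2.lintegral_prod_right'
    (hlim.trans_lt ENNReal.ofReal_lt_top).ne).exists
  have hL : MemLp (fun q => F z - F q) 2 π := by
    refine (memLp_two_iff_integrable_sq (measurable_const.sub hFm).aestronglyMeasurable).2 ?_
    refine ⟨((measurable_const.sub hFm).pow_const 2).aestronglyMeasurable, ?_⟩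
    rw [hasFiniteIntegral_iff_ofReal (ae_of_all _ fun _ => sq_nonneg _)]
    exact hz
  have := (memLp_const (F z) (p := 2) (μ := π)).sub hL
  refine this.ae_eq (ae_of_all _ fun q => ?_)
  simp

/-- The variance identity. -/
lemma FullyExchangeable.variance_eq (hG : FullyExchangeable ν G) (hg : Measurable g)
    (hc : FiniteCost m ν G g) :
    variance (fun q : ℕ × Θ => g (G (cls 0 q.1) q.2)) ((poissonMeasure m).prod ν) =
      m * ∫ t, resampled m ν G g t := by
  set π := (poissonMeasure m).prod ν
  have hE := hG.exchangeableAt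
  set F := fun q : ℕ × Θ => g (G (cls 0 q.1) q.2) with hF
  have hFm : Measurable F := hE.measurable_value hg
  have hL := hG.memLp hg hc
  have hLk : ∀ k : ℕ, MemLp (fun q => clamp k (F q)) 2 π := fun k =>
    MemLp.mono hL ((measurable_clamp k).comp hFm).aestronglyMeasurable
      (ae_of_all _ fun q => abs_clamp_le_abs (Nat.cast_nonneg k) _)
  have t1 : Tendsto (fun k : ℕ => variance (fun q => clamp k (F q)) π) atTop
      (𝓝 (variance F π)) := by
    rw [variance_eq_sub hL]
    refine Tendsto.congr (fun k => (variance_eq_sub (hLk k)).symm) ?_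
    refine Tendsto.sub ?_ (Tendsto.pow ?_ 2)
    · refine tendsto_integral_of_dominated_convergence (fun q => F q ^ 2)
        (fun k => (((measurable_clamp k).comp hFm).pow_const 2).aestronglyMeasurable)
        hL.integrable_sq (fun k => ae_of_all _ fun q => ?_)
        (ae_of_all _ fun q => (tendsto_clamp _).pow 2)
      simp only [Pi.pow_apply]
      rw [Real.norm_eq_abs, abs_of_nonneg (sq_nonneg _)]
      exact sq_le_sq.2 (abs_clamp_le_abs (Nat.cast_nonneg k) _)
    · exact tendsto_integral_of_dominated_convergence (fun q => |F q|)
        (fun k => ((measurable_clamp k).comp hFm).aestronglyMeasurable)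
        (hL.integrable (by norm_num)).abs
        (fun k => ae_of_all _ fun q => abs_clamp_le_abs (Nat.cast_nonneg k) _)
        (ae_of_all _ fun q => tendsto_clamp _)
  -- The correlations of the truncated functionals are all dominated by the second moment of the
  -- untruncated cost.
  have t2 : Tendsto (fun k : ℕ => m * ∫ t, resampled m ν G (fun x => clamp k (g x)) t) atTop
      (𝓝 (m * ∫ t, resampled m ν G g t)) := by
    refine Tendsto.const_mul _ ?_
    refine tendsto_integral_of_dominated_convergence (fun _ => costMoment m ν G g)
      (fun k => (hE.continuous_resampled ((measurable_clamp k).comp hg)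
        (hE.finiteCost_clamp hg hc k)).aestronglyMeasurable) (integrable_const _)
      (fun k => ae_of_all _ fun t => ?_) (ae_of_all _ fun t =>
        (hE.tendstoUniformly_resampled_clamp hg hc).tendsto_at t)
    exact (hE.abs_resampled_le ((measurable_clamp k).comp hg) (hE.finiteCost_clamp hg hc k)
      t).trans (costMoment_clamp_le hc k)
  refine tendsto_nhds_unique t1 (t2.congr fun k => ?_)
  exact (hG.variance_eq_of_bounded ((measurable_clamp k).comp hg)
    fun x => abs_clamp_le (Nat.cast_nonneg k) _).symm

/-- The Poincaré inequality in general form. In the central limit theorem it controls the part of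
the functional that is not captured by the blocks. -/
lemma FullyExchangeable.variance_le (hG : FullyExchangeable ν G) (hg : Measurable g)
    (hc : FiniteCost m ν G g) :
    variance (fun q : ℕ × Θ => g (G (cls 0 q.1) q.2)) ((poissonMeasure m).prod ν) ≤
      m * costMoment m ν G g := by
  rw [hG.variance_eq hg hc]
  refine mul_le_mul_of_nonneg_left ?_ m.2
  refine (le_abs_self _).trans ?_
  have := norm_integral_le_of_norm_le_const (μ := (volume : Measure unitInterval))
    (f := fun t => resampled m ν G g t) (C := costMoment m ν G g)
    (ae_of_all _ fun t => hG.exchangeableAt.abs_resampled_le hg hc t)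
  simpa using this

end Abstract

end MarkedPoisson

namespace MarkedPoisson

attribute [local instance] finiteConfigSigma

/-! ## Products of measures -/

section Products

lemma prod_comm_middle {α β γ δ : Type*} [MeasurableSpace α] [MeasurableSpace β]
    [MeasurableSpace γ] [MeasurableSpace δ] (μ₁ : Measure α) (μ₂ : Measure β) (μ₃ : Measure γ)
    (μ₄ : Measure δ) [SFinite μ₁] [SFinite μ₂] [SFinite μ₃] [SFinite μ₄] :
    ((μ₁.prod μ₂).prod (μ₃.prod μ₄)).map (fun p => ((p.1.1, p.2.1), (p.1.2, p.2.2))) =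
      (μ₁.prod μ₃).prod (μ₂.prod μ₄) := by
  have hm : Measurable fun p : (α × β) × (γ × δ) => ((p.1.1, p.2.1), (p.1.2, p.2.2)) := by fun_prop
  refine Measure.ext_of_lintegral _ fun f hf => ?_
  rw [lintegral_map hf hm, lintegral_prod _ (by fun_prop),
    lintegral_prod _ (by fun_prop), lintegral_prod _ hf.aemeasurable,
    lintegral_prod _ (by fun_prop)]
  refine lintegral_congr fun a => ?_
  have e1 : ∀ b, ∫⁻ y : γ × δ, f ((a, y.1), (b, y.2)) ∂(μ₃.prod μ₄) =
      ∫⁻ c, ∫⁻ e, f ((a, c), (b, e)) ∂μ₄ ∂μ₃ := fun b =>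
    lintegral_prod _ (by fun_prop)
  have e2 : ∀ c, ∫⁻ y : β × δ, f ((a, c), (y.1, y.2)) ∂(μ₂.prod μ₄) =
      ∫⁻ b, ∫⁻ e, f ((a, c), (b, e)) ∂μ₄ ∂μ₂ := fun c =>
    lintegral_prod _ (by fun_prop)
  simp only at e1 e2 ⊢
  simp_rw [e1, e2]
  exact lintegral_lintegral_swap (by fun_prop)

lemma indepFun_prodMk_prod {α β X₁ X₂ Y₁ Y₂ : Type*} [MeasurableSpace α] [MeasurableSpace β]
    [MeasurableSpace X₁] [MeasurableSpace X₂] [MeasurableSpace Y₁] [MeasurableSpace Y₂]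
    {μ : Measure α} {ν : Measure β} [IsProbabilityMeasure μ] [IsProbabilityMeasure ν]
    {f₁ : α → X₁} {f₂ : α → X₂} {g₁ : β → Y₁} {g₂ : β → Y₂} (hf₁ : Measurable f₁)
    (hf₂ : Measurable f₂) (hg₁ : Measurable g₁) (hg₂ : Measurable g₂) (hf : IndepFun f₁ f₂ μ)
    (hg : IndepFun g₁ g₂ ν) :
    IndepFun (fun p : α × β => (f₁ p.1, g₁ p.2)) (fun p => (f₂ p.1, g₂ p.2)) (μ.prod ν) := by
  rw [indepFun_iff_map_prod_eq_prod_map_map (by fun_prop) (by fun_prop)] at hf hg ⊢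
  have e1 : (μ.prod ν).map (fun p : α × β => (f₁ p.1, g₁ p.2)) = (μ.map f₁).prod (ν.map g₁) :=
    (Measure.map_prod_map _ _ hf₁ hg₁).symm
  have e2 : (μ.prod ν).map (fun p : α × β => (f₂ p.1, g₂ p.2)) = (μ.map f₂).prod (ν.map g₂) :=
    (Measure.map_prod_map _ _ hf₂ hg₂).symm
  rw [e1, e2, ← prod_comm_middle, ← hf, ← hg, Measure.map_prod_map _ _ (by fun_prop) (by fun_prop),
    Measure.map_map (by fun_prop) (by fun_prop)]
  rfl

/-- Replacing one coordinate of an independent family. -/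
lemma map_update_infinitePi {ι X : Type*} [DecidableEq ι] [MeasurableSpace X]
    (ρ : ι → Measure X) [∀ i, IsProbabilityMeasure (ρ i)] (μ : Measure X) [IsProbabilityMeasure μ]
    (i : ι) [∀ j, IsProbabilityMeasure (Function.update ρ i μ j)] :
    (μ.prod (Measure.infinitePi ρ)).map (fun p => Function.update p.2 i p.1) =
      Measure.infinitePi (Function.update ρ i μ) := by
  have hm : Measurable fun p : X × (ι → X) => Function.update p.2 i p.1 :=
    measurable_pi_iff.2 fun j => by
      by_cases h : j = i
      · subst h; simpa using measurable_fst
      · simp only [Function.update_of_ne h]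
        fun_prop
  refine Measure.eq_infinitePi _ fun s t ht => ?_
  rw [Measure.map_apply hm (MeasurableSet.pi s.countable_toSet fun j _ => ht j)]
  have hs : (fun p : X × (ι → X) => Function.update p.2 i p.1) ⁻¹' (Set.pi s t) =
      (if i ∈ s then t i else Set.univ) ×ˢ (Set.pi (s.erase i) t) := by
    ext ⟨z, x⟩
    simp only [Set.mem_preimage, Set.mem_pi, Set.mem_prod, Finset.mem_coe, Finset.mem_erase]
    constructor
    · intro h
      refine ⟨?_, fun j hj => by simpa [hj.1] using h j hj.2⟩
      split_ifs with hi
      · simpa using h i hi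
      · trivial
    · rintro ⟨h1, h2⟩ j hj
      by_cases hji : j = i
      · subst hji; simpa [hj] using h1
      · simpa [hji] using h2 j ⟨hji, hj⟩
  rw [hs, Measure.prod_prod, Measure.infinitePi_pi _ fun j _ => ht j]
  have h2 : ∏ j ∈ s.erase i, ρ j (t j) = ∏ j ∈ s.erase i, Function.update ρ i μ j (t j) :=
    Finset.prod_congr rfl fun j hj => by rw [Function.update_of_ne (Finset.ne_of_mem_erase hj)]
  rw [h2]
  split_ifs with hi
  · rw [← Finset.mul_prod_erase s _ hi, Function.update_self]
  · rw [measure_univ, one_mul, Finset.erase_eq_of_notMem hi]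

end Products

/-! ## Random marked graphs -/

section RandomGraph

variable {d : ℕ}

/-- Locations of all vertices and marks of all pairs. -/
abbrev Field (d : ℕ) : Type := (Vertex → Loc d) × (Sym2 Vertex → unitInterval)

open Classical in
/-- The complete graph on the vertices with labels in `I`. -/
def randomGraph (I : Finset Vertex) (θ : Field d) : Finset (MarkedEdge d) :=
  if Set.InjOn θ.1 I then graph θ.1 θ.2 I else ∅

lemma randomGraph_of_injOn {I : Finset Vertex} {θ : Field d} (h : Set.InjOn θ.1 I) :
    randomGraph I θ = graph θ.1 θ.2 I := by simp [randomGraph, h]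

lemma randomGraph_of_not_injOn {I : Finset Vertex} {θ : Field d} (h : ¬ Set.InjOn θ.1 I) :
    randomGraph I θ = ∅ := by simp [randomGraph, h]

lemma measurable_randomGraph (I : Finset Vertex) : Measurable (randomGraph (d := d) I) := by
  classical
  exact measurable_graph (x := fun θ : Field d => θ.1) (u := fun θ : Field d => θ.2)
    (fun i => (measurable_pi_apply i).comp measurable_fst)
    (fun p _ => (measurable_pi_apply p).comp measurable_snd)

/-- Independent locations and independent uniform marks. -/
def graphLaw (ρ : Vertex → Measure (Loc d)) : Measure (Field d) :=
  (Measure.infinitePi ρ).prod (fieldLaw Vertex)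

instance (κ : Type*) : SFinite (fieldLaw κ) := inferInstance

variable {ρ : Vertex → Measure (Loc d)} [∀ i, IsProbabilityMeasure (ρ i)]

instance : IsProbabilityMeasure (graphLaw ρ) := by unfold graphLaw; infer_instance

instance : SFinite (graphLaw ρ) :=
  have : SigmaFinite (graphLaw ρ) := IsFiniteMeasure.toSigmaFinite _
  inferInstance

/-- Relabelling. -/
def relabel (σ : Equiv.Perm Vertex) (θ : Field d) : Field d :=
  (fun i => θ.1 (σ i), fun q => θ.2 (q.map σ))

lemma measurable_relabel (σ : Equiv.Perm Vertex) : Measurable (relabel (d := d) σ) := by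
  unfold relabel; fun_prop

lemma map_relabel {σ : Equiv.Perm Vertex} (hσ : ∀ i, ρ (σ i) = ρ i) :
    (graphLaw ρ).map (relabel σ) = graphLaw ρ := by
  have h1 : (Measure.infinitePi ρ).map (fun x i => x (σ i)) = Measure.infinitePi ρ := by
    rw [Measure.map_infinitePi_infinitePi_of_inj σ.injective, funext hσ]
  have h2 : (fieldLaw Vertex).map (fun u q => u (Sym2.map σ q)) = fieldLaw Vertex :=
    map_fieldLaw_of_injective (Sym2.map.injective σ.injective)
  conv_rhs => rw [graphLaw, ← h1, ← h2, Measure.map_prod_map _ _ (by fun_prop) (by fun_prop)]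
  rfl

lemma injOn_relabel {σ : Equiv.Perm Vertex} {I : Finset Vertex} {θ : Field d} :
    Set.InjOn (relabel σ θ).1 I ↔ Set.InjOn θ.1 (I.map σ.toEmbedding) := by
  rw [Finset.coe_map]
  constructor
  · rintro h _ ⟨i, hi, rfl⟩ _ ⟨k, hk, rfl⟩ hik
    rw [h hi hk hik]
  · intro h i hi k hk hik
    exact σ.injective (h ⟨i, hi, rfl⟩ ⟨k, hk, rfl⟩ hik)

lemma randomGraph_relabel (σ : Equiv.Perm Vertex) (I : Finset Vertex) (θ : Field d) :
    randomGraph I (relabel σ θ) = randomGraph (I.map σ.toEmbedding) θ := by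
  by_cases h : Set.InjOn (relabel σ θ).1 I
  · rw [randomGraph_of_injOn h, randomGraph_of_injOn (injOn_relabel.1 h)]
    ext a
    simp only [mem_graph, Finset.mem_map, exists_exists_and_eq_and, relabel, Sym2.map_mk,
      Equiv.coe_toEmbedding, ne_eq, EmbeddingLike.apply_eq_iff_eq]
  · rw [randomGraph_of_not_injOn h, randomGraph_of_not_injOn (mt injOn_relabel.2 h)]

lemma map_randomGraph_map {σ : Equiv.Perm Vertex} (hσ : ∀ i, ρ (σ i) = ρ i)
    (I J : Finset Vertex) :
    (graphLaw ρ).map (fun θ => (randomGraph I θ, randomGraph J θ)) =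
      (graphLaw ρ).map (fun θ => (randomGraph (I.map σ.toEmbedding) θ,
        randomGraph (J.map σ.toEmbedding) θ)) := by
  conv_lhs => rw [← map_relabel hσ]
  rw [Measure.map_map ((measurable_randomGraph I).prodMk (measurable_randomGraph J))
    (measurable_relabel σ)]
  simp only [Function.comp_def, randomGraph_relabel]

-- The graph on `I` depends only on the locations with labels in `I` and on the marks of pairs
-- inside `I`. Disjoint label sets have disjoint sets of pairs, so these are disjoint groups of
-- independent variables.
open Classical in
lemma indepFun_randomGraph {I J : Finset Vertex} (h : Disjoint I J) :
    IndepFun (randomGraph I) (randomGraph J) (graphLaw ρ) := by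
  let extL : (I : Finset Vertex) → (I → Loc d) → Vertex → Loc d := fun I x i =>
    if hi : i ∈ I then x ⟨i, hi⟩ else 0
  let extM : (I : Finset Vertex) → (properPairs I → unitInterval) → Sym2 Vertex → unitInterval :=
    fun I u q => if hq : q ∈ properPairs I then u ⟨q, hq⟩ else 0
  have hL : ∀ I, Measurable (extL I) := fun I => measurable_pi_iff.2 fun i => by
    by_cases hi : i ∈ I
    · simpa [extL, hi] using measurable_pi_apply _
    · simp [extL, hi]
  have hM : ∀ I, Measurable (extM I) := fun I => measurable_pi_iff.2 fun i => by
    by_cases hi : i ∈ properPairs I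
    · simpa [extM, hi] using measurable_pi_apply _
    · simp [extM, hi]
  let r : (I : Finset Vertex) → Field d → (I → Loc d) × (properPairs I → unitInterval) :=
    fun I θ => (fun i => θ.1 i, fun q => θ.2 q)
  let φ : (I : Finset Vertex) → (I → Loc d) × (properPairs I → unitInterval) →
      Finset (MarkedEdge d) := fun I y => randomGraph I (extL I y.1, extM I y.2)
  have hφ : ∀ I, Measurable (φ I) := fun I => (measurable_randomGraph I).comp
    (((hL I).comp measurable_fst).prodMk ((hM I).comp measurable_snd))
  have hr : ∀ I : Finset Vertex, randomGraph (d := d) I = φ I ∘ r I := fun I => by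
    ext1 θ
    have e1 : ∀ i ∈ I, extL I (r I θ).1 i = θ.1 i := fun i hi => by simp [extL, r, hi]
    have e2 : ∀ q ∈ properPairs I, extM I (r I θ).2 q = θ.2 q := fun q hq => by
      simp [extM, r, hq]
    by_cases hx : Set.InjOn θ.1 I
    · have hx' : Set.InjOn (extL I (r I θ).1) I := hx.congr fun i hi => (e1 i hi).symm
      simp only [φ, Function.comp_apply]
      rw [randomGraph_of_injOn hx, randomGraph_of_injOn (θ := (extL I (r I θ).1, extM I (r I θ).2)) hx']
      ext a
      simp only [mem_graph]
      refine exists_congr fun i => and_congr_right fun hi => exists_congr fun k =>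
        and_congr_right fun hk => and_congr_right fun hik => ?_
      rw [e1 i hi, e1 k hk, e2 _ (mk_mem_properPairs.2 ⟨⟨hi, hk⟩, hik⟩)]
    · have hx' : ¬ Set.InjOn (extL I (r I θ).1) I := fun h' => hx (h'.congr fun i hi => e1 i hi)
      simp only [φ, Function.comp_apply]
      rw [randomGraph_of_not_injOn hx,
        randomGraph_of_not_injOn (θ := (extL I (r I θ).1, extM I (r I θ).2)) hx']
  rw [hr I, hr J]
  refine IndepFun.comp ?_ (hφ I) (hφ J)
  have h1 : IndepFun (fun (x : Vertex → Loc d) (i : I) => x i) (fun x (i : J) => x i)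
      (Measure.infinitePi ρ) :=
    iIndepFun.indepFun_finset I J h (iIndepFun_infinitePi (X := fun _ x => x)
      fun _ => measurable_id) fun i => measurable_pi_apply i
  have hd : Disjoint (properPairs I) (properPairs J) := by
    rw [Finset.disjoint_left]
    intro q h1 h2
    induction q with
    | _ i k =>
      exact Finset.disjoint_left.1 h (mk_mem_properPairs.1 h1).1.1 (mk_mem_properPairs.1 h2).1.1
  have h2 : IndepFun (fun (u : Sym2 Vertex → unitInterval) (q : properPairs I) => u q)
      (fun u (q : properPairs J) => u q) (fieldLaw Vertex) :=
    iIndepFun.indepFun_finset _ _ hd (iIndepFun_infinitePi (X := fun _ x => x)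
      fun _ => measurable_id) fun i => measurable_pi_apply i
  exact indepFun_prodMk_prod (by fun_prop) (by fun_prop) (by fun_prop) (by fun_prop) h1 h2

lemma fullyExchangeable_randomGraph {μ : Measure (Loc d)} [IsProbabilityMeasure μ] :
    FullyExchangeable (graphLaw fun _ => μ) randomGraph :=
  ⟨measurable_randomGraph, fun _ => map_randomGraph_map fun _ => rfl,
    fun _ _ => indepFun_randomGraph⟩

/-- The laws of the locations where the additional vertex has law `δ`. -/
def rootedFamily (δ μ : Measure (Loc d)) (i : Vertex) : Measure (Loc d) := i.elim δ fun _ => μ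

instance {δ μ : Measure (Loc d)} [IsProbabilityMeasure δ] [IsProbabilityMeasure μ] (i : Vertex) :
    IsProbabilityMeasure (rootedFamily δ μ i) := by
  cases i <;> (simp only [rootedFamily, Option.elim]; infer_instance)

/-- The additional vertex has its own location law; a permutation that fixes it only permutes labels
with the common law `μ`. -/
lemma exchangeableAt_randomGraph {δ μ : Measure (Loc d)} [IsProbabilityMeasure δ]
    [IsProbabilityMeasure μ] : ExchangeableAt (graphLaw (rootedFamily δ μ)) randomGraph :=
  ⟨measurable_randomGraph, fun σ hσ => map_randomGraph_map fun i => by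
    cases i with
    | none => rw [hσ]
    | some j =>
      cases h : σ (some j) with
      | none => exact absurd (σ.injective (h.trans hσ.symm)) (by simp)
      | some k => rfl⟩

lemma update_rootedFamily (δ μ : Measure (Loc d)) :
    Function.update (fun _ => μ) none δ = rootedFamily δ μ := by
  ext1 i
  cases i with
  | none => simp [rootedFamily]
  | some j => simp [rootedFamily]

/-- Moving the additional vertex to `z`. -/
def rootAt (z : Loc d) (θ : Field d) : Field d := (Function.update θ.1 none z, θ.2)

lemma measurable_rootAt : Measurable fun p : Loc d × Field d => rootAt p.1 p.2 := by
  unfold rootAt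
  refine Measurable.prodMk (measurable_pi_iff.2 fun j => ?_) (by fun_prop)
  cases j with
  | none => simpa using measurable_fst
  | some j =>
    simp only [Function.update_of_ne (Option.some_ne_none j)]
    fun_prop

lemma map_rootAt_prod (δ μ : Measure (Loc d)) [IsProbabilityMeasure δ] [IsProbabilityMeasure μ] :
    (δ.prod (graphLaw fun _ => μ)).map (fun p => rootAt p.1 p.2) =
      graphLaw (rootedFamily δ μ) := by
  have hi : ∀ j, IsProbabilityMeasure (Function.update (fun _ : Vertex => μ) none δ j) := fun j => by
    rw [update_rootedFamily]; infer_instance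
  have h := map_update_infinitePi (fun _ : Vertex => μ) δ none
  have hm : Measurable fun p : Loc d × (Vertex → Loc d) => Function.update p.2 none p.1 :=
    measurable_pi_iff.2 fun j => by
      cases j with
      | none => simpa using measurable_fst
      | some j =>
        simp only [Function.update_of_ne (Option.some_ne_none j)]
        fun_prop
  have hr : graphLaw (rootedFamily δ μ) = (Measure.infinitePi
      (Function.update (fun _ : Vertex => μ) none δ)).prod (fieldLaw Vertex) := by
    simp_rw [update_rootedFamily, graphLaw]
  rw [hr, ← h, graphLaw]
  have h3 := Measure.map_prod_map (δ.prod (Measure.infinitePi fun _ : Vertex => μ))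
    (fieldLaw Vertex) hm measurable_id
  rw [Measure.map_id] at h3
  rw [h3, ← Measure.prodAssoc_prod, Measure.map_map measurable_rootAt (by fun_prop)]
  rfl

lemma map_rootAt (z : Loc d) (μ : Measure (Loc d)) [IsProbabilityMeasure μ] :
    (graphLaw fun _ => μ).map (rootAt z) = graphLaw (rootedFamily (Measure.dirac z) μ) := by
  rw [← map_rootAt_prod, Measure.dirac_prod, Measure.map_map measurable_rootAt (by fun_prop)]
  rfl

lemma rootedFamily_self (μ : Measure (Loc d)) : rootedFamily μ μ = fun _ => μ := by
  ext1 i; cases i <;> rfl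

/-- Conditioning on the location of the additional vertex. -/
lemma lintegral_prod_graphLaw {Y : Type*} [MeasurableSpace Y] {μ₀ : Measure Y} [SFinite μ₀]
    (μ : Measure (Loc d)) [IsProbabilityMeasure μ] {F : Y × Field d → ℝ≥0∞} (hF : Measurable F) :
    ∫⁻ q, F q ∂(μ₀.prod (graphLaw fun _ => μ)) =
      ∫⁻ z, ∫⁻ q, F q ∂(μ₀.prod (graphLaw (rootedFamily (Measure.dirac z) μ))) ∂μ := by
  have hroot : Measurable fun p : (Loc d × Y) × Field d => F (p.1.2, rootAt p.1.1 p.2) :=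
    hF.comp (Measurable.prodMk (by fun_prop)
      (measurable_rootAt.comp (Measurable.prodMk (by fun_prop) (by fun_prop))))
  have e : ∀ z, ∫⁻ q, F q ∂(μ₀.prod (graphLaw (rootedFamily (Measure.dirac z) μ))) =
      ∫⁻ y, ∫⁻ θ, F (y, rootAt z θ) ∂(graphLaw fun _ => μ) ∂μ₀ := fun z => by
    rw [lintegral_prod _ hF.aemeasurable]
    refine lintegral_congr fun y => ?_
    rw [← map_rootAt]
    exact lintegral_map (hF.comp measurable_prodMk_left)
      (measurable_rootAt.comp (measurable_const.prodMk measurable_id))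
  simp_rw [e]
  rw [lintegral_prod _ hF.aemeasurable]
  have hsw := lintegral_lintegral_swap (μ := μ) (ν := μ₀)
    (f := fun z y => ∫⁻ θ, F (y, rootAt z θ) ∂(graphLaw fun _ => μ))
    (hroot.lintegral_prod_right' (ν := graphLaw fun _ => μ)).aemeasurable
  rw [hsw]
  refine lintegral_congr fun y => ?_
  -- A vertex with law `μ` is a vertex at a fixed place that is then averaged over `μ`.
  conv_lhs => rw [← rootedFamily_self μ, ← map_rootAt_prod]
  rw [lintegral_map (by fun_prop) measurable_rootAt, lintegral_prod]
  exact ((hF.comp measurable_prodMk_left).comp measurable_rootAt).aemeasurable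

/-- Translation of the locations. -/
def shiftField (c : Loc d) (θ : Field d) : Field d := (fun i => c + θ.1 i, θ.2)

lemma measurable_shiftField (c : Loc d) : Measurable (shiftField c) := by
  unfold shiftField; fun_prop

lemma map_shiftField (c : Loc d) {ρ' : Vertex → Measure (Loc d)}
    (h : ∀ i, (ρ i).map (fun x => c + x) = ρ' i) :
    (graphLaw ρ).map (shiftField c) = graphLaw ρ' := by
  have h1 := Measure.infinitePi_map_pi ρ (f := fun _ x => c + x) (fun _ => by fun_prop)
  rw [funext h] at h1
  rw [graphLaw, graphLaw, ← h1]
  have h3 := Measure.map_prod_map (Measure.infinitePi ρ) (fieldLaw Vertex)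
    (f := fun x i => c + x i) (g := id) (by fun_prop) measurable_id
  rw [Measure.map_id] at h3
  rw [h3]
  rfl

lemma randomGraph_shiftField (c : Loc d) (I : Finset Vertex) (θ : Field d) :
    randomGraph I (shiftField c θ) = translate c (randomGraph I θ) := by
  classical
  have hi : Set.InjOn (shiftField c θ).1 I ↔ Set.InjOn θ.1 I := by
    simp [Set.InjOn, shiftField]
  by_cases h : Set.InjOn θ.1 I
  · rw [randomGraph_of_injOn h, randomGraph_of_injOn (hi.2 h)]
    ext ⟨a, v⟩
    simp only [translate, Finset.mem_image, mem_graph, shiftField, Prod.mk.injEq, Prod.exists]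
    constructor
    · rintro ⟨i, hi, k, hk, hik, h1, h2⟩
      refine ⟨⟨s(θ.1 i, θ.1 k), fun h' => hik (h hi hk (by simpa using h'))⟩, v,
        ⟨i, hi, k, hk, hik, rfl, h2⟩, Subtype.ext ?_, rfl⟩
      rw [h1]; rfl
    · rintro ⟨b, w, ⟨i, hi, k, hk, hik, h1, h2⟩, rfl, rfl⟩
      refine ⟨i, hi, k, hk, hik, ?_, h2⟩
      simp only [translateEdge, h1, Sym2.map_mk]
  · rw [randomGraph_of_not_injOn h, randomGraph_of_not_injOn (mt hi.1 h)]
    simp [translate]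

end RandomGraph

end MarkedPoisson

namespace MarkedPoisson

attribute [local instance] finiteConfigSigma

/-! ## Independent marked points -/

section Zip

variable {ι : Type*}

/-- Pairing two independent families coordinatewise. -/
lemma map_zip_infinitePi {X Y : ι → Type*} [∀ i, MeasurableSpace (X i)]
    [∀ i, MeasurableSpace (Y i)] (μ : ∀ i, Measure (X i)) (ν : ∀ i, Measure (Y i))
    [∀ i, IsProbabilityMeasure (μ i)] [∀ i, IsProbabilityMeasure (ν i)] :
    ((Measure.infinitePi μ).prod (Measure.infinitePi ν)).map (fun p i => (p.1 i, p.2 i)) =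
      Measure.infinitePi fun i => (μ i).prod (ν i) := by
  have hm : Measurable fun p : (∀ i, X i) × (∀ i, Y i) => fun i => (p.1 i, p.2 i) := by fun_prop
  refine ((Measure.isProjectiveLimit_infinitePi fun i => (μ i).prod (ν i)).unique fun I => ?_).symm
  rw [Measure.map_map (Finset.measurable_restrict I) hm]
  symm
  -- Measurable rectangles in each coordinate generate the product sigma-field, and on boxes of
  -- rectangles both measures factorize in the same way.
  refine Measure.pi_eq_generateFrom (μ := fun i : I => (μ i).prod (ν i))
    (C := fun i : I => Set.image2 (· ×ˢ ·) {s : Set (X i) | MeasurableSet s}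
      {t : Set (Y i) | MeasurableSet t}) (fun i => generateFrom_prod) (fun i => isPiSystem_prod)
    (fun i => ⟨fun _ => Set.univ, fun _ => ⟨Set.univ, MeasurableSet.univ, Set.univ,
      MeasurableSet.univ, Set.univ_prod_univ⟩, fun _ => measure_lt_top _ _, Set.iUnion_const _⟩) ?_
  intro s hs
  choose a ha b hb hab using hs
  classical
  let a' : ∀ i, Set (X i) := fun i => if h : i ∈ I then a ⟨i, h⟩ else Set.univ
  let b' : ∀ i, Set (Y i) := fun i => if h : i ∈ I then b ⟨i, h⟩ else Set.univ
  have ha' : ∀ i, MeasurableSet (a' i) := fun i => by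
    by_cases h : i ∈ I
    · simpa [a', h] using ha ⟨i, h⟩
    · simp [a', h]
  have hb' : ∀ i, MeasurableSet (b' i) := fun i => by
    by_cases h : i ∈ I
    · simpa [b', h] using hb ⟨i, h⟩
    · simp [b', h]
  have hae : ∀ i : I, a' i = a i := fun i => by simp [a']
  have hbe : ∀ i : I, b' i = b i := fun i => by simp [b']
  have hsm : ∀ i, MeasurableSet (s i) := fun i => by
    rw [← hab i]; exact (ha i).prod (hb i)
  rw [Measure.map_apply ((Finset.measurable_restrict I).comp hm) (MeasurableSet.univ_pi hsm)]
  have hpre : (I.restrict ∘ fun (p : (∀ i, X i) × (∀ i, Y i)) i => (p.1 i, p.2 i)) ⁻¹'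
      Set.univ.pi s = ((I : Set ι).pi a') ×ˢ ((I : Set ι).pi b') := by
    ext p
    simp only [Set.mem_preimage, Set.mem_pi, Set.mem_univ, true_implies, Function.comp_apply,
      Finset.restrict, Set.mem_prod, Finset.mem_coe]
    constructor
    · intro h
      refine ⟨fun i hi => ?_, fun i hi => ?_⟩
      · have := h ⟨i, hi⟩
        rw [← hab] at this
        simpa [a', hi] using this.1
      · have := h ⟨i, hi⟩
        rw [← hab] at this
        simpa [b', hi] using this.2
    · rintro ⟨h1, h2⟩ i
      rw [← hab]
      exact ⟨by simpa [a'] using h1 i i.2, by simpa [b'] using h2 i i.2⟩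
  rw [hpre, Measure.prod_prod, Measure.infinitePi_pi _ fun i _ => ha' i,
    Measure.infinitePi_pi _ fun i _ => hb' i, ← Finset.prod_mul_distrib,
    ← Finset.prod_coe_sort]
  refine Finset.prod_congr rfl fun i _ => ?_
  rw [← hab, hae, hbe, Measure.prod_prod]

/-- By Fubini, one atomless law in each pair of indices excludes coincidence. This leaves room for
one deterministic coordinate, namely the location or birth time of the added point. -/
lemma ae_injective_infinitePi [Countable ι] {X : Type*} [MeasurableSpace X]
    [MeasurableSingletonClass X] [MeasurableEq X] {ρ : ι → Measure X}
    [∀ i, IsProbabilityMeasure (ρ i)]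
    (h : ∀ i j, i ≠ j → NullSingletonClass (ρ i) ∨ NullSingletonClass (ρ j)) :
    ∀ᵐ x ∂(Measure.infinitePi ρ), Function.Injective x := by
  have key : ∀ i j, i ≠ j → NullSingletonClass (ρ j) → ∀ᵐ x ∂(Measure.infinitePi ρ), x i ≠ x j := by
    intro i j hij hj
    have hm : MeasurableSet {p : X × X | p.1 = p.2} := measurableSet_eq_fun measurable_fst
      measurable_snd
    have h0 : (Measure.infinitePi ρ).map (fun x => (x i, x j)) {p : X × X | p.1 = p.2} = 0 := by
      rw [Measure.infinitePi_map_eval_prod hij, Measure.prod_apply hm]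
      refine lintegral_eq_zero_of_ae_eq_zero (ae_of_all _ fun z => ?_)
      have : Prod.mk z ⁻¹' {p : X × X | p.1 = p.2} = {z} := by
        ext w; simp [eq_comm]
      simp only [this, measure_singleton, Pi.zero_apply]
    rw [Measure.map_apply (by fun_prop) hm] at h0
    rw [ae_iff]
    simpa using h0
  have h2 : ∀ i j, i ≠ j → ∀ᵐ x ∂(Measure.infinitePi ρ), x i ≠ x j := fun i j hij => by
    rcases h i j hij with h1 | h1
    · filter_upwards [key j i hij.symm h1] with x hx using hx.symm
    · exact key i j hij h1
  have h3 : ∀ᵐ x ∂(Measure.infinitePi ρ), ∀ i j, i ≠ j → x i ≠ x j := by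
    rw [ae_all_iff]; intro i
    rw [ae_all_iff]; intro j
    by_cases hij : i = j
    · simp [hij]
    · filter_upwards [h2 i j hij] with x hx _ using hx
  filter_upwards [h3] with x hx i j hij
  by_contra hne
  exact hx i j hne hij

end Zip

section Points

variable {d : ℕ} (e : ℕ ≃ (Fin d → ℤ))

open Classical in
/-- The edge marking of a generic configuration. -/
def genericGraph (A : Conf (Pt d)) : Finset (MarkedEdge d) :=
  if Generic A then markedGraph e A else ∅

lemma genericGraph_of_generic {A : Conf (Pt d)} (h : Generic A) :
    genericGraph e A = markedGraph e A := if_pos h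

lemma measurable_genericGraph : Measurable (genericGraph (d := d) e) := measurable_markedGraph e

/-- The law of a marked point with independent location, birth time and marks. -/
def pointLaw (L : Vertex → Measure (Loc d)) (τ : Vertex → Measure unitInterval) (i : Vertex) :
    Measure (Pt d) := (L i).prod ((τ i).prod markLaw)

variable {L : Vertex → Measure (Loc d)} {τ : Vertex → Measure unitInterval}
  [∀ i, IsProbabilityMeasure (L i)] [∀ i, IsProbabilityMeasure (τ i)]

instance (i : Vertex) : IsProbabilityMeasure (pointLaw L τ i) := by
  unfold pointLaw; infer_instance

/-- Marked points from their components. -/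
def zipPoints (p : (Vertex → Loc d) × (Vertex → unitInterval)) (M : Vertex → Marks) (i : Vertex) :
    Pt d := (p.1 i, p.2 i, M i)

lemma map_zipPoints : (((Measure.infinitePi L).prod (Measure.infinitePi τ)).prod
      (marksLaw Vertex)).map (fun p => zipPoints p.1 p.2) = Measure.infinitePi (pointLaw L τ) := by
  unfold pointLaw
  rw [← map_zip_infinitePi, ← map_zip_infinitePi]
  have h := Measure.map_prod_map (Measure.infinitePi L)
    ((Measure.infinitePi τ).prod (Measure.infinitePi fun _ : Vertex => markLaw)) (f := id)
    (g := fun (p : (Vertex → unitInterval) × (Vertex → Marks)) i => (p.1 i, p.2 i))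
    measurable_id (by fun_prop)
  rw [Measure.map_id] at h
  rw [h, Measure.map_map (by fun_prop) (by fun_prop), ← Measure.prodAssoc_prod]
  rw [Measure.map_map (by fun_prop) (by fun_prop)]
  rfl

variable {Y : Type*} [MeasurableSpace Y] {μ₀ : Measure Y} [IsProbabilityMeasure μ₀]

lemma measurable_zipPoints :
    Measurable fun p : ((Vertex → Loc d) × (Vertex → unitInterval)) × (Vertex → Marks) =>
      zipPoints p.1 p.2 := by
  unfold zipPoints; fun_prop

lemma map_prod_zipPoints : ((μ₀.prod ((Measure.infinitePi L).prod (Measure.infinitePi τ))).prod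
      (marksLaw Vertex)).map (fun p => (p.1.1, zipPoints p.1.2 p.2)) =
      μ₀.prod (Measure.infinitePi (pointLaw L τ)) := by
  have h := Measure.map_prod_map μ₀ (((Measure.infinitePi L).prod (Measure.infinitePi τ)).prod
      (marksLaw Vertex)) (f := id) measurable_id measurable_zipPoints
  rw [Measure.map_id, map_zipPoints] at h
  rw [h, ← Measure.prodAssoc_prod (μ := μ₀)
    (ν := (Measure.infinitePi L).prod (Measure.infinitePi τ)), Measure.map_map
    (measurable_id.prodMap measurable_zipPoints) (by fun_prop)]
  rfl

variable {I I₁ I₂ : Y → (Vertex → Loc d) → Finset Vertex}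

lemma measurable_points_locs
    (hI : ∀ i, MeasurableSet {q : Y × (Vertex → Loc d) | i ∈ I q.1 q.2}) :
    Measurable fun q : Y × (Vertex → Pt d) => Conf.points q.2 (I q.1 fun i => (q.2 i).1) :=
  Conf.measurable_points measurable_snd fun i =>
    (hI i).preimage (f := fun q : Y × (Vertex → Pt d) => (q.1, fun i => (q.2 i).1)) (by fun_prop)

lemma measurable_randomGraph_random
    (hI : ∀ i, MeasurableSet {q : Y × (Vertex → Loc d) | i ∈ I q.1 q.2}) :
    Measurable fun q : Y × Field d => randomGraph (I q.1 q.2.1) q.2 :=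
  measurable_graph_random (x := fun q : Y × Field d => q.2.1) (u := fun q : Y × Field d => q.2.2)
    (I := fun q : Y × Field d => I q.1 q.2.1) (by fun_prop) (by fun_prop) fun i =>
    (hI i).preimage (f := fun q : Y × Field d => (q.1, q.2.1)) (by fun_prop)

/-- The edge marking of independent marked points is the complete graph with independent uniform
marks. -/
lemma map_points_pair (hI₁ : ∀ i, MeasurableSet {q : Y × (Vertex → Loc d) | i ∈ I₁ q.1 q.2})
    (hI₂ : ∀ i, MeasurableSet {q : Y × (Vertex → Loc d) | i ∈ I₂ q.1 q.2})
    (h : ∀ᵐ z ∂((Measure.infinitePi L).prod (Measure.infinitePi τ)), ∀ y,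
      Nested z.1 z.2 (I₁ y z.1) (I₂ y z.1)) :
    (μ₀.prod (Measure.infinitePi (pointLaw L τ))).map
      (fun q => (genericGraph e (Conf.points q.2 (I₁ q.1 fun i => (q.2 i).1)),
        genericGraph e (Conf.points q.2 (I₂ q.1 fun i => (q.2 i).1)))) =
    (μ₀.prod (graphLaw L)).map (fun q => (randomGraph (I₁ q.1 q.2.1) q.2,
      randomGraph (I₂ q.1 q.2.1) q.2)) := by
  -- `Q` collects the counts, locations and birth times. The mark sequences are the last,
  -- independent factor, which `identDistrib_pair` exchanges for a field of pair marks.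
  set Q := μ₀.prod ((Measure.infinitePi L).prod (Measure.infinitePi τ))
  have hQ : ∀ᵐ q ∂Q, Nested q.2.1 q.2.2 (I₁ q.1 q.2.1) (I₂ q.1 q.2.1) := by
    filter_upwards [Measure.quasiMeasurePreserving_snd.ae h] with q hq using hq q.1
  have hm := fun (I : Y → (Vertex → Loc d) → Finset Vertex)
    (hI : ∀ i, MeasurableSet {q : Y × (Vertex → Loc d) | i ∈ I q.1 q.2}) =>
    show Measurable fun q : Y × (Vertex → Pt d) =>
      genericGraph e (Conf.points q.2 (I q.1 fun i => (q.2 i).1)) from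
    (measurable_genericGraph e).comp (measurable_points_locs hI)
  have hzip : Measurable fun p : (Y × ((Vertex → Loc d) × (Vertex → unitInterval))) ×
      (Vertex → Marks) => (p.1.1, zipPoints p.1.2 p.2) :=
    Measurable.prodMk (by fun_prop) (measurable_zipPoints.comp
      (measurable_fst.snd.prodMk measurable_snd))
  have hid := (identDistrib_pair e Q (x := fun q => q.2.1) (t := fun q => q.2.2)
    (I₁ := fun q => I₁ q.1 q.2.1) (I₂ := fun q => I₂ q.1 q.2.1) (by fun_prop) (by fun_prop)
    (fun i => (hI₁ i).preimage (f := fun q : Y × ((Vertex → Loc d) × (Vertex → unitInterval)) =>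
      (q.1, q.2.1)) (by fun_prop))
    (fun i => (hI₂ i).preimage (f := fun q : Y × ((Vertex → Loc d) × (Vertex → unitInterval)) =>
      (q.1, q.2.1)) (by fun_prop)) hQ).map_eq
  rw [← map_prod_zipPoints, Measure.map_map ((hm I₁ hI₁).prodMk (hm I₂ hI₂))
    hzip]
  have hA : (Q.prod (marksLaw Vertex)).map ((fun q : Y × (Vertex → Pt d) =>
        (genericGraph e (Conf.points q.2 (I₁ q.1 fun i => (q.2 i).1)),
        genericGraph e (Conf.points q.2 (I₂ q.1 fun i => (q.2 i).1)))) ∘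
        fun p => (p.1.1, zipPoints p.1.2 p.2)) =
      (Q.prod (marksLaw Vertex)).map (fun p =>
        (markedGraph e (Conf.points (fun i => (p.1.2.1 i, p.1.2.2 i, p.2 i)) (I₁ p.1.1 p.1.2.1)),
        markedGraph e (Conf.points (fun i => (p.1.2.1 i, p.1.2.2 i, p.2 i))
          (I₂ p.1.1 p.1.2.1)))) := by
    refine Measure.map_congr ?_
    filter_upwards [Measure.quasiMeasurePreserving_fst.ae hQ] with p hp
    have h1 := generic_points (M := p.2) (hp.injOn_loc.mono fun _ => Or.inl)
      (hp.injOn_time.mono fun _ => Or.inl)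
    have h2 := generic_points (M := p.2) (hp.injOn_loc.mono fun _ => Or.inr)
      (hp.injOn_time.mono fun _ => Or.inr)
    exact Prod.ext (genericGraph_of_generic e h1) (genericGraph_of_generic e h2)
  rw [hA, hid]
  have hB : (Q.prod (fieldLaw Vertex)).map (fun p => (graph p.1.2.1 p.2 (I₁ p.1.1 p.1.2.1),
      graph p.1.2.1 p.2 (I₂ p.1.1 p.1.2.1))) = (Q.prod (fieldLaw Vertex)).map
      ((fun q : Y × Field d => (randomGraph (I₁ q.1 q.2.1) q.2,
      randomGraph (I₂ q.1 q.2.1) q.2)) ∘ fun p => (p.1.1, p.1.2.1, p.2)) := by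
    refine Measure.map_congr ?_
    filter_upwards [Measure.quasiMeasurePreserving_fst.ae hQ] with p hp
    exact Prod.ext (randomGraph_of_injOn (θ := (p.1.2.1, p.2))
        (hp.injOn_loc.mono fun _ => Or.inl)).symm
      (randomGraph_of_injOn (θ := (p.1.2.1, p.2)) (hp.injOn_loc.mono fun _ => Or.inr)).symm
  rw [hB, ← Measure.map_map ((measurable_randomGraph_random hI₁).prodMk
    (measurable_randomGraph_random hI₂)) (by fun_prop)]
  congr 1
  -- The graphs with field marks no longer depend on the birth times, which are integrated out here.
  have h4 : Q.map (fun q => (q.1, q.2.1)) = μ₀.prod (Measure.infinitePi L) := by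
    have := Measure.map_prod_map μ₀ ((Measure.infinitePi L).prod (Measure.infinitePi τ))
      (f := id) (g := Prod.fst) measurable_id measurable_fst
    rw [Measure.map_id, Measure.map_fst_prod, measure_univ, one_smul] at this
    exact this.symm
  have h5 := Measure.map_prod_map Q (fieldLaw Vertex) (f := fun q => (q.1, q.2.1)) (g := id)
    (by fun_prop) measurable_id
  rw [Measure.map_id, h4] at h5
  rw [graphLaw, ← Measure.prodAssoc_prod, h5, Measure.map_map (by fun_prop) (by fun_prop)]
  rfl

end Points

end MarkedPoisson

namespace MarkedPoisson

attribute [local instance] finiteConfigSigma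

/-! ## Restrictions of marked graphs -/

section RestrictTo

variable {d : ℕ}

open Classical in
/-- The subgraph induced by the vertices in `V`. -/
def restrictTo (V : Set (Loc d)) (A : Finset (MarkedEdge d)) : Finset (MarkedEdge d) :=
  A.filter fun a => ∀ x ∈ (a.1 : Sym2 (Loc d)), x ∈ V

lemma mem_restrictTo {V : Set (Loc d)} {A : Finset (MarkedEdge d)} {a : MarkedEdge d} :
    a ∈ restrictTo V A ↔ a ∈ A ∧ ∀ x ∈ (a.1 : Sym2 (Loc d)), x ∈ V := by
  simp [restrictTo]

lemma restrictTo_restrictTo {V W : Set (Loc d)} (h : V ⊆ W) (A : Finset (MarkedEdge d)) :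
    restrictTo V (restrictTo W A) = restrictTo V A := by
  ext a
  simp only [mem_restrictTo]
  exact ⟨fun ⟨⟨h1, _⟩, h3⟩ => ⟨h1, h3⟩, fun ⟨h1, h3⟩ => ⟨⟨h1, fun x hx => h (h3 x hx)⟩, h3⟩⟩

lemma measurableSet_edges_in {V : Set (Loc d)} (hV : MeasurableSet V) :
    MeasurableSet[markedEdgeSigma d] {a : MarkedEdge d | ∀ x ∈ (a.1 : Sym2 (Loc d)), x ∈ V} := by
  have h1 : MeasurableSet[sym2Sigma d] {q : Sym2 (Loc d) | ∀ x ∈ q, x ∈ V} := by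
    change MeasurableSet ((fun p : Loc d × Loc d => s(p.1, p.2)) ⁻¹' _)
    have : (fun p : Loc d × Loc d => s(p.1, p.2)) ⁻¹' {q : Sym2 (Loc d) | ∀ x ∈ q, x ∈ V} =
        V ×ˢ V := by
      ext p; simp
    rw [this]
    exact hV.prod hV
  have h2 : MeasurableSet[MeasurableSpace.comap Subtype.val (sym2Sigma d)]
      {q : Edge d | ∀ x ∈ (q : Sym2 (Loc d)), x ∈ V} := ⟨_, h1, rfl⟩
  exact @measurable_fst _ _ (MeasurableSpace.comap Subtype.val (sym2Sigma d)) _ _ h2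

lemma measurable_restrictTo {V : Set (Loc d)} (hV : MeasurableSet V) :
    Measurable (restrictTo V) := by
  refine measurable_of_count fun B hB => ?_
  have : (fun A : Finset (MarkedEdge d) => ((restrictTo V A : Set (MarkedEdge d)) ∩ B).encard) =
      fun A : Finset (MarkedEdge d) => ((A : Set (MarkedEdge d)) ∩
        ({a | ∀ x ∈ (a.1 : Sym2 (Loc d)), x ∈ V} ∩ B)).encard := by
    ext1 A
    congr 1
    ext a
    simp only [Set.mem_inter_iff, Finset.mem_coe, mem_restrictTo, Set.mem_ofPred_eq]
    tauto
  rw [this]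
  exact measurable_count (@MeasurableSet.inter _ (markedEdgeSigma d) _ _
    (measurableSet_edges_in hV) hB)

open Classical in
lemma restrictTo_randomGraph {V : Set (Loc d)} {I : Finset Vertex} {θ : Field d}
    (h : Set.InjOn θ.1 I) :
    restrictTo V (randomGraph I θ) = randomGraph (I.filter fun i => θ.1 i ∈ V) θ := by
  have h' : Set.InjOn θ.1 (I.filter fun i => θ.1 i ∈ V : Finset Vertex) :=
    h.mono fun i hi => (Finset.mem_filter.1 hi).1
  rw [randomGraph_of_injOn h, randomGraph_of_injOn h']
  ext a
  simp only [mem_restrictTo, mem_graph, Finset.mem_filter]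
  constructor
  · rintro ⟨⟨i, hi, k, hk, hik, h1, h2⟩, h3⟩
    rw [h1] at h3
    exact ⟨i, ⟨hi, h3 _ (Sym2.mem_mk_left _ _)⟩, k, ⟨hk, h3 _ (Sym2.mem_mk_right _ _)⟩, hik, h1, h2⟩
  · rintro ⟨i, ⟨hi, hiV⟩, k, ⟨hk, hkV⟩, hik, h1, h2⟩
    refine ⟨⟨i, hi, k, hk, hik, h1, h2⟩, ?_⟩
    rw [h1]
    simp [hiV, hkV]

lemma restrictTo_compl_randomGraph {I : Finset Vertex} {θ : Field d} (hI : none ∉ I)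
    (h : Function.Injective θ.1) :
    restrictTo {θ.1 none}ᶜ (randomGraph (insert none I) θ) = randomGraph I θ := by
  classical
  rw [restrictTo_randomGraph h.injOn]
  congr 1
  ext i
  simp only [Finset.mem_filter, Finset.mem_insert, Set.mem_compl_iff, Set.mem_singleton_iff,
    h.eq_iff]
  constructor
  · rintro ⟨h1 | h1, h2⟩
    · exact absurd h1 h2
    · exact h1
  · exact fun h1 => ⟨Or.inr h1, fun h2 => hI (h2 ▸ h1)⟩

lemma restrictTo_translate (c : Loc d) (V : Set (Loc d)) (A : Finset (MarkedEdge d)) :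
    restrictTo V (translate c A) = translate c (restrictTo {x | c + x ∈ V} A) := by
  ext a
  simp only [mem_restrictTo, translate, Finset.mem_image]
  constructor
  · rintro ⟨⟨b, hb, rfl⟩, h⟩
    refine ⟨b, ⟨hb, fun x hx => h (c + x) ?_⟩, rfl⟩
    exact Sym2.mem_map.2 ⟨x, hx, rfl⟩
  · rintro ⟨b, ⟨hb, h⟩, rfl⟩
    refine ⟨⟨b, hb, rfl⟩, fun x hx => ?_⟩
    obtain ⟨y, hy, rfl⟩ := Sym2.mem_map.1 hx
    exact h y hy

/-- The cost of the vertex at the origin. -/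
def rootCost (f : Finset (MarkedEdge d) → ℝ) (A : Finset (MarkedEdge d)) : ℝ :=
  f A - f (restrictTo {0}ᶜ A)

lemma measurable_rootCost {f : Finset (MarkedEdge d) → ℝ} (hf : Measurable f) :
    Measurable (rootCost f) :=
  hf.sub (hf.comp (measurable_restrictTo (measurableSet_singleton 0).compl))

/-- Removing the vertex at the origin deletes exactly the label `none`, because locations are
distinct. This identifies the add-one cost with the abstract cost of the additional vertex. -/
lemma rootCost_randomGraph {f : Finset (MarkedEdge d) → ℝ} {I : Finset Vertex} {θ : Field d}
    (hI : none ∉ I) (h : Function.Injective θ.1) (h0 : θ.1 none = 0) :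
    rootCost f (randomGraph (insert none I) θ) = starCost randomGraph f I θ := by
  rw [rootCost, ← h0, restrictTo_compl_randomGraph hI h, starCost]

end RestrictTo

/-! ## Cubes -/

section Cubes

variable {d : ℕ}

lemma Cube.measurableSet (W : Cube d) : MeasurableSet W.toSet := by
  have : W.toSet = ⋂ i, {y : Loc d | W.corner i ≤ y i ∧ y i < W.corner i + W.side} := by
    ext; simp [Cube.toSet]
  rw [this]
  refine .iInter fun i => ?_
  have hi : Measurable fun y : Loc d => y i := by fun_prop
  exact (measurableSet_le measurable_const hi).inter (measurableSet_lt hi measurable_const)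

lemma Cube.volume_eq (W : Cube d) : volume W.toSet = ENNReal.ofReal W.side ^ d := by
  have h : W.toSet = (WithLp.ofLp : Loc d → Fin d → ℝ) ⁻¹'
      (Set.univ.pi fun i => Set.Ico (W.corner i) (W.corner i + W.side)) := by
    ext; simp [Cube.toSet]
  rw [h, (PiLp.volume_preserving_ofLp (Fin d)).measure_preimage
    (MeasurableSet.univ_pi fun i => measurableSet_Ico).nullMeasurableSet, Real.volume_pi_Ico]
  simp

lemma Cube.volume_ne_zero (W : Cube d) : volume W.toSet ≠ 0 := by
  rw [W.volume_eq]
  exact pow_ne_zero _ (ENNReal.ofReal_pos.2 W.side_pos).ne'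

lemma Cube.volume_ne_top (W : Cube d) : volume W.toSet ≠ ∞ := by
  rw [W.volume_eq]
  exact ENNReal.pow_ne_top ENNReal.ofReal_ne_top

lemma Cube.volume_real (W : Cube d) : volume.real W.toSet = W.side ^ d := by
  rw [Measure.real, W.volume_eq, ENNReal.toReal_pow, ENNReal.toReal_ofReal W.side_pos.le]

lemma Cube.volume_real_pos (W : Cube d) : 0 < volume.real W.toSet := by
  rw [W.volume_real]; exact pow_pos W.side_pos d

lemma Cube.isBounded (W : Cube d) : ∃ r, W.toSet ⊆ Metric.closedBall 0 r := by
  have hb : Bornology.IsBounded W.toSet := by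
    have hb' : Bornology.IsBounded (Set.univ.pi fun i =>
        Set.Icc (W.corner i) (W.corner i + W.side)) := Bornology.IsBounded.pi fun i =>
      Metric.isBounded_Icc _ _
    have hl := (PiLp.antilipschitzWith_ofLp 2 fun _ : Fin d => ℝ).isBounded_preimage hb'
    refine hl.subset fun x hx => ?_
    simp only [Set.mem_preimage, Set.mem_pi, Set.mem_univ, true_implies, Set.mem_Icc]
    exact fun i => ⟨(hx i).1, (hx i).2.le⟩
  obtain ⟨r, hr⟩ := hb.subset_closedBall 0
  exact ⟨r, hr⟩

/-- The uniform distribution on a cube. -/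
def cubeLaw (W : Cube d) : Measure (Loc d) := cond volume W.toSet

instance (W : Cube d) : IsProbabilityMeasure (cubeLaw W) :=
  cond_isProbabilityMeasure_of_finite W.volume_ne_zero W.volume_ne_top

lemma nullSingletonClass_cond {X : Type*} [MeasurableSpace X] (μ : Measure X)
    [NullSingletonClass μ] (s : Set X) : NullSingletonClass (cond μ s) :=
  ⟨fun x => cond_absolutelyContinuous (measure_singleton x)⟩

instance [NeZero d] (W : Cube d) : NullSingletonClass (cubeLaw W) := nullSingletonClass_cond _ _

lemma ae_mem_cubeLaw (W : Cube d) : ∀ᵐ x ∂(cubeLaw W), x ∈ W.toSet :=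
  ae_cond_mem W.measurableSet

/-- The translated cube. -/
def Cube.shift (c : Loc d) (W : Cube d) : Cube d := ⟨c + W.corner, W.side, W.side_pos⟩

lemma Cube.add_mem_shift {c x : Loc d} {W : Cube d} : c + x ∈ (W.shift c).toSet ↔ x ∈ W.toSet := by
  simp only [Cube.toSet, Cube.shift, Set.mem_ofPred_eq, PiLp.add_apply, add_assoc,
    add_le_add_iff_left, add_lt_add_iff_left]

lemma Cube.mem_shift {c x : Loc d} {W : Cube d} : x ∈ (W.shift c).toSet ↔ -c + x ∈ W.toSet := by
  rw [← Cube.add_mem_shift (c := c) (x := -c + x), add_neg_cancel_left]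

lemma Cube.volume_shift (c : Loc d) (W : Cube d) :
    volume (W.shift c).toSet = volume W.toSet := by
  rw [Cube.volume_eq, Cube.volume_eq]; rfl

lemma map_cubeLaw (c : Loc d) (W : Cube d) :
    (cubeLaw W).map (fun x => c + x) = cubeLaw (W.shift c) := by
  refine Measure.ext fun U hU => ?_
  rw [Measure.map_apply (by fun_prop) hU, cubeLaw, cubeLaw, cond_apply W.measurableSet,
    cond_apply (W.shift c).measurableSet, Cube.volume_shift]
  congr 1
  have : W.toSet ∩ (fun x => c + x) ⁻¹' U = (fun x => c + x) ⁻¹' ((W.shift c).toSet ∩ U) := by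
    ext x
    simp only [Set.mem_inter_iff, Set.mem_preimage, Cube.add_mem_shift]
  rw [this, measure_preimage_add]

/-- The mean number of points in a cube. -/
def mass (lam : ℝ≥0) (W : Cube d) : ℝ≥0 := lam * (volume W.toSet).toNNReal

lemma mass_coe (lam : ℝ≥0) (W : Cube d) : (mass lam W : ℝ) = lam * volume.real W.toSet := by
  rw [mass, NNReal.coe_mul]; rfl

lemma mass_shift (lam : ℝ≥0) (c : Loc d) (W : Cube d) : mass lam (W.shift c) = mass lam W := by
  rw [mass, mass, Cube.volume_shift]

/-- The marked points with location in a cube and birth time in a given set. -/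
def slab (W : Cube d) (T : Set unitInterval) : Set (Pt d) := {s | s.1 ∈ W.toSet ∧ s.2.1 ∈ T}

lemma slab_eq (W : Cube d) (T : Set unitInterval) :
    slab W T = W.toSet ×ˢ (T ×ˢ Set.univ) := by
  ext; simp [slab]

lemma measurableSet_slab (W : Cube d) {T : Set unitInterval} (hT : MeasurableSet T) :
    MeasurableSet (slab W T) := by
  rw [slab_eq]; exact W.measurableSet.prod (hT.prod MeasurableSet.univ)

lemma exists_compact_slab (W : Cube d) (T : Set unitInterval) :
    ∃ K, IsCompact K ∧ slab W T ⊆ K := by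
  obtain ⟨r, hr⟩ := W.isBounded
  exact ⟨Metric.closedBall 0 r ×ˢ (Set.univ ×ˢ Set.univ),
    (isCompact_closedBall 0 r).prod (isCompact_univ.prod isCompact_univ),
    fun s hs => ⟨hr hs.1, trivial, trivial⟩⟩

lemma intensity_restrict_slab (lam : ℝ≥0) (W : Cube d) (T : Set unitInterval) (hT : volume T ≠ 0) :
    (intensity d lam).restrict (slab W T) = (mass lam W * (volume T).toNNReal) •
      ((cubeLaw W).prod ((cond volume T).prod markLaw)) := by
  have h1 : (volume : Measure (Loc d)).restrict W.toSet = volume W.toSet • cubeLaw W := by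
    rw [cubeLaw, ProbabilityTheory.cond, smul_smul, ENNReal.mul_inv_cancel W.volume_ne_zero W.volume_ne_top, one_smul]
  have h2 : (volume : Measure unitInterval).restrict T = volume T • ProbabilityTheory.cond volume T := by
    rw [ProbabilityTheory.cond, smul_smul, ENNReal.mul_inv_cancel hT (measure_ne_top _ _), one_smul]
  have hs : SFinite (((volume T) • ProbabilityTheory.cond volume T).prod markLaw) := by rw [← h2]; infer_instance
  rw [intensity, slab_eq, Measure.restrict_smul, ← Measure.prod_restrict, ← Measure.prod_restrict,
    Measure.restrict_univ, h1, h2, Measure.prod_smul_left, Measure.prod_smul_left,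
    Measure.prod_smul_right, mass, mul_smul, mul_smul]
  congr 1
  rw [ENNReal.smul_def, ENNReal.coe_toNNReal W.volume_ne_top, ENNReal.smul_def,
    ENNReal.coe_toNNReal (measure_ne_top _ _), smul_smul]

lemma intensity_slab_ne_top (lam : ℝ≥0) (W : Cube d) (T : Set unitInterval) :
    intensity d lam (slab W T) ≠ ∞ := by
  refine measure_ne_top_of_subset (s := slab W Set.univ) ?_ ?_
  · intro s hs
    exact ⟨hs.1, trivial⟩
  · have h := congrArg (fun μ => μ Set.univ) (intensity_restrict_slab lam W Set.univ (by simp))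
    simp only [Measure.restrict_apply_univ] at h
    rw [h, Measure.smul_apply, measure_univ]
    simp [ENNReal.smul_def]

/-- The cube is a union of lattice unit cubes. -/
def Cube.Aligned (W : Cube d) : Prop :=
  ∀ (n : Fin d → ℤ) (x : Loc d), x ∈ unitCube n → x ∈ W.toSet → unitCube n ⊆ W.toSet

lemma Cube.aligned_of_int {W : Cube d} {c : Fin d → ℤ} {k : ℤ} (hc : ∀ i, W.corner i = c i)
    (hk : W.side = k) : W.Aligned := by
  intro n x hxn hxW y hy i
  have h1 := hxn i
  have h2 := hxW i
  have h3 := hy i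
  rw [hc, hk] at h2 ⊢
  have h4 : c i ≤ n i := by
    have : (c i : ℝ) < n i + 1 := by linarith
    have : c i < n i + 1 := by exact_mod_cast this
    omega
  have h5 : n i + 1 ≤ c i + k := by
    have : (n i : ℝ) < c i + k := by linarith
    have : n i < c i + k := by exact_mod_cast this
    omega
  have h4' : (c i : ℝ) ≤ n i := by exact_mod_cast h4
  have h5' : (n i : ℝ) + 1 ≤ c i + k := by exact_mod_cast h5
  constructor <;> linarith

end Cubes

/-! ## The process in a cube -/

section Deterministic

variable {d : ℕ} (e : ℕ ≃ (Fin d → ℤ)) {f : Finset (MarkedEdge d) → ℝ}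

/-- The part of a configuration in `R`. -/
def Conf.part {S : Type*} (A : Conf S) (R : Set S) : Conf S :=
  ⟨A.carrier ∩ R, A.finite.subset Set.inter_subset_left⟩

/-- Ranks are counted within lattice unit cubes, and an aligned cube contains every unit cube that
it meets at a point. Forgetting the points outside of `V` thus changes no rank, and no mark, of an
edge inside `V`. For a cube that cuts through unit cubes the marks could change. -/
lemma restrictTo_markedGraph {V : Cube d} (hV : V.Aligned) (A : Conf (Pt d)) :
    restrictTo V.toSet (markedGraph e A) = markedGraph e (A.part (slab V Set.univ)) := by
  have hrank : ∀ (n : ℕ) (t : unitInterval), unitCube (e n) ⊆ V.toSet →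
      ageRank A.carrier (unitCube (e n)) t =
        ageRank (A.part (slab V Set.univ)).carrier (unitCube (e n)) t := fun n t h => by
    unfold ageRank
    congr 1
    ext s
    simp only [Set.mem_ofPred_eq, Conf.part, slab, Set.mem_inter_iff, Set.mem_univ, and_true]
    exact ⟨fun ⟨h1, h2, h3⟩ => ⟨⟨h1, h h2⟩, h2, h3⟩, fun ⟨⟨h1, _⟩, h2, h3⟩ => ⟨h1, h2, h3⟩⟩
  ext a
  simp only [mem_restrictTo, markedGraph, Set.Finite.mem_toFinset]
  constructor
  · rintro ⟨⟨s₁, h₁, s₂, h₂, n, h3, h4, h5, h6⟩, h7⟩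
    rw [h5] at h7
    have hs₁ := h7 _ (Sym2.mem_mk_left _ _)
    have hs₂ := h7 _ (Sym2.mem_mk_right _ _)
    refine ⟨s₁, ⟨h₁, hs₁, trivial⟩, s₂, ⟨h₂, hs₂, trivial⟩, n, h3, h4, h5, ?_⟩
    rw [h6, hrank n _ (hV _ _ h4 hs₁)]
  · rintro ⟨s₁, ⟨h₁, hs₁, -⟩, s₂, ⟨h₂, hs₂, -⟩, n, h3, h4, h5, h6⟩
    refine ⟨⟨s₁, h₁, s₂, h₂, n, h3, h4, h5, ?_⟩, ?_⟩
    · rw [h6, hrank n _ (hV _ _ h4 hs₁)]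
    · rw [h5]
      simp [hs₁, hs₂]

lemma evalOn_edgeMarking (A : Conf (Pt d)) :
    evalOn f (edgeMarking e A.carrier) = f (markedGraph e A) :=
  dif_pos (edgeMarking_finite e A.finite)

lemma evalOn_removeVertex (x : Loc d) (A : Conf (Pt d)) :
    evalOn f (removeVertex x (edgeMarking e A.carrier)) =
      f (restrictTo {x}ᶜ (markedGraph e A)) := by
  have hfin : (removeVertex x (edgeMarking e A.carrier)).Finite :=
    (edgeMarking_finite e A.finite).subset fun a ha => ha.1
  rw [evalOn, dif_pos hfin]
  congr 1
  ext a
  simp only [Set.Finite.mem_toFinset, mem_restrictTo, markedGraph, removeVertex, Set.mem_ofPred_eq,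
    Set.mem_compl_iff, Set.mem_singleton_iff]
  exact and_congr_right fun _ => ⟨fun h y hy hyx => h (hyx ▸ hy), fun h hx => h x hx rfl⟩

variable {Ω : Type*} {η : Ω → Set (Pt d)}

/-- The process in a cube, restricted to a set of birth times. -/
def conf (η : Ω → Set (Pt d)) (W : Cube d) (T : Set unitInterval) (ω : Ω) : Conf (Pt d) :=
  Conf.ofSet (η ω ∩ slab W T)

lemma restrict_eq (ω : Ω) (W : Cube d) : restrict (η ω) W.toSet = η ω ∩ slab W Set.univ := by
  ext; simp [restrict, slab]

lemma value_eq (ω : Ω) (W : Cube d) (hfin : (η ω ∩ slab W Set.univ).Finite) :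
    value e η f W ω = f (markedGraph e (conf η W Set.univ ω)) := by
  rw [value, restrict_eq, ← Conf.carrier_ofSet hfin, evalOn_edgeMarking]
  rfl

lemma originCost_eq (z : Ω × Marks) (t : unitInterval) (W : Cube d)
    (hfin : (η z.1 ∩ slab W Set.univ).Finite) :
    originCost e η f t W z =
      rootCost f (markedGraph e ((conf η W Set.univ z.1).add (0, t, z.2))) := by
  have h : insert ((0, t, z.2) : Pt d) (restrict (η z.1) W.toSet) =
      ((conf η W Set.univ z.1).add (0, t, z.2)).carrier := by
    change _ = insert _ (conf η W Set.univ z.1).carrier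
    rw [restrict_eq, conf, Conf.carrier_ofSet hfin]
  rw [originCost, addOneCost, h, evalOn_edgeMarking, evalOn_removeVertex]
  rfl

lemma conf_part (ω : Ω) {V W : Cube d} (h : V.toSet ⊆ W.toSet)
    (hfin : (η ω ∩ slab W Set.univ).Finite) :
    (conf η W Set.univ ω).part (slab V Set.univ) = conf η V Set.univ ω := by
  have hsub : slab V Set.univ ⊆ slab W Set.univ := fun s hs => ⟨h hs.1, trivial⟩
  refine Conf.ext_carrier ?_
  change (conf η W Set.univ ω).carrier ∩ _ = _
  rw [conf, conf, Conf.carrier_ofSet hfin,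
    Conf.carrier_ofSet (hfin.subset (Set.inter_subset_inter_right _ hsub)), Set.inter_assoc,
    Set.inter_eq_self_of_subset_right hsub]

lemma add_part {S : Type*} (A : Conf S) {s : S} {R : Set S} (hs : s ∈ R) :
    (A.add s).part R = (A.part R).add s := by
  refine Conf.ext_carrier ?_
  simp only [Conf.part, Conf.add, Set.insert_inter_of_mem hs]

end Deterministic

end MarkedPoisson

namespace MarkedPoisson

attribute [local instance] finiteConfigSigma

/-! ## Laws of the process in a cube -/

section Mask

variable {ι S : Type*} [MeasurableSpace S]

open Classical in
/-- The coordinates that satisfy `p` from the first family, the others from the second one. -/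
def merge (p : ι → Prop) (x y : ι → S) (i : ι) : S := if p i then x i else y i

lemma measurable_merge (p : ι → Prop) :
    Measurable fun z : (ι → S) × (ι → S) => merge p z.1 z.2 := by
  refine measurable_pi_iff.2 fun i => ?_
  by_cases h : p i
  · simp only [merge, h, if_true]; fun_prop
  · simp only [merge, h, if_false]; fun_prop

variable {ρ : ι → Measure S} [∀ i, IsProbabilityMeasure (ρ i)]

lemma map_merge (p : ι → Prop) :
    ((Measure.infinitePi ρ).prod (Measure.infinitePi ρ)).map (fun z => merge p z.1 z.2) =
      Measure.infinitePi ρ := by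
  classical
  refine Measure.eq_infinitePi _ fun s t ht => ?_
  rw [Measure.map_apply (measurable_merge p) (MeasurableSet.pi s.countable_toSet fun j _ => ht j)]
  have hs : (fun z : (ι → S) × (ι → S) => merge p z.1 z.2) ⁻¹' (Set.pi s t) =
      (Set.pi (s.filter p) t) ×ˢ (Set.pi (s.filter fun i => ¬ p i) t) := by
    ext ⟨x, y⟩
    simp only [Set.mem_preimage, Set.mem_pi, Set.mem_prod, Finset.mem_coe, Finset.mem_filter, merge]
    constructor
    · exact fun h => ⟨fun i hi => by simpa [hi.2] using h i hi.1,
        fun i hi => by simpa [hi.2] using h i hi.1⟩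
    · rintro ⟨h1, h2⟩ i hi
      by_cases hp : p i
      · simpa [hp] using h1 i ⟨hi, hp⟩
      · simpa [hp] using h2 i ⟨hi, hp⟩
  rw [hs, Measure.prod_prod, Measure.infinitePi_pi _ fun j _ => ht j,
    Measure.infinitePi_pi _ fun j _ => ht j, Finset.prod_filter_mul_prod_filter_not]

/-- The coordinates that satisfy `p`; the others are replaced by a default value. -/
def mask [Inhabited S] (p : ι → Prop) (x : ι → S) : ι → S := merge p x fun _ => default

variable [Inhabited S]

lemma measurable_mask (p : ι → Prop) : Measurable (mask (S := S) p) :=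
  (measurable_merge p).comp (measurable_id.prodMk measurable_const)

lemma mask_apply {p : ι → Prop} {x : ι → S} {i : ι} (h : p i) : mask p x i = x i := if_pos h

/-- The family is replaced by the merge of two independent copies, which has the same law; the two
masks then depend on different copies. -/
lemma indepFun_mask (p : ι → Prop) :
    IndepFun (mask (S := S) p) (mask fun i => ¬ p i) (Measure.infinitePi ρ) := by
  have h1 : ∀ z : (ι → S) × (ι → S), mask p (merge p z.1 z.2) = mask p z.1 := fun z => by
    ext1 i
    by_cases hi : p i <;> simp [mask, merge, hi]
  have h2 : ∀ z : (ι → S) × (ι → S), mask (fun i => ¬ p i) (merge p z.1 z.2) =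
      mask (fun i => ¬ p i) z.2 := fun z => by
    ext1 i
    by_cases hi : p i <;> simp [mask, merge, hi]
  rw [indepFun_iff_map_prod_eq_prod_map_map (measurable_mask _).aemeasurable
    (measurable_mask _).aemeasurable]
  conv_lhs => rw [← map_merge (ρ := ρ) p]
  rw [Measure.map_map ((measurable_mask _).prodMk (measurable_mask _)) (measurable_merge p),
    Measure.map_prod_map _ _ (measurable_mask _) (measurable_mask _)]
  congr 1
  ext1 z
  exact Prod.ext (h1 z) (h2 z)

lemma indepFun_prod_mask {Y Y₁ Y₂ : Type*} [MeasurableSpace Y] [MeasurableSpace Y₁]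
    [MeasurableSpace Y₂] {μ₀ : Measure Y} [IsProbabilityMeasure μ₀] {f₁ : Y → Y₁} {f₂ : Y → Y₂}
    (hf₁ : Measurable f₁) (hf₂ : Measurable f₂) (h : IndepFun f₁ f₂ μ₀) (p : ι → Prop) :
    IndepFun (fun q : Y × (ι → S) => (f₁ q.1, mask p q.2))
      (fun q => (f₂ q.1, mask (fun i => ¬ p i) q.2)) (μ₀.prod (Measure.infinitePi ρ)) :=
  indepFun_prodMk_prod hf₁ hf₂ (measurable_mask _) (measurable_mask _) h (indepFun_mask p)

lemma points_congr {S : Type*} {x y : ι → S} {I : Finset ι} (h : ∀ i ∈ I, x i = y i) :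
    Conf.points x I = Conf.points y I :=
  Conf.ext_carrier (Set.image_congr h)

end Mask

section Laws

variable {d : ℕ}

instance : Inhabited (Pt d) := ⟨(0, 0, fun _ => 0)⟩

lemma measurable_points_cls (j : Fin 3) :
    Measurable fun q : ℕ × (Vertex → Pt d) => Conf.points q.2 (cls j q.1) :=
  Conf.measurable_points measurable_snd fun i =>
    measurable_fst (MeasurableSet.of_discrete (s := {n | i ∈ cls j n}))

variable {ρ : Vertex → Measure (Pt d)} [∀ i, IsProbabilityMeasure (ρ i)]

lemma points_mask {p : Vertex → Prop} {j : Fin 3} (hp : ∀ i, p (some (j, i))) (x : Vertex → Pt d)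
    (n : ℕ) : Conf.points (mask p x) (cls j n) = Conf.points x (cls j n) :=
  points_congr fun i hi => mask_apply (by
    rcases i with _ | ⟨k, i⟩
    · exact absurd hi none_notMem_cls
    · rw [mem_cls] at hi; rw [hi.1]; exact hp i)

/-- The additional point is independent of the other points. -/
lemma map_root_points (r : ℝ≥0) :
    ((poissonMeasure r).prod (Measure.infinitePi ρ)).map
      (fun q => (q.2 none, Conf.points q.2 (cls 0 q.1))) =
    (ρ none).prod (((poissonMeasure r).prod (Measure.infinitePi ρ)).map
      fun q => Conf.points q.2 (cls 0 q.1)) := by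
  have hi : IndepFun (fun q : ℕ × (Vertex → Pt d) => q.2 none)
      (fun q => Conf.points q.2 (cls 0 q.1)) ((poissonMeasure r).prod (Measure.infinitePi ρ)) := by
    have h := indepFun_prod_mask (ρ := ρ) (μ₀ := poissonMeasure r) (f₁ := fun _ => ())
      (f₂ := id) measurable_const measurable_id (indepFun_const_left () _)
      (fun i : Vertex => i = none)
    have h2 := h.comp (φ := fun y : Unit × (Vertex → Pt d) => y.2 none)
      (ψ := fun y : ℕ × (Vertex → Pt d) => Conf.points y.2 (cls 0 y.1)) (by fun_prop)
      (measurable_points_cls 0)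
    refine h2.congr (ae_of_all _ fun q => ?_) (ae_of_all _ fun q => ?_)
    · exact mask_apply rfl
    · exact points_mask (fun i => by simp) _ _
  rw [hi.map_prod_eq_prod_map_map (by fun_prop) (measurable_points_cls 0).aemeasurable]
  congr 1
  have : (fun q : ℕ × (Vertex → Pt d) => q.2 none) = (fun x => x none) ∘ Prod.snd := rfl
  rw [this, ← Measure.map_map (by fun_prop) measurable_snd, Measure.map_snd_prod, measure_univ,
    one_smul, Measure.infinitePi_map_eval]

/-- The points of the resampling are independent. -/
lemma map_mix_points (m : ℝ≥0) (t : unitInterval) :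
    ((mixLaw m t).prod (Measure.infinitePi ρ)).map
      (fun q => ((q.2 none, Conf.points q.2 (cls 0 q.1.1)),
        (Conf.points q.2 (cls 1 q.1.2.1), Conf.points q.2 (cls 2 q.1.2.2)))) =
    ((ρ none).prod (((poissonMeasure (m * unitInterval.toNNReal t)).prod
        (Measure.infinitePi ρ)).map fun q => Conf.points q.2 (cls 0 q.1))).prod
      ((((poissonMeasure (m * unitInterval.toNNReal (unitInterval.symm t))).prod
        (Measure.infinitePi ρ)).map fun q => Conf.points q.2 (cls 1 q.1)).prod
      (((poissonMeasure (m * unitInterval.toNNReal (unitInterval.symm t))).prod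
        (Measure.infinitePi ρ)).map fun q => Conf.points q.2 (cls 2 q.1))) := by
  set π := Measure.infinitePi ρ
  set A := poissonMeasure (m * unitInterval.toNNReal t)
  set B := poissonMeasure (m * unitInterval.toNNReal (unitInterval.symm t))
  have hmA : Measurable fun q : (ℕ × ℕ × ℕ) × (Vertex → Pt d) =>
      (q.2 none, Conf.points q.2 (cls 0 q.1.1)) :=
    Measurable.prodMk (by fun_prop) ((measurable_points_cls 0).comp
      (f := fun q : (ℕ × ℕ × ℕ) × (Vertex → Pt d) => (q.1.1, q.2)) (by fun_prop))
  have hm1 : Measurable fun q : (ℕ × ℕ) × (Vertex → Pt d) => Conf.points q.2 (cls 1 q.1.1) :=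
    (measurable_points_cls 1).comp
      (f := fun q : (ℕ × ℕ) × (Vertex → Pt d) => (q.1.1, q.2)) (by fun_prop)
  have hm2 : Measurable fun q : (ℕ × ℕ) × (Vertex → Pt d) => Conf.points q.2 (cls 2 q.1.2) :=
    (measurable_points_cls 2).comp
      (f := fun q : (ℕ × ℕ) × (Vertex → Pt d) => (q.1.2, q.2)) (by fun_prop)
  have hmap : ∀ {Y Y' : Type} [MeasurableSpace Y] [MeasurableSpace Y'] {μ : Measure Y}
      {μ' : Measure Y'} [IsProbabilityMeasure μ] [IsProbabilityMeasure μ'] {g : Y → Y'},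
      Measurable g → μ.map g = μ' →
      (μ.prod π).map (fun q => (g q.1, q.2)) = μ'.prod π := by
    intro Y Y' _ _ μ μ' _ _ g hg h
    have h3 := Measure.map_prod_map μ π hg measurable_id
    rw [Measure.map_id, h] at h3
    exact h3.symm
  have hi : IndepFun (fun q : (ℕ × ℕ × ℕ) × (Vertex → Pt d) =>
      (q.2 none, Conf.points q.2 (cls 0 q.1.1))) (fun q => (Conf.points q.2 (cls 1 q.1.2.1),
        Conf.points q.2 (cls 2 q.1.2.2))) ((mixLaw m t).prod π) := by
    -- The vertices are split into the root with sequence `0` on one side and sequences `1` and `2`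
    -- on the other; these last two are separated by the same device below.
    have h := indepFun_prod_mask (ρ := ρ) (μ₀ := mixLaw m t) (f₁ := Prod.fst)
      (f₂ := Prod.snd) measurable_fst measurable_snd (indepFun_prod measurable_id measurable_id)
      (fun i : Vertex => ∀ j ∈ i, j.1 = 0)
    have h2 := h.comp (φ := fun y : ℕ × (Vertex → Pt d) => (y.2 none, Conf.points y.2 (cls 0 y.1)))
      (ψ := fun y : (ℕ × ℕ) × (Vertex → Pt d) => (Conf.points y.2 (cls 1 y.1.1),
        Conf.points y.2 (cls 2 y.1.2))) (Measurable.prodMk (by fun_prop) (measurable_points_cls 0))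
      (hm1.prodMk hm2)
    refine h2.congr (ae_of_all _ fun q => ?_) (ae_of_all _ fun q => ?_)
    · exact Prod.ext (mask_apply (p := fun i : Vertex => ∀ j ∈ i, j.1 = 0) (i := none) (by simp))
        (points_mask (fun i => by simp) _ _)
    · exact Prod.ext (points_mask (fun i => by simp) _ _) (points_mask (fun i => by simp) _ _)
  have hi2 : IndepFun (fun q : (ℕ × ℕ) × (Vertex → Pt d) => Conf.points q.2 (cls 1 q.1.1))
      (fun q => Conf.points q.2 (cls 2 q.1.2)) ((B.prod B).prod π) := by
    have h := indepFun_prod_mask (ρ := ρ) (μ₀ := B.prod B) (f₁ := Prod.fst)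
      (f₂ := Prod.snd) measurable_fst measurable_snd (indepFun_prod measurable_id measurable_id)
      (fun i : Vertex => ∃ j ∈ i, j.1 = 1)
    have h2 := h.comp (measurable_points_cls 1) (measurable_points_cls 2)
    refine h2.congr (ae_of_all _ fun q => ?_) (ae_of_all _ fun q => ?_)
    · exact points_mask (fun i => by simp) _ _
    · exact points_mask (fun i => by simp) _ _
  have hmB : Measurable fun q : (ℕ × ℕ × ℕ) × (Vertex → Pt d) =>
      (Conf.points q.2 (cls 1 q.1.2.1), Conf.points q.2 (cls 2 q.1.2.2)) :=
    (hm1.prodMk hm2).comp (f := fun q : (ℕ × ℕ × ℕ) × (Vertex → Pt d) => (q.1.2, q.2))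
      (by fun_prop)
  rw [hi.map_prod_eq_prod_map_map hmA.aemeasurable hmB.aemeasurable]
  congr 1
  · rw [← map_root_points, ← hmap (μ := mixLaw m t) (g := Prod.fst) measurable_fst
      (by rw [mixLaw, Measure.map_fst_prod, measure_univ, one_smul]), Measure.map_map
      (Measurable.prodMk (by fun_prop) (measurable_points_cls 0)) (by fun_prop)]
    rfl
  · have e1 := hmap (μ := mixLaw m t) (μ' := B.prod B) (g := Prod.snd) measurable_snd
      (by rw [mixLaw, Measure.map_snd_prod, measure_univ, one_smul])
    have e2 := hmap (μ := B.prod B) (μ' := B) (g := Prod.fst) measurable_fst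
      (by rw [Measure.map_fst_prod, measure_univ, one_smul])
    have e3 := hmap (μ := B.prod B) (μ' := B) (g := Prod.snd) measurable_snd
      (by rw [Measure.map_snd_prod, measure_univ, one_smul])
    conv_rhs => arg 1; rw [← e2, Measure.map_map (measurable_points_cls 1) (by fun_prop)]
    conv_rhs => arg 2; rw [← e3, Measure.map_map (measurable_points_cls 2) (by fun_prop)]
    refine Eq.trans ?_ (hi2.map_prod_eq_prod_map_map hm1.aemeasurable hm2.aemeasurable)
    rw [← e1]
    exact (Measure.map_map (f := fun q : (ℕ × ℕ × ℕ) × (Vertex → Pt d) => (q.1.2, q.2))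
      (hm1.prodMk hm2) (by fun_prop)).symm

end Laws

end MarkedPoisson

/-! ### Laws of the process in a cube with an added point -/

namespace MarkedPoisson

attribute [local instance] finiteConfigSigma

section RootedLaws

variable {d : ℕ} [NeZero d]

lemma ae_injective_rooted (z : Loc d) (W : Cube d) :
    ∀ᵐ x ∂(Measure.infinitePi (rootedFamily (Measure.dirac z) (cubeLaw W))),
      Function.Injective x := by
  refine ae_injective_infinitePi fun i j hij => ?_
  rcases i with _ | i
  · rcases j with _ | j
    · exact absurd rfl hij
    · exact Or.inr (inferInstanceAs (NullSingletonClass (cubeLaw W)))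
  · exact Or.inl (inferInstanceAs (NullSingletonClass (cubeLaw W)))

lemma ae_injective_cubeLaw (W : Cube d) :
    ∀ᵐ x ∂(Measure.infinitePi fun _ : Vertex => cubeLaw W), Function.Injective x :=
  ae_injective_infinitePi fun _ _ _ => Or.inl inferInstance

lemma ae_infinitePi_apply {ι X : Type*} [MeasurableSpace X] {ρ : ι → Measure X}
    [∀ i, IsProbabilityMeasure (ρ i)] (i : ι) {p : X → Prop} (h : ∀ᵐ x ∂(ρ i), p x) :
    ∀ᵐ x ∂(Measure.infinitePi ρ), p (x i) :=
  (measurePreserving_eval_infinitePi ρ i).quasiMeasurePreserving.ae h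

lemma ae_rooted_none (z : Loc d) (W : Cube d) :
    ∀ᵐ x ∂(Measure.infinitePi (rootedFamily (Measure.dirac z) (cubeLaw W))), x none = z :=
  ae_infinitePi_apply none (p := fun x => x = z) (by
    change ∀ᵐ x ∂(Measure.dirac z), x = z
    rw [ae_dirac_eq]; rfl)

lemma ae_rooted_mem {z : Loc d} {W : Cube d} (hz : z ∈ W.toSet) :
    ∀ᵐ x ∂(Measure.infinitePi (rootedFamily (Measure.dirac z) (cubeLaw W))), ∀ i, x i ∈ W.toSet := by
  rw [ae_all_iff]
  intro i
  rcases i with _ | i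
  · filter_upwards [ae_rooted_none z W] with x hx
    rwa [hx]
  · exact ae_infinitePi_apply (some i) (p := fun x => x ∈ W.toSet) (ae_mem_cubeLaw W)

/-- The birth times where the additional vertex is born at time `t`. -/
def rootTimes (t : unitInterval) (i : Vertex) : Measure unitInterval :=
  i.elim (Measure.dirac t) fun _ => volume

instance (t : unitInterval) (i : Vertex) : IsProbabilityMeasure (rootTimes t i) := by
  cases i <;> (simp only [rootTimes, Option.elim]; infer_instance)

lemma ae_injective_times {τ : Vertex → Measure unitInterval} [∀ i, IsProbabilityMeasure (τ i)]
    (h : ∀ i, NullSingletonClass (τ (some i))) :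
    ∀ᵐ x ∂(Measure.infinitePi τ), Function.Injective x := by
  refine ae_injective_infinitePi fun i j hij => ?_
  rcases i with _ | i
  · rcases j with _ | j
    · exact absurd rfl hij
    · exact Or.inr (h j)
  · exact Or.inl (h i)

variable {L : Vertex → Measure (Loc d)} {τ : Vertex → Measure unitInterval}
  [∀ i, IsProbabilityMeasure (L i)] [∀ i, IsProbabilityMeasure (τ i)]

lemma ae_generic_points (hL : ∀ᵐ x ∂(Measure.infinitePi L), Function.Injective x)
    (hτ : ∀ᵐ x ∂(Measure.infinitePi τ), Function.Injective x) :
    ∀ᵐ s ∂(Measure.infinitePi (pointLaw L τ)), ∀ I, Generic (Conf.points s I) := by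
  have h1 : (Measure.infinitePi (pointLaw L τ)).map (fun s i => (s i).1) =
      Measure.infinitePi L := by
    rw [Measure.infinitePi_map_pi _ (f := fun _ (s : Pt d) => s.1) fun _ => measurable_fst]
    congr 1
    ext1 i
    rw [pointLaw, Measure.map_fst_prod, measure_univ, one_smul]
  have h2 : (Measure.infinitePi (pointLaw L τ)).map (fun s i => (s i).2.1) =
      Measure.infinitePi τ := by
    rw [Measure.infinitePi_map_pi _ (f := fun _ (s : Pt d) => s.2.1) fun _ => measurable_snd.fst]
    congr 1
    ext1 i
    have : (fun s : Pt d => s.2.1) = Prod.fst ∘ Prod.snd := rfl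
    rw [this, ← Measure.map_map measurable_fst measurable_snd, pointLaw, Measure.map_snd_prod,
      measure_univ, one_smul, Measure.map_fst_prod, measure_univ, one_smul]
  rw [← h1] at hL
  rw [← h2] at hτ
  filter_upwards [ae_of_ae_map (Measurable.aemeasurable (by fun_prop)) hL,
    ae_of_ae_map (Measurable.aemeasurable (by fun_prop)) hτ] with s hs1 hs2 I
  exact generic_points (x := fun i => (s i).1) (t := fun i => (s i).2.1)
    (M := fun i => (s i).2.2) hs1.injOn hs2.injOn

lemma measurable_part {S : Type*} [MeasurableSpace S] {R : Set S} (hR : MeasurableSet R) :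
    Measurable fun A : Conf S => A.part R := by
  refine Conf.measurable_of_void fun B hB => ?_
  have : {A : Conf S | (A.part R).carrier ∩ B = ∅} = Conf.void (R ∩ B) := by
    ext A
    simp [Conf.void, Conf.part, Set.inter_assoc]
  rw [this]
  exact Conf.measurableSet_void (hR.inter hB)

open Classical in
lemma points_part {S κ : Type*} (x : κ → S) (I : Finset κ) (R : Set S) :
    (Conf.points x I).part R = Conf.points x (I.filter fun i => x i ∈ R) := by
  refine Conf.ext_carrier ?_
  ext s
  simp only [Conf.part, Conf.points, Set.mem_inter_iff, Set.mem_image, Finset.mem_coe,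
    Finset.mem_filter]
  constructor
  · rintro ⟨⟨i, hi, rfl⟩, h⟩
    exact ⟨i, ⟨hi, h⟩, rfl⟩
  · rintro ⟨i, ⟨hi, h⟩, rfl⟩
    exact ⟨⟨i, hi, rfl⟩, h⟩

lemma points_insert {S κ : Type*} [DecidableEq κ] (x : κ → S) (i : κ) (I : Finset κ) :
    Conf.points x (insert i I) = (Conf.points x I).add (x i) := by
  refine Conf.ext_carrier ?_
  simp only [Conf.points, Conf.add, Finset.coe_insert, Set.image_insert_eq]

lemma points_union {S κ : Type*} [DecidableEq κ] (x : κ → S) (I J : Finset κ) :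
    Conf.points x (I ∪ J) = Conf.points x I ∪ Conf.points x J := by
  refine Conf.ext_carrier ?_
  simp only [Conf.points, Conf.carrier_union, Finset.coe_union, Set.image_union]

end RootedLaws

section ProcessLaws

variable {d : ℕ} [NeZero d] (e : ℕ ≃ (Fin d → ℤ)) {Ω : Type*} [MeasurableSpace Ω] {P : Measure Ω}
  [IsProbabilityMeasure P] {lam : ℝ≥0} {η : Ω → Set (Pt d)}

lemma IsPoissonProcess.finite_slab (hη : IsPoissonProcess (intensity d lam) P η) (W : Cube d)
    (T : Set unitInterval) (ω : Ω) : (η ω ∩ slab W T).Finite := by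
  obtain ⟨K, hK, hsub⟩ := exists_compact_slab W T
  exact hη.finite_inter hK hsub ω

lemma IsPoissonProcess.measurable_conf_slab (hη : IsPoissonProcess (intensity d lam) P η)
    (W : Cube d) {T : Set unitInterval} (hT : MeasurableSet T) : Measurable (conf η W T) := by
  obtain ⟨K, hK, hsub⟩ := exists_compact_slab W T
  exact hη.measurable_conf hK hsub (measurableSet_slab W hT)

lemma IsPoissonProcess.map_conf_slab (hη : IsPoissonProcess (intensity d lam) P η)
    (W : Cube d) {T : Set unitInterval} (hTm : MeasurableSet T) (hT : volume T ≠ 0)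
    {ρ : Vertex → Measure (Pt d)} [∀ i, IsProbabilityMeasure (ρ i)] (j : Fin 3)
    (hρ : ∀ i, ρ (some (j, i)) =
      (cubeLaw W).prod ((ProbabilityTheory.cond volume T).prod markLaw)) :
    P.map (conf η W T) = ((poissonMeasure (mass lam W * (volume T).toNNReal)).prod
      (Measure.infinitePi ρ)).map fun q => Conf.points q.2 (cls j q.1) := by
  obtain ⟨K, hK, hsub⟩ := exists_compact_slab W T
  have : IsProbabilityMeasure (ProbabilityTheory.cond (volume : Measure unitInterval) T) :=
    cond_isProbabilityMeasure_of_finite hT (measure_ne_top _ _)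
  refine hη.map_conf hK hsub (measurableSet_slab W hTm) (card_cls j) (fun n i hi => ?_)
    (intensity_restrict_slab lam W T hT)
  rcases i with _ | ⟨k, i⟩
  · exact absurd hi none_notMem_cls
  · rw [mem_cls] at hi
    rw [hi.1, hρ i]

lemma IsPoissonProcess.map_conf_univ (hη : IsPoissonProcess (intensity d lam) P η)
    (W : Cube d) {ρ : Vertex → Measure (Pt d)} [∀ i, IsProbabilityMeasure (ρ i)]
    (hρ : ∀ i, ρ (some (0, i)) = (cubeLaw W).prod (volume.prod markLaw)) :
    P.map (conf η W Set.univ) = ((poissonMeasure (mass lam W)).prod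
      (Measure.infinitePi ρ)).map fun q => Conf.points q.2 (cls 0 q.1) := by
  have h := hη.map_conf_slab W MeasurableSet.univ (by simp) (ρ := ρ) 0
    (by simpa only [cond_univ] using hρ)
  simpa using h

/-- The process in a cube with a point added at the origin. -/
def rootConf (η : Ω → Set (Pt d)) (W : Cube d) (t : unitInterval) (z : Ω × Marks) : Conf (Pt d) :=
  (conf η W Set.univ z.1).add (0, t, z.2)

lemma IsPoissonProcess.measurable_rootConf (hη : IsPoissonProcess (intensity d lam) P η)
    (W : Cube d) (t : unitInterval) : Measurable (rootConf η W t) :=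
  Conf.measurable_add.comp (Measurable.prodMk (by fun_prop)
    ((hη.measurable_conf_slab W MeasurableSet.univ).comp measurable_fst))

lemma map_rootMark (t : unitInterval) :
    markLaw.map (fun M => ((0, t, M) : Pt d)) =
      (Measure.dirac 0).prod ((Measure.dirac t).prod markLaw) := by
  rw [Measure.dirac_prod, Measure.dirac_prod, Measure.map_map (by fun_prop) (by fun_prop)]
  rfl

lemma IsPoissonProcess.map_rootConf (hη : IsPoissonProcess (intensity d lam) P η)
    (W : Cube d) (t : unitInterval) :
    (P.prod markLaw).map (rootConf η W t) = ((poissonMeasure (mass lam W)).prod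
      (Measure.infinitePi (pointLaw (rootedFamily (Measure.dirac 0) (cubeLaw W))
        (rootTimes t)))).map fun q => Conf.points q.2 (insert none (cls 0 q.1)) := by
  set ρ := pointLaw (rootedFamily (Measure.dirac (0 : Loc d)) (cubeLaw W)) (rootTimes t)
  have h1 := map_root_points (ρ := ρ) (mass lam W)
  rw [← hη.map_conf_univ W (ρ := ρ) (fun i => rfl),
    show ρ none = markLaw.map (fun M => ((0, t, M) : Pt d)) from (map_rootMark t).symm,
    Measure.map_prod_map _ _ (by fun_prop) (hη.measurable_conf_slab W MeasurableSet.univ)] at h1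
  have h2 := congrArg (fun ν => ν.map fun p : Pt d × Conf (Pt d) => p.2.add p.1) h1
  have hadd : Measurable fun p : Pt d × Conf (Pt d) => p.2.add p.1 := Conf.measurable_add
  have hm : Measurable fun q : ℕ × (Vertex → Pt d) => (q.2 none, Conf.points q.2 (cls 0 q.1)) :=
    Measurable.prodMk (by fun_prop) (measurable_points_cls 0)
  rw [Measure.map_map hadd hm, Measure.map_map hadd (Measurable.prodMap (by fun_prop)
    (hη.measurable_conf_slab W MeasurableSet.univ)), ← Measure.prod_swap (μ := P), Measure.map_map
    (hadd.comp (Measurable.prodMap (by fun_prop)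
    (hη.measurable_conf_slab W MeasurableSet.univ))) measurable_swap] at h2
  refine Eq.trans ?_ (h2.symm.trans ?_)
  · rfl
  · congr 1
    ext1 q
    exact (points_insert q.2 none (cls 0 q.1)).symm

lemma IsPoissonProcess.ae_generic_rootConf (e : ℕ ≃ (Fin d → ℤ))
    (hη : IsPoissonProcess (intensity d lam) P η)
    (W : Cube d) (t : unitInterval) :
    ∀ᵐ z ∂(P.prod markLaw), Generic (rootConf η W t z) := by
  have h := ae_generic_points (ae_injective_rooted 0 W)
    (ae_injective_times (τ := rootTimes t) fun i =>
      inferInstanceAs (NullSingletonClass (volume : Measure unitInterval)))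
  have h2 : ∀ᵐ q ∂((poissonMeasure (mass lam W)).prod
      (Measure.infinitePi (pointLaw (rootedFamily (Measure.dirac (0 : Loc d)) (cubeLaw W))
        (rootTimes t)))), Generic (Conf.points q.2 (insert none (cls 0 q.1))) := by
    filter_upwards [Measure.quasiMeasurePreserving_snd.ae h] with q hq using hq _
  have hm : Measurable fun q : ℕ × (Vertex → Pt d) => Conf.points q.2 (insert none (cls 0 q.1)) :=
    Conf.measurable_points measurable_snd fun i =>
      measurable_fst (MeasurableSet.of_discrete (s := {n | i ∈ insert none (cls 0 n)}))
  have h3 : ∀ᵐ A ∂((P.prod markLaw).map (rootConf η W t)), Generic A := by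
    rw [hη.map_rootConf, ae_map_iff hm.aemeasurable (measurableSet_generic e)]
    exact h2
  exact ae_of_ae_map (hη.measurable_rootConf W t).aemeasurable h3

/-- Genericity passes to subsets, so it is inherited from the configuration with an added point;
Fubini then drops the extra marks. -/
lemma IsPoissonProcess.ae_generic_conf (e : ℕ ≃ (Fin d → ℤ))
    (hη : IsPoissonProcess (intensity d lam) P η)
    (W : Cube d) : ∀ᵐ ω ∂P, Generic (conf η W Set.univ ω) := by
  have h := hη.ae_generic_rootConf e W 0
  have h2 : ∀ᵐ z ∂(P.prod markLaw), Generic (conf η W Set.univ z.1) := by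
    filter_upwards [h] with z hz
    exact ⟨hz.1.mono (Set.subset_insert _ _), hz.2.mono (Set.subset_insert _ _)⟩
  filter_upwards [Measure.ae_ae_of_ae_prod h2] with ω hω
  exact hω.exists.choose_spec

lemma IsPoissonProcess.rootConf_part (hη : IsPoissonProcess (intensity d lam) P η)
    {V W : Cube d} (hVW : V.toSet ⊆ W.toSet) (h0 : (0 : Loc d) ∈ V.toSet) (t : unitInterval)
    (z : Ω × Marks) : (rootConf η W t z).part (slab V Set.univ) = rootConf η V t z := by
  rw [rootConf, add_part _ (show ((0, t, z.2) : Pt d) ∈ slab V Set.univ from ⟨h0, trivial⟩),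
    conf_part _ hVW (hη.finite_slab W _ _)]
  rfl

open Classical in
/-- The graph of the process in a smaller cube with a point added at the origin. -/
lemma IsPoissonProcess.map_rootGraph (hη : IsPoissonProcess (intensity d lam) P η)
    {V W : Cube d} (hVW : V.toSet ⊆ W.toSet) (h0 : (0 : Loc d) ∈ V.toSet) (t : unitInterval) :
    (P.prod markLaw).map (fun z => genericGraph e (rootConf η V t z)) =
      ((poissonMeasure (mass lam W)).prod
        (graphLaw (rootedFamily (Measure.dirac 0) (cubeLaw W)))).map
        fun q => restrictTo V.toSet (randomGraph (insert none (cls 0 q.1)) q.2) := by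
  set L := rootedFamily (Measure.dirac (0 : Loc d)) (cubeLaw W)
  -- The process in `V` is represented inside the uniform points of `W` by keeping the labels whose
  -- locations fall into `V`. Both cubes thereby live on the same probability space.
  let I : ℕ → (Vertex → Loc d) → Finset Vertex := fun n x =>
    (insert none (cls 0 n)).filter fun i => x i ∈ V.toSet
  have hI : ∀ i, MeasurableSet {q : ℕ × (Vertex → Loc d) | i ∈ I q.1 q.2} := fun i => by
    have : {q : ℕ × (Vertex → Loc d) | i ∈ I q.1 q.2} =
        Prod.fst ⁻¹' {n | i ∈ insert none (cls 0 n)} ∩ (fun q : ℕ × (Vertex → Loc d) => q.2 i) ⁻¹' V.toSet := by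
      ext q; simp [I]
    rw [this]
    exact (measurable_fst MeasurableSet.of_discrete).inter
      (V.measurableSet.preimage (by fun_prop))
  have hloc := ae_injective_rooted (0 : Loc d) W
  have htim := ae_injective_times (τ := rootTimes t) fun i =>
    inferInstanceAs (NullSingletonClass (volume : Measure unitInterval))
  -- With equal configurations, nestedness only asks for distinct locations and birth times. The
  -- root may be born at any time `t`, and `t` disappears from the resulting law.
  have key := map_points_pair e (μ₀ := poissonMeasure (mass lam W)) (L := L) (τ := rootTimes t)
    (I₁ := I) (I₂ := I) hI hI (by
      filter_upwards [Measure.quasiMeasurePreserving_fst.ae hloc,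
        Measure.quasiMeasurePreserving_snd.ae htim] with z h1 h2 y
      exact Nested.refl h1.injOn h2.injOn)
  have key2 := congrArg (Measure.map Prod.fst) key
  have hm1 : Measurable fun q : ℕ × (Vertex → Pt d) =>
      genericGraph e (Conf.points q.2 (I q.1 fun i => (q.2 i).1)) :=
    (measurable_genericGraph e).comp (measurable_points_locs hI)
  have hm2 := measurable_randomGraph_random hI
  rw [Measure.map_map measurable_fst (hm1.prodMk hm1),
    Measure.map_map measurable_fst (hm2.prodMk hm2)] at key2
  have hm3 : Measurable fun q : ℕ × (Vertex → Pt d) => Conf.points q.2 (insert none (cls 0 q.1)) :=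
    Conf.measurable_points measurable_snd fun i =>
      measurable_fst (MeasurableSet.of_discrete (s := {n | i ∈ insert none (cls 0 n)}))
  have hm4 : Measurable fun A : Conf (Pt d) => genericGraph e (A.part (slab V Set.univ)) :=
    (measurable_genericGraph e).comp (measurable_part (measurableSet_slab V MeasurableSet.univ))
  have hleft : (P.prod markLaw).map (fun z => genericGraph e (rootConf η V t z)) =
      ((poissonMeasure (mass lam W)).prod (Measure.infinitePi (pointLaw L (rootTimes t)))).map
        fun q => genericGraph e (Conf.points q.2 (I q.1 fun i => (q.2 i).1)) := by
    have h3 := congrArg (Measure.map fun A : Conf (Pt d) =>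
      genericGraph e (A.part (slab V Set.univ))) (hη.map_rootConf W t)
    rw [Measure.map_map hm4 (hη.measurable_rootConf W t), Measure.map_map hm4 hm3] at h3
    refine Eq.trans ?_ (h3.trans ?_)
    · congr 1
      ext1 z
      simp only [Function.comp_apply, hη.rootConf_part hVW h0]
    · congr 1
      ext1 q
      simp only [Function.comp_apply, points_part]
      congr 2
      ext i
      simp [I, slab]
  rw [hleft]
  refine key2.trans (Measure.map_congr ?_)
  have hinj : ∀ᵐ q ∂((poissonMeasure (mass lam W)).prod (graphLaw L)),
      Function.Injective q.2.1 :=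
    Measure.quasiMeasurePreserving_snd.ae (Measure.quasiMeasurePreserving_fst.ae hloc)
  filter_upwards [hinj] with q hq
  exact (restrictTo_randomGraph hq.injOn).symm

lemma restrictTo_randomGraph_of_mem {V : Set (Loc d)} {I : Finset Vertex} {θ : Field d}
    (hθ : Function.Injective θ.1) (h : ∀ i, θ.1 i ∈ V) :
    restrictTo V (randomGraph I θ) = randomGraph I θ := by
  classical
  rw [restrictTo_randomGraph hθ.injOn, Finset.filter_true_of_mem fun i _ => h i]

lemma IsPoissonProcess.map_rootGraph_self (hη : IsPoissonProcess (intensity d lam) P η)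
    {W : Cube d} (h0 : (0 : Loc d) ∈ W.toSet) (t : unitInterval) :
    (P.prod markLaw).map (fun z => genericGraph e (rootConf η W t z)) =
      ((poissonMeasure (mass lam W)).prod
        (graphLaw (rootedFamily (Measure.dirac 0) (cubeLaw W)))).map
        fun q => randomGraph (insert none (cls 0 q.1)) q.2 := by
  rw [hη.map_rootGraph e subset_rfl h0]
  refine Measure.map_congr ?_
  filter_upwards [Measure.quasiMeasurePreserving_snd.ae
    (Measure.quasiMeasurePreserving_fst.ae (ae_injective_rooted 0 W)),
    Measure.quasiMeasurePreserving_snd.ae (Measure.quasiMeasurePreserving_fst.ae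
      (ae_rooted_mem h0))] with q h1 h2
  exact restrictTo_randomGraph_of_mem h1 h2

/-- The graph of the process in a cube. -/
lemma IsPoissonProcess.map_valueGraph (hη : IsPoissonProcess (intensity d lam) P η)
    (W : Cube d) :
    P.map (fun ω => genericGraph e (conf η W Set.univ ω)) =
      ((poissonMeasure (mass lam W)).prod (graphLaw fun _ => cubeLaw W)).map
        fun q => randomGraph (cls 0 q.1) q.2 := by
  have hI : ∀ i, MeasurableSet {q : ℕ × (Vertex → Loc d) | i ∈ cls 0 q.1} := fun i =>
    measurable_fst (MeasurableSet.of_discrete (s := {n | i ∈ cls 0 n}))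
  have hloc := ae_injective_cubeLaw W
  have htim := ae_injective_times (τ := fun _ => volume) fun i => inferInstance
  have key := map_points_pair e (μ₀ := poissonMeasure (mass lam W)) (L := fun _ => cubeLaw W)
    (τ := fun _ => volume) (I₁ := fun n _ => cls 0 n) (I₂ := fun n _ => cls 0 n) hI hI (by
      filter_upwards [Measure.quasiMeasurePreserving_fst.ae hloc,
        Measure.quasiMeasurePreserving_snd.ae htim] with z h1 h2 y
      exact Nested.refl h1.injOn h2.injOn)
  have key2 := congrArg (Measure.map Prod.fst) key
  have hm1 : Measurable fun q : ℕ × (Vertex → Pt d) => genericGraph e (Conf.points q.2 (cls 0 q.1)) :=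
    (measurable_genericGraph e).comp (measurable_points_cls 0)
  have hm2 : Measurable fun q : ℕ × Field d => randomGraph (cls 0 q.1) q.2 :=
    measurable_randomGraph_random (I := fun n _ => cls 0 n) hI
  rw [Measure.map_map measurable_fst (hm1.prodMk hm1),
    Measure.map_map measurable_fst (hm2.prodMk hm2)] at key2
  have h3 := congrArg (Measure.map (genericGraph e)) (hη.map_conf_univ W
    (ρ := pointLaw (fun _ => cubeLaw W) fun _ => volume) fun i => rfl)
  rw [Measure.map_map (measurable_genericGraph e) (hη.measurable_conf_slab W MeasurableSet.univ),
    Measure.map_map (measurable_genericGraph e) (measurable_points_cls 0)] at h3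
  exact h3.trans key2

end ProcessLaws

end MarkedPoisson

namespace MarkedPoisson

/-! ## Conditioning on the history -/

section Freezing

variable {Ω 𝒰 𝒱 : Type*} {m m0 : MeasurableSpace Ω} [MeasurableSpace 𝒰] [MeasurableSpace 𝒱]
  {μ : Measure[m0] Ω} [IsProbabilityMeasure μ] {U : Ω → 𝒰} {V : Ω → 𝒱} {Ψ : 𝒰 × 𝒱 → ℝ}

/-- The conditional expectation of a function of a measurable and an independent variable. -/
lemma condExp_eq_integral (hm : m ≤ m0) (hU : Measurable[m] U) (hV : Measurable V)
    (h : Indep m (MeasurableSpace.comap V inferInstance) μ) (hΨ : Measurable Ψ)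
    (hint : Integrable (fun z => Ψ (U z, V z)) μ) :
    μ[fun z => Ψ (U z, V z) | m] =ᵐ[μ] fun z => ∫ v, Ψ (U z, v) ∂(μ.map V) := by
  have hUm : Measurable[m0] U := hU.mono hm le_rfl
  have : IsProbabilityMeasure (μ.map V) := Measure.isProbabilityMeasure_map hV.aemeasurable
  have : IsProbabilityMeasure (μ.map U) := Measure.isProbabilityMeasure_map hUm.aemeasurable
  have hind : ∀ {𝒴 : Type _} [MeasurableSpace 𝒴] {Y : Ω → 𝒴}, Measurable[m] Y →
      μ.map (fun z => (Y z, V z)) = (μ.map Y).prod (μ.map V) := fun {𝒴 _ Y} hY =>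
    (show IndepFun Y V μ from indep_of_indep_of_le_left h hY.comap_le).map_prod_eq_prod_map_map
      (hY.mono hm le_rfl).aemeasurable hV.aemeasurable
  have hint2 : Integrable Ψ ((μ.map U).prod (μ.map V)) := by
    rw [← hind hU, integrable_map_measure hΨ.aestronglyMeasurable (hUm.prodMk hV).aemeasurable]
    exact hint
  have hΦ : StronglyMeasurable fun u => ∫ v, Ψ (u, v) ∂(μ.map V) :=
    hΨ.stronglyMeasurable.integral_prod_right'
  have hΦint : Integrable (fun z => ∫ v, Ψ (U z, v) ∂(μ.map V)) μ :=
    (integrable_map_measure hΦ.aestronglyMeasurable hUm.aemeasurable).1 hint2.integral_prod_left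
  refine (ae_eq_condExp_of_forall_setIntegral_eq hm hint (fun s _ _ => hΦint.integrableOn)
    (fun s hs _ => ?_) (hΦ.comp_measurable hU).aestronglyMeasurable).symm
  -- The indicator of the conditioning event `s` travels as an extra coordinate next to `U`, so that
  -- independence of `V` from `m` factorizes the integral over `s`.
  set Y : Ω → ℝ × 𝒰 := fun z => (s.indicator (fun _ => 1) z, U z)
  have hYm : Measurable[m] Y := (measurable_const.indicator hs).prodMk hU
  have hY0 : Measurable[m0] Y := hYm.mono hm le_rfl
  have : IsProbabilityMeasure (μ.map Y) := Measure.isProbabilityMeasure_map hY0.aemeasurable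
  have hG : Measurable fun q : (ℝ × 𝒰) × 𝒱 => q.1.1 * Ψ (q.1.2, q.2) := by fun_prop
  have hs0 := hm s hs
  have e1 : ∫ z in s, Ψ (U z, V z) ∂μ =
      ∫ q, q.1.1 * Ψ (q.1.2, q.2) ∂((μ.map Y).prod (μ.map V)) := by
    rw [← hind hYm, integral_map (hY0.prodMk hV).aemeasurable hG.aestronglyMeasurable,
      ← integral_indicator hs0]
    refine integral_congr_ae (ae_of_all _ fun z => ?_)
    by_cases hz : z ∈ s <;> simp [Y, hz]
  have hGint : Integrable (fun q : (ℝ × 𝒰) × 𝒱 => q.1.1 * Ψ (q.1.2, q.2))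
      ((μ.map Y).prod (μ.map V)) := by
    rw [← hind hYm, integrable_map_measure hG.aestronglyMeasurable (hY0.prodMk hV).aemeasurable]
    refine hint.mono (hG.comp (hY0.prodMk hV)).aestronglyMeasurable (ae_of_all _ fun z => ?_)
    by_cases hz : z ∈ s <;> simp [Y, hz]
  have hΦ2 : StronglyMeasurable fun y : ℝ × 𝒰 => y.1 * ∫ v, Ψ (y.2, v) ∂(μ.map V) :=
    measurable_fst.stronglyMeasurable.mul (hΦ.comp_measurable measurable_snd)
  rw [e1, integral_prod _ hGint]
  simp only [integral_const_mul]
  rw [integral_map hY0.aemeasurable hΦ2.aestronglyMeasurable, ← integral_indicator hs0]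
  refine integral_congr_ae (ae_of_all _ fun z => ?_)
  by_cases hz : z ∈ s <;> simp [Y, hz]

/-- The second moment of a conditional expectation by resampling the independent variable. -/
lemma integral_condExp_sq (hm : m ≤ m0) (hU : Measurable[m] U) (hV : Measurable V)
    (h : Indep m (MeasurableSpace.comap V inferInstance) μ) (hΨ : Measurable Ψ)
    (hint : MemLp (fun z => Ψ (U z, V z)) 2 μ) :
    ∫ z, (μ[fun z => Ψ (U z, V z) | m]) z ^ 2 ∂μ =
      ∫ q, Ψ (q.1, q.2.1) * Ψ (q.1, q.2.2)
        ∂((μ.map U).prod ((μ.map V).prod (μ.map V))) := by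
  have hUm : Measurable[m0] U := hU.mono hm le_rfl
  have hc := condExp_eq_integral hm hU hV h hΨ (hint.integrable (by norm_num))
  have : IsProbabilityMeasure (μ.map V) := Measure.isProbabilityMeasure_map hV.aemeasurable
  have : IsProbabilityMeasure (μ.map U) := Measure.isProbabilityMeasure_map hUm.aemeasurable
  have hlaw : μ.map (fun z => (U z, V z)) = (μ.map U).prod (μ.map V) :=
    (show IndepFun U V μ from indep_of_indep_of_le_left h hU.comap_le).map_prod_eq_prod_map_map
      hUm.aemeasurable hV.aemeasurable
  have hL : MemLp Ψ 2 ((μ.map U).prod (μ.map V)) := by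
    rw [← hlaw, memLp_map_measure_iff hΨ.aestronglyMeasurable (hUm.prodMk hV).aemeasurable]
    exact hint
  have hL1 : MemLp (fun q : 𝒰 × 𝒱 × 𝒱 => Ψ (q.1, q.2.1)) 2
      ((μ.map U).prod ((μ.map V).prod (μ.map V))) :=
    hL.comp_measurePreserving ((MeasurePreserving.id _).prod measurePreserving_fst)
  have hL2 : MemLp (fun q : 𝒰 × 𝒱 × 𝒱 => Ψ (q.1, q.2.2)) 2
      ((μ.map U).prod ((μ.map V).prod (μ.map V))) :=
    hL.comp_measurePreserving ((MeasurePreserving.id _).prod measurePreserving_snd)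
  have hΦ : StronglyMeasurable fun u => ∫ v, Ψ (u, v) ∂(μ.map V) :=
    hΨ.stronglyMeasurable.integral_prod_right'
  rw [integral_prod (fun q : 𝒰 × 𝒱 × 𝒱 => Ψ (q.1, q.2.1) * Ψ (q.1, q.2.2))
      (hL1.integrable_mul hL2)]
  refine (integral_congr_ae (hc.pow_const 2)).trans ?_
  simp only [Pi.pow_apply]
  -- The square of the integral over `V` is an integral over two independent copies of `V` with the
  -- same `U`: resampling of the future.
  have e : ∀ u, ∫ v : 𝒱 × 𝒱, Ψ (u, v.1) * Ψ (u, v.2) ∂((μ.map V).prod (μ.map V)) =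
      (∫ v, Ψ (u, v) ∂(μ.map V)) ^ 2 := fun u => by
    rw [integral_prod_mul (fun v => Ψ (u, v)) fun v => Ψ (u, v), sq]
  simp only [e]
  exact (integral_map hUm.aemeasurable (hΦ.pow 2).aestronglyMeasurable).symm

end Freezing

/-! ### Independence of past and future -/

section History

variable {d : ℕ} {Ω : Type*} [m0 : MeasurableSpace Ω] {P : Measure Ω} [IsProbabilityMeasure P]
  {μ : Measure (Pt d)} {η : Ω → Set (Pt d)}

/-- The points that are born before `t`. -/
def past (d : ℕ) (t : unitInterval) : Set (Pt d) := {s | s.2.1 < t}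

lemma measurableSet_past (t : unitInterval) : MeasurableSet (past d t) :=
  measurableSet_lt measurable_snd.fst measurable_const

lemma past_inter (t : unitInterval) (B : Set (Pt d)) (ω : Ω) :
    {s | s ∈ η ω ∧ s.2.1 < t} ∩ B = η ω ∩ (past d t ∩ B) := by
  ext s; simp [past, and_assoc]

lemma historySigma_eq (η : Ω → Set (Pt d)) (t : unitInterval) : historySigma η t =
    ⨆ (B : Set (Pt d)) (_ : MeasurableSet B),
      MeasurableSpace.comap (fun ω => (η ω ∩ (past d t ∩ B)).encard) inferInstance := by
  simp only [historySigma, past_inter]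

lemma IsPoissonProcess.historySigma_le (hη : IsPoissonProcess μ P η) (t : unitInterval) :
    historySigma η t ≤ m0 := by
  rw [historySigma_eq]
  exact iSup₂_le fun B hB =>
    (hη.measurable_count _ ((measurableSet_past t).inter hB)).comap_le

lemma measurable_history_count (t : unitInterval) {B : Set (Pt d)} (hB : MeasurableSet B)
    (hBt : B ⊆ past d t) : Measurable[historySigma η t] fun ω => (η ω ∩ B).encard := by
  have h : MeasurableSpace.comap (fun ω => (η ω ∩ B).encard) inferInstance ≤ historySigma η t := by
    rw [historySigma_eq]
    refine le_iSup₂_of_le (f := fun (B : Set (Pt d)) (_ : MeasurableSet B) =>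
      MeasurableSpace.comap (fun ω => (η ω ∩ (past d t ∩ B)).encard) inferInstance) B hB ?_
    rw [Set.inter_eq_self_of_subset_right hBt]
  exact Measurable.mono (comap_measurable _) h le_rfl

/-- The sigma-field generated by the counts of a finite partition of `C`. -/
@[reducible] def partitionSigma (η : Ω → Set (Pt d)) (C : Set (Pt d)) (φ : Σ n : ℕ, Pt d → Fin n) :
    MeasurableSpace Ω :=
  ⨆ j, MeasurableSpace.comap (fun ω => (η ω ∩ (C ∩ φ.2 ⁻¹' {j})).encard) inferInstance

/-- The count of a coarse cell is the sum of the counts of the finer cells that it contains. -/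
lemma partitionSigma_mono (C : Set (Pt d)) {φ ψ : Σ n : ℕ, Pt d → Fin n} (g : Fin ψ.1 → Fin φ.1)
    (h : ∀ s, φ.2 s = g (ψ.2 s)) : partitionSigma η C φ ≤ partitionSigma η C ψ := by
  classical
  refine iSup_le fun j => ?_
  have e : (fun ω => (η ω ∩ (C ∩ φ.2 ⁻¹' {j})).encard) = fun ω =>
      ∑ k with g k = j, (η ω ∩ (C ∩ ψ.2 ⁻¹' {k})).encard := by
    ext1 ω
    have hU : η ω ∩ (C ∩ φ.2 ⁻¹' {j}) =
        ⋃ k ∈ (Finset.univ.filter fun k => g k = j), (η ω ∩ (C ∩ ψ.2 ⁻¹' {k})) := by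
      ext s
      simp [h]
    have hgen : ∀ F : Finset (Fin ψ.1), (⋃ k ∈ F, (η ω ∩ (C ∩ ψ.2 ⁻¹' {k}))).encard =
        ∑ k ∈ F, (η ω ∩ (C ∩ ψ.2 ⁻¹' {k})).encard := fun F => by
      induction F using Finset.induction_on with
      | empty => simp
      | insert k F hk ih =>
        rw [Finset.set_biUnion_insert, Set.encard_union_eq, ih, Finset.sum_insert hk]
        rw [Set.disjoint_left]
        rintro s ⟨-, -, hs⟩ hs2
        simp only [Set.mem_iUnion] at hs2
        obtain ⟨k', hk', -, -, hs3⟩ := hs2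
        have : ψ.2 s = k := hs
        have h4 : ψ.2 s = k' := hs3
        exact hk (this ▸ h4 ▸ hk')
    rw [hU, hgen]
  rw [e]
  refine Measurable.comap_le (Finset.measurable_sum _ fun k _ => ?_)
  exact Measurable.mono (comap_measurable _) (le_iSup (fun k => MeasurableSpace.comap
    (fun ω => (η ω ∩ (C ∩ ψ.2 ⁻¹' {k})).encard) inferInstance) k) le_rfl

/-- The history is generated by counts in possibly overlapping sets, while the Poisson property
speaks of disjoint ones. Finite measurable partitions of the past have common refinements, so the
sigma-fields of their counts form a directed family that generates the history. The cells of one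
partition are disjoint from each other and from `R`. -/
lemma IsPoissonProcess.indep_history (hη : IsPoissonProcess μ P η) (t : unitInterval)
    {R K : Set (Pt d)} (hK : IsCompact K) (hR : R ⊆ K) (hRm : MeasurableSet R)
    (hd : Disjoint (past d t) R) :
    Indep (historySigma η t)
      (MeasurableSpace.comap (fun ω => Conf.ofSet (η ω ∩ R)) inferInstance) P := by
  have hle : ∀ φ : Σ n : ℕ, {φ : Pt d → Fin n // Measurable φ},
      partitionSigma η (past d t) ⟨φ.1, φ.2.1⟩ ≤ m0 := fun φ => iSup_le fun j =>
    (hη.measurable_count _ ((measurableSet_past t).inter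
      (φ.2.2 (measurableSet_singleton j)))).comap_le
  have hcm := hη.measurable_conf hK hR hRm
  have hsup : historySigma η t ≤ ⨆ φ : Σ n : ℕ, {φ : Pt d → Fin n // Measurable φ},
      partitionSigma η (past d t) ⟨φ.1, φ.2.1⟩ := by
    classical
    rw [historySigma_eq]
    refine iSup₂_le fun B hB => ?_
    -- A single set `B` is a cell of the two-cell partition into `B` and its complement.
    refine le_trans ?_ (le_iSup _ (⟨2, fun s => if s ∈ B then 0 else 1,
      Measurable.ite hB measurable_const measurable_const⟩ :
        Σ n : ℕ, {φ : Pt d → Fin n // Measurable φ}))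
    refine le_trans (le_of_eq ?_) (le_iSup _ (0 : Fin 2))
    have : (fun s => if s ∈ B then (0 : Fin 2) else 1) ⁻¹' {0} = B := by
      ext s
      simp
    rw [this]
  refine indep_of_indep_of_le_left (indep_iSup_of_directed_le (fun φ => ?_) hle hcm.comap_le ?_)
    hsup
  · obtain ⟨n, φ, hφ⟩ := φ
    have hgen : MeasurableSpace.comap (fun ω => Conf.ofSet (η ω ∩ R)) inferInstance =
        MeasurableSpace.generateFrom (Set.preimage (fun ω => Conf.ofSet (η ω ∩ R)) ''
          {V | ∃ B, MeasurableSet B ∧ V = Conf.void B}) := MeasurableSpace.comap_generateFrom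
    refine IndepSets.indep (p1 := {s | MeasurableSet[partitionSigma η (past d t) ⟨n, φ⟩] s})
      (hle ⟨n, φ, hφ⟩) hcm.comap_le
      (@MeasurableSpace.isPiSystem_measurableSet _ (partitionSigma η (past d t) ⟨n, φ⟩))
      (Conf.isPiSystem_void.comap _)
      (@MeasurableSpace.generateFrom_measurableSet _ (partitionSigma η (past d t) ⟨n, φ⟩)).symm
      hgen ?_
    rw [IndepSets_iff]
    rintro s _ hs ⟨_, ⟨B, hB, rfl⟩, rfl⟩
    have hpre : (fun ω => Conf.ofSet (η ω ∩ R)) ⁻¹' Conf.void B = {ω | η ω ∩ (R ∩ B) = ∅} := by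
      ext ω
      exact hη.conf_mem_void hK hR B ω
    -- The future event is placed at index `0` and the cells of the past behind it, which gives one
    -- family of disjoint sets.
    let D : Fin (n + 1) → Set (Pt d) := Fin.cons (R ∩ B) fun j => past d t ∩ φ ⁻¹' {j}
    have hD : ∀ i, MeasurableSet (D i) := fun i => by
      refine Fin.cases ?_ (fun j => ?_) i
      · exact hRm.inter hB
      · exact (measurableSet_past t).inter (hφ (measurableSet_singleton j))
    have h0 : ∀ j : Fin n, Disjoint (R ∩ B) (past d t ∩ φ ⁻¹' {j}) := fun j =>
      hd.symm.mono Set.inter_subset_left Set.inter_subset_left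
    have hDd : ∀ i j, i ≠ j → Disjoint (D i) (D j) := by
      intro i j
      refine Fin.cases ?_ (fun i => ?_) i <;> refine Fin.cases ?_ (fun j => ?_) j <;> intro hij
      · exact absurd rfl hij
      · exact h0 j
      · exact (h0 i).symm
      · refine Set.disjoint_left.2 ?_
        rintro s ⟨-, hs1⟩ ⟨-, hs2⟩
        have h1 : φ s = i := hs1
        have h2 : φ s = j := hs2
        exact hij (by rw [← h1, ← h2])
    have hI := hη.indep_count (n + 1) D hD hDd
    rw [iIndepFun_iff_iIndep] at hI
    have hI2 := indep_iSup_of_disjoint (fun i => (hη.measurable_count _ (hD i)).comap_le) hI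
      (S := {0}ᶜ) (T := {0}) disjoint_compl_left
    refine (Indep_iff _ _ _).1 hI2 _ _ ?_ ?_
    · refine (iSup_le fun j => ?_ : partitionSigma η (past d t) ⟨n, φ⟩ ≤ _) _ hs
      exact le_iSup₂_of_le (f := fun (i : Fin (n + 1)) (_ : i ∈ ({0}ᶜ : Set (Fin (n + 1)))) =>
        MeasurableSpace.comap (fun ω => (η ω ∩ D i).encard) inferInstance) j.succ
        (Fin.succ_ne_zero j) le_rfl
    · rw [hpre]
      refine (le_iSup₂_of_le (f := fun (i : Fin (n + 1)) (_ : i ∈ ({0} : Set (Fin (n + 1)))) =>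
        MeasurableSpace.comap (fun ω => (η ω ∩ D i).encard) inferInstance) 0 rfl le_rfl) _ ?_
      refine ⟨{0}, measurableSet_singleton _, ?_⟩
      ext ω
      simp [D]
  · intro φ ψ
    -- The common refinement labels a point by the pair of its two cells, encoded as one number.
    refine ⟨⟨φ.1 * ψ.1, fun s => finProdFinEquiv (φ.2.1 s, ψ.2.1 s),
      (measurable_of_finite _).comp (φ.2.2.prodMk ψ.2.2)⟩, ?_, ?_⟩
    · exact partitionSigma_mono (φ := ⟨φ.1, φ.2.1⟩)
        (ψ := ⟨φ.1 * ψ.1, fun s => finProdFinEquiv (φ.2.1 s, ψ.2.1 s)⟩) _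
        (fun k => (finProdFinEquiv.symm k).1) fun s => by simp
    · exact partitionSigma_mono (φ := ⟨ψ.1, ψ.2.1⟩)
        (ψ := ⟨φ.1 * ψ.1, fun s => finProdFinEquiv (φ.2.1 s, ψ.2.1 s)⟩) _
        (fun k => (finProdFinEquiv.symm k).2) fun s => by simp

end History

end MarkedPoisson

namespace MarkedPoisson

attribute [local instance] finiteConfigSigma

section SubSigma

variable {Ω 𝒳 𝒴 : Type*} [MeasurableSpace 𝒳] [MeasurableSpace 𝒴]

lemma measurable_root_prodMk {d : ℕ} [MeasurableSpace Ω] {A : Ω → 𝒴} (hA : Measurable A)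
    (t : unitInterval) :
    Measurable fun z : Ω × Marks => (((0, t, z.2) : Pt d), A z.1) := by fun_prop

lemma indep_prod_of_indep {m m0 : MeasurableSpace Ω} {μ : Measure[m0] Ω} [IsProbabilityMeasure μ]
    {ν : Measure 𝒳} [IsProbabilityMeasure ν] (hm : m ≤ m0) {B : Ω → 𝒴} (hB : Measurable B)
    (h : Indep m (MeasurableSpace.comap B inferInstance) μ) :
    Indep (MeasurableSpace.prod m inferInstance)
      (MeasurableSpace.comap (fun z : Ω × 𝒳 => B z.1) inferInstance) (μ.prod ν) := by
  refine IndepSets.indep (p1 := Set.image2 (fun s t => s ×ˢ t) {s | MeasurableSet[m] s}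
    {t | MeasurableSet t}) (p2 := {s | MeasurableSet[MeasurableSpace.comap
      (fun z : Ω × 𝒳 => B z.1) inferInstance] s})
    (sup_le_sup (MeasurableSpace.comap_mono hm) le_rfl) (hB.comp measurable_fst).comap_le
    (@isPiSystem_prod _ _ m _) (@MeasurableSpace.isPiSystem_measurableSet _ (_))
    (@generateFrom_prod _ _ m _).symm (@MeasurableSpace.generateFrom_measurableSet _ (_)).symm ?_
  rw [IndepSets_iff]
  rintro _ _ ⟨s, hs, t, ht, rfl⟩ ⟨C, hC, rfl⟩
  have e1 : (fun z : Ω × 𝒳 => B z.1) ⁻¹' C = (B ⁻¹' C) ×ˢ Set.univ := by ext; simp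
  have h1 := (Indep_iff _ _ _).1 h s (B ⁻¹' C) hs ⟨C, hC, rfl⟩
  simp only [e1, Set.prod_inter_prod, Set.inter_univ, Measure.prod_prod, measure_univ, mul_one, h1]
  ring

end SubSigma

/-! ### Conditional expectations given the history as resampled correlations -/

section Resampling

variable {d : ℕ} [NeZero d] (e : ℕ ≃ (Fin d → ℤ)) {Ω : Type*} [MeasurableSpace Ω] {P : Measure Ω}
  [IsProbabilityMeasure P] {lam : ℝ≥0} {η : Ω → Set (Pt d)} {f : Finset (MarkedEdge d) → ℝ}

/-- The random graph on the origin and independent uniform points of a cube. -/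
abbrev rootedLaw (W : Cube d) : Measure (Field d) :=
  graphLaw (rootedFamily (Measure.dirac 0) (cubeLaw W))

lemma IsPoissonProcess.originCost_ae_eq (hη : IsPoissonProcess (intensity d lam) P η)
    (W : Cube d) (t : unitInterval) : originCost e η f t W =ᵐ[P.prod markLaw]
      fun z => rootCost f (genericGraph e (rootConf η W t z)) := by
  filter_upwards [hη.ae_generic_rootConf e W t] with z hz
  rw [genericGraph_of_generic e hz, originCost_eq e z t W (hη.finite_slab W _ _)]
  rfl

lemma IsPoissonProcess.conf_union (hη : IsPoissonProcess (intensity d lam) P η)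
    (W : Cube d) (t : unitInterval) (ω : Ω) :
    conf η W (Set.Iio t) ω ∪ conf η W (Set.Ici t) ω = conf η W Set.univ ω := by
  refine Conf.ext_carrier ?_
  simp only [Conf.carrier_union, conf, Conf.carrier_ofSet (hη.finite_slab W _ _)]
  ext s
  simp only [slab, Set.mem_union, Set.mem_inter_iff, Set.mem_ofPred_eq, Set.mem_Iio, Set.mem_Ici,
    Set.mem_univ]
  have := lt_or_ge s.2.1 t
  tauto

/-- The birth times of the resampling: the vertices of the first sequence are born before the
additional vertex, the others after it. -/
def splitTimes (t : unitInterval) : Vertex → Measure unitInterval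
  | none => Measure.dirac t
  | some (j, _) => if j = 0 then ProbabilityTheory.cond volume (Set.Iio t)
      else ProbabilityTheory.cond volume (Set.Ici t)

lemma volume_Iio_ne_zero {t : unitInterval} (ht : 0 < t) : volume (Set.Iio t) ≠ 0 := by
  simpa using ht

lemma volume_Ici_ne_zero {t : unitInterval} (ht : t < 1) : volume (Set.Ici t) ≠ 0 := by
  simpa using ht

lemma isProbabilityMeasure_splitTimes {t : unitInterval} (h0 : 0 < t) (h1 : t < 1) (i : Vertex) :
    IsProbabilityMeasure (splitTimes t i) := by
  rcases i with _ | ⟨j, i⟩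
  · exact inferInstanceAs (IsProbabilityMeasure (Measure.dirac t))
  · by_cases hj : j = 0
    · simp only [splitTimes, hj, if_true]
      exact cond_isProbabilityMeasure_of_finite (volume_Iio_ne_zero h0) (measure_ne_top _ _)
    · simp only [splitTimes, hj, if_false]
      exact cond_isProbabilityMeasure_of_finite (volume_Ici_ne_zero h1) (measure_ne_top _ _)

/-- The common vertices are the root and those of sequence `0`, born no later than `t`; all others
are born no earlier than `t`. Since birth times are distinct, the inequality between the two groups
is strict. -/
lemma ae_nested_splitTimes {t : unitInterval} [∀ i, IsProbabilityMeasure (splitTimes t i)]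
    (W : Cube d) :
    ∀ᵐ z ∂((Measure.infinitePi (rootedFamily (Measure.dirac (0 : Loc d)) (cubeLaw W))).prod
      (Measure.infinitePi (splitTimes t))), ∀ y : ℕ × ℕ × ℕ,
        Nested z.1 z.2 (insert none (comb 1 y.1 y.2.1)) (insert none (comb 2 y.1 y.2.2)) := by
  have hinj : ∀ᵐ x ∂(Measure.infinitePi (splitTimes t)), Function.Injective x :=
    ae_injective_times fun i => by
      simp only [splitTimes]
      split_ifs <;> exact nullSingletonClass_cond _ _
  have h0 : ∀ᵐ x ∂(Measure.infinitePi (splitTimes t)), x none = t :=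
    ae_infinitePi_apply none (p := fun x => x = t) (by
      change ∀ᵐ x ∂(Measure.dirac t), x = t
      rw [ae_dirac_eq]; rfl)
  have h1 : ∀ᵐ x ∂(Measure.infinitePi (splitTimes t)), ∀ i, x (some (0, i)) < t := by
    rw [ae_all_iff]
    exact fun i => ae_infinitePi_apply (some (0, i)) (p := fun x => x < t)
      (ae_cond_mem measurableSet_Iio)
  have h2 : ∀ᵐ x ∂(Measure.infinitePi (splitTimes t)), ∀ j, j ≠ 0 → ∀ i, t ≤ x (some (j, i)) := by
    rw [ae_all_iff]
    intro j
    by_cases hj : j = 0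
    · simp [hj]
    · simp only [ne_eq, hj, not_false_eq_true, true_implies]
      rw [ae_all_iff]
      intro i
      refine ae_infinitePi_apply (some (j, i)) (p := fun x => t ≤ x) ?_
      simp only [splitTimes, hj, if_false]
      exact ae_cond_mem measurableSet_Ici
  filter_upwards [Measure.quasiMeasurePreserving_fst.ae (ae_injective_rooted 0 W),
    Measure.quasiMeasurePreserving_snd.ae hinj, Measure.quasiMeasurePreserving_snd.ae h0,
    Measure.quasiMeasurePreserving_snd.ae h1, Measure.quasiMeasurePreserving_snd.ae h2]
    with z hx ht h0 h1 h2 y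
  refine ⟨hx.injOn, ht.injOn, fun i hi hi' k hk hk' => ?_⟩
  have hit : z.2 i ≤ t := by
    rcases i with _ | ⟨j, i⟩
    · exact h0.le
    · simp only [Finset.mem_insert, reduceCtorEq, false_or, mem_comb] at hi hi'
      have hj : j = 0 := by
        by_contra hj
        simp only [hj, false_and, false_or] at hi hi'
        exact absurd (hi.1.symm.trans hi'.1) (by decide)
      rw [hj]
      exact (h1 i).le
  have htk : t ≤ z.2 k := by
    rcases k with _ | ⟨j, k⟩
    · exact absurd ⟨Finset.mem_insert_self _ _, Finset.mem_insert_self _ _⟩ hk'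
    · refine h2 j (fun hj => ?_) k
      subst hj
      simp only [Finset.mem_insert, reduceCtorEq, false_or, mem_comb, true_and] at hk hk'
      have h3 : ¬ ((0 : Fin 3) = 1) := by decide
      have h4 : ¬ ((0 : Fin 3) = 2) := by decide
      simp only [h3, h4, false_and, or_false] at hk hk'
      exact hk' ⟨hk.elim id id, hk.elim id id⟩
  exact (hit.trans htk).lt_of_ne fun h => hk' (ht h ▸ ⟨hi, hi'⟩)

lemma measurable_points_insert_comb (j : Fin 3) (k : ℕ × ℕ × ℕ → ℕ) :
    Measurable fun q : (ℕ × ℕ × ℕ) × (Vertex → Pt d) =>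
      Conf.points q.2 (insert none (comb j q.1.1 (k q.1))) :=
  Conf.measurable_points measurable_snd fun i =>
    measurable_fst (MeasurableSet.of_discrete
      (s := {n : ℕ × ℕ × ℕ | i ∈ insert none (comb j n.1 (k n))}))

/-- The cost as a function of the additional point, of the past and of the future. -/
def splitCost (f : Finset (MarkedEdge d) → ℝ) (q : (Pt d × Conf (Pt d)) × Conf (Pt d)) : ℝ :=
  rootCost f (genericGraph e ((q.1.2 ∪ q.2).add q.1.1))

lemma measurable_splitCost (hf : Measurable f) : Measurable (splitCost e f) := by
  have h : Measurable fun q : (Pt d × Conf (Pt d)) × Conf (Pt d) => (q.1.2 ∪ q.2).add q.1.1 :=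
    Conf.measurable_add.comp (f := fun q : (Pt d × Conf (Pt d)) × Conf (Pt d) =>
      (q.1.1, q.1.2 ∪ q.2)) (Measurable.prodMk (by fun_prop) (Conf.measurable_union.comp
        (f := fun q : (Pt d × Conf (Pt d)) × Conf (Pt d) => (q.1.2, q.2)) (by fun_prop)))
  exact (measurable_rootCost hf).comp ((measurable_genericGraph e).comp h)

lemma points_insert_comb (x : Vertex → Pt d) (j : Fin 3) (a b : ℕ) :
    Conf.points x (insert none (comb j a b)) =
      (Conf.points x (cls 0 a) ∪ Conf.points x (cls j b)).add (x none) := by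
  rw [points_insert, comb, points_union]

/-- Here nestedness is used for two different configurations. Both share the past, which is older,
so their edge marks come jointly from a single field of pair marks, and the birth times leave a
trace only in the counts of `mixLaw`. -/
lemma integral_splitCost (hf : Measurable f) (m : ℝ≥0) (W : Cube d) {t : unitInterval}
    [∀ i, IsProbabilityMeasure (splitTimes t i)] :
    ∫ q : (ℕ × ℕ × ℕ) × (Vertex → Pt d),
      rootCost f (genericGraph e (Conf.points q.2 (insert none (comb 1 q.1.1 q.1.2.1)))) *
      rootCost f (genericGraph e (Conf.points q.2 (insert none (comb 2 q.1.1 q.1.2.2))))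
      ∂((mixLaw m t).prod (Measure.infinitePi
        (pointLaw (rootedFamily (Measure.dirac 0) (cubeLaw W)) (splitTimes t)))) =
    resampled m (rootedLaw W) randomGraph f t := by
  set L := rootedFamily (Measure.dirac (0 : Loc d)) (cubeLaw W)
  have hI : ∀ (j : Fin 3) (k : ℕ × ℕ × ℕ → ℕ) (i : Vertex), MeasurableSet
      {q : (ℕ × ℕ × ℕ) × (Vertex → Loc d) | i ∈ insert none (comb j q.1.1 (k q.1))} := fun j k i =>
    measurable_fst (MeasurableSet.of_discrete
      (s := {n : ℕ × ℕ × ℕ | i ∈ insert none (comb j n.1 (k n))}))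
  have key := map_points_pair e (μ₀ := mixLaw m t) (L := L) (τ := splitTimes t)
    (I₁ := fun n _ => insert none (comb 1 n.1 n.2.1))
    (I₂ := fun n _ => insert none (comb 2 n.1 n.2.2)) (hI 1 fun n => n.2.1) (hI 2 fun n => n.2.2)
    (ae_nested_splitTimes W)
  have hG : Measurable fun z : Finset (MarkedEdge d) × Finset (MarkedEdge d) =>
      rootCost f z.1 * rootCost f z.2 :=
    ((measurable_rootCost hf).comp measurable_fst).mul ((measurable_rootCost hf).comp measurable_snd)
  have h := congrArg (fun ν => ∫ z, rootCost f z.1 * rootCost f z.2 ∂ν) key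
  have m1 : Measurable fun q : (ℕ × ℕ × ℕ) × (Vertex → Pt d) =>
      (genericGraph e (Conf.points q.2 (insert none (comb 1 q.1.1 q.1.2.1))),
        genericGraph e (Conf.points q.2 (insert none (comb 2 q.1.1 q.1.2.2)))) :=
    ((measurable_genericGraph e).comp (measurable_points_insert_comb 1 fun n => n.2.1)).prodMk
      ((measurable_genericGraph e).comp (measurable_points_insert_comb 2 fun n => n.2.2))
  have m2 : Measurable fun q : (ℕ × ℕ × ℕ) × Field d =>
      (randomGraph (insert none (comb 1 q.1.1 q.1.2.1)) q.2,
        randomGraph (insert none (comb 2 q.1.1 q.1.2.2)) q.2) :=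
    (exchangeableAt_randomGraph (δ := Measure.dirac (0 : Loc d))
      (μ := cubeLaw W)).measurable_pair
      (fun n : ℕ × ℕ × ℕ => insert none (comb 1 n.1 n.2.1)) fun n => insert none (comb 2 n.1 n.2.2)
  refine (integral_map m1.aemeasurable hG.aestronglyMeasurable).symm.trans
    (h.trans ((integral_map m2.aemeasurable hG.aestronglyMeasurable).trans ?_))
  rw [resampled]
  refine integral_congr_ae ?_
  have hx : ∀ᵐ q ∂((mixLaw m t).prod (rootedLaw W)), Function.Injective q.2.1 :=
    Measure.quasiMeasurePreserving_snd.ae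
      (Measure.quasiMeasurePreserving_fst.ae (ae_injective_rooted 0 W))
  have hx0 : ∀ᵐ q ∂((mixLaw m t).prod (rootedLaw W)), q.2.1 none = 0 :=
    Measure.quasiMeasurePreserving_snd.ae
      (Measure.quasiMeasurePreserving_fst.ae (ae_rooted_none 0 W))
  filter_upwards [hx, hx0] with q h1 h2
  rw [rootCost_randomGraph none_notMem_comb h1 h2, rootCost_randomGraph none_notMem_comb h1 h2]

/-- The second moment of the conditional expectation of the cost given the history. -/
lemma IsPoissonProcess.integral_condHistory_sq (hη : IsPoissonProcess (intensity d lam) P η)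
    (hf : Measurable f) (W : Cube d) {t : unitInterval} (h0 : 0 < t) (h1 : t < 1)
    (hL : MemLp (originCost e η f t W) 2 (P.prod markLaw)) :
    ∫ z, condHistory P η t (originCost e η f t W) z ^ 2 ∂(P.prod markLaw) =
      resampled (mass lam W) (rootedLaw W) randomGraph f t := by
  have := isProbabilityMeasure_splitTimes h0 h1
  -- `U` is known at time `t`, consisting of the added point with its marks and the past in `W`. `V`
  -- is the future in `W`, which is independent of the history.
  let U : Ω × Marks → Pt d × Conf (Pt d) := fun z => ((0, t, z.2), conf η W (Set.Iio t) z.1)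
  let V : Ω × Marks → Conf (Pt d) := fun z => conf η W (Set.Ici t) z.1
  have hVm : Measurable V := (hη.measurable_conf_slab W measurableSet_Ici).comp measurable_fst
  have hae : originCost e η f t W =ᵐ[P.prod markLaw] fun z => splitCost e f (U z, V z) := by
    filter_upwards [hη.originCost_ae_eq e (f := f) W t] with z hz
    rw [hz, rootConf, ← hη.conf_union W t]
    rfl
  have hle : MeasurableSpace.prod (historySigma η t) (inferInstance : MeasurableSpace Marks) ≤
      MeasurableSpace.prod ‹MeasurableSpace Ω› inferInstance :=
    sup_le_sup (MeasurableSpace.comap_mono (hη.historySigma_le t)) le_rfl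
  have hAm : Measurable[historySigma η t] (conf η W (Set.Iio t)) := by
    refine @Conf.measurable_of_void _ _ (historySigma η t) _ _ fun B hB => ?_
    have hs : {ω | (conf η W (Set.Iio t) ω).carrier ∩ B = ∅} =
        (fun ω => (η ω ∩ (slab W (Set.Iio t) ∩ B)).encard) ⁻¹' {0} := by
      ext ω
      simp [conf, Conf.carrier_ofSet (hη.finite_slab W _ _), Set.inter_assoc]
    rw [hs]
    exact measurable_history_count t ((measurableSet_slab W measurableSet_Iio).inter hB)
      (fun s hs => hs.1.2) (measurableSet_singleton 0)
  have hUm : Measurable[MeasurableSpace.prod (historySigma η t) inferInstance] U :=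
    @measurable_root_prodMk _ _ _ d (historySigma η t) _ hAm t
  obtain ⟨K, hK, hsub⟩ := exists_compact_slab W (Set.Ici t)
  have hind := hη.indep_history t hK hsub (measurableSet_slab W measurableSet_Ici)
    (Set.disjoint_left.2 fun s hs hs' => not_le_of_gt (show s.2.1 < t from hs) hs'.2)
  have hind2 : Indep (MeasurableSpace.prod (historySigma η t) inferInstance)
      (MeasurableSpace.comap V inferInstance) (P.prod markLaw) :=
    indep_prod_of_indep (hη.historySigma_le t)
      (hη.measurable_conf_slab W measurableSet_Ici) hind
  have hlawA := hη.map_conf_slab W measurableSet_Iio (volume_Iio_ne_zero h0)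
    (ρ := pointLaw (rootedFamily (Measure.dirac (0 : Loc d)) (cubeLaw W)) (splitTimes t)) 0
    fun i => rfl
  have hlawB := fun (j : Fin 3) (hj : j ≠ 0) =>
    hη.map_conf_slab W measurableSet_Ici (volume_Ici_ne_zero h1)
    (ρ := pointLaw (rootedFamily (Measure.dirac (0 : Loc d)) (cubeLaw W)) (splitTimes t)) j
    fun i => by simp only [pointLaw, splitTimes, hj, if_false]; rfl
  have hvA : (volume (Set.Iio t)).toNNReal = unitInterval.toNNReal t := by
    simp [unitInterval.toNNReal, ENNReal.ofReal, Real.toNNReal_of_nonneg t.2.1]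
    rfl
  have hvB : (volume (Set.Ici t)).toNNReal = unitInterval.toNNReal (unitInterval.symm t) := by
    simp [unitInterval.toNNReal, ENNReal.ofReal,
      Real.toNNReal_of_nonneg (unitInterval.one_minus_nonneg t)]
    rfl
  rw [hvA] at hlawA
  rw [hvB] at hlawB
  have hUlaw : (P.prod markLaw).map U = (pointLaw (rootedFamily (Measure.dirac (0 : Loc d))
      (cubeLaw W)) (splitTimes t) none).prod (P.map (conf η W (Set.Iio t))) := by
    have hA0 := hη.measurable_conf_slab W (measurableSet_Iio (a := t))
    rw [show pointLaw (rootedFamily (Measure.dirac (0 : Loc d)) (cubeLaw W)) (splitTimes t) none =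
      markLaw.map (fun M => ((0, t, M) : Pt d)) from (map_rootMark t).symm,
      Measure.map_prod_map _ _ (by fun_prop) hA0, ← Measure.prod_swap (μ := P),
      Measure.map_map (Measurable.prodMap (by fun_prop) hA0) measurable_swap]
    rfl
  have hVlaw : (P.prod markLaw).map V = P.map (conf η W (Set.Ici t)) := by
    have : V = conf η W (Set.Ici t) ∘ Prod.fst := rfl
    rw [this, ← Measure.map_map (hη.measurable_conf_slab W measurableSet_Ici) measurable_fst,
      Measure.map_fst_prod, measure_univ, one_smul]
  have e1 : ∀ᵐ z ∂(P.prod markLaw), condHistory P η t (originCost e η f t W) z =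
      condHistory P η t (fun z => splitCost e f (U z, V z)) z := condExp_congr_ae hae
  have e2 := integral_condExp_sq hle hUm hVm hind2 (measurable_splitCost e hf)
    (hL.ae_eq hae)
  refine (integral_congr_ae (by filter_upwards [e1] with z hz; exact congrArg (fun x => x ^ 2) hz)).trans (e2.trans ?_)
  -- The past is realized by sequence `0`, the two independent copies of the future by sequences `1`
  -- and `2`. The strict inequalities `0 < t < 1` make the conditional laws of the birth times well
  -- defined.
  rw [hUlaw, hVlaw]
  conv_lhs => arg 1; arg 2; arg 1; rw [hlawB 1 (by decide)]
  conv_lhs => arg 1; arg 2; arg 2; rw [hlawB 2 (by decide)]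
  rw [hlawA, ← map_mix_points, integral_map]
  · simp only [splitCost, ← points_insert_comb]
    exact integral_splitCost e hf _ W
  · exact (Measurable.prodMk (Measurable.prodMk (by fun_prop) ((measurable_points_cls 0).comp
      (f := fun q : (ℕ × ℕ × ℕ) × (Vertex → Pt d) => (q.1.1, q.2)) (by fun_prop)))
      (Measurable.prodMk ((measurable_points_cls 1).comp
      (f := fun q : (ℕ × ℕ × ℕ) × (Vertex → Pt d) => (q.1.2.1, q.2)) (by fun_prop))
      ((measurable_points_cls 2).comp
      (f := fun q : (ℕ × ℕ × ℕ) × (Vertex → Pt d) => (q.1.2.2, q.2)) (by fun_prop)))).aemeasurable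
  · exact (((measurable_splitCost e hf).comp (f := fun q : (Pt d × Conf (Pt d)) × Conf (Pt d) ×
      Conf (Pt d) => (q.1, q.2.1)) (by fun_prop)).mul ((measurable_splitCost e hf).comp
      (f := fun q : (Pt d × Conf (Pt d)) × Conf (Pt d) × Conf (Pt d) => (q.1, q.2.2))
      (by fun_prop))).aestronglyMeasurable

end Resampling

end MarkedPoisson

/-! ### Mean square convergence, cost norms and centered boxes -/

namespace MarkedPoisson

attribute [local instance] finiteConfigSigma

section ConvergenceOfMoments

variable {X : Type*} [MeasurableSpace X] {μ : Measure X} [IsProbabilityMeasure μ]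

/-- Convergence in probability with bounded moments of an order above two is convergence in mean
square. -/
lemma tendsto_eLpNorm_two_of_moment {F : ℕ → X → ℝ} {g : X → ℝ} {p : ℝ} (hp : 2 < p) {C : ℝ≥0∞}
    (hC : C ≠ ∞) (hF : ∀ n, AEStronglyMeasurable (F n) μ) (hg : AEStronglyMeasurable g μ)
    (hb : ∀ n, eLpNorm (F n) (ENNReal.ofReal p) μ ≤ C) (h : TendstoInMeasure μ F atTop g) :
    Tendsto (fun n => eLpNorm (F n - g) 2 μ) atTop (𝓝 0) := by
  have h2p : (2 : ℝ≥0∞) ≤ ENNReal.ofReal p := by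
    rw [show (2 : ℝ≥0∞) = ENNReal.ofReal 2 by simp]
    exact ENNReal.ofReal_le_ofReal hp.le
  have hb2 : ∀ n, eLpNorm (F n) 2 μ ≤ C := fun n =>
    (eLpNorm_le_eLpNorm_of_exponent_le h2p (hF n)).trans (hb n)
  have hgL : MemLp g 2 μ := by
    obtain ⟨ns, -, hns⟩ := h.exists_seq_tendsto_ae
    refine ⟨hg, (Lp.eLpNorm_lim_le_liminf_eLpNorm (fun n => hF (ns n)) g hns).trans_lt ?_⟩
    refine lt_of_le_of_lt ?_ hC.lt_top
    exact liminf_le_of_le (by isBoundedDefault) fun b hb' =>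
      (hb'.exists.choose_spec).trans (hb2 _)
  refine tendsto_Lp_finite_of_tendstoInMeasure (by norm_num) (by norm_num) hF hgL ?_ h
  intro ε hε
  -- The gain of Hölder's inequality on a small set. It is positive because `p > 2`, which makes the
  -- sequence uniformly square integrable, so that Vitali's theorem applies.
  set a : ℝ := 1 / 2 - 1 / p with ha
  have hapos : 0 < a := by
    rw [ha, sub_pos]
    exact one_div_lt_one_div_of_lt (by norm_num) hp
  have hp0 : 0 < p := by linarith
  have key : ∀ n s, MeasurableSet s → eLpNorm (s.indicator (F n)) 2 μ ≤ C * μ s ^ a := by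
    intro n s hs
    rw [eLpNorm_indicator_eq_eLpNorm_restrict hs]
    refine (eLpNorm_le_eLpNorm_mul_rpow_measure_univ h2p (hF n).restrict).trans ?_
    rw [Measure.restrict_apply_univ, ENNReal.toReal_ofReal hp0.le]
    refine mul_le_mul' ((eLpNorm_mono_measure _ Measure.restrict_le_self).trans (hb n)) (le_of_eq ?_)
    rw [ha, ENNReal.toReal_ofNat]
  -- The size of `s` for which `(C + 1) * μ s ^ a ≤ ε`; adding one guards against `C = 0`.
  refine ⟨(ε / (C.toReal + 1)) ^ a⁻¹, by positivity, fun n s hs hsδ => (key n s hs).trans ?_⟩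
  calc C * μ s ^ a ≤ ENNReal.ofReal (C.toReal + 1) *
        ENNReal.ofReal ((ε / (C.toReal + 1)) ^ a⁻¹) ^ a := by
        gcongr
        rw [← ENNReal.ofReal_toReal hC]
        exact ENNReal.ofReal_le_ofReal (by rw [ENNReal.toReal_ofReal ENNReal.toReal_nonneg]; linarith)
    _ = ENNReal.ofReal ε := by
        rw [ENNReal.ofReal_rpow_of_nonneg (by positivity) hapos.le, ← Real.rpow_mul (by positivity),
          inv_mul_cancel₀ hapos.ne', Real.rpow_one, ← ENNReal.ofReal_mul (by positivity)]
        congr 1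
        have : C.toReal + 1 ≠ 0 := by positivity
        field_simp

end ConvergenceOfMoments

section CostNorm

variable {Θ 𝒢 : Type*} [MeasurableSpace Θ] [MeasurableSpace 𝒢]

/-- The `L²` norm of the cost of the additional vertex. -/
def costNorm (m : ℝ≥0) (ν : Measure Θ) (G : Finset Vertex → Θ → 𝒢) (g : 𝒢 → ℝ) : ℝ≥0∞ :=
  eLpNorm (fun q : ℕ × Θ => starCost G g (cls 0 q.1) q.2) 2 ((poissonMeasure m).prod ν)

variable {m : ℝ≥0} {ν : Measure Θ} [IsProbabilityMeasure ν] {G : Finset Vertex → Θ → 𝒢}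
  {g g' : 𝒢 → ℝ}

lemma ExchangeableAt.finiteCost_of_costNorm (hG : ExchangeableAt ν G) (hg : Measurable g)
    (h : costNorm m ν G g ≠ ∞) : FiniteCost m ν G g :=
  ⟨(hG.measurable_cost hg).aestronglyMeasurable, h.lt_top⟩

lemma FiniteCost.ofReal_costMoment (hc : FiniteCost m ν G g) :
    ENNReal.ofReal (costMoment m ν G g) = costNorm m ν G g ^ 2 := by
  rw [costMoment, ofReal_integral_eq_lintegral_ofReal hc.integrable_sq
    (ae_of_all _ fun _ => sq_nonneg _), costNorm,
    eLpNorm_eq_lintegral_rpow_enorm_toReal (by norm_num) (by norm_num)]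
  simp only [ENNReal.toReal_ofNat, one_div]
  rw [← ENNReal.rpow_natCast, ← ENNReal.rpow_mul]
  norm_num
  refine lintegral_congr fun q => ?_
  rw [Real.enorm_eq_ofReal_abs, ← ENNReal.ofReal_pow (abs_nonneg _), sq_abs]

lemma ExchangeableAt.costNorm_sub_le (hG : ExchangeableAt ν G) (hg : Measurable g)
    (hg' : Measurable g') :
    costNorm m ν G (fun x => g x - g' x) ≤ costNorm m ν G g + costNorm m ν G g' := by
  unfold costNorm
  simp_rw [starCost_sub]
  exact eLpNorm_sub_le (hG.measurable_cost hg).aestronglyMeasurable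
    (hG.measurable_cost hg').aestronglyMeasurable (by norm_num)

end CostNorm

section Boxes

variable {d : ℕ}

/-- The centered cube of side length `2 (k + 1)`. -/
def box (d k : ℕ) : Cube d := ⟨WithLp.toLp 2 fun _ => -(k + 1 : ℝ), 2 * (k + 1), by positivity⟩

lemma box_aligned (k : ℕ) : (box d k).Aligned :=
  Cube.aligned_of_int (c := fun _ => -(k + 1)) (k := 2 * (k + 1)) (fun i => by simp [box])
    (by simp [box])

lemma abs_apply_le_norm (x : Loc d) (i : Fin d) : |x i| ≤ ‖x‖ := PiLp.norm_apply_le x i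

lemma closedBall_subset_box {r : ℝ} {k : ℕ} (h : r ≤ k) :
    Metric.closedBall 0 r ⊆ (box d k).toSet := by
  intro x hx i
  rw [mem_closedBall_zero_iff] at hx
  have h1 := abs_le.1 ((abs_apply_le_norm x i).trans (hx.trans h))
  simp only [box]
  constructor <;> linarith

lemma tendsToSpace_box : TendsToSpace (box d) := fun r => by
  filter_upwards [eventually_ge_atTop ⌈r⌉₊] with k hk
  exact closedBall_subset_box ((Nat.le_ceil r).trans (by exact_mod_cast hk))

lemma zero_mem_box (k : ℕ) : (0 : Loc d) ∈ (box d k).toSet :=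
  closedBall_subset_box (r := 0) (by positivity) (by simp)

end Boxes

/-! ### Stabilization at all birth times -/

section Stabilization

variable {d : ℕ} [NeZero d] (e : ℕ ≃ (Fin d → ℤ)) {Ω : Type*} [MeasurableSpace Ω] {P : Measure Ω}
  [IsProbabilityMeasure P] {lam : ℝ≥0} {η : Ω → Set (Pt d)} {f : Finset (MarkedEdge d) → ℝ}
  {p : ℝ}

lemma restrictTo_comm (V W : Set (Loc d)) (A : Finset (MarkedEdge d)) :
    restrictTo V (restrictTo W A) = restrictTo W (restrictTo V A) := by
  ext a
  simp only [mem_restrictTo]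
  tauto

/-- The contribution to `f` of the edges that are not inside `V`. -/
def cutoff (V : Set (Loc d)) (f : Finset (MarkedEdge d) → ℝ) (A : Finset (MarkedEdge d)) : ℝ :=
  f A - f (restrictTo V A)

lemma measurable_cutoff {V : Set (Loc d)} (hV : MeasurableSet V) (hf : Measurable f) :
    Measurable (cutoff V f) := hf.sub (hf.comp (measurable_restrictTo hV))

/-- The cost of the cut-off functional is the difference between the costs in the full graph and in
the subgraph. Its norm thus measures how far the cost in a small cube is from the cost in a large
one. -/
lemma rootCost_cutoff (V : Set (Loc d)) (A : Finset (MarkedEdge d)) :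
    rootCost (cutoff V f) A = rootCost f A - rootCost f (restrictTo V A) := by
  simp only [rootCost, cutoff, restrictTo_comm V]
  ring

/-- The `L²` norm of the cost of the origin in a cube. -/
def rootedNorm (lam : ℝ≥0) (W : Cube d) (g : Finset (MarkedEdge d) → ℝ) : ℝ≥0∞ :=
  costNorm (mass lam W) (rootedLaw W) randomGraph g

lemma ae_rootCost_eq (lam : ℝ≥0) (W : Cube d) (g : Finset (MarkedEdge d) → ℝ) :
    (fun q : ℕ × Field d => rootCost g (randomGraph (insert none (cls 0 q.1)) q.2))
      =ᵐ[(poissonMeasure (mass lam W)).prod (rootedLaw W)]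
      fun q => starCost randomGraph g (cls 0 q.1) q.2 := by
  filter_upwards [Measure.quasiMeasurePreserving_snd.ae
    (Measure.quasiMeasurePreserving_fst.ae (ae_injective_rooted (0 : Loc d) W)),
    Measure.quasiMeasurePreserving_snd.ae (Measure.quasiMeasurePreserving_fst.ae
      (ae_rooted_none (0 : Loc d) W))] with q h1 h2
  exact rootCost_randomGraph none_notMem_cls h1 h2

lemma measurable_rooted_graph : Measurable fun q : ℕ × Field d =>
    randomGraph (insert none (cls 0 q.1)) q.2 :=
  measurable_from_prod_countable_right fun n => measurable_randomGraph (insert none (cls 0 n))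

lemma IsPoissonProcess.identDistrib_rootCost (hη : IsPoissonProcess (intensity d lam) P η)
    {V W : Cube d} (hVW : V.toSet ⊆ W.toSet) (h0 : (0 : Loc d) ∈ V.toSet)
    {g : Finset (MarkedEdge d) → ℝ} (hg : Measurable g) (t : unitInterval) :
    IdentDistrib (fun z => rootCost g (genericGraph e (rootConf η V t z)))
      (fun q : ℕ × Field d => starCost randomGraph (fun A => g (restrictTo V.toSet A))
        (cls 0 q.1) q.2) (P.prod markLaw) ((poissonMeasure (mass lam W)).prod (rootedLaw W)) := by
  have hr := measurable_rootCost hg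
  have h1 : IdentDistrib (fun z => genericGraph e (rootConf η V t z))
      (fun q : ℕ × Field d => restrictTo V.toSet (randomGraph (insert none (cls 0 q.1)) q.2))
      (P.prod markLaw) ((poissonMeasure (mass lam W)).prod (rootedLaw W)) :=
    ⟨((measurable_genericGraph e).comp (hη.measurable_rootConf V t)).aemeasurable,
      ((measurable_restrictTo V.measurableSet).comp measurable_rooted_graph).aemeasurable,
      hη.map_rootGraph e hVW h0 t⟩
  refine (h1.comp hr).trans (IdentDistrib.of_ae_eq
    (hr.comp ((measurable_restrictTo V.measurableSet).comp measurable_rooted_graph)).aemeasurable ?_)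
  filter_upwards [ae_rootCost_eq lam W fun A => g (restrictTo V.toSet A)] with q hq
  rw [← hq]
  simp only [Function.comp_apply, rootCost, restrictTo_comm V.toSet]

/-- The right-hand side does not involve `t`: the law of the graph with the root forgets the root's
birth time. Assumptions at birth time one thereby become estimates at all birth times. -/
lemma IsPoissonProcess.eLpNorm_rootCost (hη : IsPoissonProcess (intensity d lam) P η)
    {W : Cube d} (h0 : (0 : Loc d) ∈ W.toSet)
    {g : Finset (MarkedEdge d) → ℝ} (hg : Measurable g) (t : unitInterval) :
    eLpNorm (fun z => rootCost g (genericGraph e (rootConf η W t z))) 2 (P.prod markLaw) =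
      rootedNorm lam W g := by
  have hr := measurable_rootCost hg
  have h1 : IdentDistrib (fun z => genericGraph e (rootConf η W t z))
      (fun q : ℕ × Field d => randomGraph (insert none (cls 0 q.1)) q.2)
      (P.prod markLaw) ((poissonMeasure (mass lam W)).prod (rootedLaw W)) :=
    ⟨((measurable_genericGraph e).comp (hη.measurable_rootConf W t)).aemeasurable,
      measurable_rooted_graph.aemeasurable, hη.map_rootGraph_self e h0 t⟩
  exact ((h1.comp hr).eLpNorm_eq 2).trans (eLpNorm_congr_ae (ae_rootCost_eq lam W g))

/-- Both norms are read off from the same process: the subgraph induced by `V` of the complete graph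
in `W` has the law of the graph of the process in `V`. -/
lemma IsPoissonProcess.rootedNorm_restrict (e : ℕ ≃ (Fin d → ℤ))
    (hη : IsPoissonProcess (intensity d lam) P η)
    {V W : Cube d} (hVW : V.toSet ⊆ W.toSet) (h0 : (0 : Loc d) ∈ V.toSet)
    {g : Finset (MarkedEdge d) → ℝ} (hg : Measurable g) :
    rootedNorm lam W (fun A => g (restrictTo V.toSet A)) = rootedNorm lam V g := by
  rw [← hη.eLpNorm_rootCost e h0 hg 1]
  exact ((hη.identDistrib_rootCost e hVW h0 hg 1).eLpNorm_eq 2).symm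

lemma IsPoissonProcess.aestronglyMeasurable_originCost
    (hη : IsPoissonProcess (intensity d lam) P η) (hf : Measurable f) (W : Cube d)
    (t : unitInterval) : AEStronglyMeasurable (originCost e η f t W) (P.prod markLaw) :=
  ((measurable_rootCost hf).comp ((measurable_genericGraph e).comp
    (hη.measurable_rootConf W t))).aestronglyMeasurable.congr (hη.originCost_ae_eq e W t).symm

lemma IsPoissonProcess.eLpNorm_originCost (hη : IsPoissonProcess (intensity d lam) P η)
    (hf : Measurable f) {W : Cube d} (h0 : (0 : Loc d) ∈ W.toSet) (t : unitInterval) :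
    eLpNorm (originCost e η f t W) 2 (P.prod markLaw) = rootedNorm lam W f := by
  rw [← hη.eLpNorm_rootCost e h0 hf t]
  exact eLpNorm_congr_ae (hη.originCost_ae_eq e W t)

/-- For an aligned `V`, the cost in `V` is the cost of the induced subgraph for each realization,
not merely in law. The distance is therefore a cost norm and again independent of `t`. -/
lemma IsPoissonProcess.eLpNorm_originCost_sub (hη : IsPoissonProcess (intensity d lam) P η)
    (hf : Measurable f) {V W : Cube d} (hV : V.Aligned) (hVW : V.toSet ⊆ W.toSet)
    (h0 : (0 : Loc d) ∈ V.toSet) (t : unitInterval) :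
    eLpNorm (originCost e η f t W - originCost e η f t V) 2 (P.prod markLaw) =
      rootedNorm lam W (cutoff V.toSet f) := by
  rw [← hη.eLpNorm_rootCost e (hVW h0) (measurable_cutoff V.measurableSet hf) t]
  refine eLpNorm_congr_ae ?_
  filter_upwards [hη.originCost_ae_eq e (f := f) W t, hη.originCost_ae_eq e (f := f) V t,
    hη.ae_generic_rootConf e W t, hη.ae_generic_rootConf e V t] with z h1 h2 h3 h4
  rw [Pi.sub_apply, h1, h2, rootCost_cutoff, genericGraph_of_generic e h3,
    genericGraph_of_generic e h4, restrictTo_markedGraph e hV, hη.rootConf_part hVW h0]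

lemma MomentCondition.exists_bound (hmom : MomentCondition P e η f p) (hp : 0 < p) :
    ∃ C : ℝ≥0∞, C ≠ ∞ ∧ ∀ W : Cube d, (0 : Loc d) ∈ W.toSet →
      eLpNorm (originCost e η f 1 W) (ENNReal.ofReal p) (P.prod markLaw) ≤ C := by
  refine ⟨_ ^ (1 / p), (ENNReal.rpow_lt_top_of_nonneg (by positivity) (ne_of_lt hmom)).ne,
    fun W hW => ?_⟩
  rw [eLpNorm_eq_lintegral_rpow_enorm_toReal (by simpa using hp) ENNReal.ofReal_ne_top,
    ENNReal.toReal_ofReal hp.le]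
  gcongr
  exact le_iSup₂_of_le (f := fun (W : Cube d) (_ : (0 : Loc d) ∈ W.toSet) =>
    ∫⁻ z, ‖originCost e η f 1 W z‖ₑ ^ p ∂(P.prod markLaw)) W hW le_rfl

lemma IsPoissonProcess.exists_rootedNorm_le (hη : IsPoissonProcess (intensity d lam) P η)
    (hf : Measurable f) (hmom : MomentCondition P e η f p) (hp : 2 < p) :
    ∃ C : ℝ≥0, ∀ W : Cube d, (0 : Loc d) ∈ W.toSet → rootedNorm lam W f ≤ C := by
  obtain ⟨C, hC, h⟩ := hmom.exists_bound e (by linarith)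
  lift C to ℝ≥0 using hC
  refine ⟨C, fun W hW => ?_⟩
  rw [← hη.eLpNorm_originCost e hf hW 1]
  refine (eLpNorm_le_eLpNorm_of_exponent_le ?_
    (hη.aestronglyMeasurable_originCost e hf W 1)).trans (h W hW)
  rw [show (2 : ℝ≥0∞) = ENNReal.ofReal 2 by simp]
  exact ENNReal.ofReal_le_ofReal hp.le

lemma zero_mem_of_closedBall_subset {r : ℝ} (hr : 0 ≤ r) {W : Set (Loc d)}
    (h : Metric.closedBall 0 r ⊆ W) : (0 : Loc d) ∈ W := h (by simpa using hr)

/-- At birth time one, the costs converge in mean square, uniformly over large cubes. -/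
lemma IsPoissonProcess.exists_radius_one (hη : IsPoissonProcess (intensity d lam) P η)
    (hf : Measurable f) (hmom : MomentCondition P e η f p) (hp : 2 < p) {Δ : Ω × Marks → ℝ}
    (hΔ : IsLimitCost P e η f 1 Δ) {ε : ℝ≥0∞} (hε : 0 < ε) :
    ∃ r : ℝ, 0 ≤ r ∧ ∀ W : Cube d, Metric.closedBall 0 r ⊆ W.toSet →
      eLpNorm (originCost e η f 1 W - Δ) 2 (P.prod markLaw) ≤ ε := by
  -- If no radius worked, counterexamples for the radii `n` would form a sequence of cubes tending
  -- to the space, along which convergence holds by assumption.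
  by_contra! hcon
  choose W hW hWε using fun n : ℕ => hcon n (Nat.cast_nonneg n)
  have hW' : TendsToSpace W := fun r => by
    filter_upwards [eventually_ge_atTop ⌈r⌉₊] with n hn
    exact (Metric.closedBall_subset_closedBall ((Nat.le_ceil r).trans
      (by exact_mod_cast hn))).trans (hW n)
  obtain ⟨C, hC, h⟩ := hmom.exists_bound e (by linarith)
  have hlim := tendsto_eLpNorm_two_of_moment hp hC
    (fun n => hη.aestronglyMeasurable_originCost e hf (W n) 1) hΔ.1.aestronglyMeasurable
    (fun n => h (W n) (zero_mem_of_closedBall_subset (Nat.cast_nonneg n) (hW n))) (hΔ.2 W hW')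
  obtain ⟨n, hn⟩ := (hlim.eventually_lt_const hε).exists
  exact absurd hn (hWε n).not_gt

/-- The stabilization assumption, stated for the process at birth time one, is translated into a
statement on a functional of the complete graph, in which no birth time occurs. -/
lemma IsPoissonProcess.exists_radius_box (hη : IsPoissonProcess (intensity d lam) P η)
    (hf : Measurable f) (hstab : WeaklyStabilizing P e η f) (hmom : MomentCondition P e η f p)
    (hp : 2 < p) {ε : ℝ≥0∞} (hε : 0 < ε) :
    ∃ r : ℝ, 0 ≤ r ∧ ∀ (k : ℕ) (W : Cube d), r ≤ k → (box d k).toSet ⊆ W.toSet →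
      rootedNorm lam W (cutoff (box d k).toSet f) ≤ ε := by
  obtain ⟨-, Δ, hΔ⟩ := hstab
  obtain ⟨r, hr, h⟩ := hη.exists_radius_one e hf hmom hp hΔ (ENNReal.half_pos hε.ne')
  refine ⟨r, hr, fun k W hk hW => ?_⟩
  rw [← hη.eLpNorm_originCost_sub e hf (box_aligned k) hW (zero_mem_box k) 1]
  have hb := closedBall_subset_box (d := d) hk
  have e1 : originCost e η f 1 W - originCost e η f 1 (box d k) =
      (originCost e η f 1 W - Δ) - (originCost e η f 1 (box d k) - Δ) := by ring
  rw [e1]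
  refine (eLpNorm_sub_le ((hη.aestronglyMeasurable_originCost e hf W 1).sub
    hΔ.1.aestronglyMeasurable) ((hη.aestronglyMeasurable_originCost e hf _ 1).sub
    hΔ.1.aestronglyMeasurable) (by norm_num)).trans ?_
  exact (add_le_add (h W (hb.trans hW)) (h _ hb)).trans (ENNReal.add_halves ε).le

/-- Removes the alignment of `V`: the cutoff at an arbitrary `V` is expressed through the cutoff at
an aligned box `U` inside it. -/
lemma cutoff_eq_sub {U V : Set (Loc d)} (hUV : U ⊆ V) :
    cutoff V f = fun A => cutoff U f A - cutoff U f (restrictTo V A) := by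
  ext1 A
  simp only [cutoff, restrictTo_restrictTo hUV]
  ring

/-- The edges outside of a large cube contribute little to the cost of the origin. -/
lemma IsPoissonProcess.exists_radius (hη : IsPoissonProcess (intensity d lam) P η)
    (hf : Measurable f) (hstab : WeaklyStabilizing P e η f) (hmom : MomentCondition P e η f p)
    (hp : 2 < p) {ε : ℝ≥0∞} (hε : 0 < ε) :
    ∃ r : ℝ, 0 ≤ r ∧ ∀ V W : Cube d, Metric.closedBall 0 r ⊆ V.toSet → V.toSet ⊆ W.toSet →
      rootedNorm lam W (cutoff V.toSet f) ≤ ε := by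
  obtain ⟨r, hr, h⟩ := hη.exists_radius_box e hf hstab hmom hp (ENNReal.half_pos hε.ne')
  obtain ⟨r', hr'⟩ := (box d ⌈r⌉₊).isBounded
  refine ⟨max r' 0, le_max_right _ _, fun V W hV hVW => ?_⟩
  have hbV : (box d ⌈r⌉₊).toSet ⊆ V.toSet :=
    hr'.trans ((Metric.closedBall_subset_closedBall (le_max_left _ _)).trans hV)
  have hm := measurable_cutoff (box d ⌈r⌉₊).measurableSet hf
  rw [cutoff_eq_sub hbV]
  -- Two cutoffs at the inner box remain, one for the graph in `W` and one for its restriction to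
  -- `V`; the latter has the norm belonging to the cube `V`.
  refine (exchangeableAt_randomGraph.costNorm_sub_le hm
    (hm.comp (measurable_restrictTo V.measurableSet))).trans ?_
  have e2 := hη.rootedNorm_restrict e hVW (hbV (zero_mem_box _)) hm
  refine (add_le_add (h _ W (Nat.le_ceil r) (hbV.trans hVW))
    (e2.trans_le (h _ V (Nat.le_ceil r) hbV))).trans (ENNReal.add_halves ε).le

/-- The limit costs exist for all birth times, and the convergence is uniform. -/
lemma IsPoissonProcess.exists_limitCost (hη : IsPoissonProcess (intensity d lam) P η)
    (hf : Measurable f) (hstab : WeaklyStabilizing P e η f) (hmom : MomentCondition P e η f p)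
    (hp : 2 < p) (t : unitInterval) :
    ∃ Δ : Ω × Marks → ℝ, Measurable Δ ∧ MemLp Δ 2 (P.prod markLaw) ∧
      Tendsto (fun k => eLpNorm (originCost e η f t (box d k) - Δ) 2 (P.prod markLaw)) atTop
        (𝓝 0) := by
  obtain ⟨C, hC⟩ := hη.exists_rootedNorm_le e hf hmom hp
  have hL : ∀ k, MemLp (originCost e η f t (box d k)) 2 (P.prod markLaw) := fun k =>
    ⟨hη.aestronglyMeasurable_originCost e hf _ t, by
      rw [hη.eLpNorm_originCost e hf (zero_mem_box k) t]
      exact (hC _ (zero_mem_box k)).trans_lt ENNReal.coe_lt_top⟩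
  have hbox : ∀ {k l : ℕ}, k ≤ l → (box d k).toSet ⊆ (box d l).toSet := fun {k l} hkl x hx i => by
    have h1 := hx i
    simp only [box] at h1 ⊢
    have : (k : ℝ) ≤ l := by exact_mod_cast hkl
    constructor <;> linarith
  -- The distances are cutoff norms, which `exists_radius_box` makes small irrespective of `t`;
  -- completeness of `L²` yields the limit.
  have hcauchy : CauchySeq fun k => (hL k).toLp (originCost e η f t (box d k)) := by
    rw [EMetric.cauchySeq_iff_NNReal]
    intro ε hε
    obtain ⟨r, hr, h⟩ := hη.exists_radius_box e hf hstab hmom hp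
      (ε := ENNReal.ofReal (ε / 2)) (ENNReal.ofReal_pos.2 (by positivity))
    refine ⟨⌈r⌉₊, fun n hn => ?_⟩
    rw [Lp.edist_toLp_toLp, hη.eLpNorm_originCost_sub e hf (box_aligned _) (hbox hn)
      (zero_mem_box _)]
    refine (h _ _ (Nat.le_ceil r) (hbox hn)).trans_lt ?_
    rw [ENNReal.ofReal_lt_coe_iff (by positivity)]
    have : (0 : ℝ) < ε := hε
    linarith
  obtain ⟨Δ, hΔ⟩ := cauchySeq_tendsto_of_complete hcauchy
  refine ⟨Δ, (Lp.stronglyMeasurable Δ).measurable, Lp.memLp Δ, ?_⟩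
  rw [Lp.tendsto_Lp_iff_tendsto_eLpNorm'] at hΔ
  refine hΔ.congr fun k => eLpNorm_congr_ae ?_
  filter_upwards [(hL k).coeFn_toLp] with z hz
  simp [hz]

/-- The radius serves all birth times at once, since the errors are cutoff norms. Only the last
comparison, of a far box with the limit, depends on `t`, and that box may be chosen afterwards. -/
lemma IsPoissonProcess.exists_radius_limit (hη : IsPoissonProcess (intensity d lam) P η)
    (hf : Measurable f) (hstab : WeaklyStabilizing P e η f) (hmom : MomentCondition P e η f p)
    (hp : 2 < p) {ε : ℝ≥0∞} (hε : 0 < ε) :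
    ∃ r : ℝ, 0 ≤ r ∧ ∀ (t : unitInterval) (Δ : Ω × Marks → ℝ), Measurable Δ →
      Tendsto (fun k => eLpNorm (originCost e η f t (box d k) - Δ) 2 (P.prod markLaw)) atTop
        (𝓝 0) → ∀ W : Cube d, Metric.closedBall 0 r ⊆ W.toSet →
      eLpNorm (originCost e η f t W - Δ) 2 (P.prod markLaw) ≤ ε := by
  have hε4 : 0 < ε / 4 := ENNReal.div_pos hε.ne' (by norm_num)
  obtain ⟨r, hr, h⟩ := hη.exists_radius_box e hf hstab hmom hp hε4
  obtain ⟨r', hr'⟩ := (box d ⌈r⌉₊).isBounded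
  refine ⟨max r' 0, le_max_right _ _, fun t Δ hΔm hΔ W hW => ?_⟩
  have hbW : (box d ⌈r⌉₊).toSet ⊆ W.toSet :=
    hr'.trans ((Metric.closedBall_subset_closedBall (le_max_left _ _)).trans hW)
  obtain ⟨k, hk1, hk2⟩ := ((hΔ.eventually_lt_const hε4).and
    (tendsToSpace_box (d := d) (max r' 0))).exists
  have hbk : (box d ⌈r⌉₊).toSet ⊆ (box d k).toSet :=
    hr'.trans ((Metric.closedBall_subset_closedBall (le_max_left _ _)).trans hk2)
  have m := fun W => hη.aestronglyMeasurable_originCost e hf W t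
  -- The cubes `W` and `box d k` are both compared with an aligned box inside them, because `W`
  -- itself need not be aligned.
  have e1 : originCost e η f t W - Δ = (originCost e η f t W - originCost e η f t (box d ⌈r⌉₊)) -
      (originCost e η f t (box d k) - originCost e η f t (box d ⌈r⌉₊)) +
      (originCost e η f t (box d k) - Δ) := by ring
  rw [e1]
  refine (eLpNorm_add_le (((m _).sub (m _)).sub ((m _).sub (m _)))
    ((m _).sub hΔm.aestronglyMeasurable) (by norm_num)).trans ?_
  refine (add_le_add_left (eLpNorm_sub_le ((m _).sub (m _)) ((m _).sub (m _)) (by norm_num))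
    _).trans ?_
  rw [hη.eLpNorm_originCost_sub e hf (box_aligned _) hbW (zero_mem_box _),
    hη.eLpNorm_originCost_sub e hf (box_aligned _) hbk (zero_mem_box _)]
  calc _ ≤ ε / 4 + ε / 4 + ε / 4 := add_le_add (add_le_add (h _ W (Nat.le_ceil r) hbW)
        (h _ _ (Nat.le_ceil r) hbk)) hk1.le
    _ ≤ ε / 4 + ε / 4 + ε / 4 + ε / 4 := le_self_add
    _ = ε := by
        rw [show ε / 4 + ε / 4 + ε / 4 + ε / 4 = 4 * (ε / 4) by ring]
        exact ENNReal.mul_div_cancel (by norm_num) (by norm_num)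

lemma IsPoissonProcess.isLimitCost_of_tendsto (hη : IsPoissonProcess (intensity d lam) P η)
    (hf : Measurable f) (hstab : WeaklyStabilizing P e η f) (hmom : MomentCondition P e η f p)
    (hp : 2 < p) {t : unitInterval} {Δ : Ω × Marks → ℝ} (hΔm : Measurable Δ)
    (hΔ : Tendsto (fun k => eLpNorm (originCost e η f t (box d k) - Δ) 2 (P.prod markLaw)) atTop
        (𝓝 0)) : IsLimitCost P e η f t Δ := by
  refine ⟨hΔm, fun W hW => tendstoInMeasure_of_tendsto_eLpNorm (p := 2) (by norm_num)
    (fun n => hη.aestronglyMeasurable_originCost e hf _ t) hΔm.aestronglyMeasurable ?_⟩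
  rw [ENNReal.tendsto_nhds_zero]
  intro ε hε
  obtain ⟨r, hr, h⟩ := hη.exists_radius_limit e hf hstab hmom hp hε
  filter_upwards [hW r] with n hn
  exact h t Δ hΔm hΔ (W n) hn

/-- Limits in probability are almost surely unique, so every limit cost is a version of the mean
square limit. -/
lemma IsPoissonProcess.tendsto_of_isLimitCost (hη : IsPoissonProcess (intensity d lam) P η)
    (hf : Measurable f) (hstab : WeaklyStabilizing P e η f) (hmom : MomentCondition P e η f p)
    (hp : 2 < p) {t : unitInterval} {Δ : Ω × Marks → ℝ} (hΔ : IsLimitCost P e η f t Δ) :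
    Tendsto (fun k => eLpNorm (originCost e η f t (box d k) - Δ) 2 (P.prod markLaw)) atTop
        (𝓝 0) := by
  obtain ⟨Δ', hm, -, hΔ'⟩ := hη.exists_limitCost e hf hstab hmom hp t
  have h := tendstoInMeasure_ae_unique (hΔ.2 _ tendsToSpace_box)
    ((hη.isLimitCost_of_tendsto e hf hstab hmom hp hm hΔ').2 _ tendsToSpace_box)
  refine hΔ'.congr fun k => eLpNorm_congr_ae ?_
  filter_upwards [h] with z hz
  simp [hz]

end Stabilization

end MarkedPoisson

/-! ### Averages over the location of the root -/

namespace MarkedPoisson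

attribute [local instance] finiteConfigSigma

section Rooting

variable {d : ℕ}

lemma map_prod_rootAt {Y : Type*} [MeasurableSpace Y] {μ₀ : Measure Y} [SFinite μ₀]
    (μ : Measure (Loc d)) [IsProbabilityMeasure μ] :
    (μ.prod (μ₀.prod (graphLaw fun _ => μ))).map (fun p => (p.2.1, rootAt p.1 p.2.2)) =
      μ₀.prod (graphLaw fun _ => μ) := by
  refine Measure.ext fun s hs => ?_
  have hm : Measurable fun p : Loc d × Y × Field d => (p.2.1, rootAt p.1 p.2.2) :=
    Measurable.prodMk (by fun_prop) (measurable_rootAt.comp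
      (f := fun p : Loc d × Y × Field d => (p.1, p.2.2)) (by fun_prop))
  have h := lintegral_prod_graphLaw (μ₀ := μ₀) μ
    (F := s.indicator 1) (measurable_one.indicator hs)
  rw [lintegral_indicator_one hs] at h
  rw [h, Measure.map_apply hm hs, Measure.prod_apply (hm hs)]
  refine lintegral_congr fun z => ?_
  rw [lintegral_indicator_one hs, ← map_rootAt]
  have h2 := Measure.map_prod_map μ₀ (graphLaw fun _ => μ) measurable_id
    (measurable_rootAt.comp (f := fun θ : Field d => (z, θ)) (by fun_prop))
  rw [Measure.map_id] at h2
  change _ = (μ₀.prod (Measure.map (((fun p : Loc d × Field d => rootAt p.1 p.2)) ∘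
    fun θ : Field d => (z, θ)) _)) s
  rw [h2, Measure.map_apply _ hs]
  · rfl
  · exact measurable_id.prodMap (measurable_rootAt.comp (by fun_prop))

/-- Replacing the location of the additional vertex by a fresh independent one with the same law
changes nothing, so Fubini conditions on that location. -/
lemma integral_prod_graphLaw {Y : Type*} [MeasurableSpace Y] {μ₀ : Measure Y} [SFinite μ₀]
    (μ : Measure (Loc d)) [IsProbabilityMeasure μ] {F : Y × Field d → ℝ} (hFm : Measurable F)
    (hF : Integrable F (μ₀.prod (graphLaw fun _ => μ))) :
    Integrable (fun z => ∫ q, F q ∂(μ₀.prod (graphLaw (rootedFamily (Measure.dirac z) μ)))) μ ∧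
    ∫ q, F q ∂(μ₀.prod (graphLaw fun _ => μ)) =
      ∫ z, ∫ q, F q ∂(μ₀.prod (graphLaw (rootedFamily (Measure.dirac z) μ))) ∂μ := by
  have hm : Measurable fun p : Loc d × Y × Field d => (p.2.1, rootAt p.1 p.2.2) :=
    Measurable.prodMk (by fun_prop) (measurable_rootAt.comp
      (f := fun p : Loc d × Y × Field d => (p.1, p.2.2)) (by fun_prop))
  have hm2 : ∀ z : Loc d, Measurable fun q : Y × Field d => (q.1, rootAt z q.2) := fun z =>
    Measurable.prodMk (by fun_prop) (measurable_rootAt.comp (f := fun q : Y × Field d => (z, q.2))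
      (by fun_prop))
  have hin : ∀ z, ∫ q, F q ∂(μ₀.prod (graphLaw (rootedFamily (Measure.dirac z) μ))) =
      ∫ q, F (q.1, rootAt z q.2) ∂(μ₀.prod (graphLaw fun _ => μ)) := fun z => by
    have h2 := Measure.map_prod_map μ₀ (graphLaw fun _ => μ) measurable_id
      (measurable_rootAt.comp (f := fun θ : Field d => (z, θ)) (by fun_prop))
    have h3 : μ₀.prod (graphLaw (rootedFamily (Measure.dirac z) μ)) =
        (μ₀.prod (graphLaw fun _ => μ)).map fun q => (q.1, rootAt z q.2) := by
      rw [Measure.map_id] at h2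
      rw [← map_rootAt]
      exact h2
    rw [h3, integral_map (hm2 z).aemeasurable hFm.aestronglyMeasurable]
  have hI : Integrable (fun p : Loc d × Y × Field d => F (p.2.1, rootAt p.1 p.2.2))
      (μ.prod (μ₀.prod (graphLaw fun _ => μ))) := by
    rw [← map_prod_rootAt, integrable_map_measure hFm.aestronglyMeasurable hm.aemeasurable] at hF
    exact hF
  simp only [hin]
  refine ⟨hI.integral_prod_left, ?_⟩
  conv_lhs => rw [← map_prod_rootAt, integral_map hm.aemeasurable hFm.aestronglyMeasurable]
  exact integral_prod _ hI

/-- A graph with a root at `x` is a translated graph with a root at the origin. -/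
lemma map_shiftField_rootedLaw (W : Cube d) (x : Loc d) :
    (rootedLaw (W.shift (-x))).map (shiftField x) =
      graphLaw (rootedFamily (Measure.dirac x) (cubeLaw W)) := by
  refine map_shiftField x fun i => ?_
  rcases i with _ | i
  · change (Measure.dirac (0 : Loc d)).map _ = Measure.dirac x
    rw [Measure.map_dirac' (by fun_prop), add_zero]
  · change (cubeLaw (W.shift (-x))).map _ = cubeLaw W
    rw [map_cubeLaw]
    congr 1
    simp [Cube.shift]

lemma prod_rootedFamily {Y : Type*} [MeasurableSpace Y] (μ₀ : Measure Y) [SFinite μ₀] (W : Cube d)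
    (x : Loc d) : μ₀.prod (graphLaw (rootedFamily (Measure.dirac x) (cubeLaw W))) =
      (μ₀.prod (rootedLaw (W.shift (-x)))).map fun q => (q.1, shiftField x q.2) := by
  have h := Measure.map_prod_map μ₀ (rootedLaw (W.shift (-x))) measurable_id
    (measurable_shiftField x)
  rw [Measure.map_id, map_shiftField_rootedLaw] at h
  exact h

variable {g : Finset (MarkedEdge d) → ℝ}

lemma starCost_shiftField (x : Loc d) (I : Finset Vertex) (θ : Field d) :
    starCost randomGraph g I (shiftField x θ) =
      starCost randomGraph (fun A => g (translate x A)) I θ := by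
  simp only [starCost, randomGraph_shiftField]

lemma measurable_starCost_prod {Y : Type*} [MeasurableSpace Y] [Countable Y]
    [MeasurableSingletonClass Y] (hg : Measurable g) (I : Y → Finset Vertex) :
    Measurable fun q : Y × Field d => starCost randomGraph g (I q.1) q.2 :=
  measurable_from_prod_countable_right fun n =>
    (exchangeableAt_randomGraph (δ := Measure.dirac 0)
      (μ := Measure.dirac 0)).measurable_starCost hg (I n)

/-- By translation invariance a root at `x` in `W` may be moved to the origin, with `W` replaced by
its translate by `-x`. -/
lemma resampled_shift (hg : Measurable g) (hti : TranslationInvariant g) (m : ℝ≥0) (W : Cube d)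
    (x : Loc d) (t : unitInterval) :
    resampled m (graphLaw (rootedFamily (Measure.dirac x) (cubeLaw W))) randomGraph g t =
      resampled m (rootedLaw (W.shift (-x))) randomGraph g t := by
  have hinv : (fun A => g (translate x A)) = g := funext fun A => hti x A
  rw [resampled, prod_rootedFamily, integral_map]
  · simp only [starCost_shiftField, hinv, resampled]
  · exact (Measurable.prodMk measurable_fst
      ((measurable_shiftField x).comp measurable_snd)).aemeasurable
  · exact ((measurable_starCost_prod hg fun n : ℕ × ℕ × ℕ => comb 1 n.1 n.2.1).mul
      (measurable_starCost_prod hg fun n : ℕ × ℕ × ℕ => comb 2 n.1 n.2.2)).aestronglyMeasurable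

lemma costNorm_shift (hg : Measurable g) (lam : ℝ≥0) (W : Cube d) (x : Loc d) :
    costNorm (mass lam W) (graphLaw (rootedFamily (Measure.dirac x) (cubeLaw W))) randomGraph g =
      rootedNorm lam (W.shift (-x)) fun A => g (translate x A) := by
  rw [costNorm, prod_rootedFamily, eLpNorm_map_measure]
  · rw [rootedNorm, costNorm, mass_shift]
    congr 1
    ext1 q
    exact starCost_shiftField x _ _
  · exact (measurable_starCost_prod hg _).aestronglyMeasurable
  · exact (Measurable.prodMk measurable_fst
      ((measurable_shiftField x).comp measurable_snd)).aemeasurable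

lemma costNorm_sq {Θ 𝒢 : Type*} [MeasurableSpace Θ] (m : ℝ≥0) (ν : Measure Θ)
    (G : Finset Vertex → Θ → 𝒢) (g : 𝒢 → ℝ) : costNorm m ν G g ^ 2 =
      ∫⁻ q : ℕ × Θ, ‖starCost G g (cls 0 q.1) q.2‖ₑ ^ 2 ∂((poissonMeasure m).prod ν) := by
  rw [costNorm, eLpNorm_eq_lintegral_rpow_enorm_toReal (by norm_num) (by norm_num)]
  simp only [ENNReal.toReal_ofNat, one_div]
  rw [← ENNReal.rpow_natCast, ← ENNReal.rpow_mul]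
  norm_num

lemma lintegral_costNorm_sq (hg : Measurable g) (m : ℝ≥0) (μ : Measure (Loc d))
    [IsProbabilityMeasure μ] : costNorm m (graphLaw fun _ => μ) randomGraph g ^ 2 =
      ∫⁻ x, costNorm m (graphLaw (rootedFamily (Measure.dirac x) μ)) randomGraph g ^ 2 ∂μ := by
  simp only [costNorm_sq]
  exact lintegral_prod_graphLaw μ ((measurable_starCost_prod hg _).enorm.pow_const 2)

end Rooting

section Averages

variable {d : ℕ}

/-- The points of a cube whose distance to the boundary is at least `r`. -/
def Cube.inner (W : Cube d) (r : ℝ) : Set (Loc d) :=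
  {x | ∀ i, W.corner i + r ≤ x i ∧ x i < W.corner i + W.side - r}

lemma Cube.inner_eq {W : Cube d} {r : ℝ} (h : 2 * r < W.side) :
    ∃ V : Cube d, V.toSet = W.inner r ∧ V.side = W.side - 2 * r := by
  refine ⟨⟨W.corner + WithLp.toLp 2 fun _ => r, W.side - 2 * r, by linarith⟩, ?_, rfl⟩
  ext x
  simp only [Cube.toSet, Cube.inner, Set.mem_ofPred_eq, PiLp.add_apply]
  refine forall_congr' fun i => and_congr Iff.rfl ?_
  rw [show W.corner i + r + (W.side - 2 * r) = W.corner i + W.side - r by ring]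

lemma Cube.closedBall_subset_of_inner {W : Cube d} {r : ℝ} {x : Loc d} (hx : x ∈ W.inner r) :
    Metric.closedBall 0 r ⊆ (W.shift (-x)).toSet := by
  intro y hy
  rw [mem_closedBall_zero_iff] at hy
  rw [Cube.mem_shift, neg_neg]
  intro i
  have h1 := abs_le.1 ((abs_apply_le_norm y i).trans hy)
  have h2 := hx i
  rw [PiLp.add_apply]
  constructor <;> linarith

lemma Cube.inner_subset (W : Cube d) {r : ℝ} (hr : 0 ≤ r) : W.inner r ⊆ W.toSet := fun x hx i => by
  have := hx i
  constructor <;> linarith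

lemma Cube.measurableSet_inner (W : Cube d) (r : ℝ) : MeasurableSet (W.inner r) := by
  have : W.inner r = ⋂ i, {x : Loc d | W.corner i + r ≤ x i ∧ x i < W.corner i + W.side - r} := by
    ext; simp [Cube.inner]
  rw [this]
  refine .iInter fun i => ?_
  have hi : Measurable fun y : Loc d => y i := by fun_prop
  exact (measurableSet_le measurable_const hi).inter (measurableSet_lt hi measurable_const)

lemma Cube.zero_mem_shift {W : Cube d} {x : Loc d} (hx : x ∈ W.toSet) :
    (0 : Loc d) ∈ (W.shift (-x)).toSet := by
  rw [Cube.mem_shift, neg_neg, add_zero]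
  exact hx

lemma cubeLaw_real (W : Cube d) {G : Set (Loc d)} (hGW : G ⊆ W.toSet) :
    (cubeLaw W).real G = volume.real G / W.side ^ d := by
  rw [cubeLaw, Measure.real, cond_apply W.measurableSet, Set.inter_eq_self_of_subset_right hGW,
    ENNReal.toReal_mul, ENNReal.toReal_inv, ← Measure.real, W.volume_real, ← Measure.real]
  ring

lemma cubeLaw_real_inner {W : Cube d} {r : ℝ} (hr : 0 ≤ r) (h : 2 * r < W.side) :
    (cubeLaw W).real (W.inner r) = ((W.side - 2 * r) / W.side) ^ d := by
  obtain ⟨V, hV, hs⟩ := Cube.inner_eq h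
  rw [cubeLaw_real W (W.inner_subset hr), ← hV, V.volume_real, hs, div_pow]

/-- A bound for an average from a bound on a large part. -/
lemma abs_integral_le_of_le_on {X : Type*} [MeasurableSpace X] {μ : Measure X}
    [IsProbabilityMeasure μ] {h : X → ℝ} {ε C : ℝ} {G : Set X} (hG : MeasurableSet G)
    (hε : 0 ≤ ε)
    (h1 : ∀ x ∈ G, |h x| ≤ ε) (h2 : ∀ᵐ x ∂μ, |h x| ≤ C) :
    |∫ x, h x ∂μ| ≤ ε + C * (1 - μ.real G) := by
  have hi : Integrable (fun x => ε + Gᶜ.indicator (fun _ => C) x) μ :=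
    (integrable_const ε).add ((integrable_const C).indicator hG.compl)
  have hb : |∫ x, h x ∂μ| ≤ ∫ x, (ε + Gᶜ.indicator (fun _ => C) x) ∂μ := by
    rw [← Real.norm_eq_abs]
    refine norm_integral_le_of_norm_le hi ?_
    filter_upwards [h2] with x hx
    by_cases hxG : x ∈ G
    · simpa [hxG] using h1 x hxG
    · simp only [Set.mem_compl_iff, hxG, not_false_eq_true, Set.indicator_of_mem, Real.norm_eq_abs]
      linarith
  refine hb.trans (le_of_eq ?_)
  rw [integral_add (integrable_const ε) ((integrable_const C).indicator hG.compl),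
    integral_indicator_const _ hG.compl, integral_const, probReal_univ, one_smul, smul_eq_mul,
    probReal_compl_eq_one_sub hG]
  ring

lemma TendsToSpace.tendsto_side [NeZero d] {W : ℕ → Cube d} (hW : TendsToSpace W) :
    Tendsto (fun n => (W n).side) atTop atTop := by
  rw [tendsto_atTop]
  intro b
  filter_upwards [hW |b|] with n hn
  have h1 : EuclideanSpace.single (0 : Fin d) |b| ∈ (W n).toSet := hn (by simp)
  have h2 : EuclideanSpace.single (0 : Fin d) (-|b|) ∈ (W n).toSet := hn (by simp)
  have h3 := h1 0
  have h4 := h2 0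
  simp only [PiLp.single_apply, if_true] at h3 h4
  have := le_abs_self b
  have := abs_nonneg b
  linarith

lemma tendsto_inner_fraction [NeZero d] {W : ℕ → Cube d} (hW : TendsToSpace W) {r : ℝ}
    (hr : 0 ≤ r) : Tendsto (fun n => (cubeLaw (W n)).real ((W n).inner r)) atTop (𝓝 1) := by
  have hs := hW.tendsto_side
  have h1 : Tendsto (fun n => (((W n).side - 2 * r) / (W n).side) ^ d) atTop (𝓝 ((1 - 0) ^ d)) := by
    refine Tendsto.pow ?_ d
    have h2 : Tendsto (fun n => 1 - 2 * r / (W n).side) atTop (𝓝 (1 - 0)) :=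
      tendsto_const_nhds.sub (hs.const_div_atTop (2 * r))
    refine h2.congr fun n => ?_
    rw [sub_div, div_self (W n).side_pos.ne']
  rw [sub_zero, one_pow] at h1
  refine h1.congr' ?_
  filter_upwards [hs.eventually_gt_atTop (2 * r)] with n hn
  exact (cubeLaw_real_inner hr hn).symm

end Averages

end MarkedPoisson

/-! ### The limit of the variance -/

namespace MarkedPoisson

attribute [local instance] finiteConfigSigma

section SquareNorms

variable {X : Type*} {m m0 : MeasurableSpace X} {μ : Measure[m0] X}

lemma ofReal_integral_sq {Z : X → ℝ} (h : MemLp Z 2 μ) :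
    ENNReal.ofReal (∫ x, Z x ^ 2 ∂μ) = eLpNorm Z 2 μ ^ 2 := by
  rw [ofReal_integral_eq_lintegral_ofReal h.integrable_sq (ae_of_all _ fun _ => sq_nonneg _),
    eLpNorm_eq_lintegral_rpow_enorm_toReal (by norm_num) (by norm_num)]
  simp only [ENNReal.toReal_ofNat, one_div]
  rw [← ENNReal.rpow_natCast, ← ENNReal.rpow_mul]
  norm_num
  refine lintegral_congr fun q => ?_
  rw [Real.enorm_eq_ofReal_abs, ← ENNReal.ofReal_pow (abs_nonneg _), sq_abs]

lemma integral_sq_eq_eLpNorm {Z : X → ℝ} (h : MemLp Z 2 μ) :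
    ∫ x, Z x ^ 2 ∂μ = (eLpNorm Z 2 μ).toReal ^ 2 := by
  rw [← ENNReal.toReal_pow, ← ofReal_integral_sq h,
    ENNReal.toReal_ofReal (integral_nonneg fun _ => sq_nonneg _)]

lemma integral_sq_le {Z : X → ℝ} (h : MemLp Z 2 μ) {C : ℝ≥0} (hC : eLpNorm Z 2 μ ≤ C) :
    ∫ x, Z x ^ 2 ∂μ ≤ C ^ 2 := by
  rw [integral_sq_eq_eLpNorm h]
  gcongr
  exact ENNReal.toReal_le_coe_of_le_coe hC

/-- Conditional expectation contracts the `L²` norm, and the squares of two norms differ by the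
product of their sum and their difference. -/
lemma abs_integral_condExp_sq_sub_le [IsProbabilityMeasure μ] {Y Z : X → ℝ} (hY : MemLp Y 2 μ)
    (hZ : MemLp Z 2 μ) {C ε : ℝ≥0} (hYC : eLpNorm Y 2 μ ≤ C) (hZC : eLpNorm Z 2 μ ≤ C)
    (h : eLpNorm (Y - Z) 2 μ ≤ ε) :
    |∫ x, (μ[Y | m]) x ^ 2 ∂μ - ∫ x, (μ[Z | m]) x ^ 2 ∂μ| ≤ 2 * C * ε := by
  have hY' : MemLp (μ[Y | m]) 2 μ := hY.condExp (by norm_num)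
  have hZ' : MemLp (μ[Z | m]) 2 μ := hZ.condExp (by norm_num)
  rw [integral_sq_eq_eLpNorm hY', integral_sq_eq_eLpNorm hZ']
  have hsub : μ[Y - Z | m] =ᵐ[μ] μ[Y | m] - μ[Z | m] :=
    condExp_sub (hY.integrable (by norm_num)) (hZ.integrable (by norm_num)) m
  have hd : eLpNorm (μ[Y | m] - μ[Z | m]) 2 μ ≤ ε := by
    rw [← eLpNorm_congr_ae hsub]
    exact (eLpNorm_condExp_le_eLpNorm _ (by norm_num)).trans h
  have h1 : eLpNorm (μ[Y | m]) 2 μ ≤ eLpNorm (μ[Z | m]) 2 μ + ε := by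
    calc _ = eLpNorm (μ[Z | m] + (μ[Y | m] - μ[Z | m])) 2 μ := by rw [add_sub_cancel]
      _ ≤ _ := (eLpNorm_add_le hZ'.1 (hY'.1.sub hZ'.1) (by norm_num)).trans (by gcongr)
  have h2 : eLpNorm (μ[Z | m]) 2 μ ≤ eLpNorm (μ[Y | m]) 2 μ + ε := by
    calc _ = eLpNorm (μ[Y | m] - (μ[Y | m] - μ[Z | m])) 2 μ := by rw [sub_sub_cancel]
      _ ≤ _ := (eLpNorm_sub_le hY'.1 (hY'.1.sub hZ'.1) (by norm_num)).trans (by gcongr)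
  have h3 : eLpNorm (μ[Y | m]) 2 μ ≤ C := (eLpNorm_condExp_le_eLpNorm _ (by norm_num)).trans hYC
  have h4 : eLpNorm (μ[Z | m]) 2 μ ≤ C := (eLpNorm_condExp_le_eLpNorm _ (by norm_num)).trans hZC
  lift eLpNorm (μ[Y | m]) 2 μ to ℝ≥0 using hY'.2.ne with y
  lift eLpNorm (μ[Z | m]) 2 μ to ℝ≥0 using hZ'.2.ne with z
  norm_cast at h1 h2 h3 h4
  have h1' : (y : ℝ) ≤ z + ε := by exact_mod_cast h1
  have h2' : (z : ℝ) ≤ y + ε := by exact_mod_cast h2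
  have h3' : (y : ℝ) ≤ C := by exact_mod_cast h3
  have h4' : (z : ℝ) ≤ C := by exact_mod_cast h4
  simp only [ENNReal.coe_toReal]
  have e1 : (y : ℝ) ^ 2 - z ^ 2 = (y + z) * (y - z) := by ring
  rw [e1, abs_mul, abs_of_nonneg (by positivity)]
  refine mul_le_mul (by linarith) (abs_le.2 ⟨by linarith, by linarith⟩) (abs_nonneg _)
    (by positivity)

end SquareNorms

section VarianceLimit

variable {d : ℕ} [NeZero d] (e : ℕ ≃ (Fin d → ℤ)) {Ω : Type*} [MeasurableSpace Ω] {P : Measure Ω}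
  [IsProbabilityMeasure P] {lam : ℝ≥0} {η : Ω → Set (Pt d)} {f : Finset (MarkedEdge d) → ℝ}
  {p : ℝ}

/-- The graph of independent uniform points of a cube. -/
abbrev uniformLaw (W : Cube d) : Measure (Field d) := graphLaw fun _ => cubeLaw W

/-- The squared norm is an average over the location of the root; each location can be moved to the
origin of a translated cube, where the uniform bound applies. -/
lemma TranslationInvariant.costNorm_le (hti : TranslationInvariant f) (hf : Measurable f)
    {C : ℝ≥0} (hC : ∀ W : Cube d, (0 : Loc d) ∈ W.toSet → rootedNorm lam W f ≤ C) (W : Cube d) :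
    costNorm (mass lam W) (uniformLaw W) randomGraph f ≤ C := by
  have h : costNorm (mass lam W) (uniformLaw W) randomGraph f ^ 2 ≤ (C : ℝ≥0∞) ^ 2 := by
    rw [lintegral_costNorm_sq hf]
    refine (lintegral_mono_ae (g := fun _ => (C : ℝ≥0∞) ^ 2) ?_).trans (by simp)
    filter_upwards [ae_mem_cubeLaw W] with x hx
    rw [costNorm_shift hf, funext fun A => hti x A]
    gcongr
    exact hC _ (Cube.zero_mem_shift hx)
  exact (ENNReal.pow_le_pow_left_iff (by norm_num)).1 h

lemma IsPoissonProcess.identDistrib_value (hη : IsPoissonProcess (intensity d lam) P η)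
    {g : Finset (MarkedEdge d) → ℝ} (hg : Measurable g) (W : Cube d) :
    IdentDistrib (fun ω => g (genericGraph e (conf η W Set.univ ω)))
      (fun q : ℕ × Field d => g (randomGraph (cls 0 q.1) q.2)) P
      ((poissonMeasure (mass lam W)).prod (uniformLaw W)) := by
  have h : IdentDistrib (fun ω => genericGraph e (conf η W Set.univ ω))
      (fun q : ℕ × Field d => randomGraph (cls 0 q.1) q.2) P
      ((poissonMeasure (mass lam W)).prod (uniformLaw W)) :=
    ⟨((measurable_genericGraph e).comp
      (hη.measurable_conf_slab W MeasurableSet.univ)).aemeasurable,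
      (measurable_from_prod_countable_right fun n =>
        measurable_randomGraph (cls 0 n)).aemeasurable, hη.map_valueGraph e W⟩
  exact h.comp hg

lemma IsPoissonProcess.value_ae_eq (hη : IsPoissonProcess (intensity d lam) P η) (W : Cube d) :
    value e η f W =ᵐ[P] fun ω => f (genericGraph e (conf η W Set.univ ω)) := by
  filter_upwards [hη.ae_generic_conf e W] with ω hω
  rw [genericGraph_of_generic e hω, value_eq e ω W (hη.finite_slab W _ _)]

lemma IsPoissonProcess.memLp_value (hη : IsPoissonProcess (intensity d lam) P η)
    (hf : Measurable f) {W : Cube d} (hc : FiniteCost (mass lam W) (uniformLaw W) randomGraph f) :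
    MemLp (value e η f W) 2 P :=
  (memLp_congr_ae (hη.value_ae_eq e W)).2 ((hη.identDistrib_value e hf W).memLp_iff.2
    (fullyExchangeable_randomGraph.memLp hf hc))

lemma IsPoissonProcess.variance_value (hη : IsPoissonProcess (intensity d lam) P η)
    (hf : Measurable f) {W : Cube d} (hc : FiniteCost (mass lam W) (uniformLaw W) randomGraph f) :
    variance (value e η f W) P =
      mass lam W * ∫ t, resampled (mass lam W) (uniformLaw W) randomGraph f t := by
  rw [variance_congr (hη.value_ae_eq e W), (hη.identDistrib_value e hf W).variance_eq]
  exact fullyExchangeable_randomGraph.variance_eq hf hc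

/-- The resampled correlation in a cube is an average over the location of the root. -/
lemma TranslationInvariant.resampled_uniformLaw (hti : TranslationInvariant f) (hf : Measurable f)
    {W : Cube d} (hc : FiniteCost (mass lam W) (uniformLaw W) randomGraph f) (t : unitInterval) :
    Integrable (fun x => resampled (mass lam W) (rootedLaw (W.shift (-x))) randomGraph f t)
      (cubeLaw W) ∧
    resampled (mass lam W) (uniformLaw W) randomGraph f t =
      ∫ x, resampled (mass lam W) (rootedLaw (W.shift (-x))) randomGraph f t ∂(cubeLaw W) := by
  have h := integral_prod_graphLaw (μ₀ := mixLaw (mass lam W) t) (cubeLaw W)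
    ((measurable_starCost_prod hf fun n : ℕ × ℕ × ℕ => comb 1 n.1 n.2.1).mul
      (measurable_starCost_prod hf fun n : ℕ × ℕ × ℕ => comb 2 n.1 n.2.2))
    (fullyExchangeable_randomGraph.exchangeableAt.integrable_mul hf hc t)
  have e1 : ∀ x, resampled (mass lam W) (rootedLaw (W.shift (-x))) randomGraph f t =
      resampled (mass lam W) (graphLaw (rootedFamily (Measure.dirac x) (cubeLaw W)))
        randomGraph f t := fun x => (resampled_shift hf hti _ W x t).symm
  simp only [e1]
  exact h

/-- The second moment of the conditional expectation given the history. -/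
def historyMoment (P : Measure Ω) (η : Ω → Set (Pt d)) (t : unitInterval) (X : Ω × Marks → ℝ) : ℝ :=
  ∫ z, condHistory P η t X z ^ 2 ∂(P.prod markLaw)

lemma historyMoment_nonneg (t : unitInterval) (X : Ω × Marks → ℝ) : 0 ≤ historyMoment P η t X :=
  integral_nonneg fun _ => sq_nonneg _

lemma ExchangeableAt.abs_resampled_le_of_costNorm {W : Cube d} (hf : Measurable f) {C : ℝ≥0}
    (hC : rootedNorm lam W f ≤ C) (t : unitInterval) :
    |resampled (mass lam W) (rootedLaw W) randomGraph f t| ≤ C ^ 2 := by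
  have hE := exchangeableAt_randomGraph (δ := Measure.dirac (0 : Loc d)) (μ := cubeLaw W)
  have hc : FiniteCost (mass lam W) (rootedLaw W) randomGraph f :=
    hE.finiteCost_of_costNorm hf (hC.trans_lt ENNReal.coe_lt_top).ne
  exact (hE.abs_resampled_le hf hc t).trans (integral_sq_le hc hC)

lemma IsPoissonProcess.memLp_originCost (hη : IsPoissonProcess (intensity d lam) P η)
    (hf : Measurable f) {C : ℝ≥0}
    {W : Cube d} (h0 : (0 : Loc d) ∈ W.toSet) (hC : rootedNorm lam W f ≤ C) (t : unitInterval) :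
    MemLp (originCost e η f t W) 2 (P.prod markLaw) ∧
      eLpNorm (originCost e η f t W) 2 (P.prod markLaw) ≤ C := by
  rw [← hη.eLpNorm_originCost e hf h0 t] at hC
  exact ⟨⟨hη.aestronglyMeasurable_originCost e hf W t, hC.trans_lt ENNReal.coe_lt_top⟩, hC⟩

/-- Fatou's lemma along an almost surely convergent subsequence. -/
lemma IsPoissonProcess.memLp_limitCost (hη : IsPoissonProcess (intensity d lam) P η)
    (hf : Measurable f) {C : ℝ≥0} (hC : ∀ W : Cube d, (0 : Loc d) ∈ W.toSet → rootedNorm lam W f ≤ C)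
    {t : unitInterval} {Δ : Ω × Marks → ℝ} (hΔ : IsLimitCost P e η f t Δ) :
    MemLp Δ 2 (P.prod markLaw) ∧ eLpNorm Δ 2 (P.prod markLaw) ≤ C := by
  obtain ⟨ns, -, hns⟩ := (hΔ.2 _ tendsToSpace_box).exists_seq_tendsto_ae
  have h : eLpNorm Δ 2 (P.prod markLaw) ≤ C := by
    refine (Lp.eLpNorm_lim_le_liminf_eLpNorm
      (fun n => hη.aestronglyMeasurable_originCost e hf _ t) Δ hns).trans ?_
    exact liminf_le_of_le (by isBoundedDefault) fun b hb' => (hb'.exists.choose_spec).trans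
      (hη.memLp_originCost e hf (zero_mem_box _) (hC _ (zero_mem_box _)) t).2
  exact ⟨⟨hΔ.1.aestronglyMeasurable, h.trans_lt ENNReal.coe_lt_top⟩, h⟩

/-- The resampled correlations converge, uniformly over large cubes and over the birth time. -/
lemma IsPoissonProcess.exists_radius_resampled (hη : IsPoissonProcess (intensity d lam) P η)
    (hf : Measurable f) (hstab : WeaklyStabilizing P e η f) (hmom : MomentCondition P e η f p)
    (hp : 2 < p) {ε : ℝ} (hε : 0 < ε) :
    ∃ r : ℝ, 0 ≤ r ∧ ∀ (t : unitInterval), 0 < t → t < 1 → ∀ (Δ : Ω × Marks → ℝ),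
      IsLimitCost P e η f t Δ → ∀ W : Cube d, Metric.closedBall 0 r ⊆ W.toSet →
      |resampled (mass lam W) (rootedLaw W) randomGraph f t - historyMoment P η t Δ| ≤ ε := by
  obtain ⟨C, hC⟩ := hη.exists_rootedNorm_le e hf hmom hp
  -- Chosen so that the bound `2 C δ` of `abs_integral_condExp_sq_sub_le` is at most `ε`; the added
  -- one covers `C = 0`.
  have hδ : 0 < ε / (2 * (C + 1)) := by positivity
  obtain ⟨δ, hδε⟩ : ∃ δ : ℝ≥0, (δ : ℝ) = ε / (2 * (C + 1)) := ⟨⟨_, hδ.le⟩, rfl⟩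
  rw [← hδε] at hδ
  obtain ⟨r, hr, h⟩ := hη.exists_radius_limit e hf hstab hmom hp
    (ε := (δ : ℝ≥0∞)) (by exact_mod_cast hδ)
  refine ⟨r, hr, fun t ht0 ht1 Δ hΔ W hW => ?_⟩
  have h0 := zero_mem_of_closedBall_subset hr hW
  obtain ⟨hL, hLC⟩ := hη.memLp_originCost e hf h0 (hC W h0) t
  obtain ⟨hD, hDC⟩ := hη.memLp_limitCost e hf hC hΔ
  rw [← hη.integral_condHistory_sq e hf W ht0 ht1 hL]
  refine (abs_integral_condExp_sq_sub_le hL hD hLC hDC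
    (h t Δ hΔ.1 (hη.tendsto_of_isLimitCost e hf hstab hmom hp hΔ) W hW)).trans ?_
  have hC0 : (0 : ℝ) ≤ C := C.2
  rw [hδε, ← mul_div_assoc, div_le_iff₀ (by positivity)]
  nlinarith

lemma ae_mem_Ioo_unitInterval : ∀ᵐ t : unitInterval, 0 < t ∧ t < 1 := by
  have h0 : ∀ᵐ t : unitInterval, t ≠ 0 := by
    rw [ae_iff]; simp
  have h1 : ∀ᵐ t : unitInterval, t ≠ 1 := by
    rw [ae_iff]; simp
  filter_upwards [h0, h1] with t ht0 ht1
  exact ⟨unitInterval.pos_iff_ne_zero.2 ht0, unitInterval.lt_one_iff_ne_one.2 ht1⟩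

/-- The limits `Δ t` are chosen separately for each `t`, so measurability in `t` is not automatic.
It holds because the moments are almost everywhere limits of the continuous resampled correlations
in boxes. -/
lemma IsPoissonProcess.integrable_historyMoment (hη : IsPoissonProcess (intensity d lam) P η)
    (hf : Measurable f) (hstab : WeaklyStabilizing P e η f) (hmom : MomentCondition P e η f p)
    (hp : 2 < p) {Δ : unitInterval → Ω × Marks → ℝ} (hΔ : ∀ t, IsLimitCost P e η f t (Δ t)) :
    Integrable fun t => historyMoment P η t (Δ t) := by
  obtain ⟨C, hC⟩ := hη.exists_rootedNorm_le e hf hmom hp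
  have hcont : ∀ k, Continuous
      (resampled (mass lam (box d k)) (rootedLaw (box d k)) randomGraph f) := fun k => by
    have hE := exchangeableAt_randomGraph (δ := Measure.dirac (0 : Loc d)) (μ := cubeLaw (box d k))
    exact hE.continuous_resampled hf (hE.finiteCost_of_costNorm hf
      ((hC _ (zero_mem_box k)).trans_lt ENNReal.coe_lt_top).ne)
  have hlim : ∀ᵐ t : unitInterval, Tendsto
      (fun k => resampled (mass lam (box d k)) (rootedLaw (box d k)) randomGraph f t) atTop
      (𝓝 (historyMoment P η t (Δ t))) := by
    filter_upwards [ae_mem_Ioo_unitInterval] with t ht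
    rw [Metric.tendsto_atTop']
    intro ε hε
    obtain ⟨r, hr, h⟩ := hη.exists_radius_resampled e hf hstab hmom hp (half_pos hε)
    refine ⟨⌈r⌉₊, fun k hk => ?_⟩
    rw [Real.dist_eq]
    refine (h t ht.1 ht.2 (Δ t) (hΔ t) _ (closedBall_subset_box ((Nat.le_ceil r).trans
      (by exact_mod_cast hk.le)))).trans_lt (by linarith)
  refine Integrable.mono' (integrable_const ((C : ℝ) ^ 2))
    (aestronglyMeasurable_of_tendsto_ae atTop (fun k => (hcont k).aestronglyMeasurable) hlim) ?_
  filter_upwards [hlim] with t ht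
  refine le_of_tendsto ht.norm (Eventually.of_forall fun k => ?_)
  exact ExchangeableAt.abs_resampled_le_of_costNorm hf (hC _ (zero_mem_box k)) t

/-- The limit of the variance. -/
lemma IsPoissonProcess.tendsto_variance (hη : IsPoissonProcess (intensity d lam) P η)
    (hf : Measurable f) (hstab : WeaklyStabilizing P e η f) (hmom : MomentCondition P e η f p)
    (hp : 2 < p) {Δ : unitInterval → Ω × Marks → ℝ} (hΔ : ∀ t, IsLimitCost P e η f t (Δ t))
    {W : ℕ → Cube d} (hW : TendsToSpace W) :
    Tendsto (fun n => variance (value e η f (W n)) P / volume.real (W n).toSet) atTop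
      (𝓝 (lam * ∫ t, historyMoment P η t (Δ t))) := by
  obtain ⟨C, hC⟩ := hη.exists_rootedNorm_le e hf hmom hp
  have hE := fun V : Cube d => (fullyExchangeable_randomGraph (μ := cubeLaw V)).exchangeableAt
  have hfin : ∀ V : Cube d, FiniteCost (mass lam V) (uniformLaw V) randomGraph f := fun V =>
    (hE V).finiteCost_of_costNorm hf ((hstab.1.costNorm_le hf hC V).trans_lt ENNReal.coe_lt_top).ne
  have hvar : ∀ n, variance (value e η f (W n)) P / volume.real (W n).toSet =
      lam * ∫ t, resampled (mass lam (W n)) (uniformLaw (W n)) randomGraph f t := fun n => by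
    have hv := (W n).volume_real_pos.ne'
    rw [hη.variance_value e hf (hfin _), mass_coe]
    field_simp
  simp only [hvar]
  refine Tendsto.const_mul _ ?_
  rw [Metric.tendsto_atTop]
  intro ε hε
  obtain ⟨r, hr, h⟩ := hη.exists_radius_resampled e hf hstab hmom hp (half_pos hε)
  -- Roots at distance at least `r` from the boundary contribute an error of at most `ε / 2`. The
  -- others contribute at most `2 C²` each, and their fraction tends to zero.
  have hfr : Tendsto (fun n => ε / 2 + 2 * (C : ℝ) ^ 2 *
      (1 - (cubeLaw (W n)).real ((W n).inner r))) atTop (𝓝 (ε / 2 + 2 * (C : ℝ) ^ 2 * (1 - 1))) :=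
    ((tendsto_const_nhds.sub (tendsto_inner_fraction hW hr)).const_mul _).const_add _
  have hlt : ε / 2 + 2 * (C : ℝ) ^ 2 * (1 - 1) < ε := by linarith
  obtain ⟨N, hN⟩ := eventually_atTop.1 (hfr.eventually_lt_const hlt)
  refine ⟨N, fun n hn => lt_of_le_of_lt ?_ (hN n hn)⟩
  have hSi := hη.integrable_historyMoment e hf hstab hmom hp hΔ
  have hRi : Integrable (resampled (mass lam (W n)) (uniformLaw (W n)) randomGraph f) :=
    ((hE (W n)).continuous_resampled hf (hfin _)).integrable_of_hasCompactSupport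
      (HasCompactSupport.of_compactSpace _)
  rw [Real.dist_eq, ← integral_sub hRi hSi, ← Real.norm_eq_abs]
  refine (norm_integral_le_of_norm_le_const (μ := (volume : Measure unitInterval))
    (C := ε / 2 + 2 * (C : ℝ) ^ 2 *
    (1 - (cubeLaw (W n)).real ((W n).inner r))) ?_).trans_eq (by rw [probReal_univ, mul_one])
  filter_upwards [ae_mem_Ioo_unitInterval] with t ht
  obtain ⟨hi, heq⟩ := hstab.1.resampled_uniformLaw hf (hfin (W n)) t
  have hS : |historyMoment P η t (Δ t)| ≤ (C : ℝ) ^ 2 := by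
    obtain ⟨hD, hDC⟩ := hη.memLp_limitCost e hf hC (hΔ t)
    rw [abs_of_nonneg (historyMoment_nonneg t _)]
    exact integral_sq_le (hD.condExp (by norm_num))
      ((eLpNorm_condExp_le_eLpNorm _ (by norm_num)).trans hDC)
  have e2 : resampled (mass lam (W n)) (uniformLaw (W n)) randomGraph f t -
      historyMoment P η t (Δ t) = ∫ x, (resampled (mass lam (W n))
        (rootedLaw ((W n).shift (-x))) randomGraph f t - historyMoment P η t (Δ t))
        ∂(cubeLaw (W n)) := by
    rw [integral_sub hi (integrable_const _), heq, integral_const, probReal_univ, one_smul]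
  rw [Real.norm_eq_abs, e2]
  refine abs_integral_le_of_le_on ((W n).measurableSet_inner r) (by linarith) (fun x hx => ?_) ?_
  · have := h t ht.1 ht.2 (Δ t) (hΔ t) _ (Cube.closedBall_subset_of_inner hx)
    rwa [mass_shift] at this
  · filter_upwards [ae_mem_cubeLaw (W n)] with x hx
    have h3 := ExchangeableAt.abs_resampled_le_of_costNorm hf
      (hC _ (Cube.zero_mem_shift hx)) t
    rw [mass_shift] at h3
    exact (abs_sub _ _).trans (by linarith)

lemma varianceFormula_eq {Δ : unitInterval → Ω × Marks → ℝ}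
    (hΔ : ∀ t, MemLp (Δ t) 2 (P.prod markLaw))
    (hi : Integrable fun t => historyMoment P η t (Δ t)) :
    varianceFormula P lam η Δ = ENNReal.ofReal (lam * ∫ t, historyMoment P η t (Δ t)) := by
  rw [varianceFormula, ENNReal.ofReal_mul (NNReal.coe_nonneg lam), ofReal_integral_eq_lintegral_ofReal hi
    (ae_of_all _ fun t => integral_nonneg fun _ => sq_nonneg _)]
  congr 1
  · simp
  · refine lintegral_congr fun t => ?_
    have hL : MemLp (condHistory P η t (Δ t)) 2 (P.prod markLaw) := (hΔ t).condExp (by norm_num)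
    exact (ofReal_integral_eq_lintegral_ofReal hL.integrable_sq
      (ae_of_all _ fun _ => sq_nonneg _)).symm

end VarianceLimit

end MarkedPoisson

/-! ### Positivity of the limit variance -/

namespace MarkedPoisson

attribute [local instance] finiteConfigSigma

section Positivity

/-- An interval `(a, 1]` with `a < 1` has positive measure, so it meets every set of full measure.
This carries almost everywhere bounds over to the endpoint by continuity. -/
lemma one_mem_closure_of_ae {q : unitInterval → Prop} (h : ∀ᵐ t, q t) :
    (1 : unitInterval) ∈ closure {t | q t} := by
  rw [mem_closure_iff_nhds]
  intro U hU
  obtain ⟨a, ha, haU⟩ := exists_Ioc_subset_of_mem_nhds hU ⟨0, zero_lt_one⟩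
  have hpos : volume (Set.Ioc a 1) ≠ 0 := by
    rw [unitInterval.volume_Ioc]
    simpa using ha
  obtain ⟨t, ht, hq⟩ := (frequently_ae_mem_iff.2 hpos).and_eventually h |>.exists
  exact ⟨t, haU ht, hq⟩

variable {d : ℕ} [NeZero d] (e : ℕ ≃ (Fin d → ℤ)) {Ω : Type*} [MeasurableSpace Ω] {P : Measure Ω}
  [IsProbabilityMeasure P] {lam : ℝ≥0} {η : Ω → Set (Pt d)} {f : Finset (MarkedEdge d) → ℝ}
  {p : ℝ}

/-- If the limit of the variance vanishes, the add-one cost of a youngest point vanishes. -/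
lemma IsPoissonProcess.ae_eq_zero_of_integral_historyMoment
    (hη : IsPoissonProcess (intensity d lam) P η)
    (hf : Measurable f) (hstab : WeaklyStabilizing P e η f) (hmom : MomentCondition P e η f p)
    (hp : 2 < p) {Δ : unitInterval → Ω × Marks → ℝ} (hΔ : ∀ t, IsLimitCost P e η f t (Δ t))
    (h0 : ∫ t, historyMoment P η t (Δ t) = 0) : Δ 1 =ᵐ[P.prod markLaw] 0 := by
  obtain ⟨C, hC⟩ := hη.exists_rootedNorm_le e hf hmom hp
  have hS := (integral_eq_zero_iff_of_nonneg (fun t => historyMoment_nonneg t (Δ t))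
    (hη.integrable_historyMoment e hf hstab hmom hp hΔ)).1 h0
  have hE := fun k => exchangeableAt_randomGraph (δ := Measure.dirac (0 : Loc d))
    (μ := cubeLaw (box d k))
  have hfin : ∀ k, FiniteCost (mass lam (box d k)) (rootedLaw (box d k)) randomGraph f := fun k =>
    (hE k).finiteCost_of_costNorm hf ((hC _ (zero_mem_box k)).trans_lt ENNReal.coe_lt_top).ne
  have hlim : Tendsto (fun k => costMoment (mass lam (box d k)) (rootedLaw (box d k))
      randomGraph f) atTop (𝓝 0) := by
    rw [Metric.tendsto_atTop]
    intro ε hε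
    obtain ⟨r, hr, h⟩ := hη.exists_radius_resampled e hf hstab hmom hp (half_pos hε)
    refine ⟨⌈r⌉₊, fun k hk => ?_⟩
    have hae : ∀ᵐ t : unitInterval,
        resampled (mass lam (box d k)) (rootedLaw (box d k)) randomGraph f t ≤ ε / 2 := by
      filter_upwards [ae_mem_Ioo_unitInterval, hS] with t ht hSt
      have h1 := h t ht.1 ht.2 (Δ t) (hΔ t) _ (closedBall_subset_box ((Nat.le_ceil r).trans
        (by exact_mod_cast hk)))
      rw [show historyMoment P η t (Δ t) = 0 from hSt, sub_zero] at h1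
      exact (le_abs_self _).trans h1
    -- The correlation in the box is small for almost every `t`, hence by continuity at `t = 1`,
    -- where it is the second moment of the cost.
    have h1 := (isClosed_le ((hE k).continuous_resampled hf (hfin k))
      continuous_const).closure_subset (one_mem_closure_of_ae hae)
    rw [Set.mem_ofPred_eq, (hE k).resampled_one hf (hfin k)] at h1
    have h2 : 0 ≤ costMoment (mass lam (box d k)) (rootedLaw (box d k)) randomGraph f :=
      integral_nonneg fun _ => sq_nonneg _
    rw [Real.dist_eq, sub_zero, abs_of_nonneg h2]
    exact h1.trans_lt (half_lt_self hε)
  have hsq : Tendsto (fun k => rootedNorm lam (box d k) f ^ 2) atTop (𝓝 0) := by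
    have := (ENNReal.tendsto_ofReal hlim)
    rw [ENNReal.ofReal_zero] at this
    exact this.congr fun k => (hfin k).ofReal_costMoment
  have hnorm : Tendsto (fun k => rootedNorm lam (box d k) f) atTop (𝓝 0) := by
    have := (ENNReal.continuous_rpow_const (y := 1 / 2)).tendsto 0 |>.comp hsq
    rw [ENNReal.zero_rpow_of_pos (by norm_num)] at this
    refine this.congr fun k => ?_
    rw [Function.comp_apply, ← ENNReal.rpow_natCast, ← ENNReal.rpow_mul]
    norm_num
  have hsum := hnorm.add (hη.tendsto_of_isLimitCost e hf hstab hmom hp (hΔ 1))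
  rw [add_zero] at hsum
  have hz : eLpNorm (Δ 1) 2 (P.prod markLaw) = 0 := by
    refine le_antisymm (ge_of_tendsto hsum (Eventually.of_forall fun k => ?_)) zero_le
    have hm := hη.aestronglyMeasurable_originCost e hf (box d k) 1
    rw [← hη.eLpNorm_originCost e hf (zero_mem_box k) 1]
    calc eLpNorm (Δ 1) 2 (P.prod markLaw) = eLpNorm (originCost e η f 1 (box d k) -
          (originCost e η f 1 (box d k) - Δ 1)) 2 (P.prod markLaw) := by rw [sub_sub_cancel]
      _ ≤ _ := eLpNorm_sub_le hm (hm.sub (hΔ 1).1.aestronglyMeasurable) (by norm_num)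
  exact (eLpNorm_eq_zero_iff (hΔ 1).1.aestronglyMeasurable (by norm_num)).1 hz

end Positivity

end MarkedPoisson

/-! ### Characteristic functions and approximation -/

namespace MarkedPoisson

section CharacteristicFunctions

variable {Ω : Type*} [MeasurableSpace Ω] {P : Measure Ω} [IsProbabilityMeasure P]

/-- The Cauchy–Schwarz inequality, obtained from the nonnegativity of the variance of `|X - E X|`.
-/
lemma integral_abs_sub_integral_le {X : Ω → ℝ} (hX : MemLp X 2 P) :
    ∫ ω, |X ω - ∫ ω', X ω' ∂P| ∂P ≤ √(variance X P) := by
  have hZ : MemLp (fun ω => |X ω - ∫ ω', X ω' ∂P|) 2 P := (hX.sub (memLp_const _)).norm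
  refine Real.le_sqrt_of_sq_le ?_
  have h := variance_nonneg (fun ω => |X ω - ∫ ω', X ω' ∂P|) P
  rw [variance_eq_sub hZ] at h
  rw [variance_eq_integral hX.1.aemeasurable]
  simp only [Pi.pow_apply, sq_abs] at h
  linarith

/-- After factoring out a unimodular exponential, `|exp (i a) - 1| ≤ |a|`. An `L¹` approximation
therefore suffices for convergence in distribution. -/
lemma norm_charFun_map_sub_le {Y Z : Ω → ℝ} (hY : Integrable Y P) (hZ : Integrable Z P) (u : ℝ) :
    ‖charFun (P.map Y) u - charFun (P.map Z) u‖ ≤ |u| * ∫ ω, |Y ω - Z ω| ∂P := by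
  have hint : ∀ {X : Ω → ℝ}, Integrable X P →
      Integrable (fun ω => Complex.exp (u * X ω * Complex.I)) P := fun {X} hX => by
    have hm : AEStronglyMeasurable (fun ω => Complex.exp (u * X ω * Complex.I)) P :=
      (by fun_prop : Continuous fun x : ℝ =>
        Complex.exp (u * x * Complex.I)).comp_aestronglyMeasurable hX.1
    refine Integrable.of_bound hm 1 (ae_of_all _ fun ω => ?_)
    rw [← Complex.ofReal_mul, Complex.norm_exp_ofReal_mul_I]
  rw [charFun_apply_real, charFun_apply_real, integral_map hY.aemeasurable (by fun_prop),
    integral_map hZ.aemeasurable (by fun_prop), ← integral_sub (hint hY) (hint hZ),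
    ← integral_const_mul]
  refine norm_integral_le_of_norm_le ((hY.sub hZ).abs.const_mul _) (ae_of_all _ fun ω => ?_)
  have e1 : Complex.exp (u * Y ω * Complex.I) - Complex.exp (u * Z ω * Complex.I) =
      Complex.exp ((u * Z ω : ℝ) * Complex.I) *
        (Complex.exp (Complex.I * (u * (Y ω - Z ω) : ℝ)) - 1) := by
    rw [mul_sub, mul_one, ← Complex.exp_add]
    push_cast
    ring_nf
  rw [e1, norm_mul, Complex.norm_exp_ofReal_mul_I, one_mul]
  refine (Real.norm_exp_I_mul_ofReal_sub_one_le).trans ?_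
  rw [Real.norm_eq_abs, abs_mul]

/-- The central limit theorem for characteristic functions. -/
lemma tendsto_charFun_pow {X : Ω → ℝ} (hX : MemLp X 2 P) (h0 : P[X] = 0) (u : ℝ) :
    Tendsto (fun n : ℕ => charFun (P.map X) ((√n)⁻¹ * u) ^ n) atTop
      (𝓝 (Complex.exp (-(variance X P * u ^ 2 / 2 : ℝ)))) := by
  have hm := hX.1.aemeasurable
  -- A degenerate variable cannot be normalized to unit variance; it vanishes almost surely and both
  -- sides are one.
  rcases eq_or_ne (variance X P) 0 with hv | hv
  · have hX0 : X =ᵐ[P] fun _ => 0 := by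
      have := ae_eq_integral_of_variance_eq_zero hX hv
      rwa [h0] at this
    simp [Measure.map_congr hX0, hv]
  set s := √(variance X P) with hs
  have hs0 : s ≠ 0 := (Real.sqrt_pos.2 ((variance_nonneg X P).lt_of_ne' hv)).ne'
  have hs2 : s ^ 2 = variance X P := Real.sq_sqrt (variance_nonneg X P)
  have hX' : X = fun ω => s * (X ω / s) := by
    ext ω
    field_simp
  have hm' : AEMeasurable (fun ω => X ω / s) P := hm.div_const s
  have h1 : P[(fun ω => X ω / s) ^ 2] = 1 := by
    simp only [Pi.pow_apply, div_pow]
    rw [integral_div, hs2, ← variance_of_integral_eq_zero hm h0, div_self hv]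
  have h := tendsto_charFun_inv_sqrt_mul_pow hm' (by rw [integral_div, h0, zero_div]) h1 (s * u)
  have e1 : Complex.exp (-((s * u : ℝ) : ℂ) ^ 2 / 2) =
      Complex.exp (-(variance X P * u ^ 2 / 2 : ℝ)) := by
    rw [← hs2]
    push_cast
    ring_nf
  rw [e1] at h
  refine h.congr fun n => ?_
  conv_rhs => rw [hX', charFun_map_mul_comp hm']
  congr 2
  ring

/-- Convergence to a normal distribution by approximation. -/
lemma tendstoInDistribution_of_approx {Y : ℕ → Ω → ℝ} {v : ℝ≥0} (hY : ∀ n, Integrable (Y n) P)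
    (h : ∀ ε > 0, ∃ w : ℝ, |w - v| ≤ ε ∧ ∃ Z : ℕ → Ω → ℝ, (∀ n, Integrable (Z n) P) ∧
      (∀ᶠ n in atTop, ∫ ω, |Y n ω - Z n ω| ∂P ≤ ε) ∧
      ∀ u, Tendsto (fun n => charFun (P.map (Z n)) u) atTop
        (𝓝 (Complex.exp (-(w * u ^ 2 / 2 : ℝ))))) :
    TendstoInDistribution Y atTop (id : ℝ → ℝ) (fun _ => P) (gaussianReal 0 v) where
  forall_aemeasurable n := (hY n).aemeasurable
  tendsto := by
    refine ProbabilityMeasure.tendsto_iff_tendsto_charFun.2 fun u => ?_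
    simp only [ProbabilityMeasure.coe_mk, Measure.map_id]
    have e0 : charFun (gaussianReal 0 v) u = Complex.exp (-((v : ℝ) * u ^ 2 / 2 : ℝ)) := by
      rw [charFun_gaussianReal]
      push_cast
      ring_nf
    rw [e0, Metric.tendsto_atTop]
    intro δ hδ
    have hc : Continuous fun w : ℝ => Complex.exp (-(w * u ^ 2 / 2 : ℝ)) := by fun_prop
    obtain ⟨ε₁, hε₁, hc1⟩ := Metric.continuous_iff.1 hc v (δ / 3) (by positivity)
    -- The first entry keeps `w` strictly within the continuity radius of `v`; the second makes the
    -- error of the characteristic functions at `u` at most `δ / 3`, also for `u = 0`.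
    set ε := min (ε₁ / 2) (δ / (3 * (|u| + 1))) with hε
    have hε0 : 0 < ε := lt_min (by positivity) (by positivity)
    obtain ⟨w, hw, Z, hZ, hYZ, hlim⟩ := h ε hε0
    have hw1 := hc1 w (by
      rw [Real.dist_eq]
      exact (hw.trans (min_le_left _ _)).trans_lt (half_lt_self hε₁))
    obtain ⟨N, hN⟩ := eventually_atTop.1
      (hYZ.and (Metric.tendsto_atTop.1 (hlim u) (δ / 3) (by positivity) |> fun ⟨N, h⟩ =>
        eventually_atTop.2 ⟨N, h⟩))
    refine ⟨N, fun n hn => ?_⟩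
    obtain ⟨h1, h2⟩ := hN n hn
    have h3 : dist (charFun (P.map (Y n)) u) (charFun (P.map (Z n)) u) ≤ δ / 3 := by
      rw [dist_eq_norm]
      refine (norm_charFun_map_sub_le (hY n) (hZ n) u).trans ?_
      calc |u| * ∫ ω, |Y n ω - Z n ω| ∂P ≤ (|u| + 1) * (δ / (3 * (|u| + 1))) := by
            gcongr
            · linarith
            · exact h1.trans (min_le_right _ _)
        _ = δ / 3 := by field_simp
    calc _ ≤ dist (charFun (P.map (Y n)) u) (charFun (P.map (Z n)) u) +
          dist (charFun (P.map (Z n)) u) (Complex.exp (-(w * u ^ 2 / 2 : ℝ))) +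
          dist (Complex.exp (-(w * u ^ 2 / 2 : ℝ))) _ := dist_triangle4 _ _ _ _
      _ < δ := by linarith

end CharacteristicFunctions

end MarkedPoisson

/-! ### The remainder of a decomposition into disjoint cubes -/

namespace MarkedPoisson

attribute [local instance] finiteConfigSigma

section Remainder

variable {d : ℕ} {ι : Type*} [Fintype ι] {f : Finset (MarkedEdge d) → ℝ}

/-- The contribution to `f` of the edges that are not inside one of the cubes. -/
def remainder (Q : ι → Cube d) (f : Finset (MarkedEdge d) → ℝ) (A : Finset (MarkedEdge d)) : ℝ :=
  f A - ∑ j, f (restrictTo (Q j).toSet A)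

lemma measurable_remainder (Q : ι → Cube d) (hf : Measurable f) : Measurable (remainder Q f) :=
  hf.sub (Finset.measurable_fun_sum _ fun j _ => hf.comp (measurable_restrictTo (Q j).measurableSet))

lemma restrictTo_insert_root {V : Set (Loc d)} {I : Finset Vertex} {θ : Field d}
    (h : Function.Injective θ.1) (h0 : θ.1 none ∉ V) :
    restrictTo V (randomGraph (insert none I) θ) = restrictTo V (randomGraph I θ) := by
  classical
  rw [restrictTo_randomGraph h.injOn, restrictTo_randomGraph h.injOn, Finset.filter_insert,
    if_neg h0]

lemma starCost_remainder {Q : ι → Cube d} {I : Finset Vertex} {θ : Field d} :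
    starCost randomGraph (remainder Q f) I θ = starCost randomGraph f I θ -
      ∑ j, starCost randomGraph (fun A => f (restrictTo (Q j).toSet A)) I θ := by
  simp only [starCost, remainder, Finset.sum_sub_distrib]
  ring

lemma starCost_restrictTo_eq_zero {V : Set (Loc d)} {I : Finset Vertex} {θ : Field d}
    (h : Function.Injective θ.1) (h0 : θ.1 none ∉ V) :
    starCost randomGraph (fun A => f (restrictTo V A)) I θ = 0 := by
  simp only [starCost, restrictTo_insert_root h h0, sub_self]

variable {m : ℝ≥0}

/-- A root in the `j`th cube is not a vertex of the subgraphs in the other cubes, so only the `j`th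
summand contributes to its cost. -/
lemma costNorm_remainder_of_mem [NeZero d] {Q : ι → Cube d}
    (hQ : Pairwise (Function.onFun Disjoint fun j => (Q j).toSet)) {W : Cube d} {x : Loc d} {j : ι}
    (hx : x ∈ (Q j).toSet) :
    costNorm m (graphLaw (rootedFamily (Measure.dirac x) (cubeLaw W))) randomGraph (remainder Q f) =
      costNorm m (graphLaw (rootedFamily (Measure.dirac x) (cubeLaw W))) randomGraph
        (cutoff (Q j).toSet f) := by
  refine eLpNorm_congr_ae ?_
  filter_upwards [Measure.quasiMeasurePreserving_snd.ae
    (Measure.quasiMeasurePreserving_fst.ae (ae_injective_rooted x W)),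
    Measure.quasiMeasurePreserving_snd.ae (Measure.quasiMeasurePreserving_fst.ae
      (ae_rooted_none x W))] with q h1 h2
  rw [starCost_remainder, Finset.sum_eq_single j]
  · exact (starCost_sub (g := f) (g' := fun A => f (restrictTo (Q j).toSet A)) _ _).symm
  · intro i _ hij
    refine starCost_restrictTo_eq_zero h1 ?_
    rw [h2]
    exact fun hxi => Set.disjoint_left.1 (hQ hij) hxi hx
  · simp

lemma costNorm_remainder_of_notMem [NeZero d] {Q : ι → Cube d} {W : Cube d} {x : Loc d}
    (hx : ∀ j, x ∉ (Q j).toSet) :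
    costNorm m (graphLaw (rootedFamily (Measure.dirac x) (cubeLaw W))) randomGraph (remainder Q f) =
      costNorm m (graphLaw (rootedFamily (Measure.dirac x) (cubeLaw W))) randomGraph f := by
  refine eLpNorm_congr_ae ?_
  filter_upwards [Measure.quasiMeasurePreserving_snd.ae
    (Measure.quasiMeasurePreserving_fst.ae (ae_injective_rooted x W)),
    Measure.quasiMeasurePreserving_snd.ae (Measure.quasiMeasurePreserving_fst.ae
      (ae_rooted_none x W))] with q h1 h2
  rw [starCost_remainder, Finset.sum_eq_zero fun j _ =>
    starCost_restrictTo_eq_zero h1 (by rw [h2]; exact hx j), sub_zero]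

end Remainder

section RemainderVariance

variable {d : ℕ} [NeZero d] (e : ℕ ≃ (Fin d → ℤ)) {Ω : Type*} [MeasurableSpace Ω] {P : Measure Ω}
  [IsProbabilityMeasure P] {lam : ℝ≥0} {η : Ω → Set (Pt d)} {f : Finset (MarkedEdge d) → ℝ}
  {ι : Type*} [Fintype ι]

/-- Translation moves the root to the origin and carries the cutting cube along with the ambient
one. -/
lemma TranslationInvariant.costNorm_cutoff (hti : TranslationInvariant f) (hf : Measurable f)
    (W V : Cube d) (x : Loc d) :
    costNorm (mass lam W) (graphLaw (rootedFamily (Measure.dirac x) (cubeLaw W))) randomGraph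
      (cutoff V.toSet f) = rootedNorm lam (W.shift (-x)) (cutoff (V.shift (-x)).toSet f) := by
  rw [costNorm_shift (measurable_cutoff V.measurableSet hf)]
  congr 1
  ext1 A
  simp only [cutoff, restrictTo_translate, hti x]
  congr 3
  ext y
  rw [Set.mem_ofPred_eq, Cube.mem_shift, neg_neg]

lemma Cube.shift_mono {V W : Cube d} (h : V.toSet ⊆ W.toSet) (c : Loc d) :
    (V.shift c).toSet ⊆ (W.shift c).toSet := fun y hy => by
  rw [Cube.mem_shift] at hy ⊢
  exact h hy

lemma lintegral_sq_le_of_le_on {X : Type*} [MeasurableSpace X] {μ : Measure X}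
    [IsProbabilityMeasure μ] {F : X → ℝ≥0∞} {ε C : ℝ≥0} {G : Set X} (hG : MeasurableSet G)
    (h1 : ∀ x ∈ G, F x ≤ ε) (h2 : ∀ᵐ x ∂μ, F x ≤ C) :
    ∫⁻ x, F x ^ 2 ∂μ ≤ ENNReal.ofReal (ε ^ 2 + C ^ 2 * (1 - μ.real G)) := by
  rw [← lintegral_add_compl _ hG]
  have h3 : ∫⁻ x in G, F x ^ 2 ∂μ ≤ (ε : ℝ≥0∞) ^ 2 := by
    refine (setLIntegral_mono measurable_const fun x hx => pow_le_pow_left₀ zero_le (h1 x hx) 2).trans ?_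
    rw [setLIntegral_const]
    exact mul_le_of_le_one_right' prob_le_one
  have h4 : ∫⁻ x in Gᶜ, F x ^ 2 ∂μ ≤ (C : ℝ≥0∞) ^ 2 * μ Gᶜ := by
    rw [← setLIntegral_const]
    refine lintegral_mono_ae (ae_restrict_of_ae ?_)
    filter_upwards [h2] with x hx
    gcongr
  refine (add_le_add h3 h4).trans_eq ?_
  have h5 : 0 ≤ 1 - μ.real G := sub_nonneg.2 measureReal_le_one
  rw [ENNReal.ofReal_add (by positivity) (by positivity), ENNReal.ofReal_mul (by positivity),
    ENNReal.ofReal_pow (by positivity), ENNReal.ofReal_pow (by positivity),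
    ← probReal_compl_eq_one_sub hG, ofReal_measureReal]
  simp

/-- The remainder has a small variance. -/
lemma IsPoissonProcess.variance_remainder_le (hη : IsPoissonProcess (intensity d lam) P η)
    (hf : Measurable f) (hti : TranslationInvariant f) {C ε : ℝ≥0} {r : ℝ} (hr : 0 ≤ r)
    (hC : ∀ W : Cube d, (0 : Loc d) ∈ W.toSet → rootedNorm lam W f ≤ C)
    (hε : ∀ V W : Cube d, Metric.closedBall 0 r ⊆ V.toSet → V.toSet ⊆ W.toSet →
      rootedNorm lam W (cutoff V.toSet f) ≤ ε) {Q : ι → Cube d} {W : Cube d}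
    (hQ : Pairwise (Function.onFun Disjoint fun j => (Q j).toSet))
    (hQW : ∀ j, (Q j).toSet ⊆ W.toSet) :
    MemLp (fun ω => remainder Q f (genericGraph e (conf η W Set.univ ω))) 2 P ∧
    variance (fun ω => remainder Q f (genericGraph e (conf η W Set.univ ω))) P ≤
      lam * volume.real W.toSet * (ε ^ 2 + (2 * C) ^ 2 *
        (1 - (cubeLaw W).real (⋃ j, (Q j).inner r))) := by
  have hm := measurable_remainder Q hf
  have hfull := fullyExchangeable_randomGraph (μ := cubeLaw W)
  have hbound : costNorm (mass lam W) (uniformLaw W) randomGraph (remainder Q f) ^ 2 ≤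
      ENNReal.ofReal (ε ^ 2 + ((2 * C : ℝ≥0) : ℝ) ^ 2 *
        (1 - (cubeLaw W).real (⋃ j, (Q j).inner r))) := by
    rw [lintegral_costNorm_sq hm]
    refine lintegral_sq_le_of_le_on (.iUnion fun j => (Q j).measurableSet_inner r) ?_ ?_
    -- Deep inside one of the cubes, the edges that leave this cube hardly affect the cost of the
    -- root.
    · intro x hx
      obtain ⟨j, hj⟩ := Set.mem_iUnion.1 hx
      rw [costNorm_remainder_of_mem hQ ((Q j).inner_subset hr hj), hti.costNorm_cutoff hf]
      exact hε _ _ (Cube.closedBall_subset_of_inner hj) (Cube.shift_mono (hQW j) _)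
    -- Elsewhere the crude bound `2 C` holds: the cost in `W` minus, if the root lies in one of the
    -- cubes, the cost in that cube.
    · filter_upwards [ae_mem_cubeLaw W] with x hx
      by_cases h : ∃ j, x ∈ (Q j).toSet
      · obtain ⟨j, hj⟩ := h
        have h0 := Cube.zero_mem_shift hj
        rw [costNorm_remainder_of_mem hQ hj, hti.costNorm_cutoff hf]
        refine (exchangeableAt_randomGraph.costNorm_sub_le hf
          (hf.comp (measurable_restrictTo (Cube.measurableSet _)))).trans ?_
        have e2 := hη.rootedNorm_restrict e (Cube.shift_mono (hQW j) (-x)) h0 hf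
        push_cast
        rw [two_mul]
        exact add_le_add (hC _ (Cube.zero_mem_shift hx)) (e2.trans_le (hC _ h0))
      · rw [costNorm_remainder_of_notMem (not_exists.1 h), costNorm_shift hf,
          funext fun A => hti x A]
        refine (hC _ (Cube.zero_mem_shift hx)).trans ?_
        exact_mod_cast le_mul_of_one_le_left zero_le one_le_two
  have hfin : FiniteCost (mass lam W) (uniformLaw W) randomGraph (remainder Q f) :=
    hfull.exchangeableAt.finiteCost_of_costNorm hm fun h => by
      rw [h] at hbound
      exact absurd (hbound.trans_lt ENNReal.ofReal_lt_top) (by simp)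
  have hid := hη.identDistrib_value e hm W
  refine ⟨hid.memLp_iff.2 (hfull.memLp hm hfin), ?_⟩
  rw [hid.variance_eq, ← mass_coe]
  refine (hfull.variance_le hm hfin).trans (mul_le_mul_of_nonneg_left ?_ (mass lam W).2)
  have h5 : 0 ≤ 1 - (cubeLaw W).real (⋃ j, (Q j).inner r) := sub_nonneg.2 measureReal_le_one
  rw [← hfin.ofReal_costMoment, ENNReal.ofReal_le_ofReal_iff (by positivity)] at hbound
  simpa using hbound

/-- The value in a cube is the sum of the values in disjoint aligned cubes and the remainder. -/
lemma IsPoissonProcess.value_ae_eq_add (hη : IsPoissonProcess (intensity d lam) P η)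
    {Q : ι → Cube d} {W : Cube d} (hQW : ∀ j, (Q j).toSet ⊆ W.toSet) (hal : ∀ j, (Q j).Aligned) :
    value e η f W =ᵐ[P] fun ω => ∑ j, value e η f (Q j) ω +
      remainder Q f (genericGraph e (conf η W Set.univ ω)) := by
  filter_upwards [hη.value_ae_eq e (f := f) W, hη.ae_generic_conf e W,
    ae_all_iff.2 fun j => hη.value_ae_eq e (f := f) (Q j),
    ae_all_iff.2 fun j => hη.ae_generic_conf e (Q j)] with ω h1 h2 h3 h4
  have h5 : ∀ j, f (restrictTo (Q j).toSet (genericGraph e (conf η W Set.univ ω))) =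
      value e η f (Q j) ω := fun j => by
    rw [h3 j, genericGraph_of_generic e h2, genericGraph_of_generic e (h4 j),
      restrictTo_markedGraph e (hal j), conf_part ω (hQW j) (hη.finite_slab W _ _)]
  rw [remainder, h1, Finset.sum_congr rfl fun j _ => h5 j]
  ring

/-- The values in disjoint cubes are independent. -/
lemma IsPoissonProcess.iIndepFun_value (hη : IsPoissonProcess (intensity d lam) P η)
    (hf : Measurable f) {Q : ι → Cube d}
    (hQ : Pairwise (Function.onFun Disjoint fun j => (Q j).toSet)) :
    iIndepFun (fun j => value e η f (Q j)) P := by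
  choose K hK hsub using fun j => exists_compact_slab (Q j) Set.univ
  have h := hη.iIndepFun_conf hK hsub (fun j => measurableSet_slab (Q j) MeasurableSet.univ)
    (fun j => intensity_slab_ne_top lam (Q j) Set.univ) (fun i j hij =>
      Set.disjoint_left.2 fun s hs hs' => Set.disjoint_left.1 (hQ hij) hs.1 hs'.1)
  exact (h.comp (fun _ A => f (genericGraph e A))
    fun _ => hf.comp (measurable_genericGraph e)).congr fun j => (hη.value_ae_eq e (Q j)).symm

/-- The law of the value is invariant under translations of the cube. -/
lemma IsPoissonProcess.identDistrib_value_shift (hη : IsPoissonProcess (intensity d lam) P η)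
    (hf : Measurable f) (hti : TranslationInvariant f) (W : Cube d) (c : Loc d) :
    IdentDistrib (value e η f (W.shift c)) (value e η f W) P P := by
  -- The lattice and its enumeration enter through the edge marking only and are absent from the law
  -- of the complete graph. Hence the translation `c` need not be an integer vector.
  have hlaw : ∀ V : Cube d, IdentDistrib (value e η f V)
      (fun q : ℕ × Field d => f (randomGraph (cls 0 q.1) q.2)) P
      ((poissonMeasure (mass lam V)).prod (uniformLaw V)) := fun V =>
    (IdentDistrib.of_ae_eq ((hf.comp ((measurable_genericGraph e).comp
      (hη.measurable_conf_slab V MeasurableSet.univ))).aemeasurable.congr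
        (hη.value_ae_eq e V).symm) (hη.value_ae_eq e V)).trans (hη.identDistrib_value e hf V)
  have hmap : (uniformLaw W).map (shiftField c) = uniformLaw (W.shift c) :=
    map_shiftField c fun _ => map_cubeLaw c W
  have hprod := Measure.map_prod_map (poissonMeasure (mass lam W)) (uniformLaw W) measurable_id
    (measurable_shiftField c)
  rw [Measure.map_id, hmap] at hprod
  have hm : Measurable fun q : ℕ × Field d => f (randomGraph (cls 0 q.1) q.2) :=
    hf.comp (measurable_from_prod_countable_right fun n => measurable_randomGraph (cls 0 n))
  refine (hlaw _).trans (IdentDistrib.trans ⟨hm.aemeasurable, hm.aemeasurable, ?_⟩ (hlaw W).symm)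
  rw [mass_shift, hprod, Measure.map_map hm (measurable_id.prodMap (measurable_shiftField c))]
  congr 1
  ext q
  exact (congrArg f (randomGraph_shiftField c _ _)).trans (hti c _)

end RemainderVariance

end MarkedPoisson

/-! ### Packing boxes with integer corners into a cube -/

namespace MarkedPoisson

section Blocks

variable {d : ℕ}

/-- The number of boxes in a row that fit into the cube. -/
def blockCount (k : ℕ) (W : Cube d) : ℕ := ⌊(W.side - 1) / (box d k).side⌋₊

/-- Disjoint aligned translates of the box in the cube. -/
def block (k : ℕ) (W : Cube d) (j : Fin d → Fin (blockCount k W)) : Cube d :=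
  (box d k).shift (WithLp.toLp 2 fun i => ⌈W.corner i⌉ + (k + 1) + 2 * (k + 1) * (j i : ℕ))

/-- The summand `k + 1` in `block` compensates the corner `-(k + 1)` of the centered box. -/
lemma block_corner (k : ℕ) (W : Cube d) (j : Fin d → Fin (blockCount k W)) (i : Fin d) :
    (block k W j).corner i = ⌈W.corner i⌉ + (box d k).side * (j i : ℕ) := by
  simp only [block, Cube.shift, box, PiLp.add_apply]
  ring

lemma block_side (k : ℕ) (W : Cube d) (j : Fin d → Fin (blockCount k W)) :
    (block k W j).side = (box d k).side := rfl

lemma block_aligned (k : ℕ) (W : Cube d) (j : Fin d → Fin (blockCount k W)) :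
    (block k W j).Aligned :=
  Cube.aligned_of_int (c := fun i => ⌈W.corner i⌉ + 2 * (k + 1) * (j i : ℕ)) (k := 2 * (k + 1))
    (fun i => by rw [block_corner]; simp [box]) (by simp [block_side, box])

/-- Rounding the corner of `W` up to an integer costs less than one unit of length, which is the
unit subtracted from the side in `blockCount`. -/
lemma block_subset (k : ℕ) (W : Cube d) (j : Fin d → Fin (blockCount k W)) :
    (block k W j).toSet ⊆ W.toSet := by
  intro y hy i
  have h := hy i
  rw [block_corner, block_side] at h
  have hs := (box d k).side_pos
  have hj : ((j i : ℕ) : ℝ) + 1 ≤ blockCount k W := by exact_mod_cast (j i).2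
  have h0 : 0 < blockCount k W := (j i).pos
  have hq : (blockCount k W : ℝ) ≤ (W.side - 1) / (box d k).side :=
    Nat.floor_le (le_of_lt (zero_lt_one.trans_le (Nat.floor_pos.1 h0)))
  rw [le_div_iff₀ hs] at hq
  have h1 := Int.le_ceil (W.corner i)
  have h2 := Int.ceil_lt_add_one (W.corner i)
  have h3 : 0 ≤ (box d k).side * ((j i : ℕ) : ℝ) := by positivity
  have h4 : (box d k).side * (((j i : ℕ) : ℝ) + 1) ≤ blockCount k W * (box d k).side := by
    rw [mul_comm]
    gcongr
  constructor <;> linarith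

lemma block_disjoint (k : ℕ) (W : Cube d) :
    Pairwise (Function.onFun Disjoint fun j => (block k W j).toSet) := by
  intro j j' hjj
  obtain ⟨i, hi⟩ := Function.ne_iff.1 hjj
  refine Set.disjoint_left.2 fun y hy hy' => hi ?_
  have h := hy i
  have h' := hy' i
  rw [block_corner, block_side] at h h'
  have hs := (box d k).side_pos
  have h1 : ((j i : ℕ) : ℝ) < (j' i : ℕ) + 1 := by
    refine lt_of_mul_lt_mul_left ?_ hs.le
    linarith
  have h2 : ((j' i : ℕ) : ℝ) < (j i : ℕ) + 1 := by
    refine lt_of_mul_lt_mul_left ?_ hs.le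
    linarith
  have h3 : (j i : ℕ) < (j' i : ℕ) + 1 := by exact_mod_cast h1
  have h4 : (j' i : ℕ) < (j i : ℕ) + 1 := by exact_mod_cast h2
  exact Fin.ext (by omega)

lemma cubeLaw_real_blocks (k : ℕ) (W : Cube d) {r : ℝ} (hr : 0 ≤ r) (h : 2 * r < (box d k).side) :
    (cubeLaw W).real (⋃ j, (block k W j).inner r) =
      (blockCount k W * ((box d k).side - 2 * r) / W.side) ^ d := by
  have hsub : ∀ j, (block k W j).inner r ⊆ (block k W j).toSet := fun j =>
    (block k W j).inner_subset hr
  have hv : ∀ j, volume.real ((block k W j).inner r) = ((box d k).side - 2 * r) ^ d := fun j => by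
    obtain ⟨V, hV, hs⟩ := Cube.inner_eq (W := block k W j) h
    rw [← hV, V.volume_real, hs, block_side]
  have hU : volume.real (⋃ j, (block k W j).inner r) =
      ∑ j, volume.real ((block k W j).inner r) := by
    rw [measureReal_def, measure_iUnion (fun i j hij => (block_disjoint k W hij).mono (hsub i) (hsub j))
      (fun j => (block k W j).measurableSet_inner r), tsum_fintype,
      ENNReal.toReal_sum fun j _ => measure_ne_top_of_subset (hsub j) (block k W j).volume_ne_top]
    rfl
  rw [cubeLaw_real W (Set.iUnion_subset fun j => (hsub j).trans (block_subset k W j)), hU,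
    Finset.sum_congr rfl fun j _ => hv j]
  simp [div_pow, mul_pow]

/-- Along each axis the blocks leave uncovered at most the side of one box plus the unit lost to
rounding. -/
lemma tendsto_blockCount [NeZero d] (k : ℕ) {W : ℕ → Cube d} (hW : TendsToSpace W) :
    Tendsto (fun n => (blockCount k (W n) : ℝ) * (box d k).side / (W n).side) atTop (𝓝 1) := by
  have hs := (box d k).side_pos
  have hl := hW.tendsto_side
  have hinv : Tendsto (fun n => ((W n).side)⁻¹) atTop (𝓝 0) := tendsto_inv_atTop_zero.comp hl
  have hlow : Tendsto (fun n => 1 - (1 + (box d k).side) * ((W n).side)⁻¹) atTop (𝓝 1) := by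
    simpa using (hinv.const_mul (1 + (box d k).side)).const_sub 1
  refine tendsto_of_tendsto_of_tendsto_of_le_of_le' hlow tendsto_const_nhds ?_ ?_
  · filter_upwards with n
    have h0 := (W n).side_pos
    have h1 : ((W n).side - 1) / (box d k).side < blockCount k (W n) + 1 := Nat.lt_floor_add_one _
    rw [div_lt_iff₀ hs] at h1
    rw [le_div_iff₀ h0, sub_mul, mul_assoc, inv_mul_cancel₀ h0.ne']
    linarith
  · filter_upwards [hl.eventually_ge_atTop 1] with n hn
    have h1 : (blockCount k (W n) : ℝ) ≤ ((W n).side - 1) / (box d k).side :=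
      Nat.floor_le (div_nonneg (by linarith) hs.le)
    rw [le_div_iff₀ hs] at h1
    rw [div_le_one (W n).side_pos]
    linarith

lemma tendsto_blockCount_atTop [NeZero d] (k : ℕ) {W : ℕ → Cube d} (hW : TendsToSpace W) :
    Tendsto (fun n => blockCount k (W n)) atTop atTop :=
  tendsto_nat_floor_atTop.comp
    ((tendsto_atTop_add_const_right _ _ hW.tendsto_side).atTop_div_const (box d k).side_pos)

end Blocks

end MarkedPoisson

/-! ### Sums over blocks -/

namespace MarkedPoisson

attribute [local instance] finiteConfigSigma

section IndependentSums

variable {Ω : Type*} [MeasurableSpace Ω] {P : Measure Ω} [IsProbabilityMeasure P] {ι : Type*}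
  [Fintype ι] {X : ι → Ω → ℝ} {X₀ : Ω → ℝ}

lemma charFun_mul_sum (hi : iIndepFun X P) (hid : ∀ j, IdentDistrib (X j) X₀ P P) (a u : ℝ) :
    charFun (P.map fun ω => a * ∑ j, X j ω) u =
      charFun (P.map X₀) (a * u) ^ Fintype.card ι := by
  have hm := fun j => (hid j).aemeasurable_fst
  rw [charFun_map_mul_comp (Finset.aemeasurable_fun_sum _ fun j _ => hm j),
    (hi.restrict _).charFun_map_fun_finsetSum_eq_prod fun j _ => hm j]
  simp [fun j => (hid j).map_eq]

lemma variance_sum_of_identDistrib (hi : iIndepFun X P) (hid : ∀ j, IdentDistrib (X j) X₀ P P)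
    (hX₀ : MemLp X₀ 2 P) :
    variance (fun ω => ∑ j, X j ω) P = Fintype.card ι * variance X₀ P := by
  have h := IndepFun.variance_sum (s := Finset.univ) (fun j _ => (hid j).memLp_iff.2 hX₀)
    fun i _ j _ hij => hi.indepFun hij
  rw [Finset.sum_congr rfl fun j _ => (hid j).variance_eq, Finset.sum_const, nsmul_eq_mul] at h
  rw [← Finset.card_univ, ← h]
  congr 1
  ext ω
  simp

end IndependentSums

section CentralLimit

variable {d : ℕ} [NeZero d] (e : ℕ ≃ (Fin d → ℤ)) {Ω : Type*} [MeasurableSpace Ω] {P : Measure Ω}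
  [IsProbabilityMeasure P] {lam : ℝ≥0} {η : Ω → Set (Pt d)} {f : Finset (MarkedEdge d) → ℝ}
  {p : ℝ}

/-- The centered and normalized sum of the values in the blocks. -/
def blockSum (P : Measure Ω) (η : Ω → Set (Pt d)) (f : Finset (MarkedEdge d) → ℝ) (k : ℕ)
    (W : Cube d) (ω : Ω) : ℝ :=
  (√((blockCount k W ^ d : ℕ) : ℝ))⁻¹ * ∑ j, (value e η f (block k W j) ω -
    ∫ ω', value e η f (box d k) ω' ∂P) / √(volume.real (box d k).toSet)

/-- For fixed `k` the block values are independent copies of one square integrable variable. The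
classical theorem is applied along the numbers of blocks, which tend to infinity. -/
lemma IsPoissonProcess.tendsto_charFun_blockSum (hη : IsPoissonProcess (intensity d lam) P η)
    (hf : Measurable f) (hti : TranslationInvariant f) {k : ℕ}
    (hL : MemLp (value e η f (box d k)) 2 P) {W : ℕ → Cube d} (hW : TendsToSpace W) (u : ℝ) :
    Tendsto (fun n => charFun (P.map (blockSum e P η f k (W n))) u) atTop
      (𝓝 (Complex.exp (-(variance (value e η f (box d k)) P / volume.real (box d k).toSet *
        u ^ 2 / 2 : ℝ)))) := by
  set m := ∫ ω', value e η f (box d k) ω' ∂P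
  set V := volume.real (box d k).toSet
  have hV : 0 < V := (box d k).volume_real_pos
  set φ : ℝ → ℝ := fun x => (x - m) / √V
  have hφ : Measurable φ := by fun_prop
  have hX : MemLp (fun ω => φ (value e η f (box d k) ω)) 2 P := by
    simp only [φ, div_eq_inv_mul]
    exact (hL.sub (memLp_const m)).const_mul (√V)⁻¹
  have h0 : P[fun ω => φ (value e η f (box d k) ω)] = 0 := by
    simp only [φ]
    rw [integral_div, integral_sub (hL.integrable (by norm_num)) (integrable_const _),
      integral_const, probReal_univ, one_smul, sub_self, zero_div]
  have hvar : variance (fun ω => φ (value e η f (box d k) ω)) P =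
      variance (value e η f (box d k)) P / V := by
    simp only [φ, div_eq_inv_mul]
    rw [variance_const_mul, variance_sub_const hL.1, inv_pow, Real.sq_sqrt hV.le]
  have h := (tendsto_charFun_pow hX h0 u).comp ((tendsto_pow_atTop (NeZero.ne d)).comp
    (tendsto_blockCount_atTop k hW))
  rw [hvar] at h
  refine h.congr fun n => ?_
  have hi := (hη.iIndepFun_value e hf (block_disjoint k (W n))).comp (fun _ => φ) fun _ => hφ
  have hid : ∀ j, IdentDistrib (φ ∘ value e η f (block k (W n) j))
      (fun ω => φ (value e η f (box d k) ω)) P P := fun j =>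
    (hη.identDistrib_value_shift e hf hti (box d k) _).comp hφ
  have h2 := charFun_mul_sum hi hid (√((blockCount k (W n) ^ d : ℕ) : ℝ))⁻¹ u
  rw [Fintype.card_pi, Finset.prod_const, Fintype.card_fin, Finset.card_univ, Fintype.card_fin] at h2
  exact h2.symm

/-- There are two sources of error: the remainder, and the difference between the normalizations by
the volume of `W` and by the total volume of the blocks. Each centered variable is bounded in mean
by its standard deviation. -/
lemma IsPoissonProcess.integral_abs_sub_blockSum_le (hη : IsPoissonProcess (intensity d lam) P η)
    (hf : Measurable f) (hti : TranslationInvariant f) {k : ℕ}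
    (hL : MemLp (value e η f (box d k)) 2 P) {W : Cube d}
    (hR : MemLp (fun ω => remainder (block k W) f (genericGraph e (conf η W Set.univ ω))) 2 P) :
    Integrable (blockSum e P η f k W) P ∧
    ∫ ω, |(value e η f W ω - ∫ ω', value e η f W ω' ∂P) / √(volume.real W.toSet) -
        blockSum e P η f k W ω| ∂P ≤
      √(variance (fun ω => remainder (block k W) f (genericGraph e (conf η W Set.univ ω))) P /
        volume.real W.toSet) +
      |(√(volume.real W.toSet))⁻¹ - (√((blockCount k W ^ d : ℕ) : ℝ))⁻¹ *
        (√(volume.real (box d k).toSet))⁻¹| *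
        √((blockCount k W ^ d : ℕ) * variance (value e η f (box d k)) P) := by
  set R := fun ω => remainder (block k W) f (genericGraph e (conf η W Set.univ ω))
  set S := fun ω => ∑ j, value e η f (block k W j) ω with hSdef
  have hid : ∀ j, IdentDistrib (value e η f (block k W j)) (value e η f (box d k)) P P := fun j =>
    hη.identDistrib_value_shift e hf hti (box d k) _
  have hLj : ∀ j, MemLp (value e η f (block k W j)) 2 P := fun j => (hid j).memLp_iff.2 hL
  have hS : MemLp S 2 P := memLp_finsetSum _ fun j _ => hLj j
  have hSi := hS.integrable (by norm_num)
  have hRi := hR.integrable (by norm_num)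
  have hES : ∫ ω, S ω ∂P = (blockCount k W ^ d : ℕ) * ∫ ω', value e η f (box d k) ω' ∂P := by
    rw [integral_finsetSum _ fun j _ => (hLj j).integrable (by norm_num),
      Finset.sum_congr rfl fun j _ => (hid j).integral_eq]
    simp
  have hVS : variance S P = (blockCount k W ^ d : ℕ) * variance (value e η f (box d k)) P := by
    rw [variance_sum_of_identDistrib (hη.iIndepFun_value e hf (block_disjoint k W)) hid hL]
    simp
  have hadd := hη.value_ae_eq_add e (f := f) (block_subset k W) (block_aligned k W)
  have hEV : ∫ ω', value e η f W ω' ∂P = ∫ ω, S ω ∂P + ∫ ω, R ω ∂P := by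
    rw [integral_congr_ae hadd, integral_add hSi hRi]
  have hB : ∀ ω, blockSum e P η f k W ω = (√((blockCount k W ^ d : ℕ) : ℝ))⁻¹ *
      (√(volume.real (box d k).toSet))⁻¹ * (S ω - ∫ ω, S ω ∂P) := fun ω => by
    rw [blockSum, ← Finset.sum_div, Finset.sum_sub_distrib, hES]
    simp [hSdef]
    ring
  set c := (√((blockCount k W ^ d : ℕ) : ℝ))⁻¹ * (√(volume.real (box d k).toSet))⁻¹
  have hSc : Integrable (fun ω => S ω - ∫ ω, S ω ∂P) P := hSi.sub (integrable_const _)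
  have hRc : Integrable (fun ω => R ω - ∫ ω, R ω ∂P) P := hRi.sub (integrable_const _)
  refine ⟨(hSc.const_mul c).congr (ae_of_all _ fun ω => (hB ω).symm), ?_⟩
  set w := √(volume.real W.toSet) with hw
  have hw0 : 0 ≤ w := Real.sqrt_nonneg _
  have hle : ∀ᵐ ω ∂P, |(value e η f W ω - ∫ ω', value e η f W ω' ∂P) / w -
      blockSum e P η f k W ω| ≤ w⁻¹ * |R ω - ∫ ω, R ω ∂P| +
        |w⁻¹ - c| * |S ω - ∫ ω, S ω ∂P| := by
    filter_upwards [hadd] with ω hω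
    rw [hω, hB, hEV]
    have e1 : (S ω + R ω - (∫ ω, S ω ∂P + ∫ ω, R ω ∂P)) / w - c * (S ω - ∫ ω, S ω ∂P) =
        w⁻¹ * (R ω - ∫ ω, R ω ∂P) + (w⁻¹ - c) * (S ω - ∫ ω, S ω ∂P) := by ring
    refine (congrArg abs e1).trans_le ((abs_add_le _ _).trans_eq ?_)
    rw [abs_mul, abs_mul, abs_of_nonneg (inv_nonneg.2 hw0)]
  have hint := (hRc.abs.const_mul w⁻¹).add (hSc.abs.const_mul |w⁻¹ - c|)
  refine (integral_mono_of_nonneg (ae_of_all _ fun _ => abs_nonneg _) hint hle).trans ?_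
  change ∫ ω, w⁻¹ * |R ω - ∫ ω, R ω ∂P| + |w⁻¹ - c| * |S ω - ∫ ω, S ω ∂P| ∂P ≤ _
  rw [integral_add (hRc.abs.const_mul _) (hSc.abs.const_mul _), integral_const_mul,
    integral_const_mul, Real.sqrt_div (variance_nonneg _ _), ← hVS, div_eq_inv_mul]
  gcongr
  · exact integral_abs_sub_integral_le hR
  · exact integral_abs_sub_integral_le hS

/-- The blocks cover asymptotically the whole volume, so the ratio of the two normalizations tends
to one, while the standard deviation of the block sum grows like the square root of the number of
blocks. -/
lemma tendsto_normalization {k : ℕ} {W : ℕ → Cube d} (hW : TendsToSpace W) (v : ℝ) :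
    Tendsto (fun n => |(√(volume.real (W n).toSet))⁻¹ - (√((blockCount k (W n) ^ d : ℕ) : ℝ))⁻¹ *
        (√(volume.real (box d k).toSet))⁻¹| * √((blockCount k (W n) ^ d : ℕ) * v)) atTop (𝓝 0) := by
  set V := volume.real (box d k).toSet with hVdef
  have hV : 0 < V := (box d k).volume_real_pos
  have h1 : Tendsto (fun n => |√(((blockCount k (W n) : ℝ) * (box d k).side / (W n).side) ^ d) - 1| *
      ((√V)⁻¹ * √v)) atTop (𝓝 (|√(1 ^ d) - 1| * ((√V)⁻¹ * √v))) :=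
    ((((tendsto_blockCount k hW).pow d).sqrt.sub_const 1).abs).mul_const _
  rw [one_pow, Real.sqrt_one, sub_self, abs_zero, zero_mul] at h1
  refine h1.congr' ?_
  filter_upwards [(tendsto_blockCount_atTop k hW).eventually_gt_atTop 0] with n hn
  have hN : (0 : ℝ) < ((blockCount k (W n) ^ d : ℕ) : ℝ) := by exact_mod_cast pow_pos hn d
  have hw := (W n).volume_real_pos
  have e1 : ((blockCount k (W n) : ℝ) * (box d k).side / (W n).side) ^ d =
      ((blockCount k (W n) ^ d : ℕ) : ℝ) * V / volume.real (W n).toSet := by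
    rw [hVdef, Cube.volume_real, Cube.volume_real, div_pow, mul_pow]
    push_cast
    rfl
  rw [e1, Real.sqrt_div (by positivity), Real.sqrt_mul hN.le, Real.sqrt_mul hN.le]
  have hN' := Real.sqrt_pos.2 hN
  have hV' := Real.sqrt_pos.2 hV
  have hw' := Real.sqrt_pos.2 hw
  set a := √((blockCount k (W n) ^ d : ℕ) : ℝ)
  set b := √(volume.real (W n).toSet)
  have e2 : b⁻¹ - a⁻¹ * (√V)⁻¹ = (a * √V / b - 1) * (a * √V)⁻¹ := by
    field_simp
  rw [e2, abs_mul, abs_of_pos (inv_pos.2 (mul_pos hN' hV'))]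
  field_simp

end CentralLimit

end MarkedPoisson

/-! ### The central limit theorem -/

namespace MarkedPoisson

attribute [local instance] finiteConfigSigma

section CentralLimitTheorem

variable {d : ℕ} [NeZero d] (e : ℕ ≃ (Fin d → ℤ)) {Ω : Type*} [MeasurableSpace Ω] {P : Measure Ω}
  [IsProbabilityMeasure P] {lam : ℝ≥0} {η : Ω → Set (Pt d)} {f : Finset (MarkedEdge d) → ℝ}
  {p : ℝ}

/-- A large box has a small boundary. -/
lemma tendsto_box_inner {r : ℝ} (hr : 0 ≤ r) :
    Tendsto (fun k => (((box d k).side - 2 * r) / (box d k).side) ^ d) atTop (𝓝 1) := by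
  refine (tendsto_inner_fraction (tendsToSpace_box (d := d)) hr).congr' ?_
  filter_upwards [(tendsToSpace_box (d := d)).tendsto_side.eventually_gt_atTop (2 * r)] with k hk
  exact cubeLaw_real_inner hr hk

lemma IsPoissonProcess.memLp_value_of_bound (hη : IsPoissonProcess (intensity d lam) P η)
    (hf : Measurable f) (hti : TranslationInvariant f) {C : ℝ≥0}
    (hC : ∀ W : Cube d, (0 : Loc d) ∈ W.toSet → rootedNorm lam W f ≤ C) (W : Cube d) :
    MemLp (value e η f W) 2 P :=
  hη.memLp_value e hf (fullyExchangeable_randomGraph.exchangeableAt.finiteCost_of_costNorm hf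
    ((hti.costNorm_le hf hC W).trans_lt ENNReal.coe_lt_top).ne)

/-- The central limit theorem for the values in large cubes. -/
lemma IsPoissonProcess.tendstoInDistribution_value (hη : IsPoissonProcess (intensity d lam) P η)
    (hf : Measurable f) (hstab : WeaklyStabilizing P e η f) (hmom : MomentCondition P e η f p)
    (hp : 2 < p) {v : ℝ≥0}
    (hv : Tendsto (fun k => variance (value e η f (box d k)) P / volume.real (box d k).toSet) atTop
      (𝓝 (v : ℝ))) {W : ℕ → Cube d} (hW : TendsToSpace W) :
    TendstoInDistribution
      (fun n ω => (value e η f (W n) ω - ∫ ω', value e η f (W n) ω' ∂P) /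
        √(volume.real (W n).toSet))
      atTop (id : ℝ → ℝ) (fun _ => P) (gaussianReal 0 v) := by
  obtain ⟨C, hC⟩ := hη.exists_rootedNorm_le e hf hmom hp
  have hL := hη.memLp_value_of_bound e hf hstab.1 hC
  refine tendstoInDistribution_of_approx (fun n => (((hL (W n)).integrable (by norm_num)).sub
    (integrable_const _)).div_const _) fun ε hε => ?_
  -- The bound `δ` on the cost deep inside the blocks is chosen so that its share of the normalized
  -- remainder variance is below `ε² / 8`.
  obtain ⟨δ, hδ0, hδ⟩ : ∃ δ : ℝ≥0, 0 < δ ∧ (lam : ℝ) * δ ^ 2 < ε ^ 2 / 8 := by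
    have h : Tendsto (fun δ : ℝ≥0 => (lam : ℝ) * δ ^ 2) (𝓝[>] 0) (𝓝 (lam * ((0 : ℝ≥0) : ℝ) ^ 2)) :=
      ((by fun_prop : Continuous fun δ : ℝ≥0 => (lam : ℝ) * δ ^ 2).tendsto 0).mono_left
        nhdsWithin_le_nhds
    have h2 := (h.eventually_lt_const (u := ε ^ 2 / 8) (by simp; positivity)).and
      self_mem_nhdsWithin
    obtain ⟨δ, h3, h4⟩ := h2.exists
    exact ⟨δ, h4, h3⟩
  obtain ⟨r, hr, hrad⟩ := hη.exists_radius e hf hstab hmom hp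
    (ε := (δ : ℝ≥0∞)) (by exact_mod_cast hδ0)
  -- As the box grows, the share of roots near block boundaries vanishes, and only the term with `δ`
  -- is left in the bound.
  have hκ : Tendsto (fun k => (lam : ℝ) * (δ ^ 2 + (2 * C) ^ 2 *
      (1 - (((box d k).side - 2 * r) / (box d k).side) ^ d))) atTop (𝓝 ((lam : ℝ) * δ ^ 2)) := by
    simpa using (((tendsto_box_inner (d := d) hr).const_sub 1).const_mul
      ((2 * C : ℝ) ^ 2)).const_add ((δ : ℝ) ^ 2) |>.const_mul (lam : ℝ)
  -- The box size is fixed before `n` tends to infinity. It makes the boundary share small, leaves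
  -- room for the inner part, and brings the variance per volume of the box within `ε` of `v`.
  obtain ⟨k, hk1, hk2, hk3⟩ := ((hκ.eventually_lt_const hδ).and
    (((tendsToSpace_box (d := d)).tendsto_side.eventually_gt_atTop (2 * r)).and
      (Metric.tendsto_nhds.1 hv ε hε))).exists
  refine ⟨_, hk3.le, fun n => blockSum e P η f k (W n), fun n => ?_, ?_,
    hη.tendsto_charFun_blockSum e hf hstab.1 (hL _) hW⟩
  · exact (hη.integral_abs_sub_blockSum_le e hf hstab.1 (hL _)
      (hη.variance_remainder_le e hf hstab.1 hr hC hrad (block_disjoint k (W n))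
        (block_subset k (W n))).1).1
  have hs := (box d k).side_pos
  have hfrac : Tendsto (fun n => (cubeLaw (W n)).real (⋃ j, (block k (W n) j).inner r)) atTop
      (𝓝 ((((box d k).side - 2 * r) / (box d k).side) ^ d)) := by
    have h := ((tendsto_blockCount k hW).mul_const
      (((box d k).side - 2 * r) / (box d k).side)).pow d
    rw [one_mul] at h
    refine h.congr fun n => ?_
    rw [cubeLaw_real_blocks k (W n) hr hk2]
    congr 1
    field_simp
  have hbd : Tendsto (fun n => (lam : ℝ) * (δ ^ 2 + (2 * C) ^ 2 *
      (1 - (cubeLaw (W n)).real (⋃ j, (block k (W n) j).inner r)))) atTop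
      (𝓝 ((lam : ℝ) * (δ ^ 2 + (2 * C) ^ 2 * (1 - (((box d k).side - 2 * r) / (box d k).side) ^ d)))) :=
    (((hfrac.const_sub 1).const_mul _).const_add _).const_mul _
  filter_upwards [hbd.eventually_lt_const hk1, (tendsto_normalization (k := k) hW
    (variance (value e η f (box d k)) P)).eventually_lt_const (half_pos hε)] with n h1 h2
  obtain ⟨hR, hRv⟩ := hη.variance_remainder_le e hf hstab.1 hr hC hrad (block_disjoint k (W n))
    (block_subset k (W n))
  refine ((hη.integral_abs_sub_blockSum_le e hf hstab.1 (hL _) hR).2.trans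
    (add_le_add ?_ h2.le)).trans_eq (add_halves ε)
  -- The normalized remainder variance is at most `ε² / 8`, which lies below the required `(ε /
  -- 2)²`; the normalization error supplies the other half of `ε`.
  refine Real.sqrt_le_iff.2 ⟨by positivity, ?_⟩
  rw [div_le_iff₀ (W n).volume_real_pos]
  refine hRv.trans ?_
  rw [mul_right_comm]
  refine mul_le_mul_of_nonneg_right (h1.le.trans ?_) measureReal_nonneg
  nlinarith [sq_nonneg ε]

end CentralLimitTheorem

end MarkedPoisson

end

/-! ### The main theorem -/

open MarkedPoisson in
theorem mainTheorem1 {d : ℕ} (hd : 1 ≤ d) {Ω : Type*} [MeasurableSpace Ω]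
    (P : Measure Ω) [IsProbabilityMeasure P]
    (lam : ℝ≥0) (hlam : 0 < lam)
    (η : Ω → Set (Pt d)) (hη : IsPoissonProcess (intensity d lam) P η)
    (e : ℕ ≃ (Fin d → ℤ))
    (f : Finset (MarkedEdge d) → ℝ) (hf : Measurable[finiteConfigSigma d] f)
    (hstab : WeaklyStabilizing P e η f)
    (p : ℝ) (hp : 2 < p) (hmom : MomentCondition P e η f p) :
    ∃ σ2 : ℝ≥0,
      (∀ W : Cube d, MemLp (value e η f W) 2 P) ∧
      (∀ W : ℕ → Cube d, TendsToSpace W →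
        TendstoInDistribution
          (fun n ω => (value e η f (W n) ω - ∫ ω', value e η f (W n) ω' ∂P) /
            √(volume.real (W n).toSet))
          atTop (id : ℝ → ℝ) (fun _ => P) (gaussianReal 0 σ2)) ∧
      (∀ W : ℕ → Cube d, TendsToSpace W →
        Tendsto (fun n => variance (value e η f (W n)) P / volume.real (W n).toSet)
          atTop (𝓝 (σ2 : ℝ))) ∧
      (∀ t : unitInterval, ∃ Δ : Ω × Marks → ℝ, IsLimitCost P e η f t Δ) ∧
      (∀ Δ : unitInterval → Ω × Marks → ℝ, (∀ t, IsLimitCost P e η f t (Δ t)) →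
        (σ2 : ℝ≥0∞) = varianceFormula P lam η Δ) ∧
      (∀ Δ₁ : Ω × Marks → ℝ, IsLimitCost P e η f 1 Δ₁ →
        0 < (P.prod markLaw) {z | Δ₁ z ≠ 0} → 0 < σ2) := by
  -- A positive dimension makes Lebesgue measure atomless, so that locations are almost surely
  -- distinct.
  have : NeZero d := ⟨by omega⟩
  have hex : ∀ t : unitInterval, ∃ Δ : Ω × Marks → ℝ, IsLimitCost P e η f t Δ := fun t => by
    obtain ⟨Δ, hm, -, hΔ⟩ := hη.exists_limitCost e hf hstab hmom hp t
    exact ⟨Δ, hη.isLimitCost_of_tendsto e hf hstab hmom hp hm hΔ⟩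
  obtain ⟨C, hC⟩ := hη.exists_rootedNorm_le e hf hmom hp
  choose Δ₀ hΔ₀ using hex
  have hvar := fun (Δ : unitInterval → Ω × Marks → ℝ) (hΔ : ∀ t, IsLimitCost P e η f t (Δ t))
    (W : ℕ → Cube d) (hW : TendsToSpace W) => hη.tendsto_variance e hf hstab hmom hp hΔ hW
  obtain ⟨σ2, hσ⟩ : ∃ σ2 : ℝ≥0, (σ2 : ℝ) = lam * ∫ t, historyMoment P η t (Δ₀ t) :=
    ⟨⟨_, mul_nonneg lam.2 (integral_nonneg fun t => historyMoment_nonneg t (Δ₀ t))⟩, rfl⟩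
  -- Every choice of the limit costs yields the limit of the same normalized variances, so `σ²`
  -- cannot depend on the choice.
  have huniq : ∀ Δ : unitInterval → Ω × Marks → ℝ, (∀ t, IsLimitCost P e η f t (Δ t)) →
      lam * ∫ t, historyMoment P η t (Δ t) = σ2 :=
    fun Δ hΔ => (tendsto_nhds_unique (hvar Δ hΔ _ tendsToSpace_box)
      (hvar Δ₀ hΔ₀ _ tendsToSpace_box)).trans hσ.symm
  have hlim : ∀ W : ℕ → Cube d, TendsToSpace W →
      Tendsto (fun n => variance (value e η f (W n)) P / volume.real (W n).toSet) atTop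
        (𝓝 (σ2 : ℝ)) := fun W hW => hσ ▸ hvar Δ₀ hΔ₀ W hW
  refine ⟨σ2, hη.memLp_value_of_bound e hf hstab.1 hC, fun W hW =>
    hη.tendstoInDistribution_value e hf hstab hmom hp (hlim _ tendsToSpace_box) hW,
    hlim, fun t => ⟨Δ₀ t, hΔ₀ t⟩, fun Δ hΔ => ?_, fun Δ₁ hΔ₁ hpos => ?_⟩
  · rw [varianceFormula_eq (fun t => (hη.memLp_limitCost e hf hC (hΔ t)).1)
      (hη.integrable_historyMoment e hf hstab hmom hp hΔ), huniq Δ hΔ, ENNReal.ofReal_coe_nnreal]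
  -- The given `Δ₁` is inserted at time one into a complete family of limit costs, to which the
  -- vanishing criterion applies.
  · have hΔ : ∀ t, IsLimitCost P e η f t (Function.update Δ₀ 1 Δ₁ t) := fun t => by
      rcases eq_or_ne t 1 with rfl | ht
      · rwa [Function.update_self]
      · rw [Function.update_of_ne ht]
        exact hΔ₀ t
    refine pos_of_ne_zero fun h0 => hpos.ne' ?_
    have h1 : lam * ∫ t, historyMoment P η t (Function.update Δ₀ 1 Δ₁ t) = 0 := by
      rw [huniq _ hΔ]
      exact congrArg NNReal.toReal h0
    have h2 := hη.ae_eq_zero_of_integral_historyMoment e hf hstab hmom hp hΔ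
      ((mul_eq_zero.1 h1).resolve_left (by exact_mod_cast hlam.ne'))
    rw [Function.update_self] at h2
    exact h2
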